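/- **Groups.** Let $W_n$ be the group of signed permutation matrices of size $n$ (Weyl group of type $B_n$) and $W_n'\leqslant W_n$ the subgroup of elements with an even number of signs (type $D_n$). For $n=a+b$ regard $W_a\times W_b$ (block diagonal matrices) and its subgroups $W_a'\times W_b$, $W_a'\times W_b'$ as subgroups of $W_n$. Let $t_0$, resp. $s_n$, be the diagonal matrix changing the sign of one coordinate in the first, resp. second, block. Conjugation by $t_0$ on $W_a'$ is $\gamma_a$ (for $a\geqslant 2$), conjugation by $s_n$ on $W_b'$ is $\gamma_b$ (for $b\geqslant 2$), and conjugation by a sign change on $W_n'$ is $\gamma_n$ (all sign changes lie in one coset of $W_n'$, so the choice of the coordinate does not matter). **Symbols.** A $\beta$-set is a finite $A=\{a_1<\dots<a_s\}\subset\mathbb N_0$; it gives the partition with parts $a_i-(i-1)$. For $|A|=|B|=s$ put $A\odot B=\{a_i+b_i-(i-1)\mid 1\leqslant i\leqslant s\}$. The irreducible characters of $W_n$ are labelled by pairs $\binom{A}{B}$ with $|A|=|B|$ (up to simultaneous shift) in the usual way, i.e. through bipartitions, the trivial character corresponding to $((n),\emptyset)$. The irreducible characters of $W_n'$ are the constituents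 of their restrictions: $\binom AB=\binom BA$ is irreducible if $A\ne B$, while for $n\geqslant1$ a degenerate label $\binom AA$ belongs to two characters $\binom AA_\pm$. **The $b$-function.** For a type and $t\geqslant 0$, $b^d$ sends $\binom AB$ to $\sum_{j=0}^{l-1}(l-1-j)(x_j-x_j^0)$, where $x_0\leqslant\dots\leqslant x_{l-1}$ are all entries of the following pair of sets (with multiplicity) and $x^0=(0,1,2,3,\dots)$ in type $C$, $x^0=(0,0,2,2,4,4,\dots)$ in types $B$, $D$. Let $X=\{0\}\cup\{a_i+i+1\}$, $Y=\{b_i+i\}$, $X'=\{a_i+i-1\}$, $Y'=\{b_i+i-1\}$, and let $X^{[k]}=\{0,2,\dots,2k-2\}\cup\{x+2k\mid x\in X\}$. The pair is $(X^{[2t]},Y')$ in type $B$ ($d=2t+1$); $(X^{[4t]},Y)$ in type $C$, $d=4t+1$; in type $C$, $d=1-4t$, $t\geqslant1$, it is $\bigl(\{0\}\cup\{b_i+i+1\},\ \{1,3,\dots,8t-1\}\cup\{a_i+i+8t\}\bigr)$; in type $D$ it is $(X^{[4t-1]},Y')$ if $d=4t$, $t\geqslant1$, and $(X',Y')$ if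 $t=0$. **Twisted induction.** Let $K$ be an algebraically closed field of characteristic $0$ with an automorphism $x\mapsto\bar x$ inverting roots of unity (e.g. $K=\overline{\mathbb Q}_\ell$). Let $H\leqslant W$ be subgroups of $W_n$, $f$ an element normalising $W$ (representing $F$) and $v\in Wf$ normalising $H$ (representing $F_w$). Put $(\mathrm{Ind}_{Hv}^{Wf}\varphi)(x)=|H|^{-1}\sum_{y\in W,\;y^{-1}xy\in Hv}\varphi(y^{-1}xy)$ for $x \in Wf$, and $\langle\varphi,\psi\rangle=|W|^{-1}\sum_{x\in Wf}\varphi(x)\overline{\psi(x)}$. For a $v$-invariant $E\in\mathrm{Irr}(H)$ and an $f$-stable $X\in\mathrm{Irr}(W)$ let $\widetilde E$, $\widetilde X$ be extensions to $H\langle v\rangle$, $W\langle f\rangle$, and $m(\widetilde E,\widetilde X)=\langle\mathrm{Ind}_{Hv}^{Wf}\widetilde E,\widetilde X\rangle$; whether this vanishes does not depend on the extensions. Call $X$ *$d$-minimal for $E$* if $X$ is $f$-stable, $m(\widetilde E,\widetilde X)\ne0$, and $b^d(X)\leqslant b^d(Y)$ for every $f$-stable $Y\in\mathrm{Irr}(W)$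 with $m(\widetilde E,\widetilde Y)\neq0$. **Proposition.** Let $E=A\boxtimes B=\binom{A_1}{A_2}\boxtimes\binom{B_1}{B_2}\in\mathrm{Irr}(H)$ be $F_w$-invariant (all four rows of the same size; $\pm$ is chosen in any way for degenerate symbols), $\Lambda=\binom{A_1\odot B_1}{A_2\odot B_2}$, $\Lambda'=\binom{A_2\odot B_1}{A_1\odot B_2}$, and let $X$ be $d$-minimal for $E$. For $W=W_n'$, "$X=\Lambda$" means that $X$ has label $\Lambda$. (a) Let $H=W_a\times W_b\leqslant W=W_n$, $F$ and $F_w$ trivial, and let $t\neq0$ or the type be $B$. Then $X=\Lambda$. (b) Type $C$, $t=0$ ($d=1$), $H=W_a'\times W_b\leqslant W=W_n$, $F$ trivial. If $F_w$ is trivial and $A$ is non-degenerate, or if $F_w=\gamma_a\times\mathrm{id}$, then $X\in\{\Lambda,\Lambda'\}$. If $F_w$ is trivial and $A$ is degenerate then $X=\Lambda$. (c) Type $D$, $t=0$, $H=W_a'\times W_b'\leqslant W=W_n'$, $F$ trivial. If $F_w$ is trivial and $A$ or $B$ is non-degenerate, or if $F_w=\gamma_a\times\gamma_b$, then $X\in\{\Lambda,\Lambda'\}$.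 If $F_w$ is trivial and $A$, $B$ are degenerate then $X=\Lambda$. Moreover let $Y\in\{\Lambda,\Lambda'\}$ be degenerate. If $A$ or $B$ is degenerate then exactly one of the characters labelled by $Y$ is $d$-minimal for $E$. If neither is degenerate and one of $Y_+,Y_-$ is $d$-minimal for $E$, then so is the other. *Multiplicities in (a)–(c).* If $F_w$ is trivial then $m(\widetilde E,\widetilde X)=1$. If $F_w$ is not trivial then $m(\widetilde E,\widetilde X)\in\{1,-1\}$ for every extension $\widetilde E$ of $E$; it is $1$ if $X=\Lambda$ and $\widetilde E$ is the restriction to $H\langle v\rangle$ of the character $\binom{A_1}{A_2}\boxtimes\binom{B_1}{B_2}$ of $W_a\times W_b$, or if $X=\Lambda'$ and $\widetilde E$ is the restriction of $\binom{A_2}{A_1}\boxtimes\binom{B_1}{B_2}$. Also, for $F_w$ non-trivial in (b), (c), and any extension $\widetilde E$, the statements of (b), (c) hold with twisted induction replaced by ordinary induction $\mathrm{Ind}_{H\langle v\rangle}^{W}\widetilde E$ (also in the definition of $d$-minimality), and then the multiplicity of a $d$-minimal $X$ is exactly $1$. (d) Type $D$, $t=0$, $H=W_a'\times W_b'\leqslant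 W=W_n'$, $F=\gamma_n$, $F_w\in\{\gamma_a\times\mathrm{id},\mathrm{id}\times\gamma_b\}$. If $\Lambda$ or $\Lambda'$ is non-degenerate then $X\in\{\Lambda,\Lambda'\}$ and $m(\widetilde E,\widetilde X)=\pm1$ for all extensions. -/

import Mathlib

noncomputable section

namespace SymbolInduction

/-! ### Class functions on finite groups and on cosets -/

/-- `χ` is the character of an irreducible representation of `G` over `K`. -/
def IsIrrChar {K : Type*} [Field K] {G : Type} [Group G] (χ : G → K) : Prop :=
  ∃ (d : ℕ) (ρ : Representation K G (Fin d → K)), ρ.IsIrreducible ∧ χ = ρ.character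

/-- Extension by zero of a function on a subgroup. -/
def extZero {K : Type*} [Field K] {Γ : Type} [Group Γ] {S : Subgroup Γ} (χ : S → K) : Γ → K :=
  open Classical in fun x => if h : x ∈ S then χ ⟨x, h⟩ else 0

/-- Let `W` be a subgroup of `Γ` and `f ∈ Γ` an element normalising `W`.  The scalar product
`|W|⁻¹ ∑_{x ∈ W} φ(x f) · bar (ψ(x f))` of functions on the coset `W f`. -/
def cosetInner {K : Type*} [Field K] (bar : K ≃+* K) {Γ : Type} [Group Γ] [Fintype Γ]
    (W : Subgroup Γ) (f : Γ) (φ ψ : Γ → K) : K :=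
  open Classical in
  (Nat.card W : K)⁻¹ * ∑ x : Γ, if x ∈ W then φ (x * f) * bar (ψ (x * f)) else 0

/-- Induction from the coset `H v` to the coset `W f`, where `H ≤ W` and `H v ⊆ W f`:
`x ↦ |H|⁻¹ ∑ φ(y⁻¹ x y)`, the sum being over all `y ∈ W` such that `y⁻¹ x y ∈ H v`. -/
def cosetInd {K : Type*} [Field K] {Γ : Type} [Group Γ] [Fintype Γ]
    (W H : Subgroup Γ) (v : Γ) (φ : Γ → K) : Γ → K :=
  open Classical in
  fun x => (Nat.card H : K)⁻¹ *
    ∑ y : Γ, if y ∈ W ∧ y⁻¹ * x * y * v⁻¹ ∈ H then φ (y⁻¹ * x * y) else 0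

/-- The group `S⟨f⟩` generated by the subgroup `S` and the element `f`. -/
abbrev adjoin {Γ : Type} [Group Γ] (S : Subgroup Γ) (f : Γ) : Subgroup Γ :=
  S ⊔ Subgroup.zpowers f

/-- The irreducible character `χ'` of `S⟨f⟩` extends the function `χ` on `S`. -/
def IsExtension {K : Type*} [Field K] {Γ : Type} [Group Γ] (S : Subgroup Γ) (f : Γ)
    (χ : S → K) (χ' : adjoin S f → K) : Prop :=
  IsIrrChar χ' ∧ ∀ x : S, χ' ⟨x, (le_sup_left : S ≤ adjoin S f) x.2⟩ = χ x

/-- The function `χ` on `S` is invariant under conjugation by `f`. -/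
def IsStable {K : Type*} [Field K] {Γ : Type} [Group Γ] (S : Subgroup Γ) (f : Γ)
    (χ : S → K) : Prop :=
  ∀ (x : S) (h : f * x * f⁻¹ ∈ S), χ ⟨f * x * f⁻¹, h⟩ = χ x

/-- The multiplicity `⟨Ind_{H v}^{W f} E', X'⟩` for `E'` a character of `H⟨v⟩` and `X'` a
character of `W⟨f⟩` (restricted to the cosets `H v` and `W f`). -/
def mult {K : Type*} [Field K] (bar : K ≃+* K) {Γ : Type} [Group Γ] [Fintype Γ]
    (W H : Subgroup Γ) (f v : Γ) (E' : adjoin H v → K) (X' : adjoin W f → K) : K :=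
  cosetInner bar W f (cosetInd W H v (extZero E')) (extZero X')

/-! ### Partitions, beta-sets and symbols of defect zero -/

/-- The entry number `i` (counted from `0`) of the beta-set `A`, in increasing order. -/
def entry (A : Finset ℕ) (i : ℕ) : ℕ := A.sort.getD i 0

/-- The parts `a_i - i` (`0 ≤ i < |A|`) of the partition given by the beta-set `A`. -/
def part (A : Finset ℕ) (i : ℕ) : ℕ := entry A i - i

/-- `A ⊙ B = {a_1 + b_1 < a_2 + b_2 - 1 < ⋯ < a_s + b_s - (s - 1)}` for `|A| = |B| = s`. -/
def odot (A B : Finset ℕ) : Finset ℕ :=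
  (Finset.range A.card).image fun i => entry A i + entry B i - i

/-- `χ` is the irreducible character of the symmetric group on `κ` labelled by the beta-set `A`,
that is, by the partition `α` with parts `part A i`: the unique common irreducible constituent of
the trivial character induced from the row stabiliser, and of the sign character induced from the
column stabiliser, of a tableau `T` of shape `α` (written by Frobenius reciprocity). -/
def IsYoungChar {K : Type*} [Field K] {κ : Type} [Fintype κ] (χ : Equiv.Perm κ → K)
    (A : Finset ℕ) : Prop :=
  open Classical in
  IsIrrChar χ ∧ ∃ T : κ ≃ (Σ i : Fin A.card, Fin (part A i)),
    (∑ σ : Equiv.Perm κ, if ∀ x, (T (σ x)).1 = (T x).1 then χ σ else 0) ≠ 0 ∧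
    (∑ σ : Equiv.Perm κ, if ∀ x, ((T (σ x)).2 : ℕ) = (T x).2
      then (((Equiv.Perm.sign σ : ℤˣ) : ℤ) : K) * χ σ else 0) ≠ 0

/-! ### Weyl groups of type `B_n` and `D_n` -/

/-- The Weyl group of type `B_n`, `n = |ι|`: the group of signed permutation matrices.  The pair
`(s, σ)` is the matrix sending the basis vector `e_i` to `s (σ i) • e_{σ i}`. -/
abbrev SignedPerm (ι : Type) : Type :=
  (ι → ℤˣ) ⋊[mulAutArrow (G := Equiv.Perm ι) (A := ι) (M := ℤˣ)] Equiv.Perm ι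

instance {ι : Type} [Fintype ι] : Fintype (SignedPerm ι) :=
  open Classical in Fintype.ofEquiv _ SemidirectProduct.equivProd.symm

/-- The linear character of the group of signed permutations which sends an element to the product
of its signs. -/
def signProd (ι : Type) [Fintype ι] : SignedPerm ι →* ℤˣ where
  toFun x := ∏ i, x.left i
  map_one' := by simp
  map_mul' x y := by
    simp only [SemidirectProduct.mul_left, Pi.mul_apply, Finset.prod_mul_distrib,
      mulAutArrow_apply_apply]
    congr 1
    exact Equiv.prod_comp (x.right⁻¹) y.left

/-- The Weyl group of type `D_n` (an even number of signs) inside that of type `B_n`. -/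
def evenSub (ι : Type) [Fintype ι] : Subgroup (SignedPerm ι) := (signProd ι).ker

/-- The reflection changing the sign of the coordinate `i`. -/
def signFlip {ι : Type} (i : ι) : SignedPerm ι :=
  open Classical in ⟨Pi.mulSingle i (-1), 1⟩

/-- Block diagonal signed permutation matrices. -/
def blockHom (α β : Type) : SignedPerm α × SignedPerm β →* SignedPerm (α ⊕ β) where
  toFun p := ⟨Sum.elim p.1.left p.2.left, Equiv.sumCongr p.1.right p.2.right⟩
  map_one' := by
    ext i <;> rcases i with i | i <;> rfl
  map_mul' p q := by
    ext i <;> rcases i with i | i <;> rfl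

/-- The subgroup `U × V` of block diagonal elements. -/
def blockSub {α β : Type} (U : Subgroup (SignedPerm α)) (V : Subgroup (SignedPerm β)) :
    Subgroup (SignedPerm (α ⊕ β)) :=
  (U.prod V).map (blockHom α β)

/-- For a predicate `S` on the coordinates and functions `φ`, `ψ` on the symmetric groups of `S`
and of its complement: the function on signed permutations which is
`φ(σ|_S) · ψ(σ|_{Sᶜ}) · ∏_{i ∉ S} s i` at the elements `(s, σ)` preserving `S`, and zero
elsewhere. -/
def twoBlock {K : Type*} [Field K] {ι : Type} [Fintype ι] (S : ι → Prop)
    (φ : Equiv.Perm {i // S i} → K) (ψ : Equiv.Perm {i // ¬ S i} → K) (x : SignedPerm ι) : K :=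
  open Classical in
  if h : ∀ i, S (x.right i) ↔ S i then
    φ (x.right.subtypePerm h) * ψ (x.right.subtypePerm fun i => not_congr (h i)) *
      (((∏ i, if S i then 1 else x.left i : ℤˣ) : ℤ) : K)
  else 0

/-- `χ` is the irreducible character of the Weyl group of type `B_n` labelled by the symbol
`(A / B)` of defect zero: the character induced from `W_k × W_l`, `k = rk A`, `l = rk B`, of
the product of the character of `S_k` labelled by `A` and the character of `S_l` labelled by
`B` (inflated to `W_k` and `W_l`), the second one being multiplied by the product of the signs. -/
def IsSymbolChar {K : Type*} [Field K] {ι : Type} [Fintype ι] (χ : SignedPerm ι → K)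
    (A B : Finset ℕ) : Prop :=
  open Classical in
  A.card = B.card ∧
  ∃ (S : ι → Prop) (φ : Equiv.Perm {i // S i} → K) (ψ : Equiv.Perm {i // ¬ S i} → K),
    IsYoungChar φ A ∧ IsYoungChar ψ B ∧
    ∀ x, χ x = (Nat.card {z : SignedPerm ι // ∀ i, S (z.right i) ↔ S i} : K)⁻¹ *
      ∑ y : SignedPerm ι, twoBlock S φ ψ (y⁻¹ * x * y)

/-- `X` is an irreducible character of the subgroup `U` with label the symbol `(A / B)`, i.e. a
constituent of the restriction to `U` of the character labelled by `(A / B)`.  For `U = ⊤` this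
is that character.  For `U` of type `D_n` the order of the rows is irrelevant, and if
`A = B` and `n ≥ 1` there are two such characters `(A / A)_±`. -/
def HasLabel {K : Type*} [Field K] {ι : Type} [Fintype ι] (U : Subgroup (SignedPerm ι))
    (X : U → K) (A B : Finset ℕ) : Prop :=
  open Classical in
  IsIrrChar X ∧ ∃ χ : SignedPerm ι → K, IsSymbolChar χ A B ∧ ∑ x : U, χ x * X x⁻¹ ≠ 0

/-- `E` is an irreducible character `φ ⊠ ψ` of `U × V`, where `φ` has label `(A₁ / A₂)` and
`ψ` has label `(B₁ / B₂)`. -/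
def HasBoxLabel {K : Type*} [Field K] {α β : Type} [Fintype α] [Fintype β]
    (U : Subgroup (SignedPerm α)) (V : Subgroup (SignedPerm β)) (E : blockSub U V → K)
    (A₁ A₂ B₁ B₂ : Finset ℕ) : Prop :=
  ∃ (φ : U → K) (ψ : V → K), HasLabel U φ A₁ A₂ ∧ HasLabel V ψ B₁ B₂ ∧
    ∀ (x : U) (y : V), E ⟨blockHom α β (x, y), ⟨(x, y), ⟨x.2, y.2⟩, rfl⟩⟩ = φ x * ψ y

/-- The function `E'` on a subgroup `S` of block diagonal elements is the restriction of the
irreducible character `(A₁ / A₂) ⊠ (B₁ / B₂)` of the product of two groups of type `B`. -/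
def IsBoxRestriction {K : Type*} [Field K] {α β : Type} [Fintype α] [Fintype β]
    (S : Subgroup (SignedPerm (α ⊕ β))) (E' : S → K) (A₁ A₂ B₁ B₂ : Finset ℕ) : Prop :=
  ∃ (χ : SignedPerm α → K) (ω : SignedPerm β → K), IsSymbolChar χ A₁ A₂ ∧ IsSymbolChar ω B₁ B₂ ∧
    ∀ (x : SignedPerm α) (y : SignedPerm β) (h : blockHom α β (x, y) ∈ S),
      E' ⟨blockHom α β (x, y), h⟩ = χ x * ω y

/-! ### The `b`-function -/

/-- The four series of cuspidal data: type `B_n` (with `d = 2t + 1`), type `C_n` (with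
`d = 4t + 1` or `d = 1 - 4t`) and type `D_n` (with `d = 4t`), where `t ≥ 0`. -/
inductive Series
  | B
  | Cplus
  | Cminus
  | D

/-- `{a_1 + c < a_2 + 1 + c < ⋯ < a_s + (s - 1) + c}`. -/
def spread (A : Finset ℕ) (c : ℕ) : Finset ℕ :=
  (Finset.range A.card).image fun i => entry A i + i + c

/-- `{0, 2, …, 2k - 2} ∪ {x + 2k | x ∈ X}`. -/
def evenShift (k : ℕ) (X : Finset ℕ) : Finset ℕ :=
  (Finset.range k).image (fun i => 2 * i) ∪ X.image (fun x => x + 2 * k)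

/-- `{1, 3, …, 2k - 1} ∪ {y + 2k | y ∈ Y}`. -/
def oddShift (k : ℕ) (Y : Finset ℕ) : Finset ℕ :=
  (Finset.range k).image (fun i => 2 * i + 1) ∪ Y.image (fun y => y + 2 * k)

/-- The combinatorial generalised Springer map, sending a symbol `(A / B)` of defect zero to a
pair of sets of defect `d` without consecutive entries. -/
def springerPair : Series → ℕ → Finset ℕ → Finset ℕ → Finset ℕ × Finset ℕ
  | .B, t, A, B => (evenShift (2 * t) (insert 0 (spread A 2)), spread B 0)
  | .Cplus, t, A, B => (evenShift (4 * t) (insert 0 (spread A 2)), spread B 1)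
  | .Cminus, t, A, B => (insert 0 (spread B 2), oddShift (4 * t) (spread A 1))
  | .D, 0, A, B => (spread A 0, spread B 0)
  | .D, t + 1, A, B => (evenShift (4 * t + 3) (insert 0 (spread A 2)), spread B 0)

/-- The minimal sequence `0, 1, 2, 3, …` (type `C`), resp. `0, 0, 2, 2, 4, 4, …` (types `B`
and `D`). -/
def baseEntry : Series → ℕ → ℕ
  | .Cplus, j => j
  | .Cminus, j => j
  | .B, j => 2 * (j / 2)
  | .D, j => 2 * (j / 2)

/-- Lusztig's `b`-function at a symbol of defect zero.  If `x_0 ≤ ⋯ ≤ x_{l-1}` are all entries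
of the two rows of `springerPair`, in one row and with multiplicities, and
`x⁰_0 ≤ ⋯ ≤ x⁰_{l-1}` is the minimal sequence, this is `∑_j (l - 1 - j) (x_j - x⁰_j)`. -/
def bSymbol (T : Series) (t : ℕ) (A B : Finset ℕ) : ℤ :=
  let P := springerPair T t A B
  let L : List ℕ := (P.1.val + P.2.val).sort
  ∑ j ∈ Finset.range L.length,
    ((L.length : ℤ) - 1 - j) * ((L.getD j 0 : ℤ) - baseEntry T j)

/-- The data entering into twisted induction: the parameters `T`, `t` of the `b`-function,
subgroups `H ≤ W` of the group of signed permutations, an element `f` normalising `W` and an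
element `v ∈ W f` normalising `H`.  The element `f` represents the automorphism `F` of `W`, and
`v` the automorphism `F_w` of `H`. -/
structure Datum (a b : ℕ) where
  T : Series
  t : ℕ
  W : Subgroup (SignedPerm (Fin a ⊕ Fin b))
  H : Subgroup (SignedPerm (Fin a ⊕ Fin b))
  f : SignedPerm (Fin a ⊕ Fin b)
  v : SignedPerm (Fin a ⊕ Fin b)

namespace Datum

variable {a b : ℕ}

/-- `W_a × W_b ≤ W_{a+b}`, with trivial `F` and `F_w`. -/
abbrev split (a b : ℕ) (T : Series) (t : ℕ) : Datum a b :=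
  ⟨T, t, ⊤, blockSub ⊤ ⊤, 1, 1⟩

/-- Type `C`, `t = 0`: `W'_a × W_b ≤ W_{a+b}`, where `F` is trivial and `F_w` is given by `v`. -/
abbrev typeC (a b : ℕ) (v : SignedPerm (Fin a ⊕ Fin b)) : Datum a b :=
  ⟨Series.Cplus, 0, ⊤, blockSub (evenSub (Fin a)) ⊤, 1, v⟩

/-- Type `D`, `t = 0`: `W'_a × W'_b ≤ W'_{a+b}`, where `F` is given by `f` and `F_w` by `v`. -/
abbrev typeD (a b : ℕ) (f v : SignedPerm (Fin a ⊕ Fin b)) : Datum a b :=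
  ⟨Series.D, 0, evenSub (Fin a ⊕ Fin b), blockSub (evenSub (Fin a)) (evenSub (Fin b)), f, v⟩

/-- The datum for the ordinary induction from `H⟨v⟩` to `W` (when `F` is trivial). -/
abbrev ordinary (D : Datum a b) : Datum a b :=
  ⟨D.T, D.t, D.W, adjoin D.H D.v, 1, 1⟩

variable {K : Type*} [Field K] (D : Datum a b)

/-- `X` occurs in the twisted induction of `E`: the multiplicity is non-zero for extensions
`E'`, `X'` of `E`, `X` (on the cosets `H v`, `W f` extensions are unique up to roots of unity,
so that the choice is immaterial). -/
def Occurs (bar : K ≃+* K) (E : D.H → K) (X : D.W → K) : Prop :=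
  ∃ (E' : adjoin D.H D.v → K) (X' : adjoin D.W D.f → K),
    IsExtension D.H D.v E E' ∧ IsExtension D.W D.f X X' ∧ mult bar D.W D.H D.f D.v E' X' ≠ 0

/-- For all extensions `E'` of `E` and `X'` of `X` satisfying `Q E'` the multiplicity
`⟨Ind_{H v}^{W f} E', X'⟩` lies in the set `Z`. -/
def MultMem (bar : K ≃+* K) (E : D.H → K) (X : D.W → K) (Q : (adjoin D.H D.v → K) → Prop)
    (Z : Set K) : Prop :=
  ∀ (E' : adjoin D.H D.v → K) (X' : adjoin D.W D.f → K),
    IsExtension D.H D.v E E' → IsExtension D.W D.f X X' → Q E' →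
      mult bar D.W D.H D.f D.v E' X' ∈ Z

/-- The irreducible character `X` of `W` has `b`-value `z`. -/
def HasBValue (X : D.W → K) (z : ℤ) : Prop :=
  ∃ A B : Finset ℕ, HasLabel D.W X A B ∧ bSymbol D.T D.t A B = z

/-- `X` is `d`-minimal for `E`: it is an `F`-stable irreducible character of `W` which occurs in
the induction from `H v` to `W f` of `E`, and its `b`-value is minimal among those of all
such characters. -/
structure IsDMinimal (bar : K ≃+* K) (E : D.H → K) (X : D.W → K) : Prop where
  irr : IsIrrChar X
  stable : IsStable D.W D.f X
  occurs : D.Occurs bar E X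
  minimal : ∀ Y : D.W → K, IsIrrChar Y → IsStable D.W D.f Y → D.Occurs bar E Y →
    ∀ z z' : ℤ, D.HasBValue X z → D.HasBValue Y z' → z ≤ z'

/-- The statement on degenerate labels.  Let `Y` be one of the symbols
`(A₁ ⊙ B₁ / A₂ ⊙ B₂)`, `(A₂ ⊙ B₁ / A₁ ⊙ B₂)` and suppose that `Y` is degenerate, i.e. has equal
rows.  If `(A₁ / A₂)` or `(B₁ / B₂)` is degenerate then exactly one character with label `Y` is
`d`-minimal for `E`.  If neither is degenerate and some character with label `Y` is `d`-minimal
for `E`, then all characters with label `Y` are. -/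
def DegenerateClause (bar : K ≃+* K) (E : D.H → K) (A₁ A₂ B₁ B₂ : Finset ℕ) : Prop :=
  ∀ Y : Finset ℕ, ((odot A₁ B₁ = Y ∧ odot A₂ B₂ = Y) ∨ (odot A₂ B₁ = Y ∧ odot A₁ B₂ = Y)) →
    ((A₁ = A₂ ∨ B₁ = B₂) →
      ∃! X : D.W → K, HasLabel D.W X Y Y ∧ D.IsDMinimal bar E X) ∧
    ((A₁ ≠ A₂ ∧ B₁ ≠ B₂) →
      (∃ X : D.W → K, HasLabel D.W X Y Y ∧ D.IsDMinimal bar E X) →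
      ∀ X : D.W → K, HasLabel D.W X Y Y → D.IsDMinimal bar E X)

end Datum

end SymbolInduction

end

open SymbolInduction

set_option linter.unusedSectionVars false

noncomputable section

namespace SymbolInduction

open Representation

/-! ### Irreducible representations -/

section Irreducible

variable {K : Type*} [Field K] {G : Type*} [Group G]

/-! All the multiplicities are reduced to restriction multiplicities between groups of type `B`.
Since `bar` sends χ(x) to χ(x⁻¹) (`IsIrrChar.bar_apply`), Frobenius reciprocity for cosets
(`mult_eq`) turns a twisted multiplicity into a sum over block diagonal elements. Exchanging the
rows of a symbol multiplies its character by the product of the signs (`symbolFun_swap`). Hence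
summing over the first factor, be it W_a, W_a' or the coset W_a \ W_a', amounts to pairing with
(A₁/A₂) + x (A₂/A₁) on all of W_a: x = 0 for W_a and for a degenerate label of W_a', x = 1 for a
non-degenerate label of W_a', x = -1 for the coset. With y playing the same role for the second
factor, the multiplicity is, up to a sign from the choice of extensions, the `twistSum` with
coefficients 1, x, y, xy (`Represents.blockSum_twist`). Ordinary induction in type `D` gives the
coefficients 1, 0, 0, 1 (`blockSum_even`).

Each term of a `twistSum` is a multiplicity `blockMult`. Fourier analysis on the group of signs
writes it as a product of two Littlewood-Richardson coefficients, one for each row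
(`blockMult_eq_lr`). In terms of partitions ⊙ is addition (`pt_odot`), so two facts on symmetric
groups suffice: the constituents of the induction product of the characters α and β are dominated by
α + β (`IsYoungChar.top_le_of_lr`), and α + β occurs exactly once (`IsYoungChar.lr_eq_one`). Both
come from comparing the trivial character induced from a row stabiliser with the sign character
induced from a column stabiliser. Diagrams are allowed arbitrary column labels, so that two diagrams
placed side by side form a diagram for α + β.

The b-function is, up to terms constant for fixed ranks and row lengths, half the sum of min(x, y)
over all pairs of entries (`two_mul_bSymbol`); it is therefore strictly decreasing in the dominance
order (`bSymbol_le`). So the term belonging to one twist of (A, B) only sees labels with b at least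
that of its own ⊙-symbol, with equality at this symbol only. The ⊙-symbols of the twists are Λ and
Λ', in type `D` up to exchanging the rows. The one with smaller b is minimal. For equal values no
cancellation is possible, since a coincidence of the symbols would force A₁ = A₂ or B₁ = B₂.

In type `D` a degenerate label belongs to two conjugate characters, and a priori only the sum of
their multiplicities is known. If A and B are both non-degenerate, the function induced is invariant
under a sign change in one block, so the two multiplicities agree. If one of A, B is degenerate and
F_w is trivial, they are natural numbers with sum 1, so exactly one of them is non-zero. For F = γ_n
the stable characters are those with non-degenerate label, and if just one of Λ, Λ' is degenerate,
concavity of min gives the other a smaller b-value (`bSymbol_D_lt`). -/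

theorem isIrreducible_iff {V : Type*} [AddCommGroup V] [Module K V] (ρ : Representation K G V) :
    ρ.IsIrreducible ↔ Nontrivial V ∧
      ∀ U : Submodule K V, (∀ g, ∀ v ∈ U, ρ g v ∈ U) → U = ⊥ ∨ U = ⊤ := by
  constructor
  · intro h
    refine ⟨?_, fun U hU => ?_⟩
    · by_contra hn
      rw [not_nontrivial_iff_subsingleton] at hn
      apply (bot_ne_top : (⊥ : Subrepresentation ρ) ≠ ⊤)
      apply Subrepresentation.toSubmodule_injective
      exact Subsingleton.elim _ _
    · rcases h.eq_bot_or_eq_top ⟨U, fun g v hv => hU g v hv⟩ with h1 | h1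
      · left; exact congrArg Subrepresentation.toSubmodule h1
      · right; exact congrArg Subrepresentation.toSubmodule h1
  · rintro ⟨h1, h2⟩
    have : Nontrivial (Subrepresentation ρ) := by
      refine ⟨⊥, ⊤, fun h => ?_⟩
      exact bot_ne_top (α := Submodule K V) (congrArg Subrepresentation.toSubmodule h)
    refine ⟨fun s => ?_⟩
    rcases h2 s.toSubmodule (fun g v hv => s.apply_mem_toSubmodule g hv) with h | h
    · left; exact Subrepresentation.toSubmodule_injective h
    · right; exact Subrepresentation.toSubmodule_injective h

/-- Transport of a representation along a linear equivalence. -/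
def conjRep {V W : Type*} [AddCommGroup V] [Module K V] [AddCommGroup W] [Module K W]
    (ρ : Representation K G V) (e : V ≃ₗ[K] W) : Representation K G W where
  toFun g := e.conj (ρ g)
  map_one' := by ext; simp [LinearEquiv.conj_apply]
  map_mul' g h := by ext; simp [LinearEquiv.conj_apply]

theorem conjRep_character {V W : Type*} [AddCommGroup V] [Module K V] [AddCommGroup W] [Module K W]
    (ρ : Representation K G V) (e : V ≃ₗ[K] W) : (conjRep ρ e).character = ρ.character := by
  ext g
  simp [character, conjRep]

theorem conjRep_isIrreducible {V W : Type*} [AddCommGroup V] [Module K V] [AddCommGroup W]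
    [Module K W] (ρ : Representation K G V) (e : V ≃ₗ[K] W) (h : ρ.IsIrreducible) :
    (conjRep ρ e).IsIrreducible := by
  rw [isIrreducible_iff] at h ⊢
  obtain ⟨h1, h2⟩ := h
  refine ⟨e.symm.toEquiv.nontrivial, fun U hU => ?_⟩
  have key := h2 (U.comap e.toLinearMap) (fun g v hv => by
    have := hU g (e v) hv
    simpa [conjRep, LinearEquiv.conj_apply] using this)
  have hback : U = (U.comap e.toLinearMap).map e.toLinearMap :=
    (Submodule.map_comap_eq_of_surjective e.surjective U).symm
  rcases key with h | h
  · left; rw [hback, h, Submodule.map_bot]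
  · right; rw [hback, h, Submodule.map_top]; exact LinearMap.range_eq_top.2 e.surjective

theorem isIrrChar_of_isIrreducible {G : Type} [Group G] {V : Type*} [AddCommGroup V] [Module K V]
    [FiniteDimensional K V] (ρ : Representation K G V) (h : ρ.IsIrreducible) :
    IsIrrChar ρ.character :=
  ⟨Module.finrank K V, conjRep ρ (Module.finBasis K V).equivFun, conjRep_isIrreducible _ _ h,
    (conjRep_character _ _).symm⟩

/-- The operator `∑ f(g) ρ(g)`. -/
def avgOp [Fintype G] {V : Type*} [AddCommGroup V] [Module K V] (f : G → K)
    (ρ : Representation K G V) : V →ₗ[K] V :=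
  ∑ g : G, f g • ρ g

theorem avgOp_comm [Fintype G] {V : Type*} [AddCommGroup V] [Module K V] {f : G → K}
    (hf : ∀ x y, f (y * x * y⁻¹) = f x)
    (ρ : Representation K G V) (y : G) : avgOp f ρ ∘ₗ ρ y = ρ y ∘ₗ avgOp f ρ := by
  ext v
  simp only [avgOp, LinearMap.comp_apply, LinearMap.sum_apply, LinearMap.smul_apply, map_sum,
    map_smul]
  refine (Fintype.sum_equiv (MulAut.conj y).toEquiv _ _ fun x => ?_).symm
  have h1 : (MulAut.conj y).toEquiv x = y * x * y⁻¹ := rfl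
  rw [h1, hf, ← Module.End.mul_apply, ← Module.End.mul_apply, ← map_mul, ← map_mul]
  simp

/-- By Schur's lemma the operator is a scalar, and its trace is the sum assumed to vanish. -/
theorem avgOp_eq_zero_of_irr [IsAlgClosed K] [CharZero K] [Fintype G] {V : Type*} [AddCommGroup V]
    [Module K V] [FiniteDimensional K V] {f : G → K} (hf : ∀ x y, f (y * x * y⁻¹) = f x)
    (ρ : Representation K G V) (h : ρ.IsIrreducible) (h0 : ∑ g, f g * ρ.character g = 0) :
    avgOp f ρ = 0 := by
  have hV := ((isIrreducible_iff ρ).1 h).1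
  obtain ⟨c, hc⟩ := (IsIrreducible.algebraMap_intertwiningMap_bijective_of_isAlgClosed
    (ρ := ρ)).2 ⟨avgOp f ρ, avgOp_comm hf ρ⟩
  have hc' : avgOp f ρ = c • LinearMap.id := by
    have := congrArg IntertwiningMap.toLinearMap hc
    refine this.symm.trans ?_
    ext v
    simp [Algebra.algebraMap_eq_smul_one]
  have ht : LinearMap.trace K V (avgOp f ρ) = 0 := by
    rw [avgOp, map_sum, ← h0]
    exact Finset.sum_congr rfl fun g _ => by rw [map_smul]; rfl
  rw [hc', map_smul, LinearMap.trace_id, smul_eq_mul, mul_eq_zero] at ht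
  have : (Module.finrank K V : K) ≠ 0 := by exact_mod_cast Module.finrank_pos.ne'
  rw [hc', ht.resolve_right this, zero_smul]

/-- Maschke's theorem splits off an invariant subspace, and induction on the dimension reduces to
irreducible representations. Applied to the regular representation, this gives the completeness of
the irreducible characters. -/
theorem avgOp_eq_zero.{v} [IsAlgClosed K] [CharZero K] {G : Type} [Group G] [Fintype G] {f : G → K}
    (hf : ∀ x y, f (y * x * y⁻¹) = f x)
    (h0 : ∀ χ : G → K, IsIrrChar χ → ∑ g, f g * χ g = 0) (n : ℕ) :
    ∀ {V : Type v} [AddCommGroup V] [Module K V] [FiniteDimensional K V]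
      (ρ : Representation K G V), Module.finrank K V = n → avgOp f ρ = 0 := by
  induction n using Nat.strong_induction_on with
  | _ n ih =>
    intro V _ _ _ ρ hn
    have : NeZero (Nat.card G : K) := ⟨by exact_mod_cast Nat.card_pos.ne'⟩
    by_cases hirr : ρ.IsIrreducible
    · exact avgOp_eq_zero_of_irr hf ρ hirr (h0 _ (isIrrChar_of_isIrreducible ρ hirr))
    rw [isIrreducible_iff] at hirr
    by_cases hV : Nontrivial V
    swap
    · rw [not_nontrivial_iff_subsingleton] at hV
      exact LinearMap.ext fun v => Subsingleton.elim _ _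
    have : ∃ U : Submodule K V, (∀ g, ∀ v ∈ U, ρ g v ∈ U) ∧ U ≠ ⊥ ∧ U ≠ ⊤ := by
      by_contra hcon
      push Not at hcon
      exact hirr ⟨hV, fun U hU => or_iff_not_imp_left.2 (hcon U hU)⟩
    obtain ⟨U, hU, hb, ht⟩ := this
    let σ : Subrepresentation ρ := ⟨U, fun g v hv => hU g v hv⟩
    obtain ⟨τ, hτ⟩ := exists_isCompl σ
    have hzero : ∀ ξ : Subrepresentation ρ, Module.finrank K ξ.toSubmodule < n →
        ∀ v ∈ ξ.toSubmodule, avgOp f ρ v = 0 := by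
      intro ξ hξ v hv
      have := ih _ hξ ξ.toRepresentation rfl
      have h2 := congrArg (fun l => (l ⟨v, hv⟩ : V)) this
      simpa [avgOp, Subrepresentation.toRepresentation] using h2
    have hsup : σ.toSubmodule ⊔ τ.toSubmodule = ⊤ := by
      have := congrArg Subrepresentation.toSubmodule hτ.sup_eq_top
      rwa [Subrepresentation.toSubmodule_sup] at this
    have hinf : σ.toSubmodule ⊓ τ.toSubmodule = ⊥ := by
      have := congrArg Subrepresentation.toSubmodule hτ.inf_eq_bot
      rwa [Subrepresentation.toSubmodule_inf] at this
    have hdim : Module.finrank K σ.toSubmodule + Module.finrank K τ.toSubmodule = n := by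
      rw [← Submodule.finrank_sup_add_finrank_inf_eq, hsup, hinf]
      simp [hn]
    have hσ : 0 < Module.finrank K σ.toSubmodule :=
      Nat.pos_of_ne_zero fun h => hb (Submodule.finrank_eq_zero.1 h)
    have hσ' : Module.finrank K σ.toSubmodule < n := by
      rw [← hn]; exact Submodule.finrank_lt ht
    ext v
    obtain ⟨x, hx, y, hy, rfl⟩ := Submodule.mem_sup.1 (hsup ▸ Submodule.mem_top : v ∈ _ ⊔ _)
    rw [map_add, hzero σ hσ' x hx, hzero τ (by omega) y hy]
    simp

end Irreducible

/-! ### Class functions -/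

/-- The scalar product `|G|⁻¹ ∑ f(x) g(x⁻¹)`. -/
def cinner {K : Type*} [Field K] {G : Type} [Group G] [Finite G] (f g : G → K) : K :=
  (Nat.card G : K)⁻¹ * ∑ᶠ x : G, f x * g x⁻¹

/-- `f` is constant on conjugacy classes. -/
def IsClassFn {K : Type*} {G : Type} [Group G] (f : G → K) : Prop :=
  ∀ x y, f (y * x * y⁻¹) = f x

section ClassFn

variable {K : Type*} [Field K] {G : Type} [Group G]

theorem IsClassFn.conj' {f : G → K} (hf : IsClassFn f) (x y : G) : f (y⁻¹ * x * y) = f x := by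
  have := hf x y⁻¹
  rwa [inv_inv] at this

theorem IsClassFn.inv {f : G → K} (hf : IsClassFn f) : IsClassFn fun x => f x⁻¹ := fun x y => by
  have := hf x⁻¹ y
  simpa [mul_assoc] using this

theorem IsClassFn.add {f g : G → K} (hf : IsClassFn f) (hg : IsClassFn g) : IsClassFn (f + g) :=
  fun x y => by simp [hf x y, hg x y]

theorem IsClassFn.sub {f g : G → K} (hf : IsClassFn f) (hg : IsClassFn g) : IsClassFn (f - g) :=
  fun x y => by simp [hf x y, hg x y]

theorem IsClassFn.smul {f : G → K} (hf : IsClassFn f) (c : K) : IsClassFn (c • f) :=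
  fun x y => by simp [hf x y]

theorem IsClassFn.sum {ι : Type*} {s : Finset ι} {f : ι → G → K} (hf : ∀ i ∈ s, IsClassFn (f i)) :
    IsClassFn (∑ i ∈ s, f i) := fun x y => by
  simp only [Finset.sum_apply]
  exact Finset.sum_congr rfl fun i hi => hf i hi x y

theorem IsClassFn.comp {H : Type} [Group H] {f : G → K} (hf : IsClassFn f) (φ : H →* G) :
    IsClassFn (f ∘ φ) := fun x y => by
  simp [hf (φ x) (φ y)]

variable [Finite G]

theorem cinner_eq [Fintype G] (f g : G → K) :
    cinner f g = (Nat.card G : K)⁻¹ * ∑ x : G, f x * g x⁻¹ := by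
  rw [cinner, finsum_eq_sum_of_fintype]

theorem cinner_comm (f g : G → K) : cinner f g = cinner g f := by
  have := Fintype.ofFinite G
  rw [cinner_eq, cinner_eq]
  congr 1
  refine Fintype.sum_equiv (Equiv.inv G) _ _ fun x => ?_
  simp [mul_comm]

theorem cinner_add_left (f g h : G → K) : cinner (f + g) h = cinner f h + cinner g h := by
  have := Fintype.ofFinite G
  simp [cinner_eq, add_mul, Finset.sum_add_distrib, mul_add]

theorem cinner_sub_left (f g h : G → K) : cinner (f - g) h = cinner f h - cinner g h := by
  have := Fintype.ofFinite G
  simp [cinner_eq, sub_mul, Finset.sum_sub_distrib, mul_sub]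

theorem cinner_smul_left (c : K) (f h : G → K) : cinner (c • f) h = c * cinner f h := by
  have := Fintype.ofFinite G
  simp only [cinner_eq, Pi.smul_apply, smul_eq_mul, mul_assoc]
  rw [← Finset.mul_sum]
  ring

theorem cinner_zero_left (h : G → K) : cinner 0 h = 0 := by
  have := Fintype.ofFinite G
  simp [cinner_eq]

theorem cinner_sum_left {ι : Type*} (s : Finset ι) (f : ι → G → K) (h : G → K) :
    cinner (∑ i ∈ s, f i) h = ∑ i ∈ s, cinner (f i) h := by
  classical
  induction s using Finset.induction_on with
  | empty => simp [cinner_zero_left]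
  | insert a s ha ih => rw [Finset.sum_insert ha, Finset.sum_insert ha, cinner_add_left, ih]

theorem cinner_add_right (f g h : G → K) : cinner h (f + g) = cinner h f + cinner h g := by
  rw [cinner_comm, cinner_add_left, cinner_comm f, cinner_comm g]

theorem cinner_smul_right (c : K) (f h : G → K) : cinner h (c • f) = c * cinner h f := by
  rw [cinner_comm, cinner_smul_left, cinner_comm f]

theorem cinner_sum_right {ι : Type*} (s : Finset ι) (f : ι → G → K) (h : G → K) :
    cinner h (∑ i ∈ s, f i) = ∑ i ∈ s, cinner h (f i) := by
  rw [cinner_comm, cinner_sum_left]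
  exact Finset.sum_congr rfl fun i _ => cinner_comm _ _

/-- Invariance of the scalar product under isomorphisms. -/
theorem cinner_comp_equiv {H : Type} [Group H] [Finite H] (e : H ≃* G) (f g : G → K) :
    cinner (f ∘ e) (g ∘ e) = cinner f g := by
  have := Fintype.ofFinite G
  have := Fintype.ofFinite H
  rw [cinner_eq, cinner_eq, Nat.card_congr e.toEquiv]
  congr 1
  exact Fintype.sum_equiv e.toEquiv _ _ fun x => by simp

end ClassFn

/-! ### Irreducible characters -/

section IrrChar

variable {K : Type*} [Field K] [IsAlgClosed K] [CharZero K] {G : Type} [Group G]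

theorem IsIrrChar.isClassFn {χ : G → K} (h : IsIrrChar χ) : IsClassFn χ := by
  obtain ⟨d, ρ, -, rfl⟩ := h
  exact fun x y => char_conj ρ x y

theorem IsIrrChar.one_ne_zero {χ : G → K} (h : IsIrrChar χ) : χ 1 ≠ 0 := by
  obtain ⟨d, ρ, hρ, rfl⟩ := h
  have := ((isIrreducible_iff ρ).1 hρ).1
  rw [char_one]
  exact_mod_cast Module.finrank_pos.ne'

variable [Finite G]

-- Schur orthogonality is phrased by isomorphism of representations; the content here is that
-- equality of characters may be tested instead, because a character determines its own norm.
open scoped Classical in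
theorem IsIrrChar.cinner_eq_ite {χ ψ : G → K} (h : IsIrrChar χ) (h' : IsIrrChar ψ) :
    cinner χ ψ = if χ = ψ then 1 else 0 := by
  obtain ⟨d, ρ, hρ, rfl⟩ := h
  obtain ⟨e, σ, hσ, rfl⟩ := h'
  have := Fintype.ofFinite G
  have : Invertible (Nat.card G : K) :=
    invertibleOfNonzero (by exact_mod_cast Nat.card_pos.ne')
  have key : ∀ (d e : ℕ) (ρ : Representation K G (Fin d → K)) (σ : Representation K G (Fin e → K)),
      ρ.IsIrreducible → σ.IsIrreducible → cinner ρ.character σ.character =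
        if Nonempty (Representation.Equiv σ ρ) then 1 else 0 := by
    intro d e ρ σ hρ hσ
    rw [cinner_eq, char_orthonormal]
  rw [key d e ρ σ hρ hσ]
  by_cases hn : Nonempty (Representation.Equiv σ ρ)
  · rw [if_pos hn, if_pos]
    exact (char_iso hn.some).symm
  · rw [if_neg hn, if_neg]
    intro heq
    -- If non-isomorphic representations had the same character, its norm would be both 0 and 1.
    have h1 := key d e ρ σ hρ hσ
    have h2 := key d d ρ ρ hρ hρ
    rw [if_neg hn, ← heq, h2, if_pos ⟨Representation.Equiv.refl ρ⟩] at h1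
    exact _root_.one_ne_zero h1

theorem IsIrrChar.cinner_self {χ : G → K} (h : IsIrrChar χ) : cinner χ χ = 1 := by
  classical
  rw [h.cinner_eq_ite h, if_pos rfl]

theorem IsIrrChar.eq_of_cinner_ne_zero {χ ψ : G → K} (h : IsIrrChar χ) (h' : IsIrrChar ψ)
    (h0 : cinner χ ψ ≠ 0) : χ = ψ := by
  classical
  by_contra hne
  rw [h.cinner_eq_ite h', if_neg hne] at h0
  exact h0 rfl

theorem IsIrrChar.cinner_of_ne {χ ψ : G → K} (h : IsIrrChar χ) (h' : IsIrrChar ψ)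
    (h0 : χ ≠ ψ) : cinner χ ψ = 0 := by
  by_contra hne
  exact h0 (h.eq_of_cinner_ne_zero h' hne)

/-- A class function orthogonal to all irreducible characters vanishes. -/
theorem IsClassFn.eq_zero {f : G → K} (hf : IsClassFn f)
    (h0 : ∀ χ : G → K, IsIrrChar χ → cinner f χ = 0) : f = 0 := by
  have := Fintype.ofFinite G
  let ρ : Representation K G (G → K) :=
    { toFun := fun g => LinearMap.funLeft K K fun x => g⁻¹ * x
      map_one' := by ext; simp [LinearMap.funLeft]
      map_mul' := fun g h => by
        ext v x
        simp [LinearMap.funLeft, mul_assoc] }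
  have key : avgOp (fun x => f x⁻¹) ρ = 0 := by
    refine avgOp_eq_zero (fun x y => hf.inv x y) (fun χ hχ => ?_) _ ρ rfl
    have h1 := h0 χ hχ
    rw [cinner_comm, cinner_eq, mul_eq_zero] at h1
    have h2 : ((Nat.card G : K)⁻¹) ≠ 0 := inv_ne_zero (by exact_mod_cast Nat.card_pos.ne')
    rw [← h1.resolve_left h2]
    exact Finset.sum_congr rfl fun x _ => mul_comm _ _
  classical
  ext g
  -- Applying the zero operator to the delta function at 1 and evaluating at g⁻¹ isolates the
  -- coefficient f(g).
  have h2 := congrFun (congrArg (fun l => l (Pi.single 1 (1 : K))) key) g⁻¹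
  simp only [avgOp, LinearMap.sum_apply, LinearMap.smul_apply, Finset.sum_apply, Pi.smul_apply,
    smul_eq_mul, LinearMap.zero_apply, Pi.zero_apply] at h2
  rw [Finset.sum_eq_single g⁻¹] at h2
  · simpa [ρ, LinearMap.funLeft] using h2
  · intro b _ hb
    have : b⁻¹ * g⁻¹ ≠ 1 := fun h => hb (by
      rw [inv_mul_eq_one] at h; exact h)
    simp [ρ, LinearMap.funLeft, this]
  · simp

/-- Orthonormality makes them linearly independent in a finite-dimensional space. -/
theorem finite_irrChar : {χ : G → K | IsIrrChar χ}.Finite := by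
  have := Fintype.ofFinite G
  have hli : LinearIndependent K (fun χ : {χ : G → K | IsIrrChar χ} => (χ : G → K)) := by
    rw [linearIndependent_iff']
    intro s c hc χ hχ
    have h1 := congrArg (fun f => cinner f (χ : G → K)) hc
    simp only [cinner_sum_left, cinner_smul_left, cinner_zero_left] at h1
    rw [Finset.sum_eq_single χ] at h1
    · rwa [IsIrrChar.cinner_self χ.2, mul_one] at h1
    · intro ψ _ hne
      rw [IsIrrChar.cinner_of_ne ψ.2 χ.2 (fun h => hne (Subtype.ext h)), mul_zero]
    · exact fun h => absurd hχ h
  exact LinearIndependent.set_finite_of_isNoetherian hli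

variable (K G) in
/-- The irreducible characters of a finite group. -/
def irrChars : Finset (G → K) := (finite_irrChar (K := K) (G := G)).toFinset

@[simp]
theorem mem_irrChars {χ : G → K} : χ ∈ irrChars K G ↔ IsIrrChar χ := by
  simp [irrChars]

theorem IsClassFn.expand {f : G → K} (hf : IsClassFn f) :
    f = ∑ χ ∈ irrChars K G, cinner f χ • χ := by
  rw [← sub_eq_zero]
  refine IsClassFn.eq_zero (hf.sub (IsClassFn.sum fun χ hχ =>
    (mem_irrChars.1 hχ).isClassFn.smul _)) fun χ hχ => ?_
  rw [cinner_sub_left, cinner_sum_left, Finset.sum_eq_single χ]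
  · rw [cinner_smul_left, hχ.cinner_self, mul_one, sub_self]
  · intro ψ hψ hne
    rw [cinner_smul_left, (mem_irrChars.1 hψ).cinner_of_ne hχ hne, mul_zero]
  · exact fun h => absurd (mem_irrChars.2 hχ) h

theorem IsClassFn.parseval {f : G → K} (hf : IsClassFn f) (g : G → K) :
    cinner f g = ∑ χ ∈ irrChars K G, cinner f χ * cinner g χ := by
  conv_lhs => rw [hf.expand]
  rw [cinner_sum_left]
  exact Finset.sum_congr rfl fun χ _ => by rw [cinner_smul_left, cinner_comm χ g]

/-- A class function whose scalar products with irreducible characters are natural numbers. -/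
def IsChar (f : G → K) : Prop :=
  IsClassFn f ∧ ∀ χ, IsIrrChar χ → ∃ n : ℕ, cinner f χ = n

theorem isChar_character {V : Type*} [AddCommGroup V] [Module K V] [FiniteDimensional K V]
    (ρ : Representation K G V) : IsChar ρ.character := by
  refine ⟨fun x y => char_conj ρ x y, ?_⟩
  rintro _ ⟨d, σ, hσ, rfl⟩
  have := Fintype.ofFinite G
  have : Invertible (Nat.card G : K) :=
    invertibleOfNonzero (by exact_mod_cast Nat.card_pos.ne')
  exact ⟨_, by rw [cinner_eq, card_inv_mul_sum_char_mul_char_eq_finrank]⟩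

theorem IsIrrChar.isChar {χ : G → K} (h : IsIrrChar χ) : IsChar χ := by
  obtain ⟨d, ρ, hρ, rfl⟩ := h
  exact isChar_character ρ

theorem IsChar.add {f g : G → K} (hf : IsChar f) (hg : IsChar g) : IsChar (f + g) := by
  refine ⟨hf.1.add hg.1, fun χ hχ => ?_⟩
  obtain ⟨m, hm⟩ := hf.2 χ hχ
  obtain ⟨n, hn⟩ := hg.2 χ hχ
  exact ⟨m + n, by rw [cinner_add_left, hm, hn, Nat.cast_add]⟩

theorem IsChar.nsmul {f : G → K} (hf : IsChar f) (n : ℕ) : IsChar ((n : K) • f) := by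
  refine ⟨hf.1.smul _, fun χ hχ => ?_⟩
  obtain ⟨m, hm⟩ := hf.2 χ hχ
  exact ⟨n * m, by rw [cinner_smul_left, hm, Nat.cast_mul]⟩

theorem IsChar.sum {ι : Type*} {s : Finset ι} {f : ι → G → K} (hf : ∀ i ∈ s, IsChar (f i)) :
    IsChar (∑ i ∈ s, f i) := by
  classical
  induction s using Finset.induction_on with
  | empty => exact ⟨fun x y => rfl, fun χ _ => ⟨0, by simp [cinner_zero_left]⟩⟩
  | insert a s ha ih =>
    rw [Finset.sum_insert ha]
    exact (hf a (Finset.mem_insert_self a s)).add (ih fun i hi => hf i (Finset.mem_insert_of_mem hi))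

theorem IsChar.exists_cinner {f g : G → K} (hf : IsChar f) (hg : IsChar g) :
    ∃ n : ℕ, cinner f g = n := by
  choose m hm using hf.2
  choose n hn using hg.2
  refine ⟨∑ χ ∈ (irrChars K G).attach, m χ (mem_irrChars.1 χ.2) * n χ (mem_irrChars.1 χ.2), ?_⟩
  rw [hf.1.parseval, ← Finset.sum_attach, Nat.cast_sum]
  exact Finset.sum_congr rfl fun χ _ => by rw [hm _ (mem_irrChars.1 χ.2), hn _ (mem_irrChars.1 χ.2),
    Nat.cast_mul]

/-- The squares of the multiplicities are natural numbers with sum 1, so one multiplicity is 1 and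
the others vanish. -/
theorem IsChar.isIrrChar {f : G → K} (hf : IsChar f) (h1 : cinner f f = 1) : IsIrrChar f := by
  choose m hm using hf.2
  have hsum : ∑ χ ∈ (irrChars K G).attach, m χ (mem_irrChars.1 χ.2) ^ 2 = 1 := by
    have := hf.1.parseval f
    rw [h1, ← Finset.sum_attach] at this
    have h2 : ((1 : ℕ) : K) = ((∑ χ ∈ (irrChars K G).attach, m χ (mem_irrChars.1 χ.2) ^ 2 : ℕ) : K) := by
      rw [Nat.cast_one, this, Nat.cast_sum]
      exact Finset.sum_congr rfl fun χ _ => by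
        rw [hm _ (mem_irrChars.1 χ.2), Nat.cast_pow, sq]
    exact (Nat.cast_injective h2).symm
  have hex : ∃ χ : {χ // χ ∈ irrChars K G}, m χ (mem_irrChars.1 χ.2) ≠ 0 := by
    by_contra hcon
    push Not at hcon
    simp [hcon] at hsum
  obtain ⟨χ, hχ⟩ := hex
  have hle : m χ (mem_irrChars.1 χ.2) ^ 2 ≤ 1 := by
    rw [← hsum]
    exact Finset.single_le_sum (f := fun χ : {χ // χ ∈ irrChars K G} =>
      m χ (mem_irrChars.1 χ.2) ^ 2) (fun _ _ => Nat.zero_le _) (Finset.mem_attach _ χ)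
  have hone : m χ (mem_irrChars.1 χ.2) = 1 := by nlinarith [Nat.pos_of_ne_zero hχ]
  have hother : ∀ ψ : {χ // χ ∈ irrChars K G}, ψ ≠ χ → m ψ (mem_irrChars.1 ψ.2) = 0 := by
    intro ψ hne
    have h3 := Finset.add_le_sum (f := fun χ : {χ // χ ∈ irrChars K G} =>
      m χ (mem_irrChars.1 χ.2) ^ 2) (fun _ _ => Nat.zero_le _) (Finset.mem_attach _ χ)
      (Finset.mem_attach _ ψ) hne.symm
    rw [hsum, hone] at h3
    have : m ψ (mem_irrChars.1 ψ.2) ^ 2 = 0 := by omega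
    exact pow_eq_zero_iff (two_ne_zero) |>.1 this
  have : f = χ := by
    conv_lhs => rw [hf.1.expand]
    rw [Finset.sum_eq_single (χ : G → K)]
    · rw [hm _ (mem_irrChars.1 χ.2), hone, Nat.cast_one, one_smul]
    · intro ψ hψ hne
      rw [hm _ (mem_irrChars.1 hψ), hother ⟨ψ, hψ⟩ fun h => hne (congrArg Subtype.val h),
        Nat.cast_zero, zero_smul]
    · exact fun h => absurd χ.2 h
  rw [this]
  exact mem_irrChars.1 χ.2

theorem IsChar.expand {f : G → K} (hf : IsChar f) :
    ∃ m : (G → K) → ℕ, f = ∑ χ ∈ irrChars K G, (m χ : K) • χ := by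
  classical
  choose m hm using hf.2
  refine ⟨fun χ => if h : IsIrrChar χ then m χ h else 0, ?_⟩
  conv_lhs => rw [hf.1.expand]
  refine Finset.sum_congr rfl fun χ hχ => ?_
  rw [hm _ (mem_irrChars.1 hχ)]
  simp only [dif_pos (mem_irrChars.1 hχ)]

theorem IsChar.comp {H : Type} [Group H] [Finite H] {f : G → K} (hf : IsChar f) (φ : H →* G) :
    IsChar (f ∘ φ) := by
  obtain ⟨m, hm⟩ := hf.expand
  have : f ∘ φ = ∑ χ ∈ irrChars K G, (m χ : K) • (χ ∘ φ) := by
    conv_lhs => rw [hm]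
    ext x
    simp
  rw [this]
  refine IsChar.sum fun χ hχ => IsChar.nsmul ?_ _
  obtain ⟨d, ρ, hρ, rfl⟩ := mem_irrChars.1 hχ
  exact isChar_character (ρ.comp φ)

theorem IsChar.mul {f g : G → K} (hf : IsChar f) (hg : IsChar g) : IsChar (f * g) := by
  obtain ⟨m, hm⟩ := hf.expand
  obtain ⟨n, hn⟩ := hg.expand
  have : f * g = ∑ χ ∈ irrChars K G, ∑ ψ ∈ irrChars K G, ((m χ * n ψ : ℕ) : K) • (χ * ψ) := by
    conv_lhs => rw [hm, hn]
    rw [Finset.sum_mul]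
    refine Finset.sum_congr rfl fun χ _ => ?_
    rw [Finset.mul_sum]
    refine Finset.sum_congr rfl fun ψ _ => ?_
    rw [smul_mul_smul_comm, Nat.cast_mul]
  rw [this]
  refine IsChar.sum fun χ hχ => IsChar.sum fun ψ hψ => IsChar.nsmul ?_ _
  obtain ⟨d, ρ, hρ, rfl⟩ := mem_irrChars.1 hχ
  obtain ⟨e, σ, hσ, rfl⟩ := mem_irrChars.1 hψ
  rw [← char_tensor]
  exact isChar_character _

theorem isChar_hom (ε : G →* K) : IsChar (fun x => ε x) := by
  let ρ : Representation K G K := ((Algebra.lmul K K : K →* Module.End K K)).comp ε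
  have : (fun x => ε x) = ρ.character := by
    ext x
    simp only [ρ, character, MonoidHom.comp_apply]
    exact (LinearMap.trace_eq_matrix_trace K (Module.Basis.singleton Unit K) _ |>.trans (by
      simp [Matrix.trace, LinearMap.toMatrix_apply])).symm
  rw [this]
  exact isChar_character ρ

theorem IsIrrChar.hom_mul {χ : G → K} (h : IsIrrChar χ) (ε : G →* K) :
    IsIrrChar fun x => ε x * χ x := by
  refine ((isChar_hom ε).mul h.isChar).isIrrChar ?_
  rw [← h.cinner_self]
  have := Fintype.ofFinite G
  rw [cinner_eq, cinner_eq]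
  congr 1
  refine Finset.sum_congr rfl fun x _ => ?_
  have : ε x * ε x⁻¹ = 1 := by rw [← map_mul, mul_inv_cancel, map_one]
  simp only [Pi.mul_apply]
  linear_combination χ x * χ x⁻¹ * this

theorem IsIrrChar.comp_surjective {H : Type} [Group H] {χ : G → K} (h : IsIrrChar χ)
    (φ : H →* G) (hφ : Function.Surjective φ) : IsIrrChar (χ ∘ φ) := by
  obtain ⟨d, ρ, hρ, rfl⟩ := h
  refine ⟨d, ρ.comp φ, ?_, rfl⟩
  rw [isIrreducible_iff] at hρ ⊢
  refine ⟨hρ.1, fun U hU => hρ.2 U fun g v hv => ?_⟩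
  obtain ⟨x, rfl⟩ := hφ g
  exact hU x v hv

theorem cinner_prod {H : Type} [Group H] [Finite H] (φ φ' : G → K) (ψ ψ' : H → K) :
    cinner (fun p : G × H => φ p.1 * ψ p.2) (fun p : G × H => φ' p.1 * ψ' p.2) =
      cinner φ φ' * cinner ψ ψ' := by
  have := Fintype.ofFinite G
  have := Fintype.ofFinite H
  rw [cinner_eq, cinner_eq, cinner_eq, Nat.card_prod, Nat.cast_mul, mul_inv, Fintype.sum_prod_type]
  rw [mul_mul_mul_comm, Finset.sum_mul_sum]
  congr 1
  refine Finset.sum_congr rfl fun x _ => Finset.sum_congr rfl fun y _ => ?_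
  simp only [Prod.fst_inv, Prod.snd_inv]
  ring

theorem IsIrrChar.prod {H : Type} [Group H] [Finite H] {φ : G → K} {ψ : H → K}
    (hφ : IsIrrChar φ) (hψ : IsIrrChar ψ) : IsIrrChar fun p : G × H => φ p.1 * ψ p.2 := by
  refine IsChar.isIrrChar ((hφ.isChar.comp (MonoidHom.fst G H)).mul
    (hψ.isChar.comp (MonoidHom.snd G H))) ?_
  exact (cinner_prod φ φ ψ ψ).trans (by rw [hφ.cinner_self, hψ.cinner_self, mul_one])

/-- A class function on a product which is orthogonal to all products vanishes. -/
theorem IsClassFn.eq_zero_of_prod {H : Type} [Group H] [Finite H] {f : G × H → K}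
    (hf : IsClassFn f) (h0 : ∀ φ ψ, IsIrrChar φ → IsIrrChar ψ →
      cinner f (fun p : G × H => φ p.1 * ψ p.2) = 0) : f = 0 := by
  have := Fintype.ofFinite G
  have := Fintype.ofFinite H
  have step : ∀ φ : G → K, IsIrrChar φ → (fun y : H => cinner (fun x => f (x, y)) φ) = 0 := by
    intro φ hφ
    refine IsClassFn.eq_zero (fun y z => ?_) fun ψ hψ => ?_
    · congr 1
      ext x
      have := hf (x, y) (1, z)
      simpa using this
    · rw [← h0 φ ψ hφ hψ, cinner_eq, cinner_eq, Nat.card_prod, Nat.cast_mul, mul_inv,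
        Fintype.sum_prod_type, mul_comm (Nat.card G : K)⁻¹, mul_assoc, Finset.sum_comm,
        Finset.mul_sum (s := Finset.univ) (a := (Nat.card G : K)⁻¹)]
      congr 1
      refine Finset.sum_congr rfl fun y _ => ?_
      rw [cinner_eq, mul_assoc, Finset.sum_mul]
      congr 1
      refine Finset.sum_congr rfl fun x _ => ?_
      simp only [Prod.fst_inv, Prod.snd_inv]
      ring
  ext ⟨x, y⟩
  have : (fun x => f (x, y)) = 0 := IsClassFn.eq_zero (fun x z => by
    have := hf (x, y) (z, 1)
    simpa using this) fun φ hφ => congrFun (step φ hφ) y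
  exact congrFun this x

/-- Two irreducible characters of a group whose restrictions to the kernel of a sign character
coincide and are irreducible differ at most by that sign. -/
theorem IsIrrChar.eq_or_eq_hom_mul {χ ψ : G → K} (hχ : IsIrrChar χ) (hψ : IsIrrChar ψ)
    (ε : G →* K) (hε : ∀ x, ε x = 1 ∨ ε x = -1) (h : ∀ x, ε x = 1 → χ x = ψ x) :
    χ = ψ ∨ χ = fun x => ε x * ψ x := by
  by_contra hcon
  push Not at hcon
  have h1 := hχ.cinner_of_ne hψ hcon.1
  have h2 := hχ.cinner_of_ne (hψ.hom_mul ε) hcon.2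
  have h3 := hψ.cinner_self
  -- 1 + ε is twice the indicator function of the kernel, where χ and ψ agree. The left side is 0
  -- under the assumption to be refuted, the right side is 1 plus a natural number.
  have key : cinner χ ψ + cinner χ (fun x => ε x * ψ x) = cinner ψ ψ + cinner ψ (fun x => ε x * ψ x) := by
    rw [← cinner_add_right, ← cinner_add_right]
    have := Fintype.ofFinite G
    rw [cinner_eq, cinner_eq]
    congr 1
    refine Finset.sum_congr rfl fun x _ => ?_
    have hinv : ε x⁻¹ = ε x := by
      have : ε x * ε x⁻¹ = 1 := by rw [← map_mul, mul_inv_cancel, map_one]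
      rcases hε x with h | h <;> rw [h] at this ⊢
      · simpa using this
      · linear_combination -this
    simp only [Pi.add_apply, hinv]
    rcases hε x with hx | hx
    · rw [h x hx]
    · rw [hx]; ring
  rw [h1, h2, h3] at key
  obtain ⟨n, hn⟩ := hψ.isChar.exists_cinner (hψ.hom_mul ε).isChar
  rw [hn] at key
  have h4 : ((0 : ℕ) : K) = ((1 + n : ℕ) : K) := by push_cast; linear_combination key
  have := Nat.cast_injective h4
  omega

/-! ### Induced class functions -/

/-- Extension by zero, averaged over the conjugates. -/
def indFn {S : Subgroup G} (φ : S → K) (x : G) : K :=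
  (Nat.card S : K)⁻¹ * ∑ᶠ y : G, extZero φ (y⁻¹ * x * y)

theorem isClassFn_indFn {S : Subgroup G} (φ : S → K) : IsClassFn (indFn φ) := by
  intro x z
  have := Fintype.ofFinite G
  simp only [indFn, finsum_eq_sum_of_fintype]
  congr 1
  exact Fintype.sum_equiv (Equiv.mulLeft z⁻¹) _ _ fun y => by simp [mul_assoc]

theorem extZero_apply_mem {S : Subgroup G} (φ : S → K) (x : S) : extZero φ (x : G) = φ x := by
  rw [extZero, dif_pos x.2]

theorem extZero_of_mem {S : Subgroup G} (φ : S → K) {x : G} (h : x ∈ S) :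
    extZero φ x = φ ⟨x, h⟩ := by
  rw [extZero, dif_pos h]

theorem extZero_of_notMem {S : Subgroup G} (φ : S → K) {x : G} (h : x ∉ S) :
    extZero φ x = 0 := by
  rw [extZero, dif_neg h]

theorem sum_subgroup_eq [Fintype G] {S : Subgroup G} [Fintype S] (φ : S → K) (f : G → K) :
    ∑ x : S, φ x * f x = ∑ x : G, extZero φ x * f x := by
  classical
  have h1 : ∑ x : S, φ x * f x = ∑ x : S, extZero φ (x : G) * f x :=
    Finset.sum_congr rfl fun x _ => by rw [extZero_apply_mem]
  rw [h1, ← Finset.sum_filter_add_sum_filter_not Finset.univ (· ∈ S), Finset.sum_eq_zero (s := Finset.univ.filter (¬ · ∈ S)), add_zero]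
  · exact (Finset.sum_subtype (Finset.univ.filter (· ∈ S)) (by simp)
      (fun x => extZero φ x * f x)).symm
  · intro x hx
    rw [extZero_of_notMem φ (Finset.mem_filter.1 hx).2, zero_mul]

/-- Frobenius reciprocity. -/
theorem cinner_indFn {S : Subgroup G} (φ : S → K) {f : G → K} (hf : IsClassFn f) :
    cinner (indFn φ) f = cinner φ (fun x : S => f x) := by
  have := Fintype.ofFinite G
  have := Fintype.ofFinite S
  rw [cinner_eq, cinner_eq]
  have h1 := sum_subgroup_eq φ (fun x => f x⁻¹)
  simp only [← Subgroup.coe_inv] at h1 ⊢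
  rw [h1]
  simp only [indFn, finsum_eq_sum_of_fintype]
  have h2 : ∀ y : G, ∑ x : G, extZero φ (y⁻¹ * x * y) * f x⁻¹ = ∑ x : G, extZero φ x * f x⁻¹ := by
    intro y
    refine Fintype.sum_equiv (MulAut.conj y⁻¹).toEquiv _ _ fun x => ?_
    have : (MulAut.conj y⁻¹).toEquiv x = y⁻¹ * x * y := by simp
    rw [this]
    congr 1
    have := hf.conj' x⁻¹ y
    rw [← this]
    simp [mul_assoc]
  simp_rw [mul_assoc (Nat.card S : K)⁻¹, Finset.sum_mul]
  rw [← Finset.mul_sum, Finset.sum_comm, Finset.sum_congr rfl fun y _ => h2 y]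
  rw [Finset.sum_const, Finset.card_univ, nsmul_eq_mul, ← Nat.card_eq_fintype_card,
    ← mul_assoc, ← mul_assoc, mul_comm (Nat.card G : K)⁻¹, mul_assoc (Nat.card S : K)⁻¹,
    inv_mul_cancel₀ (by exact_mod_cast Nat.card_pos.ne'), mul_one]

theorem IsChar.restrict {f : G → K} (hf : IsChar f) (S : Subgroup G) :
    IsChar fun x : S => f x := hf.comp S.subtype

theorem IsChar.indFn {S : Subgroup G} {φ : S → K} (hφ : IsChar φ) : IsChar (indFn φ) := by
  refine ⟨isClassFn_indFn φ, fun χ hχ => ?_⟩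
  rw [cinner_indFn φ hχ.isClassFn]
  exact hφ.exists_cinner (hχ.isChar.restrict S)

/-! ### Values of characters -/

/-- A field automorphism inverting the roots of unity maps `χ(x)` to `χ(x⁻¹)`. -/
theorem IsIrrChar.bar_apply {χ : G → K} (h : IsIrrChar χ) (bar : K ≃+* K)
    (hbar : ∀ (ω : K) (k : ℕ), 0 < k → ω ^ k = 1 → bar ω = ω⁻¹) (x : G) :
    bar (χ x) = χ x⁻¹ := by
  -- On the cyclic group generated by x the character is a sum of linear ones, whose values are
  -- roots of unity of order dividing the order of this group; there `bar` is inversion by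
  -- hypothesis.
  let Z := Subgroup.zpowers x
  have hZ : IsMulCommutative Z := inferInstance
  obtain ⟨m, hm⟩ := (h.isChar.restrict Z).expand
  have key : ∀ ψ : Z → K, IsIrrChar ψ → ∀ z : Z, bar (ψ z) = ψ z⁻¹ := by
    rintro _ ⟨d, ρ, hρ, rfl⟩ z
    have h1 := IsIrreducible.finrank_eq_one_of_isMulCommutative ρ
    obtain ⟨c, hc⟩ : ∃ c : Z →* K, ρ.character = c := by
      have hmul : ∀ z w, ρ.character (z * w) = ρ.character z * ρ.character w := by
        intro z w
        have hs : ∀ l : (Fin d → K) →ₗ[K] (Fin d → K),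
            l = LinearMap.trace K _ l • LinearMap.id := by
          intro l
          obtain ⟨c, hc, -⟩ := LinearMap.existsUnique_eq_smul_id_of_finrank_eq_one h1 l
          rw [hc, map_smul, LinearMap.trace_id, h1, Nat.cast_one, smul_eq_mul, mul_one]
        simp only [character]
        rw [map_mul, hs (ρ z), hs (ρ w)]
        have : (LinearMap.id : (Fin d → K) →ₗ[K] (Fin d → K)) * LinearMap.id = LinearMap.id := rfl
        rw [smul_mul_smul_comm, this]
        simp only [map_smul, LinearMap.trace_id, h1, Nat.cast_one, smul_eq_mul, mul_one]
      exact ⟨⟨⟨ρ.character, by rw [char_one, h1, Nat.cast_one]⟩, hmul⟩, rfl⟩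
    rw [hc, map_inv]
    refine hbar _ (Nat.card Z) Nat.card_pos ?_
    rw [← map_pow, pow_card_eq_one', map_one]
  have e1 := congrFun hm ⟨x, Subgroup.mem_zpowers x⟩
  have e2 := congrFun hm (⟨x, Subgroup.mem_zpowers x⟩⁻¹)
  simp only [Finset.sum_apply, Pi.smul_apply, smul_eq_mul, Subgroup.coe_inv] at e1 e2
  rw [e1, e2, map_sum]
  refine Finset.sum_congr rfl fun ψ hψ => ?_
  rw [map_mul, map_natCast, key ψ (mem_irrChars.1 hψ)]

end IrrChar

open Representation

/-! ### Row and column stabilisers -/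

section Diagrams

variable {κ : Type} [Fintype κ] {γ δ : Type}

/-- The permutations preserving the function `c`. -/
def fiberStab (c : κ → γ) : Subgroup (Equiv.Perm κ) where
  carrier := {σ | ∀ x, c (σ x) = c x}
  mul_mem' := fun {σ τ} hσ hτ x => by
    rw [Equiv.Perm.mul_apply, hσ, hτ]
  one_mem' := fun _ => rfl
  inv_mem' := fun {σ} hσ x => by
    have := hσ (σ⁻¹ x)
    rw [show σ (σ⁻¹ x) = x from σ.apply_symm_apply x] at this
    exact this.symm

theorem mem_fiberStab {c : κ → γ} {σ : Equiv.Perm κ} : σ ∈ fiberStab c ↔ ∀ x, c (σ x) = c x :=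
  Iff.rfl

/-- A generalised Young diagram, with rows numbered by `r` and columns by `c`: a cell is determined
by its row and column, and together with a cell its column has all cells above it. -/
structure IsDiagram (r : κ → ℕ) (c : κ → γ) : Prop where
  inj : ∀ x y, r x = r y → c x = c y → x = y
  closed : ∀ x, ∀ i < r x, ∃ y, c y = c x ∧ r y = i

/-- The number of cells in the first `k` rows. -/
def rowCount (r : κ → ℕ) (k : ℕ) : ℕ := Nat.card {x // r x < k}

open scoped Classical in
theorem rowCount_eq (r : κ → ℕ) (k : ℕ) :
    rowCount r k = (Finset.univ.filter fun x => r x < k).card := by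
  rw [rowCount, Nat.card_eq_fintype_card, Fintype.card_subtype]

open scoped Classical in
theorem rowCount_eq_sum (r : κ → ℕ) (c : κ → γ) (k : ℕ) :
    rowCount r k = ∑ j ∈ Finset.univ.image c,
      (Finset.univ.filter fun x => c x = j ∧ r x < k).card := by
  rw [rowCount_eq, Finset.card_eq_sum_card_fiberwise (f := c) (t := Finset.univ.image c)]
  · refine Finset.sum_congr rfl fun j _ => ?_
    rw [Finset.filter_filter]
    congr 1
    ext x
    simp [and_comm]
  · intro x _
    simp

-- Either a column of the diagram lies entirely in the first k rows, or it fills each of them. A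
-- labelling that is injective on the column puts at most k of its cells there.
open scoped Classical in
theorem IsDiagram.card_column_le {r : κ → ℕ} {c : κ → γ} (h : IsDiagram r c) {r' : κ → ℕ}
    (h' : ∀ x y, r' x = r' y → c x = c y → x = y) (j : γ) (k : ℕ) :
    (Finset.univ.filter fun x => c x = j ∧ r' x < k).card ≤
      (Finset.univ.filter fun x => c x = j ∧ r x < k).card := by
  by_cases hk : ∀ x, c x = j → r x < k
  · refine Finset.card_le_card fun x hx => ?_
    simp only [Finset.mem_filter, Finset.mem_univ, true_and] at hx ⊢
    exact ⟨hx.1, hk x hx.1⟩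
  · push Not at hk
    obtain ⟨x, hx, hkx⟩ := hk
    calc (Finset.univ.filter fun x => c x = j ∧ r' x < k).card ≤ (Finset.range k).card := by
          refine Finset.card_le_card_of_injOn r' (fun y hy => ?_) fun y hy z hz hyz => ?_
          · simp only [Finset.coe_filter, Finset.mem_univ, true_and, Set.mem_ofPred_eq] at hy
            simpa using hy.2
          · simp only [Finset.coe_filter, Finset.mem_univ, true_and, Set.mem_ofPred_eq] at hy hz
            exact h' y z hyz (hy.1.trans hz.1.symm)
      _ ≤ ((Finset.univ.filter fun x => c x = j ∧ r x < k).image r).card := by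
          refine Finset.card_le_card fun i hi => ?_
          rw [Finset.mem_range] at hi
          obtain ⟨y, hy, hyi⟩ := h.closed x i (hi.trans_le hkx)
          rw [Finset.mem_image]
          exact ⟨y, by simp [hy, hx, hyi, hi], hyi⟩
      _ ≤ _ := Finset.card_image_le

theorem IsDiagram.rowCount_le {r : κ → ℕ} {c : κ → γ} (h : IsDiagram r c) {r' : κ → ℕ}
    (h' : ∀ x y, r' x = r' y → c x = c y → x = y) (k : ℕ) : rowCount r' k ≤ rowCount r k := by
  classical
  rw [rowCount_eq_sum r' c, rowCount_eq_sum r c]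
  exact Finset.sum_le_sum fun j _ => h.card_column_le h' j k

/-- Two bijective labellings with the same fibre sizes differ by a permutation. -/
theorem exists_perm_of_rowCount_eq {r r' : κ → ℕ} {c : κ → γ} (h : IsDiagram r c)
    (h' : ∀ x y, r' x = r' y → c x = c y → x = y) (heq : ∀ k, rowCount r' k = rowCount r k) :
    ∃ q : Equiv.Perm κ, (∀ x, r (q x) = r' x) ∧ ∀ x, c (q x) = c x := by
  classical
  -- The row counts are sums over the columns of numbers comparable term by term, so equality of the
  -- sums gives equality in every column.
  have hcol : ∀ j k, (Finset.univ.filter fun x => c x = j ∧ r' x < k).card =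
      (Finset.univ.filter fun x => c x = j ∧ r x < k).card := by
    intro j k
    by_cases hj : j ∈ Finset.univ.image c
    · have := heq k
      rw [rowCount_eq_sum r' c, rowCount_eq_sum r c] at this
      exact (Finset.sum_eq_sum_iff_of_le fun j _ => h.card_column_le h' j k).1 this j hj
    · have : ∀ x, c x ≠ j := fun x hx => hj (by rw [← hx]; simp)
      simp [this]
  -- If the column of x had no cell in row `r' x`, its count for `r` would not grow from `r' x` to
  -- `r' x + 1`, whereas the count for `r'` does, because of x itself.
  have hcell : ∀ x, ∃ y, r y = r' x ∧ c y = c x := by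
    intro x
    by_contra hcon
    push Not at hcon
    have h1 := hcol (c x) (r' x)
    have h2 := hcol (c x) (r' x + 1)
    have h3 : (Finset.univ.filter fun y => c y = c x ∧ r y < r' x + 1) =
        (Finset.univ.filter fun y => c y = c x ∧ r y < r' x) := by
      ext y
      simp only [Finset.mem_filter, Finset.mem_univ, true_and]
      constructor
      · rintro ⟨h4, h5⟩
        refine ⟨h4, lt_of_le_of_ne (Nat.lt_succ_iff.1 h5) fun h6 => hcon y h6 h4⟩
      · rintro ⟨h4, h5⟩
        exact ⟨h4, by omega⟩
    rw [h3, ← h1] at h2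
    have h4 : (Finset.univ.filter fun y => c y = c x ∧ r' y < r' x) ⊂
        (Finset.univ.filter fun y => c y = c x ∧ r' y < r' x + 1) := by
      rw [Finset.ssubset_iff_of_subset]
      · exact ⟨x, by simp, by simp⟩
      · intro y hy
        simp only [Finset.mem_filter, Finset.mem_univ, true_and] at hy ⊢
        exact ⟨hy.1, by omega⟩
    exact absurd h2 (Finset.card_lt_card h4).ne'
  choose q hq hqc using hcell
  have hinj : Function.Injective q := fun x y hxy =>
    h' x y (by rw [← hq, ← hq, hxy]) (by rw [← hqc x, ← hqc y, hxy])
  exact ⟨Equiv.ofBijective q (Finite.injective_iff_bijective.1 hinj), hq, hqc⟩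

theorem rowCount_comp (r : κ → ℕ) (y : Equiv.Perm κ) (k : ℕ) :
    rowCount (fun x => r (y x)) k = rowCount r k :=
  Nat.card_congr (y.subtypeEquiv fun _ => Iff.rfl)

/-- For a diagram, the rearrangements without two cells in the same row and column are the products
of a row permutation and a column permutation. -/
theorem IsDiagram.card_rearrangements {r : κ → ℕ} {c : κ → γ} (h : IsDiagram r c) :
    Nat.card {y : Equiv.Perm κ // ∀ x x', r (y x) = r (y x') → c x = c x' → x = x'} =
      Nat.card (fiberStab r) * Nat.card (fiberStab c) := by
  rw [← Nat.card_prod]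
  symm
  refine Nat.card_congr (Equiv.ofBijective
    (fun p : fiberStab r × fiberStab c => ⟨p.1 * p.2, fun x x' h1 h2 => ?_⟩) ⟨?_, ?_⟩)
  · rw [Equiv.Perm.mul_apply, Equiv.Perm.mul_apply, p.1.2, p.1.2] at h1
    refine (p.2 : Equiv.Perm κ).injective (h.inj _ _ h1 ?_)
    rw [p.2.2, p.2.2, h2]
  · rintro ⟨p, q⟩ ⟨p', q'⟩ heq
    have heq' : (p : Equiv.Perm κ) * q = p' * q' := congrArg Subtype.val heq
    have hq : (q : Equiv.Perm κ) = q' := by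
      ext x
      refine h.inj _ _ ?_ ?_
      · have := congrArg (fun y => r (y x)) heq'
        simp only [Equiv.Perm.mul_apply] at this
        rwa [p.2, p'.2] at this
      · rw [q.2, q'.2]
    have hp : (p : Equiv.Perm κ) = p' := by rw [hq] at heq'; exact mul_right_cancel heq'
    exact Prod.ext (Subtype.ext hp) (Subtype.ext hq)
  · rintro ⟨y, hy⟩
    obtain ⟨q, hq, hqc⟩ := exists_perm_of_rowCount_eq h hy fun k => rowCount_comp r y k
    refine ⟨⟨⟨y * q⁻¹, fun x => ?_⟩, ⟨q, hqc⟩⟩, Subtype.ext (by simp)⟩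
    rw [Equiv.Perm.mul_apply, ← hq, show q (q⁻¹ x) = x from q.apply_symm_apply x]

end Diagrams

/-! ### Characters induced from row and column stabilisers -/

section Induced

variable {K : Type*} [Field K] [IsAlgClosed K] [CharZero K]
variable {κ : Type} [Fintype κ] {γ δ : Type}

variable (K κ) in
/-- The sign character with values in `K`. -/
def signHom : Equiv.Perm κ →* K :=
  open Classical in
  ((Int.castRingHom K : ℤ →* K).comp (Units.coeHom ℤ)).comp Equiv.Perm.sign

theorem signHom_apply [DecidableEq κ] (σ : Equiv.Perm κ) :
    signHom K κ σ = (((Equiv.Perm.sign σ : ℤˣ) : ℤ) : K) := by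
  simp only [signHom, MonoidHom.comp_apply, Units.coeHom_apply, MonoidHom.coe_coe,
    Int.coe_castRingHom]
  congr!

variable (K) in
/-- The permutation character on the rearrangements of the rows. -/
def rowInd (r : κ → γ) : Equiv.Perm κ → K := indFn fun _ : fiberStab r => (1 : K)

variable (K) in
/-- The character induced from the sign character of the column stabiliser. -/
def colInd (c : κ → γ) : Equiv.Perm κ → K := indFn fun σ : fiberStab c => signHom K κ σ

theorem isChar_rowInd (r : κ → γ) : IsChar (rowInd K r) :=
  IsChar.indFn (isChar_hom (1 : fiberStab r →* K))

theorem isChar_colInd (c : κ → γ) : IsChar (colInd K c) :=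
  IsChar.indFn (isChar_hom ((signHom K κ).comp (fiberStab c).subtype))

open scoped Classical in
theorem extZero_eq_ite {G : Type} [Group G] [Finite G] {S : Subgroup G} (f : G → K)
    (x : G) : extZero (fun y : S => f y) x = if x ∈ S then f x else 0 := by
  split_ifs with h
  · rw [extZero_of_mem _ h]
  · rw [extZero_of_notMem _ h]

open scoped Classical in
theorem cinner_restrict {G : Type} [Group G] [Fintype G] {S : Subgroup G} (f g : G → K) :
    cinner (fun y : S => f y) (fun y : S => g y) =
      (Nat.card S : K)⁻¹ * ∑ x : G, if x ∈ S then f x * g x⁻¹ else 0 := by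
  rw [cinner_eq]
  congr 1
  have := sum_subgroup_eq (fun y : S => f y) (fun x => g x⁻¹)
  simp only [Subgroup.coe_inv]
  rw [this]
  refine Finset.sum_congr rfl fun x _ => ?_
  rw [extZero_eq_ite]
  split_ifs <;> simp

open scoped Classical in
theorem cinner_rowInd (r : κ → γ) {χ : Equiv.Perm κ → K} (hχ : IsClassFn χ) :
    cinner (rowInd K r) χ = (Nat.card (fiberStab r) : K)⁻¹ *
      ∑ σ : Equiv.Perm κ, if ∀ x, r (σ x) = r x then χ σ else 0 := by
  rw [rowInd, cinner_indFn _ hχ, cinner_comm, cinner_restrict χ (fun _ => (1 : K))]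
  congr 1
  exact Finset.sum_congr rfl fun x _ => by simp only [mul_one, mem_fiberStab]

open scoped Classical in
theorem cinner_colInd (c : κ → γ) {χ : Equiv.Perm κ → K} (hχ : IsClassFn χ) :
    cinner (colInd K c) χ = (Nat.card (fiberStab c) : K)⁻¹ *
      ∑ σ : Equiv.Perm κ, if ∀ x, c (σ x) = c x then signHom K κ σ * χ σ else 0 := by
  rw [colInd, cinner_indFn _ hχ, cinner_comm, cinner_restrict χ]
  congr 1
  refine Finset.sum_congr rfl fun x _ => ?_
  simp only [mem_fiberStab, signHom_apply, Equiv.Perm.sign_inv, mul_comm]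

-- If two cells share both labels, their transposition pairs off permutations of opposite sign;
-- otherwise only the identity contributes.
open scoped Classical in
theorem sum_sign_fiberStab (r : κ → γ) (c : κ → δ) :
    (∑ σ : Equiv.Perm κ, if (∀ x, r (σ x) = r x) ∧ ∀ x, c (σ x) = c x then signHom K κ σ else 0) =
      if ∀ x y, r x = r y → c x = c y → x = y then 1 else 0 := by
  split_ifs with h
  · rw [Finset.sum_eq_single 1]
    · simp
    · intro σ _ hσ
      rw [if_neg]
      rintro ⟨h1, h2⟩
      exact hσ (Equiv.ext fun x => h _ _ (h1 x) (h2 x))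
    · simp
  · push Not at h
    obtain ⟨x, y, hr, hc, hxy⟩ := h
    set S := ∑ σ : Equiv.Perm κ,
      if (∀ x, r (σ x) = r x) ∧ ∀ x, c (σ x) = c x then signHom K κ σ else 0 with hS
    have hswap : ∀ {β : Type} (f : κ → β), f x = f y → ∀ z, f (Equiv.swap x y z) = f z := by
      intro β f hf z
      rcases Equiv.swap_apply_eq_iff.1 (rfl : Equiv.swap x y z = _) |>.symm with _
      by_cases hzx : z = x
      · rw [hzx, Equiv.swap_apply_left, hf]
      by_cases hzy : z = y
      · rw [hzy, Equiv.swap_apply_right, hf]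
      rw [Equiv.swap_apply_of_ne_of_ne hzx hzy]
    have h1 : S = -S := by
      conv_lhs => rw [hS]
      rw [hS, ← Finset.sum_neg_distrib]
      refine Fintype.sum_equiv (Equiv.mulLeft (Equiv.swap x y)) _ _ fun σ => ?_
      simp only [Equiv.coe_mulLeft, Equiv.Perm.mul_apply, hswap r hr, hswap c hc, signHom_apply,
        Equiv.Perm.sign_mul, Equiv.Perm.sign_swap hxy]
      split_ifs <;> simp
    have h2 : (2 : K) * S = 0 := by linear_combination h1
    exact (mul_eq_zero.1 h2).resolve_left two_ne_zero

/-- A Mackey formula by hand: the rearrangement y contributes the sum of the signs over the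
intersection of the row stabiliser with a conjugate of the column stabiliser, which is 1 or 0 by
`sum_sign_fiberStab`. -/
theorem cinner_rowInd_colInd (r : κ → γ) (c : κ → δ) :
    cinner (rowInd K r) (colInd K c) = (Nat.card (fiberStab r) : K)⁻¹ *
      (Nat.card (fiberStab c) : K)⁻¹ *
      Nat.card {y : Equiv.Perm κ // ∀ x x', r (y x) = r (y x') → c x = c x' → x = x'} := by
  classical
  rw [cinner_rowInd r (isChar_colInd c).1, mul_assoc]
  congr 1
  simp only [colInd, indFn, finsum_eq_sum_of_fintype]
  have h1 : ∀ σ : Equiv.Perm κ, (if ∀ x, r (σ x) = r x then (Nat.card (fiberStab c) : K)⁻¹ *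
      ∑ y, extZero (fun σ : fiberStab c => signHom K κ σ) (y⁻¹ * σ * y) else 0) =
      (Nat.card (fiberStab c) : K)⁻¹ * ∑ y : Equiv.Perm κ,
        if (∀ x, r (σ x) = r x) ∧ ∀ x, c (y⁻¹ (σ x)) = c (y⁻¹ x) then signHom K κ σ else 0 := by
    intro σ
    split_ifs with h
    · congr 1
      refine Finset.sum_congr rfl fun y _ => ?_
      rw [extZero_eq_ite (fun σ => signHom K κ σ)]
      have h2 : (y⁻¹ * σ * y ∈ fiberStab c) ↔
          (∀ x, r (σ x) = r x) ∧ ∀ x, c (y⁻¹ (σ x)) = c (y⁻¹ x) := by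
        rw [mem_fiberStab]
        constructor
        · intro h3
          refine ⟨h, fun x => ?_⟩
          have := h3 (y⁻¹ x)
          simpa using this
        · intro h3 x
          have := h3.2 (y x)
          simpa using this
      have h3 : signHom K κ (y⁻¹ * σ * y) = signHom K κ σ := by
        rw [map_mul, map_mul, mul_right_comm, ← map_mul, inv_mul_cancel, map_one, one_mul]
      rw [h3]
      exact if_congr h2 rfl rfl
    · rw [Finset.sum_eq_zero, mul_zero]
      intro y _
      rw [if_neg fun h3 => h h3.1]
  rw [Finset.sum_congr rfl fun σ _ => h1 σ, ← Finset.mul_sum, Finset.sum_comm]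
  congr 1
  rw [Finset.sum_congr rfl fun y _ => sum_sign_fiberStab r fun x => c (y⁻¹ x)]
  rw [Finset.sum_boole, Nat.card_eq_fintype_card, Fintype.card_subtype]
  congr 2
  ext y
  simp only [Finset.mem_filter, Finset.mem_univ, true_and]
  constructor
  · intro h x x' h1 h2
    have := h (y x) (y x') h1 (by simpa using h2)
    exact y.injective this
  · intro h x x' h1 h2
    have := h (y⁻¹ x) (y⁻¹ x') (by simpa using h1) h2
    exact y⁻¹.injective this

theorem IsDiagram.cinner_eq_one {r : κ → ℕ} {c : κ → γ} (h : IsDiagram r c) :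
    cinner (rowInd K r) (colInd K c) = 1 := by
  rw [cinner_rowInd_colInd, h.card_rearrangements, Nat.cast_mul, ← mul_inv]
  refine inv_mul_cancel₀ (mul_ne_zero ?_ ?_) <;> exact_mod_cast Nat.card_pos.ne'

/-- A non-zero scalar product provides a rearrangement of `r'` with at most one cell in each row and
column; dominance then follows column by column. -/
theorem IsDiagram.rowCount_le_of_cinner {r : κ → ℕ} {c : κ → γ} (h : IsDiagram r c) {r' : κ → ℕ}
    (h' : cinner (rowInd K r') (colInd K c) ≠ 0) (k : ℕ) : rowCount r' k ≤ rowCount r k := by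
  rw [cinner_rowInd_colInd] at h'
  have h1 : Nat.card {y : Equiv.Perm κ // ∀ x x', r' (y x) = r' (y x') → c x = c x' → x = x'} ≠ 0 :=
    fun h0 => h' (by rw [h0, Nat.cast_zero, mul_zero])
  obtain ⟨y, hy⟩ := (Nat.card_ne_zero.1 h1).1
  rw [← rowCount_comp r' y]
  exact h.rowCount_le hy k

end Induced

/-! ### Beta-sets -/

theorem entry_eq_orderEmbOfFin (A : Finset ℕ) (i : Fin A.card) :
    entry A i = A.orderEmbOfFin rfl i := by
  rw [Finset.orderEmbOfFin_apply, entry, List.getD_eq_getElem _ _ (by simp)]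
  rfl

theorem entry_lt_entry (A : Finset ℕ) {i j : ℕ} (hij : i < j) (hj : j < A.card) :
    entry A i < entry A j := by
  rw [entry_eq_orderEmbOfFin A ⟨i, hij.trans hj⟩, entry_eq_orderEmbOfFin A ⟨j, hj⟩]
  exact (A.orderEmbOfFin rfl).strictMono hij

theorem image_entry (A : Finset ℕ) : (Finset.range A.card).image (entry A) = A := by
  ext x
  rw [Finset.mem_image]
  constructor
  · rintro ⟨i, hi, rfl⟩
    rw [entry_eq_orderEmbOfFin A ⟨i, Finset.mem_range.1 hi⟩]
    exact Finset.orderEmbOfFin_mem _ _ _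
  · intro hx
    have : x ∈ Set.range (A.orderEmbOfFin rfl) := by rw [Finset.range_orderEmbOfFin]; exact hx
    obtain ⟨i, rfl⟩ := this
    exact ⟨i, Finset.mem_range.2 i.2, entry_eq_orderEmbOfFin A i⟩

theorem card_image_range {s : ℕ} {f : ℕ → ℕ} (hf : ∀ i j, i < j → j < s → f i < f j) :
    ((Finset.range s).image f).card = s := by
  rw [Finset.card_image_of_injOn, Finset.card_range]
  intro i hi j hj hij
  simp only [Finset.coe_range, Set.mem_Iio] at hi hj
  rcases lt_trichotomy i j with h | h | h
  · exact absurd hij (hf i j h hj).ne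
  · exact h
  · exact absurd hij (hf j i h hi).ne'

/-- A strictly increasing enumeration of a finite set is its sorted list. -/
theorem entry_image_range {s : ℕ} {f : ℕ → ℕ} (hf : ∀ i j, i < j → j < s → f i < f j) {i : ℕ}
    (hi : i < s) : entry ((Finset.range s).image f) i = f i := by
  have hc := card_image_range hf
  have h1 : ∀ j : Fin s, f j ∈ (Finset.range s).image f := fun j =>
    Finset.mem_image_of_mem f (Finset.mem_range.2 j.2)
  have h2 : StrictMono fun j : Fin s => f j := fun j k hjk => hf j k hjk k.2
  have := congrFun (Finset.orderEmbOfFin_unique hc h1 h2) ⟨i, hi⟩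
  simp only at this
  rw [this, Finset.orderEmbOfFin_apply, entry, List.getD_eq_getElem _ _ (by simp [hc, hi])]
  rfl

theorem le_entry (A : Finset ℕ) {i : ℕ} (hi : i < A.card) : i ≤ entry A i := by
  induction i with
  | zero => exact Nat.zero_le _
  | succ i ih => exact Nat.succ_le_of_lt ((ih (by omega)).trans_lt (entry_lt_entry A (Nat.lt_succ_self i) hi))

theorem part_add (A : Finset ℕ) {i : ℕ} (hi : i < A.card) : part A i + i = entry A i :=
  Nat.sub_add_cancel (le_entry A hi)

theorem part_mono (A : Finset ℕ) {i j : ℕ} (hij : i ≤ j) (hj : j < A.card) :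
    part A i ≤ part A j := by
  induction j, hij using Nat.le_induction with
  | base => exact le_rfl
  | succ j hij ih =>
    have h1 := entry_lt_entry A (Nat.lt_succ_self j) hj
    have h2 := part_add A hj
    have h3 := part_add A ((Nat.lt_succ_self j).trans hj)
    have h4 := ih ((Nat.lt_succ_self j).trans hj)
    simp only [Nat.succ_eq_add_one] at h1
    omega

/-- The parts of the partition given by a beta-set in decreasing order, continued by zeros. -/
def pt (A : Finset ℕ) (i : ℕ) : ℕ := if i < A.card then part A (A.card - 1 - i) else 0

theorem pt_of_lt {A : Finset ℕ} {i : ℕ} (h : i < A.card) : pt A i = part A (A.card - 1 - i) :=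
  if_pos h

theorem pt_of_le {A : Finset ℕ} {i : ℕ} (h : A.card ≤ i) : pt A i = 0 := if_neg (not_lt.2 h)

theorem part_eq_pt {A : Finset ℕ} {i : ℕ} (h : i < A.card) : part A i = pt A (A.card - 1 - i) := by
  rw [pt_of_lt (by omega)]
  congr 1
  omega

theorem entry_eq_pt {A : Finset ℕ} {i : ℕ} (h : i < A.card) :
    entry A i = pt A (A.card - 1 - i) + i := by
  rw [← part_eq_pt h, part_add A h]

theorem pt_antitone (A : Finset ℕ) : Antitone (pt A) := by
  intro i j hij
  by_cases hj : j < A.card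
  · rw [pt_of_lt hj, pt_of_lt (hij.trans_lt hj)]
    exact part_mono A (by omega) (by omega)
  · rw [pt_of_le (not_lt.1 hj)]
    exact Nat.zero_le _

theorem eq_of_pt_eq {A B : Finset ℕ} (hc : A.card = B.card) (h : pt A = pt B) : A = B := by
  rw [← image_entry A, ← image_entry B, ← hc]
  refine Finset.image_congr fun i hi => ?_
  have hi' : i < A.card := by simpa using hi
  rw [entry_eq_pt hi', entry_eq_pt (hc ▸ hi'), h, hc]

/-- The beta-set of size `s` of the partition `p`. -/
def betaOf (s : ℕ) (p : ℕ → ℕ) : Finset ℕ :=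
  (Finset.range s).image fun i => p (s - 1 - i) + i

theorem betaOf_strict {s : ℕ} {p : ℕ → ℕ} (hp : Antitone p) (i j : ℕ) (hij : i < j) (_ : j < s) :
    p (s - 1 - i) + i < p (s - 1 - j) + j := by
  have : p (s - 1 - i) ≤ p (s - 1 - j) := hp (by omega)
  omega

theorem card_betaOf (s : ℕ) {p : ℕ → ℕ} (hp : Antitone p) : (betaOf s p).card = s :=
  card_image_range (betaOf_strict hp)

theorem entry_betaOf {s : ℕ} {p : ℕ → ℕ} (hp : Antitone p) {i : ℕ} (hi : i < s) :
    entry (betaOf s p) i = p (s - 1 - i) + i :=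
  entry_image_range (betaOf_strict hp) hi

theorem pt_betaOf {s : ℕ} {p : ℕ → ℕ} (hp : Antitone p) (h0 : ∀ i, s ≤ i → p i = 0) :
    pt (betaOf s p) = p := by
  ext i
  by_cases hi : i < s
  · rw [pt_of_lt (by rwa [card_betaOf s hp]), card_betaOf s hp, part,
      entry_betaOf hp (by omega), Nat.add_sub_cancel]
    congr 1
    omega
  · rw [pt_of_le (by rw [card_betaOf s hp]; omega), h0 i (by omega)]

theorem odot_strict {A B : Finset ℕ} (h : A.card = B.card) (i j : ℕ) (hij : i < j)
    (hj : j < A.card) : entry A i + entry B i - i < entry A j + entry B j - j := by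
  have h1 := entry_lt_entry A hij hj
  have h2 := part_mono B hij.le (h ▸ hj)
  have h3 := part_add B (h ▸ hj)
  have h4 := part_add B (h ▸ hij.trans hj)
  omega

theorem card_odot {A B : Finset ℕ} (h : A.card = B.card) : (odot A B).card = A.card :=
  card_image_range (odot_strict h)

/-- The i-th entries are a part plus i each, so removing a single i leaves the sum of the parts plus
i: the operation on beta-sets is addition of partitions. -/
theorem pt_odot {A B : Finset ℕ} (h : A.card = B.card) : pt (odot A B) = pt A + pt B := by
  ext i
  rw [Pi.add_apply]
  by_cases hi : i < A.card
  · rw [pt_of_lt (by rwa [card_odot h]), card_odot h, part, odot,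
      entry_image_range (odot_strict h) (by omega), entry_eq_pt (by omega), entry_eq_pt (by omega),
      ← h]
    have : A.card - 1 - (A.card - 1 - i) = i := by omega
    rw [this]
    omega
  · rw [pt_of_le (by rw [card_odot h]; omega), pt_of_le (by omega), pt_of_le (by omega)]

/-- The sum of the first `k` parts. -/
def top (p : ℕ → ℕ) (k : ℕ) : ℕ := ∑ i ∈ Finset.range k, p i

theorem top_succ (p : ℕ → ℕ) (k : ℕ) : top p (k + 1) = top p k + p k := Finset.sum_range_succ p k

theorem top_add (p q : ℕ → ℕ) (k : ℕ) : top (p + q) k = top p k + top q k :=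
  Finset.sum_add_distrib

theorem eq_of_top_eq {p q : ℕ → ℕ} (h : ∀ k, top p k = top q k) : p = q := by
  ext k
  have h1 := h k
  have h2 := h (k + 1)
  rw [top_succ, top_succ] at h2
  omega

/-- The size of the partition given by a beta-set. -/
def rank (A : Finset ℕ) : ℕ := top (pt A) A.card

theorem top_pt_of_le (A : Finset ℕ) {k : ℕ} (h : A.card ≤ k) : top (pt A) k = rank A := by
  induction k, h using Nat.le_induction with
  | base => rfl
  | succ k hk ih => rw [top_succ, ih, pt_of_le hk, add_zero]

theorem rank_eq_of_pt_eq {A B : Finset ℕ} (h : pt A = pt B) : rank A = rank B := by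
  rw [← top_pt_of_le A (le_max_left A.card B.card), ← top_pt_of_le B (le_max_right A.card B.card), h]

theorem rank_odot {A B : Finset ℕ} (h : A.card = B.card) : rank (odot A B) = rank A + rank B := by
  rw [rank, card_odot h, pt_odot h, top_add]
  congr 1
  rw [h]
  rfl

theorem rank_eq_sum_part (A : Finset ℕ) : rank A = ∑ i ∈ Finset.range A.card, part A i := by
  rw [rank, top, ← Finset.sum_range_reflect]
  exact Finset.sum_congr rfl fun i hi => (part_eq_pt (Finset.mem_range.1 hi)).symm

/-- Every partition of `n` is given by a beta-set. -/
theorem exists_beta_of_partition {n : ℕ} (p : n.Partition) :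
    rank (betaOf n fun i => (p.parts.sort (· ≥ ·)).getD i 0) = n ∧
      (∀ i, pt (betaOf n fun i => (p.parts.sort (· ≥ ·)).getD i 0) i =
        (p.parts.sort (· ≥ ·)).getD i 0) := by
  set L := p.parts.sort (· ≥ ·) with hL
  have hsum : L.sum = n := by
    rw [← Multiset.sum_coe, hL, Multiset.sort_eq, p.parts_sum]
  have hpos : ∀ x ∈ L, 0 < x := fun x hx => p.parts_pos ((Multiset.mem_sort _).1 hx)
  have hlen : L.length ≤ n := by
    rw [← hsum]
    exact List.length_le_sum_of_one_le L hpos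
  have hsort : L.Pairwise (· ≥ ·) := Multiset.pairwise_sort _ _
  have hanti : Antitone fun i => L.getD i 0 := by
    intro i j hij
    rcases hij.eq_or_lt with rfl | hij
    · exact le_rfl
    by_cases hj : j < L.length
    · simp only
      rw [List.getD_eq_getElem _ _ hj, List.getD_eq_getElem _ _ (hij.trans hj)]
      exact List.pairwise_iff_getElem.1 hsort i j (hij.trans hj) hj hij
    · simp only
      rw [List.getD_eq_default _ _ (not_lt.1 hj)]
      exact Nat.zero_le _
  have h0 : ∀ i, n ≤ i → L.getD i 0 = 0 := fun i hi => List.getD_eq_default _ _ (hlen.trans hi)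
  have hpt := pt_betaOf hanti h0
  refine ⟨?_, fun i => congrFun hpt i⟩
  rw [rank, card_betaOf n hanti, hpt, top]
  rw [← Finset.sum_subset (Finset.range_subset_range.2 hlen)]
  · rw [Finset.sum_range]
    rw [← hsum, ← Fin.sum_univ_getElem]
    exact Finset.sum_congr rfl fun i _ => List.getD_eq_getElem _ _ i.2
  · intro i _ hi
    exact List.getD_eq_default _ _ (by simpa using hi)

/-- Parts are positive, so the number of parts can be read off from the sequence continued by zeros.
-/
theorem partition_ext {n : ℕ} {p q : n.Partition}
    (h : ∀ i, (p.parts.sort (· ≥ ·)).getD i 0 = (q.parts.sort (· ≥ ·)).getD i 0) : p = q := by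
  have key : ∀ p q : n.Partition, (∀ i, (p.parts.sort (· ≥ ·)).getD i 0 =
      (q.parts.sort (· ≥ ·)).getD i 0) →
      (p.parts.sort (· ≥ ·)).length ≤ (q.parts.sort (· ≥ ·)).length := by
    intro p q h
    by_contra hlt
    push Not at hlt
    have h1 := h (q.parts.sort (· ≥ ·)).length
    rw [List.getD_eq_default _ _ le_rfl, List.getD_eq_getElem _ _ hlt] at h1
    have := p.parts_pos ((Multiset.mem_sort (· ≥ ·)).1 (List.getElem_mem hlt))
    omega
  have hlen := le_antisymm (key p q h) (key q p fun i => (h i).symm)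
  have hl : p.parts.sort (· ≥ ·) = q.parts.sort (· ≥ ·) := by
    refine List.ext_getElem hlen fun i h1 h2 => ?_
    have := h i
    rwa [List.getD_eq_getElem _ _ h1, List.getD_eq_getElem _ _ h2] at this
  refine Nat.Partition.ext ?_
  rw [← Multiset.sort_eq p.parts (· ≥ ·), hl, Multiset.sort_eq]

open Representation

/-! ### Irreducible characters of symmetric groups -/

section Positivity

variable {K : Type*} [Field K] [IsAlgClosed K] [CharZero K] {G : Type} [Group G] [Finite G]

theorem IsChar.exists_mult {f : G → K} (hf : IsChar f) :
    ∃ m : (G → K) → ℕ, (∀ χ, IsIrrChar χ → cinner f χ = m χ) ∧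
      f = ∑ χ ∈ irrChars K G, (m χ : K) • χ := by
  classical
  choose m hm using hf.2
  refine ⟨fun χ => if h : IsIrrChar χ then m χ h else 0, fun χ hχ => ?_, ?_⟩
  · rw [hm χ hχ]
    simp only [dif_pos hχ]
  · conv_lhs => rw [hf.1.expand]
    refine Finset.sum_congr rfl fun χ hχ => ?_
    rw [hm _ (mem_irrChars.1 hχ)]
    simp only [dif_pos (mem_irrChars.1 hχ)]

/-- The scalar product is a sum of products of natural numbers, so a common constituent cannot be
cancelled. -/
theorem IsChar.cinner_ne_zero {f g χ : G → K} (hf : IsChar f) (hg : IsChar g) (hχ : IsIrrChar χ)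
    (h1 : cinner f χ ≠ 0) (h2 : cinner g χ ≠ 0) : cinner f g ≠ 0 := by
  obtain ⟨m, hm, -⟩ := hf.exists_mult
  obtain ⟨n, hn, -⟩ := hg.exists_mult
  have h : cinner f g = ((∑ χ ∈ irrChars K G, m χ * n χ : ℕ) : K) := by
    rw [hf.1.parseval, Nat.cast_sum]
    exact Finset.sum_congr rfl fun χ hχ => by
      rw [hm _ (mem_irrChars.1 hχ), hn _ (mem_irrChars.1 hχ), Nat.cast_mul]
  rw [h, Nat.cast_ne_zero]
  rw [hm χ hχ, Nat.cast_ne_zero] at h1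
  rw [hn χ hχ, Nat.cast_ne_zero] at h2
  intro h0
  have := Finset.sum_eq_zero_iff.1 h0 χ (mem_irrChars.2 hχ)
  rcases Nat.mul_eq_zero.1 this with h | h
  · exact h1 h
  · exact h2 h

theorem eq_of_sum_nat_eq_one {α : Type*} {s : Finset α} {f : α → ℕ} (h : ∑ i ∈ s, f i = 1) :
    ∃ i ∈ s, f i = 1 ∧ ∀ j ∈ s, j ≠ i → f j = 0 := by
  classical
  obtain ⟨i, hi, h0⟩ : ∃ i ∈ s, f i ≠ 0 := by
    by_contra hcon
    push Not at hcon
    rw [Finset.sum_eq_zero hcon] at h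
    omega
  have h1 := Finset.add_sum_erase s f hi
  refine ⟨i, hi, by omega, fun j hj hne => ?_⟩
  have := Finset.single_le_sum (f := f) (fun _ _ => Nat.zero_le _) (Finset.mem_erase.2 ⟨hne, hj⟩)
  omega

/-- Among the products of multiplicities, which are natural numbers with sum 1, exactly one is
non-zero, and both of its factors are 1. -/
theorem IsChar.exists_common {f g : G → K} (hf : IsChar f) (hg : IsChar g) (h : cinner f g = 1) :
    ∃ χ, IsIrrChar χ ∧ cinner f χ = 1 ∧ cinner g χ = 1 ∧
      ∀ ψ, IsIrrChar ψ → cinner f ψ ≠ 0 → cinner g ψ ≠ 0 → ψ = χ := by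
  obtain ⟨m, hm, -⟩ := hf.exists_mult
  obtain ⟨n, hn, -⟩ := hg.exists_mult
  have h' : ((1 : ℕ) : K) = ((∑ χ ∈ irrChars K G, m χ * n χ : ℕ) : K) := by
    rw [Nat.cast_one, ← h, hf.1.parseval, Nat.cast_sum]
    exact Finset.sum_congr rfl fun χ hχ => by
      rw [hm _ (mem_irrChars.1 hχ), hn _ (mem_irrChars.1 hχ), Nat.cast_mul]
  obtain ⟨χ, hχ, h1, h2⟩ := eq_of_sum_nat_eq_one (Nat.cast_injective h').symm
  have h3 := Nat.eq_one_of_mul_eq_one_right h1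
  have h4 := Nat.eq_one_of_mul_eq_one_left h1
  refine ⟨χ, mem_irrChars.1 hχ, ?_, ?_, fun ψ hψ hf0 hg0 => ?_⟩
  · rw [hm _ (mem_irrChars.1 hχ), h3, Nat.cast_one]
  · rw [hn _ (mem_irrChars.1 hχ), h4, Nat.cast_one]
  · by_contra hne
    have h5 := h2 ψ (mem_irrChars.2 hψ) hne
    rw [hm _ hψ, Nat.cast_ne_zero] at hf0
    rw [hn _ hψ, Nat.cast_ne_zero] at hg0
    rcases Nat.mul_eq_zero.1 h5 with h | h
    · exact hf0 h
    · exact hg0 h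

end Positivity

section Young

variable {K : Type*} [Field K] [IsAlgClosed K] [CharZero K]
variable {κ : Type} [Fintype κ] {γ δ : Type}

/-- `χ` is the common irreducible constituent of the trivial character induced from the row
stabiliser and of the sign character induced from the column stabiliser. -/
structure IsCommon (χ : Equiv.Perm κ → K) (r : κ → ℕ) (c : κ → γ) : Prop where
  irr : IsIrrChar χ
  diagram : IsDiagram r c
  row : cinner (rowInd K r) χ ≠ 0
  col : cinner (colInd K c) χ ≠ 0

theorem IsDiagram.exists_isCommon {r : κ → ℕ} {c : κ → γ} (h : IsDiagram r c) :
    ∃ χ : Equiv.Perm κ → K, IsCommon χ r c := by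
  obtain ⟨χ, h1, h2, h3, -⟩ := (isChar_rowInd r).exists_common (isChar_colInd c)
    (h.cinner_eq_one (K := K))
  exact ⟨χ, h1, h, by rw [h2]; exact one_ne_zero, by rw [h3]; exact one_ne_zero⟩

theorem IsCommon.cinner_colInd_eq_one {χ : Equiv.Perm κ → K} {r : κ → ℕ} {c : κ → γ}
    (h : IsCommon χ r c) : cinner (colInd K c) χ = 1 := by
  obtain ⟨ψ, -, -, h3, h4⟩ := (isChar_rowInd r).exists_common (isChar_colInd c)
    (h.diagram.cinner_eq_one (K := K))
  rw [h4 χ h.irr h.row h.col, h3]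

/-- χ is a constituent of both `rowInd K r` and `colInd K c'`, so these are not orthogonal, and the
comparison of a row stabiliser with a diagram applies. -/
theorem IsCommon.rowCount_le {χ : Equiv.Perm κ → K} {r r' : κ → ℕ} {c : κ → γ} {c' : κ → δ}
    (h : IsCommon χ r c) (hd : IsDiagram r' c') (h' : cinner (colInd K c') χ ≠ 0) (k : ℕ) :
    rowCount r k ≤ rowCount r' k :=
  hd.rowCount_le_of_cinner ((isChar_rowInd (K := K) r).cinner_ne_zero (isChar_colInd c') h.irr
    h.row h') k

/-- The row and the column of a cell of a tableau. -/
def tabRow {A : Finset ℕ} (T : κ ≃ (Σ i : Fin A.card, Fin (part A i))) (x : κ) : ℕ :=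
  A.card - 1 - (T x).1

def tabCol {A : Finset ℕ} (T : κ ≃ (Σ i : Fin A.card, Fin (part A i))) (x : κ) : ℕ := (T x).2

/-- The parts of a beta-set increase with the index; the reversal in `tabRow` places long rows on
top, which is what makes the columns closed upwards. -/
theorem isDiagram_tab {A : Finset ℕ} (T : κ ≃ (Σ i : Fin A.card, Fin (part A i))) :
    IsDiagram (tabRow T) (tabCol T) := by
  constructor
  · intro x y hr hc
    apply T.injective
    simp only [tabRow, tabCol] at hr hc
    have h1 : (T x).1 = (T y).1 := by
      have := (T x).1.2
      have := (T y).1.2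
      exact Fin.ext (by omega)
    refine Sigma.ext h1 ?_
    rw [Fin.heq_ext_iff (by rw [h1])]
    exact hc
  · intro x i hi
    simp only [tabRow, tabCol] at hi ⊢
    have h1 := (T x).1.2
    have h2 : A.card - 1 - i < A.card := by omega
    have h3 : part A (T x).1 ≤ part A (A.card - 1 - i) := part_mono A (by omega) h2
    refine ⟨T.symm ⟨⟨A.card - 1 - i, h2⟩, ⟨(T x).2, (T x).2.2.trans_le h3⟩⟩, ?_, ?_⟩
    · rw [Equiv.apply_symm_apply]
    · rw [Equiv.apply_symm_apply]
      simp only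
      omega

theorem rowCount_tab {A : Finset ℕ} (T : κ ≃ (Σ i : Fin A.card, Fin (part A i))) (k : ℕ) :
    rowCount (tabRow T) k = top (pt A) k := by
  have h1 : rowCount (tabRow T) k =
      Nat.card (Σ i : {i : Fin A.card // A.card - 1 - i < k}, Fin (part A i)) := by
    refine Nat.card_congr ?_
    refine (T.subtypeEquiv (q := fun p => A.card - 1 - p.1 < k) fun x => Iff.rfl).trans ?_
    exact
      { toFun := fun p => ⟨⟨p.1.1, p.2⟩, p.1.2⟩
        invFun := fun p => ⟨⟨p.1.1, p.2⟩, p.1.2⟩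
        left_inv := fun p => rfl
        right_inv := fun p => rfl }
  classical
  rw [h1, Nat.card_eq_fintype_card, Fintype.card_sigma]
  simp only [Fintype.card_fin]
  have h2 : ∑ i : {i : Fin A.card // A.card - 1 - i < k}, part A i =
      ∑ i ∈ Finset.univ.filter (fun i : Fin A.card => A.card - 1 - i < k), part A i :=
    (Finset.sum_subtype _ (by simp) (fun i : Fin A.card => part A i)).symm
  rw [h2, Finset.sum_filter, Fin.sum_univ_eq_sum_range (fun i => if A.card - 1 - i < k then part A i else 0),
    ← Finset.sum_range_reflect, top]
  have h3 : ∀ i ∈ Finset.range A.card, (if A.card - 1 - (A.card - 1 - i) < k then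
      part A (A.card - 1 - i) else 0) = if i < k then pt A i else 0 := by
    intro i hi
    have hi' := Finset.mem_range.1 hi
    rw [pt_of_lt hi', show A.card - 1 - (A.card - 1 - i) = i by omega]
  rw [Finset.sum_congr rfl h3, ← Finset.sum_filter]
  refine Finset.sum_subset_zero_on_sdiff ?_ ?_ fun _ _ => rfl
  · intro i hi
    simp only [Finset.mem_filter, Finset.mem_range] at hi ⊢
    exact hi.2
  · intro i hi
    simp only [Finset.mem_sdiff, Finset.mem_filter, Finset.mem_range, not_and, not_lt] at hi
    exact pt_of_le (by by_contra h; exact absurd (hi.2 (not_le.1 h)) (not_le.2 hi.1))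

/-- The two sums in the definition are, up to the orders of the stabilisers, scalar products with
`rowInd` and `colInd`. This gives access to diagrams with arbitrary column labels. -/
theorem isYoungChar_iff {χ : Equiv.Perm κ → K} {A : Finset ℕ} :
    IsYoungChar χ A ↔ ∃ T : κ ≃ (Σ i : Fin A.card, Fin (part A i)),
      IsCommon χ (tabRow T) (tabCol T) := by
  classical
  have key : ∀ (hχ : IsIrrChar χ) (T : κ ≃ (Σ i : Fin A.card, Fin (part A i))),
      ((∑ σ : Equiv.Perm κ, if ∀ x, (T (σ x)).1 = (T x).1 then χ σ else 0) ≠ 0 ↔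
        cinner (rowInd K (tabRow T)) χ ≠ 0) ∧
      ((∑ σ : Equiv.Perm κ, if ∀ x, ((T (σ x)).2 : ℕ) = (T x).2
        then (((Equiv.Perm.sign σ : ℤˣ) : ℤ) : K) * χ σ else 0) ≠ 0 ↔
        cinner (colInd K (tabCol T)) χ ≠ 0) := by
    intro hχ T
    have hr : (Nat.card (fiberStab (tabRow T)) : K)⁻¹ ≠ 0 :=
      inv_ne_zero (by exact_mod_cast Nat.card_pos.ne')
    have hc : (Nat.card (fiberStab (tabCol T)) : K)⁻¹ ≠ 0 :=
      inv_ne_zero (by exact_mod_cast Nat.card_pos.ne')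
    rw [cinner_rowInd _ hχ.isClassFn, cinner_colInd _ hχ.isClassFn, mul_ne_zero_iff,
      mul_ne_zero_iff, and_iff_right hr, and_iff_right hc]
    have e1 : ∀ x y : κ, (T x).1 = (T y).1 ↔ tabRow T x = tabRow T y := by
      intro x y
      have := (T x).1.2
      have := (T y).1.2
      rw [tabRow, tabRow, Fin.ext_iff]
      omega
    constructor
    · simp only [e1]
      exact Iff.of_eq (by congr!)
    · simp only [tabCol, signHom_apply]
  constructor
  · rintro ⟨hχ, T, h1, h2⟩
    exact ⟨T, hχ, isDiagram_tab T, (key hχ T).1.1 h1, (key hχ T).2.1 h2⟩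
  · rintro ⟨T, hχ, -, h1, h2⟩
    exact ⟨hχ, T, (key hχ T).1.2 h1, (key hχ T).2.2 h2⟩

theorem nonempty_tab {A : Finset ℕ} (h : rank A = Fintype.card κ) :
    Nonempty (κ ≃ (Σ i : Fin A.card, Fin (part A i))) := by
  refine ⟨Fintype.equivOfCardEq ?_⟩
  rw [Fintype.card_sigma, ← h, rank_eq_sum_part, Finset.sum_range]
  simp

theorem IsYoungChar.rank_eq {χ : Equiv.Perm κ → K} {A : Finset ℕ} (h : IsYoungChar χ A) :
    rank A = Fintype.card κ := by
  obtain ⟨-, T, -⟩ := h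
  rw [Fintype.card_congr T, Fintype.card_sigma, rank_eq_sum_part, Finset.sum_range]
  simp

theorem exists_isYoungChar {A : Finset ℕ} (h : rank A = Fintype.card κ) :
    ∃ χ : Equiv.Perm κ → K, IsYoungChar χ A := by
  obtain ⟨T⟩ := nonempty_tab h
  obtain ⟨χ, hχ⟩ := (isDiagram_tab T).exists_isCommon (K := K)
  exact ⟨χ, isYoungChar_iff.2 ⟨T, hχ⟩⟩

theorem IsCommon.rowCount_eq {χ : Equiv.Perm κ → K} {r r' : κ → ℕ} {c : κ → γ} {c' : κ → δ}
    (h : IsCommon χ r c) (h' : IsCommon χ r' c') (k : ℕ) : rowCount r k = rowCount r' k :=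
  le_antisymm (h.rowCount_le h'.diagram h'.col k) (h'.rowCount_le h.diagram h.col k)

theorem IsYoungChar.pt_eq {χ : Equiv.Perm κ → K} {A B : Finset ℕ} (hA : IsYoungChar χ A)
    (hB : IsYoungChar χ B) : pt A = pt B := by
  obtain ⟨T, hT⟩ := isYoungChar_iff.1 hA
  obtain ⟨U, hU⟩ := isYoungChar_iff.1 hB
  refine eq_of_top_eq fun k => ?_
  rw [← rowCount_tab T, ← rowCount_tab U, hT.rowCount_eq hU]

-- Irreducible characters are linearly independent and factor through the cycle type, hence live in
-- a space whose dimension is the number of partitions.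
variable (K κ) in
theorem card_irrChars_le : (irrChars K (Equiv.Perm κ)).card ≤
    Fintype.card (Fintype.card κ).Partition := by
  classical
  have h1 : ∀ χ : irrChars K (Equiv.Perm κ), ∃ f : (Fintype.card κ).Partition → K,
      ∀ σ, f σ.partition = (χ : Equiv.Perm κ → K) σ := by
    intro χ
    refine ⟨fun p => if h : ∃ σ : Equiv.Perm κ, σ.partition = p then
      (χ : Equiv.Perm κ → K) h.choose else 0, fun σ => ?_⟩
    have h : ∃ τ : Equiv.Perm κ, τ.partition = σ.partition := ⟨σ, rfl⟩
    have hconj : ∀ τ : Equiv.Perm κ, τ.partition = σ.partition →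
        (χ : Equiv.Perm κ → K) τ = (χ : Equiv.Perm κ → K) σ := by
      intro τ hτ
      obtain ⟨y, hy⟩ := isConj_iff.1 (Equiv.Perm.partition_eq_of_isConj.2 hτ)
      rw [← hy, (mem_irrChars.1 χ.2).isClassFn]
    simp only [dif_pos h]
    exact hconj _ h.choose_spec
  choose f hf using h1
  have hli : LinearIndependent K f := by
    rw [linearIndependent_iff']
    intro s c hc χ hχ
    have h2 : ∑ ψ ∈ s, c ψ • (ψ : Equiv.Perm κ → K) = 0 := by
      ext σ
      have := congrFun hc σ.partition
      simpa [hf] using this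
    have h3 := congrArg (fun g => cinner g (χ : Equiv.Perm κ → K)) h2
    simp only [cinner_sum_left, cinner_smul_left, cinner_zero_left] at h3
    rw [Finset.sum_eq_single χ] at h3
    · rwa [(mem_irrChars.1 χ.2).cinner_self, mul_one] at h3
    · intro ψ _ hne
      rw [(mem_irrChars.1 ψ.2).cinner_of_ne (mem_irrChars.1 χ.2) fun h => hne (Subtype.ext h),
        mul_zero]
    · exact fun h => absurd hχ h
  have := hli.fintype_card_le_finrank
  rwa [Module.finrank_fintype_fun_eq_card, Fintype.card_coe] at this

/-- Every irreducible character of a symmetric group is labelled by a partition, and determined by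
it. -/
theorem exists_label_aux : ∃ F : (Fintype.card κ).Partition → Equiv.Perm κ → K,
    (∀ p, IsYoungChar (F p) (betaOf (Fintype.card κ) fun i => (p.parts.sort (· ≥ ·)).getD i 0)) ∧
    ∀ χ, IsIrrChar χ → ∃ p, F p = χ := by
  classical
  have h1 : ∀ p : (Fintype.card κ).Partition, ∃ χ : Equiv.Perm κ → K,
      IsYoungChar χ (betaOf (Fintype.card κ) fun i => (p.parts.sort (· ≥ ·)).getD i 0) :=
    fun p => exists_isYoungChar (exists_beta_of_partition p).1
  choose F hF using h1
  refine ⟨F, hF, fun χ hχ => ?_⟩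
  have hinj : Function.Injective F := by
    intro p q hpq
    refine partition_ext fun i => ?_
    rw [← (exists_beta_of_partition p).2, ← (exists_beta_of_partition q).2]
    exact congrFun ((hF p).pt_eq (hpq ▸ hF q)) i
  -- The characters constructed from distinct partitions are distinct, and there are already as many
  -- as the upper bound permits.
  have himg : Finset.univ.image F = irrChars K (Equiv.Perm κ) := by
    refine Finset.eq_of_subset_of_card_le ?_ ?_
    · intro ψ hψ
      obtain ⟨p, -, rfl⟩ := Finset.mem_image.1 hψ
      exact mem_irrChars.2 (hF p).1
    · rw [Finset.card_image_of_injective _ hinj, Finset.card_univ]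
      exact card_irrChars_le K κ
  have := mem_irrChars.2 hχ
  rw [← himg] at this
  obtain ⟨p, -, hp⟩ := Finset.mem_image.1 this
  exact ⟨p, hp⟩

theorem IsIrrChar.exists_isYoungChar {χ : Equiv.Perm κ → K} (h : IsIrrChar χ) :
    ∃ A, IsYoungChar χ A := by
  obtain ⟨F, hF, hF'⟩ := exists_label_aux (K := K) (κ := κ)
  obtain ⟨p, rfl⟩ := hF' χ h
  exact ⟨_, hF p⟩

/-- Both characters are known to carry partitions, and the row counts of any diagram recover the
partial sums of the partition. It is used for diagrams that do not come from a tableau, such as a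
disjoint union. -/
theorem IsCommon.eq_of_rowCount_eq {χ χ' : Equiv.Perm κ → K} {r r' : κ → ℕ} {c : κ → γ}
    {c' : κ → δ} (h : IsCommon χ r c) (h' : IsCommon χ' r' c')
    (heq : ∀ k, rowCount r k = rowCount r' k) : χ = χ' := by
  obtain ⟨F, hF, hF'⟩ := exists_label_aux (K := K) (κ := κ)
  obtain ⟨p, rfl⟩ := hF' χ h.irr
  obtain ⟨q, rfl⟩ := hF' χ' h'.irr
  obtain ⟨T, hT⟩ := isYoungChar_iff.1 (hF p)
  obtain ⟨U, hU⟩ := isYoungChar_iff.1 (hF q)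
  congr 1
  refine partition_ext fun i => ?_
  rw [← (exists_beta_of_partition p).2, ← (exists_beta_of_partition q).2]
  refine congrFun (eq_of_top_eq fun k => ?_) i
  rw [← rowCount_tab T, ← rowCount_tab U, hT.rowCount_eq h, hU.rowCount_eq h', heq]

theorem IsYoungChar.eq_of_pt_eq {χ χ' : Equiv.Perm κ → K} {A B : Finset ℕ} (hA : IsYoungChar χ A)
    (hB : IsYoungChar χ' B) (h : pt A = pt B) : χ = χ' := by
  obtain ⟨T, hT⟩ := isYoungChar_iff.1 hA
  obtain ⟨U, hU⟩ := isYoungChar_iff.1 hB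
  exact hT.eq_of_rowCount_eq hU fun k => by rw [rowCount_tab, rowCount_tab, h]

theorem IsYoungChar.of_pt_eq {χ : Equiv.Perm κ → K} {A B : Finset ℕ} (hA : IsYoungChar χ A)
    (h : pt A = pt B) : IsYoungChar χ B := by
  obtain ⟨χ', h'⟩ := SymbolInduction.exists_isYoungChar (K := K) (κ := κ) (A := B)
    (by rw [← rank_eq_of_pt_eq h, hA.rank_eq])
  rwa [hA.eq_of_pt_eq h' h]

theorem IsYoungChar.resize {χ : Equiv.Perm κ → K} {A : Finset ℕ} (hA : IsYoungChar χ A) {s : ℕ}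
    (hs : A.card ≤ s) : IsYoungChar χ (betaOf s (pt A)) :=
  hA.of_pt_eq (pt_betaOf (pt_antitone A) fun _ hi => pt_of_le (hs.trans hi)).symm

/-- Transport of Young characters along a bijection. -/
theorem IsYoungChar.transport {κ' : Type} [Fintype κ'] {χ : Equiv.Perm κ → K} {A : Finset ℕ}
    (h : IsYoungChar χ A) (e : κ ≃ κ') :
    IsYoungChar (fun σ : Equiv.Perm κ' => χ (e.symm.permCongr σ)) A := by
  classical
  obtain ⟨hχ, T, h1, h2⟩ := h
  refine ⟨hχ.comp_surjective e.symm.permCongrHom.toMonoidHom e.symm.permCongrHom.surjective,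
    e.symm.trans T, ?_, ?_⟩
  · intro h0
    apply h1
    refine Eq.trans ?_ h0
    refine Fintype.sum_equiv e.permCongr _ _ fun σ => ?_
    have e1 : e.symm.permCongr (e.permCongr σ) = σ := e.permCongr.symm_apply_apply σ
    beta_reduce
    rw [e1]
    refine if_congr ⟨fun h x => ?_, fun h x => ?_⟩ rfl rfl
    · simpa using h (e.symm x)
    · simpa using h (e x)
  · intro h0
    apply h2
    refine Eq.trans ?_ h0
    refine Fintype.sum_equiv e.permCongr _ _ fun σ => ?_
    have e1 : e.symm.permCongr (e.permCongr σ) = σ := e.permCongr.symm_apply_apply σ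
    beta_reduce
    rw [e1]
    have e2 : Equiv.Perm.sign (e.permCongr σ) = Equiv.Perm.sign σ := Equiv.Perm.sign_permCongr e σ
    rw [e2]
    refine if_congr ⟨fun h x => ?_, fun h x => ?_⟩ rfl rfl
    · have h3 : e.symm (e.permCongr σ x) = σ (e.symm x) := by simp
      rw [Equiv.trans_apply, Equiv.trans_apply, h3]
      exact h (e.symm x)
    · have h3 : e.symm (e.permCongr σ (e x)) = σ x := by simp
      have h4 := h (e x)
      rwa [Equiv.trans_apply, Equiv.trans_apply, h3, Equiv.symm_apply_apply] at h4

end Young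

/-! ### Restriction to Young subgroups with two factors -/

section Product

variable {K : Type*} [Field K] [IsAlgClosed K] [CharZero K]
variable {G H : Type} [Group G] [Group H] [Finite G] [Finite H]

theorem cinner_prod_iterate (F : G × H → K) (φ : G → K) (ψ : H → K) :
    cinner F (fun p => φ p.1 * ψ p.2) =
      cinner (fun y => cinner (fun x => F (x, y)) φ) ψ := by
  have := Fintype.ofFinite G
  have := Fintype.ofFinite H
  rw [cinner_eq, cinner_eq, Nat.card_prod, Nat.cast_mul, mul_inv,
    Fintype.sum_prod_type, mul_comm (Nat.card G : K)⁻¹, mul_assoc, Finset.sum_comm,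
    Finset.mul_sum (s := Finset.univ) (a := (Nat.card G : K)⁻¹)]
  congr 1
  refine Finset.sum_congr rfl fun y _ => ?_
  rw [cinner_eq, mul_assoc, Finset.sum_mul]
  congr 1
  refine Finset.sum_congr rfl fun x _ => ?_
  simp only [Prod.fst_inv, Prod.snd_inv]
  ring

theorem IsClassFn.left {F : G × H → K} (hF : IsClassFn F) (y : H) : IsClassFn fun x => F (x, y) :=
  fun x z => by
    have := hF (x, y) (z, 1)
    simpa using this

theorem IsClassFn.right {F : G × H → K} (hF : IsClassFn F) (x : G) : IsClassFn fun y => F (x, y) :=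
  fun y z => by
    have := hF (x, y) (1, z)
    simpa using this

theorem IsClassFn.cinner_left {F : G × H → K} (hF : IsClassFn F) (φ : G → K) :
    IsClassFn fun y => cinner (fun x => F (x, y)) φ := fun y z =>
  congrArg (fun f => cinner f φ) (funext fun x => hF.right x y z)

open scoped Classical in
theorem card_subgroup_eq_sum [Fintype G] (S : Subgroup G) :
    (Nat.card S : K) = ∑ x : G, if x ∈ S then 1 else 0 := by
  rw [Finset.sum_boole, Nat.card_eq_fintype_card, Fintype.card_subtype]

end Product

section LittlewoodRichardson

variable {K : Type*} [Field K] [IsAlgClosed K] [CharZero K]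
variable {κ₁ κ₂ : Type} [Fintype κ₁] [Fintype κ₂] {γ₁ γ₂ : Type}

/-- The multiplicity of `φ ⊠ ψ` in the restriction of `χ`. -/
def lr (χ : Equiv.Perm (κ₁ ⊕ κ₂) → K) (φ : Equiv.Perm κ₁ → K) (ψ : Equiv.Perm κ₂ → K) : K :=
  cinner (fun p : Equiv.Perm κ₁ × Equiv.Perm κ₂ => χ (Equiv.Perm.sumCongrHom κ₁ κ₂ p))
    (fun p => φ p.1 * ψ p.2)

/-- Placing two diagrams side by side keeps their columns and adds their row lengths. This realises
the sum of two partitions without reordering columns and is the reason for general column labels. -/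
theorem isDiagram_sum {r₁ : κ₁ → ℕ} {c₁ : κ₁ → γ₁} {r₂ : κ₂ → ℕ} {c₂ : κ₂ → γ₂}
    (h₁ : IsDiagram r₁ c₁) (h₂ : IsDiagram r₂ c₂) :
    IsDiagram (Sum.elim r₁ r₂) (Sum.map c₁ c₂) := by
  constructor
  · rintro (x | x) (y | y) hr hc
    · exact congrArg _ (h₁.inj x y hr (Sum.inl_injective hc))
    · simp at hc
    · simp at hc
    · exact congrArg _ (h₂.inj x y hr (Sum.inr_injective hc))
  · rintro (x | x) i hi
    · obtain ⟨y, hy, hyi⟩ := h₁.closed x i hi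
      exact ⟨Sum.inl y, congrArg Sum.inl hy, hyi⟩
    · obtain ⟨y, hy, hyi⟩ := h₂.closed x i hi
      exact ⟨Sum.inr y, congrArg Sum.inr hy, hyi⟩

theorem rowCount_sum (r₁ : κ₁ → ℕ) (r₂ : κ₂ → ℕ) (k : ℕ) :
    rowCount (Sum.elim r₁ r₂) k = rowCount r₁ k + rowCount r₂ k := by
  rw [rowCount, rowCount, rowCount, ← Nat.card_sum]
  exact Nat.card_congr (Equiv.subtypeSum)

-- A permutation respecting the disjoint union of the column labels preserves both summands, so the
-- column stabiliser is the product of the two stabilisers.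
open scoped Classical in
theorem sum_fiberStab_sum {M : Type*} [AddCommMonoid M] (c₁ : κ₁ → γ₁) (c₂ : κ₂ → γ₂)
    (F : Equiv.Perm (κ₁ ⊕ κ₂) → M) :
    (∑ σ : Equiv.Perm (κ₁ ⊕ κ₂), if ∀ x, Sum.map c₁ c₂ (σ x) = Sum.map c₁ c₂ x then F σ else 0) =
      ∑ τ : Equiv.Perm κ₂, if ∀ x, c₂ (τ x) = c₂ x then
        (∑ σ : Equiv.Perm κ₁, if ∀ x, c₁ (σ x) = c₁ x then
          F (Equiv.Perm.sumCongrHom κ₁ κ₂ (σ, τ)) else 0) else 0 := by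
  have h1 : ∑ p : Equiv.Perm κ₁ × Equiv.Perm κ₂,
      (if (∀ x, c₁ (p.1 x) = c₁ x) ∧ ∀ x, c₂ (p.2 x) = c₂ x then
        F (Equiv.Perm.sumCongrHom κ₁ κ₂ p) else 0) =
      ∑ σ : Equiv.Perm (κ₁ ⊕ κ₂),
        if ∀ x, Sum.map c₁ c₂ (σ x) = Sum.map c₁ c₂ x then F σ else 0 := by
    refine Fintype.sum_of_injective (Equiv.Perm.sumCongrHom κ₁ κ₂)
      Equiv.Perm.sumCongrHom_injective _ _ ?_ ?_
    · intro σ hσ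
      rw [if_neg]
      intro h
      refine hσ (Equiv.Perm.mem_sumCongrHom_range_of_perm_mapsTo_inl ?_)
      rintro _ ⟨x, rfl⟩
      have := h (Sum.inl x)
      rcases hx : σ (Sum.inl x) with y | y
      · exact ⟨y, rfl⟩
      · rw [hx] at this
        simp at this
    · intro p
      refine if_congr ?_ rfl rfl
      simp
  rw [← h1, Fintype.sum_prod_type_right]
  refine Finset.sum_congr rfl fun τ _ => ?_
  split_ifs with h
  · refine Finset.sum_congr rfl fun σ _ => ?_
    simp [h]
  · exact Finset.sum_eq_zero fun σ _ => if_neg fun h' => h h'.2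

/-- Transitivity of induction: the sign character of the big column stabiliser is the product of the
sign characters of the two factors. -/
theorem cinner_colInd_sum (c₁ : κ₁ → γ₁) (c₂ : κ₂ → γ₂) {χ : Equiv.Perm (κ₁ ⊕ κ₂) → K}
    (hχ : IsClassFn χ) :
    cinner (colInd K (Sum.map c₁ c₂)) χ = lr χ (colInd K c₁) (colInd K c₂) := by
  classical
  have hF : IsClassFn fun p : Equiv.Perm κ₁ × Equiv.Perm κ₂ =>
      χ (Equiv.Perm.sumCongrHom κ₁ κ₂ p) := hχ.comp (Equiv.Perm.sumCongrHom κ₁ κ₂)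
  have hcard : (Nat.card (fiberStab (Sum.map c₁ c₂)) : K) =
      Nat.card (fiberStab c₁) * Nat.card (fiberStab c₂) := by
    rw [card_subgroup_eq_sum, card_subgroup_eq_sum, card_subgroup_eq_sum]
    have := sum_fiberStab_sum c₁ c₂ (fun _ => (1 : K))
    simp only [mem_fiberStab]
    rw [this, Finset.mul_sum]
    refine Finset.sum_congr rfl fun τ _ => ?_
    split_ifs <;> simp
  have hs := sum_fiberStab_sum c₁ c₂ fun σ => signHom K _ σ * χ σ
  have h1 := (cinner_colInd (Sum.map c₁ c₂) hχ).trans (congrArg _ (Eq.trans (by congr!) hs))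
  rw [lr, cinner_prod_iterate, cinner_comm _ (colInd K c₂), cinner_colInd _ (hF.cinner_left _),
    h1, hcard, mul_inv, mul_comm (Nat.card (fiberStab c₁) : K)⁻¹,
    mul_assoc, Finset.mul_sum]
  congr 1
  refine Finset.sum_congr rfl fun τ _ => ?_
  split_ifs with h
  · rw [cinner_comm _ (colInd K c₁), cinner_colInd _ (hF.left τ), mul_left_comm]
    congr 1
    rw [Finset.mul_sum]
    refine Finset.sum_congr rfl fun σ _ => ?_
    split_ifs
    · simp only [signHom_apply, Equiv.Perm.sumCongrHom_apply, Equiv.Perm.sign_sumCongr]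
      push_cast
      ring
    · simp
  · simp

theorem IsChar.isChar_restrict_sum {χ : Equiv.Perm (κ₁ ⊕ κ₂) → K} (hχ : IsChar χ) :
    IsChar fun p : Equiv.Perm κ₁ × Equiv.Perm κ₂ => χ (Equiv.Perm.sumCongrHom κ₁ κ₂ p) :=
  hχ.comp (Equiv.Perm.sumCongrHom κ₁ κ₂)

theorem exists_lr_eq {χ : Equiv.Perm (κ₁ ⊕ κ₂) → K} (hχ : IsChar χ) :
    ∃ l : (Equiv.Perm κ₁ → K) → (Equiv.Perm κ₂ → K) → ℕ, ∀ φ ψ, IsIrrChar φ → IsIrrChar ψ →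
      lr χ φ ψ = l φ ψ := by
  classical
  have h : ∀ φ : Equiv.Perm κ₁ → K, ∀ ψ : Equiv.Perm κ₂ → K, IsIrrChar φ → IsIrrChar ψ →
      ∃ n : ℕ, lr χ φ ψ = n := fun φ ψ hφ hψ => hχ.isChar_restrict_sum.2 _ (hφ.prod hψ)
  choose l hl using h
  refine ⟨fun φ ψ => if h : IsIrrChar φ ∧ IsIrrChar ψ then l φ ψ h.1 h.2 else 0,
    fun φ ψ hφ hψ => ?_⟩
  rw [hl φ ψ hφ hψ]
  simp only [dif_pos (And.intro hφ hψ)]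

theorem lr_expand {χ : Equiv.Perm (κ₁ ⊕ κ₂) → K} (hχ : IsChar χ) {f : Equiv.Perm κ₁ → K}
    {g : Equiv.Perm κ₂ → K} (hf : IsChar f) (hg : IsChar g) :
    ∃ (m : (Equiv.Perm κ₁ → K) → ℕ) (n : (Equiv.Perm κ₂ → K) → ℕ)
      (l : (Equiv.Perm κ₁ → K) → (Equiv.Perm κ₂ → K) → ℕ),
      (∀ φ, IsIrrChar φ → cinner f φ = m φ) ∧ (∀ ψ, IsIrrChar ψ → cinner g ψ = n ψ) ∧
      (∀ φ ψ, IsIrrChar φ → IsIrrChar ψ → lr χ φ ψ = l φ ψ) ∧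
      lr χ f g = ((∑ p ∈ irrChars K (Equiv.Perm κ₁) ×ˢ irrChars K (Equiv.Perm κ₂),
        m p.1 * n p.2 * l p.1 p.2 : ℕ) : K) := by
  obtain ⟨m, hm, hfm⟩ := hf.exists_mult
  obtain ⟨n, hn, hgn⟩ := hg.exists_mult
  obtain ⟨l, hl⟩ := exists_lr_eq hχ
  refine ⟨m, n, l, hm, hn, hl, ?_⟩
  have h1 : (fun p : Equiv.Perm κ₁ × Equiv.Perm κ₂ => f p.1 * g p.2) =
      ∑ p ∈ irrChars K (Equiv.Perm κ₁) ×ˢ irrChars K (Equiv.Perm κ₂),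
        ((m p.1 * n p.2 : ℕ) : K) • fun q : Equiv.Perm κ₁ × Equiv.Perm κ₂ => p.1 q.1 * p.2 q.2 := by
    ext q
    conv_lhs => rw [hfm, hgn]
    rw [Finset.sum_apply, Finset.sum_apply, Finset.sum_apply, Finset.sum_mul_sum,
      Finset.sum_product]
    refine Finset.sum_congr rfl fun φ _ => Finset.sum_congr rfl fun ψ _ => ?_
    simp only [Pi.smul_apply, smul_eq_mul, Nat.cast_mul]
    ring
  rw [lr, h1, cinner_sum_right, Nat.cast_sum]
  refine Finset.sum_congr rfl fun p hp => ?_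
  rw [Finset.mem_product, mem_irrChars, mem_irrChars] at hp
  rw [cinner_smul_right, Nat.cast_mul (m p.1 * n p.2), ← hl p.1 p.2 hp.1 hp.2]
  rfl

theorem lr_ne_zero_of_constituent {χ : Equiv.Perm (κ₁ ⊕ κ₂) → K} (hχ : IsChar χ)
    {f φ : Equiv.Perm κ₁ → K} {g ψ : Equiv.Perm κ₂ → K} (hf : IsChar f) (hg : IsChar g)
    (hφ : IsIrrChar φ) (hψ : IsIrrChar ψ) (h1 : cinner f φ ≠ 0) (h2 : cinner g ψ ≠ 0)
    (h3 : lr χ φ ψ ≠ 0) : lr χ f g ≠ 0 := by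
  obtain ⟨m, n, l, hm, hn, hl, h⟩ := lr_expand hχ hf hg
  rw [hm φ hφ, Nat.cast_ne_zero] at h1
  rw [hn ψ hψ, Nat.cast_ne_zero] at h2
  rw [hl φ ψ hφ hψ, Nat.cast_ne_zero] at h3
  rw [h, Nat.cast_ne_zero]
  intro h0
  have := Finset.sum_eq_zero_iff.1 h0 (φ, ψ)
    (Finset.mem_product.2 ⟨mem_irrChars.2 hφ, mem_irrChars.2 hψ⟩)
  exact mul_ne_zero (mul_ne_zero h1 h2) h3 this

/-- If φ ⊠ ψ occurs in χ, then χ occurs in the sign character induced from the columns of the two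
diagrams side by side, and the row counts there add up. -/
theorem IsCommon.rowCount_le_of_lr {χ : Equiv.Perm (κ₁ ⊕ κ₂) → K} {φ : Equiv.Perm κ₁ → K}
    {ψ : Equiv.Perm κ₂ → K} {γ : Type} {r : κ₁ ⊕ κ₂ → ℕ} {c : κ₁ ⊕ κ₂ → γ} {r₁ : κ₁ → ℕ}
    {c₁ : κ₁ → γ₁} {r₂ : κ₂ → ℕ} {c₂ : κ₂ → γ₂} (h : IsCommon χ r c) (h₁ : IsCommon φ r₁ c₁)
    (h₂ : IsCommon ψ r₂ c₂) (h0 : lr χ φ ψ ≠ 0) (k : ℕ) :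
    rowCount r k ≤ rowCount r₁ k + rowCount r₂ k := by
  rw [← rowCount_sum]
  refine h.rowCount_le (isDiagram_sum h₁.diagram h₂.diagram) ?_ k
  rw [cinner_colInd_sum c₁ c₂ h.irr.isClassFn]
  exact lr_ne_zero_of_constituent h.irr.isChar (isChar_colInd c₁) (isChar_colInd c₂) h₁.irr h₂.irr
    h₁.col h₂.col h0

variable {χ : Equiv.Perm (κ₁ ⊕ κ₂) → K} {φ : Equiv.Perm κ₁ → K} {ψ : Equiv.Perm κ₂ → K}
  {A B C : Finset ℕ}

/-- The constituents of the product of two Young characters are dominated by the sum. -/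
theorem IsYoungChar.top_le_of_lr (hC : IsYoungChar χ C) (hA : IsYoungChar φ A)
    (hB : IsYoungChar ψ B) (h0 : lr χ φ ψ ≠ 0) (k : ℕ) :
    top (pt C) k ≤ top (pt A + pt B) k := by
  obtain ⟨T, hT⟩ := isYoungChar_iff.1 hC
  obtain ⟨U, hU⟩ := isYoungChar_iff.1 hA
  obtain ⟨V, hV⟩ := isYoungChar_iff.1 hB
  rw [top_add, ← rowCount_tab T, ← rowCount_tab U, ← rowCount_tab V]
  exact hT.rowCount_le_of_lr hU hV h0 k

/-- The sum of two partitions occurs exactly once in the product of their Young characters. -/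
theorem IsYoungChar.lr_eq_one (hC : IsYoungChar χ C) (hA : IsYoungChar φ A)
    (hB : IsYoungChar ψ B) (h : pt C = pt A + pt B) : lr χ φ ψ = 1 := by
  obtain ⟨T, hT⟩ := isYoungChar_iff.1 hC
  obtain ⟨U, hU⟩ := isYoungChar_iff.1 hA
  obtain ⟨V, hV⟩ := isYoungChar_iff.1 hB
  have hsum : ∀ k, rowCount (tabRow T) k = rowCount (tabRow U) k + rowCount (tabRow V) k := by
    intro k
    rw [rowCount_tab, rowCount_tab, rowCount_tab, h, top_add]
  -- The side by side diagram has the row lengths of `C`, so its character is χ; this makes χ occur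
  -- exactly once in the character induced from its columns.
  obtain ⟨χ', hχ'⟩ := (isDiagram_sum hU.diagram hV.diagram).exists_isCommon (K := K)
  have heq : χ' = χ := hχ'.eq_of_rowCount_eq hT fun k => by rw [rowCount_sum, hsum]
  rw [heq] at hχ'
  have h1 := hχ'.cinner_colInd_eq_one
  rw [cinner_colInd_sum _ _ hT.irr.isClassFn] at h1
  obtain ⟨m, n, l, hm, hn, hl, hmn⟩ := lr_expand hT.irr.isChar
    (isChar_colInd (K := K) (tabCol U)) (isChar_colInd (K := K) (tabCol V))
  rw [hmn] at h1
  have h2 := Nat.cast_injective (R := K) (h1.trans Nat.cast_one.symm)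
  -- This multiplicity 1 is a sum of products of natural numbers, so precisely one pair of
  -- irreducible characters contributes, with all factors 1. It remains to identify this pair with
  -- φ, ψ.
  obtain ⟨⟨φ', ψ'⟩, hp, h3, -⟩ := eq_of_sum_nat_eq_one h2
  rw [Finset.mem_product, mem_irrChars, mem_irrChars] at hp
  obtain ⟨hφ', hψ'⟩ := hp
  simp only at h3 hφ' hψ'
  have h4 := Nat.eq_one_of_mul_eq_one_left h3
  have h5 := Nat.eq_one_of_mul_eq_one_right h3
  have h6 := Nat.eq_one_of_mul_eq_one_left h5
  have h7 := Nat.eq_one_of_mul_eq_one_right h5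
  have hl1 : lr χ φ' ψ' = 1 := by rw [hl φ' ψ' hφ' hψ', h4, Nat.cast_one]
  obtain ⟨A', hA'⟩ := hφ'.exists_isYoungChar
  obtain ⟨B', hB'⟩ := hψ'.exists_isYoungChar
  obtain ⟨U', hU'⟩ := isYoungChar_iff.1 hA'
  obtain ⟨V', hV'⟩ := isYoungChar_iff.1 hB'
  -- The two partitions of the pair are dominated by those of φ and ψ, while the sum dominates that
  -- of χ, which is the sum for φ and ψ. Hence all the inequalities are equalities.
  have e1 : ∀ k, rowCount (tabRow U') k ≤ rowCount (tabRow U) k :=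
    hU'.rowCount_le hU.diagram (by rw [hm φ' hφ', h7, Nat.cast_one]; exact one_ne_zero)
  have e2 : ∀ k, rowCount (tabRow V') k ≤ rowCount (tabRow V) k :=
    hV'.rowCount_le hV.diagram (by rw [hn ψ' hψ', h6, Nat.cast_one]; exact one_ne_zero)
  have e3 : ∀ k, rowCount (tabRow T) k ≤ rowCount (tabRow U') k + rowCount (tabRow V') k :=
    hT.rowCount_le_of_lr hU' hV' (by rw [hl1]; exact one_ne_zero)
  have hφ : φ' = φ := hU'.eq_of_rowCount_eq hU fun k => by
    have := e1 k; have := e2 k; have := e3 k; have := hsum k; omega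
  have hψ : ψ' = ψ := hV'.eq_of_rowCount_eq hV fun k => by
    have := e1 k; have := e2 k; have := e3 k; have := hsum k; omega
  rw [← hφ, ← hψ, hl1]

end LittlewoodRichardson

/-! ### Irreducible characters of the groups of signed permutations -/

section YoungFun

variable {K : Type*} [Field K] [IsAlgClosed K] [CharZero K]
variable {κ κ' : Type} [Finite κ] [Finite κ']

variable (K κ) in
/-- The irreducible character of the symmetric group on `κ` labelled by `A`. -/
def youngChar (A : Finset ℕ) : Equiv.Perm κ → K :=
  open Classical in
  letI := Fintype.ofFinite κ
  if h : ∃ χ : Equiv.Perm κ → K, IsYoungChar χ A then h.choose else 0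

theorem isYoungChar_youngChar [Fintype κ] {A : Finset ℕ} (h : rank A = Nat.card κ) :
    IsYoungChar (youngChar K κ A) A := by
  rw [Nat.card_eq_fintype_card] at h
  have h' : ∃ χ : Equiv.Perm κ → K, @IsYoungChar K _ κ (Fintype.ofFinite κ) χ A := by
    rw [Subsingleton.elim (Fintype.ofFinite κ)]
    exact exists_isYoungChar h
  rw [youngChar]
  simp only [dif_pos h']
  have h2 : ∀ (i j : Fintype κ) (χ : Equiv.Perm κ → K),
      @IsYoungChar K _ κ i χ A → @IsYoungChar K _ κ j χ A := by
    intro i j χ hi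
    rwa [Subsingleton.elim j i]
  exact h2 _ _ _ h'.choose_spec

theorem IsYoungChar.eq_youngChar [Fintype κ] {χ : Equiv.Perm κ → K} {A : Finset ℕ}
    (h : IsYoungChar χ A) : χ = youngChar K κ A :=
  h.eq_of_pt_eq (isYoungChar_youngChar (h.rank_eq.trans Nat.card_eq_fintype_card.symm)) rfl

theorem youngChar_congr {A B : Finset ℕ} (hA : rank A = Nat.card κ) (h : pt A = pt B) :
    youngChar K κ A = youngChar K κ B := by
  have := Fintype.ofFinite κ
  exact (isYoungChar_youngChar hA).eq_of_pt_eq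
    (isYoungChar_youngChar ((rank_eq_of_pt_eq h).symm.trans hA)) h

theorem youngChar_permCongr {A : Finset ℕ} (h : rank A = Nat.card κ) (e : κ ≃ κ')
    (σ : Equiv.Perm κ) : youngChar K κ' A (e.permCongr σ) = youngChar K κ A σ := by
  have := Fintype.ofFinite κ
  have := Fintype.ofFinite κ'
  rw [← ((isYoungChar_youngChar (K := K) h).transport e).eq_youngChar]
  simp only
  congr 1
  exact e.permCongr.symm_apply_apply σ

end YoungFun

section SignedPerm

variable {K : Type*} [Field K] [IsAlgClosed K] [CharZero K]
variable {ι : Type} [Fintype ι]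

variable (K) in
/-- The product of the signs at the places outside `S`. -/
def signOut (S : ι → Prop) (s : ι → ℤˣ) : K :=
  open Classical in (((∏ i, if S i then 1 else s i : ℤˣ) : ℤ) : K)

theorem signOut_mul (S : ι → Prop) (s t : ι → ℤˣ) :
    signOut K S (s * t) = signOut K S s * signOut K S t := by
  classical
  have : (∏ i, if S i then 1 else (s * t) i : ℤˣ) =
      (∏ i, if S i then 1 else s i) * ∏ i, if S i then 1 else t i := by
    rw [← Finset.prod_mul_distrib]
    refine Finset.prod_congr rfl fun i _ => ?_
    split_ifs <;> simp
  have h2 := congrArg (fun u : ℤˣ => ((u : ℤ) : K)) this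
  simp only [Units.val_mul, Int.cast_mul] at h2
  rw [signOut, signOut, signOut]
  convert h2

theorem signOut_one (S : ι → Prop) : signOut K S (1 : ι → ℤˣ) = 1 := by
  simp [signOut]

theorem signOut_mul_self (S : ι → Prop) (s : ι → ℤˣ) : signOut K S s * signOut K S s = 1 := by
  rw [← signOut_mul]
  have : s * s = 1 := by ext i; simp
  rw [this, signOut_one]

theorem signOut_comp (S : ι → Prop) (s : ι → ℤˣ) (τ : Equiv.Perm ι) :
    signOut K S (fun i => s (τ i)) = signOut K (fun i => S (τ⁻¹ i)) s := by
  classical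
  simp only [signOut]
  congr 2
  refine Fintype.prod_equiv τ _ _ fun i => ?_
  refine if_congr ?_ rfl rfl
  rw [show τ⁻¹ (τ i) = i from τ.symm_apply_apply i]

/-- The signed permutations whose underlying permutation preserves `S`. -/
def stabSub (S : ι → Prop) : Subgroup (SignedPerm ι) where
  carrier := {z | ∀ i, S (z.right i) ↔ S i}
  mul_mem' := fun {x y} hx hy i => by
    rw [SemidirectProduct.mul_right, Equiv.Perm.mul_apply]
    exact (hx _).trans (hy i)
  one_mem' := fun _ => Iff.rfl
  inv_mem' := fun {x} hx i => by
    have := hx (x.right⁻¹ i)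
    rw [show x.right (x.right⁻¹ i) = i from x.right.apply_symm_apply i] at this
    exact this.symm

variable (K) in
/-- For a permutation preserving `S`, the product of the values at its restrictions to `S` and to
the complement; zero for other permutations. -/
def pairFun (S : ι → Prop) (φ : Equiv.Perm {i // S i} → K) (ψ : Equiv.Perm {i // ¬ S i} → K)
    (σ : Equiv.Perm ι) : K :=
  open Classical in
  if h : ∀ i, S (σ i) ↔ S i then
    φ (σ.subtypePerm h) * ψ (σ.subtypePerm fun i => not_congr (h i))
  else 0

theorem twoBlock_eq (S : ι → Prop) (φ : Equiv.Perm {i // S i} → K)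
    (ψ : Equiv.Perm {i // ¬ S i} → K) (x : SignedPerm ι) :
    twoBlock S φ ψ x = pairFun K S φ ψ x.right * signOut K S x.left := by
  rw [twoBlock, pairFun]
  split_ifs with h
  · rfl
  · rw [zero_mul]

/-- The restrictions of a permutation preserving `S` to `S` and to the complement. -/
def stabHom (S : ι → Prop) :
    stabSub S →* Equiv.Perm {i // S i} × Equiv.Perm {i // ¬ S i} where
  toFun z := (z.1.right.subtypePerm z.2, z.1.right.subtypePerm fun i => not_congr (z.2 i))
  map_one' := by
    ext <;> simp
  map_mul' x y := rfl

open scoped Classical in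
theorem subtypeCongr_preserves (S : ι → Prop) (p : Equiv.Perm {i // S i} × Equiv.Perm {i // ¬ S i})
    (i : ι) : S (p.1.subtypeCongr p.2 i) ↔ S i := by
  by_cases h : S i
  · rw [Equiv.Perm.subtypeCongr.left_apply _ _ h]
    exact iff_of_true (p.1 ⟨i, h⟩).2 h
  · rw [Equiv.Perm.subtypeCongr.right_apply _ _ h]
    exact iff_of_false (p.2 ⟨i, h⟩).2 h

open scoped Classical in
theorem subtypePerm_subtypeCongr_left (S : ι → Prop)
    (p : Equiv.Perm {i // S i} × Equiv.Perm {i // ¬ S i}) :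
    (p.1.subtypeCongr p.2).subtypePerm (subtypeCongr_preserves S p) = p.1 := by
  ext ⟨i, hi⟩
  simp [Equiv.Perm.subtypeCongr.left_apply _ _ hi]

open scoped Classical in
theorem subtypePerm_subtypeCongr_right (S : ι → Prop)
    (p : Equiv.Perm {i // S i} × Equiv.Perm {i // ¬ S i}) :
    (p.1.subtypeCongr p.2).subtypePerm (fun i => not_congr (subtypeCongr_preserves S p i)) =
      p.2 := by
  ext ⟨i, hi⟩
  simp [Equiv.Perm.subtypeCongr.right_apply _ _ hi]

theorem stabHom_surjective (S : ι → Prop) : Function.Surjective (stabHom S) := by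
  classical
  intro p
  refine ⟨⟨⟨1, p.1.subtypeCongr p.2⟩, subtypeCongr_preserves S p⟩, ?_⟩
  exact Prod.ext (subtypePerm_subtypeCongr_left S p) (subtypePerm_subtypeCongr_right S p)

theorem signOut_left_smul (S : ι → Prop) (s : ι → ℤˣ) {σ : Equiv.Perm ι}
    (h : ∀ i, S (σ i) ↔ S i) : signOut K S (fun i => s (σ⁻¹ i)) = signOut K S s := by
  rw [signOut_comp, inv_inv]
  congr 1
  ext i
  rw [h]

variable (K) in
/-- The linear character of the stabiliser of `S` given by the signs outside `S`. -/
def signOutHom (S : ι → Prop) : stabSub S →* K where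
  toFun z := signOut K S z.1.left
  map_one' := signOut_one S
  map_mul' x y := by
    have : (x * y).1.left = x.1.left * fun i => y.1.left (x.1.right⁻¹ i) := by
      rfl
    rw [this, signOut_mul, signOut_left_smul S _ x.2]

theorem isIrrChar_twoBlock (S : ι → Prop) {φ : Equiv.Perm {i // S i} → K}
    {ψ : Equiv.Perm {i // ¬ S i} → K} (hφ : IsIrrChar φ) (hψ : IsIrrChar ψ) :
    IsIrrChar fun z : stabSub S => twoBlock S φ ψ z := by
  have h := (((hφ.prod hψ).comp_surjective (stabHom S) (stabHom_surjective S)).hom_mul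
    (signOutHom K S))
  convert h using 1
  ext z
  rw [twoBlock_eq, mul_comm]
  congr 1
  simp only [pairFun, Function.comp_apply]
  rw [dif_pos (show ∀ i, S (z.1.right i) ↔ S i from z.2)]
  rfl

theorem extZero_twoBlock (S : ι → Prop) (φ : Equiv.Perm {i // S i} → K)
    (ψ : Equiv.Perm {i // ¬ S i} → K) :
    extZero (fun z : stabSub S => twoBlock S φ ψ z) = twoBlock S φ ψ := by
  ext x
  by_cases h : x ∈ stabSub S
  · rw [extZero_of_mem _ h]
  · rw [extZero_of_notMem _ h, twoBlock, dif_neg (show ¬ ∀ i, S (x.right i) ↔ S i from h)]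

theorem indFn_twoBlock (S : ι → Prop) (φ : Equiv.Perm {i // S i} → K)
    (ψ : Equiv.Perm {i // ¬ S i} → K) (x : SignedPerm ι) :
    indFn (fun z : stabSub S => twoBlock S φ ψ z) x =
      (Nat.card {z : SignedPerm ι // ∀ i, S (z.right i) ↔ S i} : K)⁻¹ *
      ∑ y : SignedPerm ι, twoBlock S φ ψ (y⁻¹ * x * y) := by
  rw [indFn, extZero_twoBlock, finsum_eq_sum_of_fintype]
  rfl

variable (K ι) in
/-- The irreducible character of the group of signed permutations labelled by `(A / B)`. -/
def symbolFun (A B : Finset ℕ) (x : SignedPerm ι) : K :=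
  open Classical in
  ∑ S : ι → Prop, if Nat.card {i // S i} = rank A ∧ Nat.card {i // ¬ S i} = rank B then
    twoBlock S (youngChar K _ A) (youngChar K _ B) x else 0

theorem pairFun_conj (S : ι → Prop) {A B : Finset ℕ} (hA : Nat.card {i // S i} = rank A)
    (hB : Nat.card {i // ¬ S i} = rank B) (σ τ : Equiv.Perm ι) :
    pairFun K S (youngChar K _ A) (youngChar K _ B) (τ⁻¹ * σ * τ) =
      pairFun K (fun i => S (τ⁻¹ i)) (youngChar K _ A) (youngChar K _ B) σ := by
  classical
  have hiff : (∀ i, S ((τ⁻¹ * σ * τ) i) ↔ S i) ↔ ∀ i, S (τ⁻¹ (σ i)) ↔ S (τ⁻¹ i) := by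
    constructor
    · intro h i
      have := h (τ⁻¹ i)
      simpa using this
    · intro h i
      have := h (τ i)
      simpa using this
  rw [pairFun, pairFun]
  by_cases h : ∀ i, S ((τ⁻¹ * σ * τ) i) ↔ S i
  · rw [dif_pos h, dif_pos (hiff.1 h)]
    have e1 : ∀ i, S i ↔ S (τ⁻¹ (τ i)) := fun i => by
      rw [show τ⁻¹ (τ i) = i from τ.symm_apply_apply i]
    rw [← youngChar_permCongr hA.symm (Equiv.subtypeEquiv (q := fun i => S (τ⁻¹ i)) τ e1),
      ← youngChar_permCongr hB.symm (Equiv.subtypeEquiv (q := fun i => ¬ S (τ⁻¹ i)) τ fun i => not_congr (e1 i))]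
    congr 2
    · ext ⟨i, hi⟩
      simp
    · ext ⟨i, hi⟩
      simp
  · rw [dif_neg h, dif_neg fun h' => h (hiff.2 h')]

/-- Conjugation by y moves S to its image under the permutation of y. The signs of y enter twice,
the second time permuted by x, which preserves the image; so they cancel. -/
theorem twoBlock_conj (S : ι → Prop) {A B : Finset ℕ} (hA : Nat.card {i // S i} = rank A)
    (hB : Nat.card {i // ¬ S i} = rank B) (x y : SignedPerm ι) :
    twoBlock S (youngChar K _ A) (youngChar K _ B) (y⁻¹ * x * y) =
      twoBlock (fun i => S (y.right⁻¹ i)) (youngChar K _ A) (youngChar K _ B) x := by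
  rw [twoBlock_eq, twoBlock_eq]
  have h1 : (y⁻¹ * x * y).right = y.right⁻¹ * x.right * y.right := rfl
  rw [h1, pairFun_conj S hA hB]
  by_cases h : ∀ i, S (y.right⁻¹ (x.right i)) ↔ S (y.right⁻¹ i)
  swap
  · rw [pairFun, dif_neg h, zero_mul, zero_mul]
  congr 1
  have h2 : (y⁻¹ * x * y).left = fun i => (y.left⁻¹ * x.left * fun j => y.left (x.right⁻¹ j)) (y.right i) := by
    ext i
    change ((((y⁻¹).left * fun j => x.left ((y⁻¹).right⁻¹ j)) *
      fun j => y.left ((y⁻¹ * x).right⁻¹ j)) i : ℤ) = _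
    simp [mul_assoc]
    rfl
  rw [h2, signOut_comp, signOut_mul, signOut_mul, signOut_left_smul _ _ h, mul_right_comm,
    ← signOut_mul, inv_mul_cancel, signOut_one, one_mul]

theorem exists_perm_of_card_eq {S S' : ι → Prop}
    (h : Nat.card {i // S i} = Nat.card {i // S' i}) :
    ∃ τ : Equiv.Perm ι, ∀ i, S' (τ i) ↔ S i := by
  classical
  have h1 : Fintype.card {i // S i} = Fintype.card {i // S' i} := by
    rwa [← Nat.card_eq_fintype_card, ← Nat.card_eq_fintype_card]
  have h2 : Fintype.card {i // ¬ S i} = Fintype.card {i // ¬ S' i} := by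
    rw [Fintype.card_subtype_compl, Fintype.card_subtype_compl, h1]
  refine ⟨Equiv.subtypeCongr (Fintype.equivOfCardEq h1) (Fintype.equivOfCardEq h2), fun i => ?_⟩
  by_cases hi : S i
  · refine iff_of_true ?_ hi
    simp only [Equiv.subtypeCongr, Equiv.trans_apply, Equiv.sumCompl_symm_apply_of_pos hi]
    exact (Fintype.equivOfCardEq h1 ⟨i, hi⟩).2
  · refine iff_of_false ?_ hi
    simp only [Equiv.subtypeCongr, Equiv.trans_apply, Equiv.sumCompl_symm_apply_of_neg hi]
    exact (Fintype.equivOfCardEq h2 ⟨i, hi⟩).2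

/-- The character labelled by `(A / B)` is induced from the stabiliser of a subset. -/
theorem indFn_twoBlock_youngChar (S : ι → Prop) {A B : Finset ℕ}
    (hA : Nat.card {i // S i} = rank A) (hB : Nat.card {i // ¬ S i} = rank B) :
    indFn (fun z : stabSub S => twoBlock S (youngChar K _ A) (youngChar K _ B) z) =
      symbolFun K ι A B := by
  classical
  ext x
  rw [indFn_twoBlock, symbolFun]
  simp only [twoBlock_conj S hA hB]
  rw [← Finset.sum_fiberwise_of_maps_to (t := Finset.univ) (fun y _ => Finset.mem_univ
    ((fun i => S (y.right⁻¹ i)) : ι → Prop)), Finset.mul_sum]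
  refine Finset.sum_congr rfl fun S' _ => ?_
  have h1 : ∑ y ∈ Finset.univ.filter (fun y : SignedPerm ι => (fun i => S (y.right⁻¹ i)) = S'),
      twoBlock (fun i => S (y.right⁻¹ i)) (youngChar K _ A) (youngChar K _ B) x =
      ((Finset.univ.filter (fun y : SignedPerm ι => (fun i => S (y.right⁻¹ i)) = S')).card : K) *
        twoBlock S' (youngChar K _ A) (youngChar K _ B) x := by
    rw [← nsmul_eq_mul, ← Finset.sum_const]
    refine Finset.sum_congr rfl fun y hy => ?_
    have := (Finset.mem_filter.1 hy).2
    subst this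
    rfl
  rw [h1]
  by_cases hc : Nat.card {i // S' i} = rank A ∧ Nat.card {i // ¬ S' i} = rank B
  · rw [if_pos hc]
    -- The elements carrying S to S' form a coset of the stabiliser of S, which compensates the
    -- normalising factor of the induction.
    obtain ⟨τ, hτ⟩ := exists_perm_of_card_eq (S := S) (S' := S')
      (by rw [hA, hc.1])
    let y₀ : SignedPerm ι := ⟨1, τ⟩
    have h2 : (Finset.univ.filter (fun y : SignedPerm ι => (fun i => S (y.right⁻¹ i)) = S')).card =
        Nat.card {z : SignedPerm ι // ∀ i, S (z.right i) ↔ S i} := by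
      rw [← Fintype.card_subtype, ← Nat.card_eq_fintype_card]
      refine Nat.card_congr ((Equiv.mulLeft y₀⁻¹).subtypeEquiv fun y => ?_)
      have hr : ((Equiv.mulLeft y₀⁻¹) y).right = τ⁻¹ * y.right := rfl
      rw [hr]
      have h3 : ∀ i, S (τ⁻¹ i) ↔ S' i := fun i => by
        rw [← hτ, show τ (τ⁻¹ i) = i from τ.apply_symm_apply i]
      constructor
      · intro h i
        rw [Equiv.Perm.mul_apply, h3, ← h]
        simp only
        rw [show y.right⁻¹ (y.right i) = i from y.right.symm_apply_apply i]
      · intro h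
        ext i
        have := h (y.right⁻¹ i)
        rw [Equiv.Perm.mul_apply, h3,
          show y.right (y.right⁻¹ i) = i from y.right.apply_symm_apply i] at this
        exact this.symm
    rw [h2, ← mul_assoc, inv_mul_cancel₀, one_mul]
    have : Nonempty {z : SignedPerm ι // ∀ i, S (z.right i) ↔ S i} := ⟨1, fun _ => Iff.rfl⟩
    exact_mod_cast Nat.card_pos.ne'
  · rw [if_neg hc, Finset.filter_false_of_mem, Finset.card_empty, Nat.cast_zero, zero_mul, mul_zero]
    rintro y - rfl
    apply hc
    have e1 : ∀ i, S i ↔ S (y.right⁻¹ (y.right i)) := fun i => by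
      rw [show y.right⁻¹ (y.right i) = i from y.right.symm_apply_apply i]
    rw [← hA, ← hB]
    exact ⟨(Nat.card_congr (y.right.subtypeEquiv e1)).symm,
      (Nat.card_congr (y.right.subtypeEquiv fun i => not_congr (e1 i))).symm⟩

theorem exists_subset_card {k l : ℕ} (h : k + l = Fintype.card ι) :
    ∃ S : ι → Prop, Nat.card {i // S i} = k ∧ Nat.card {i // ¬ S i} = l := by
  classical
  obtain ⟨T, -, hT⟩ := Finset.exists_subset_card_eq (s := (Finset.univ : Finset ι)) (n := k)
    (by rw [Finset.card_univ]; omega)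
  refine ⟨(· ∈ T), ?_, ?_⟩
  · rw [Nat.card_eq_fintype_card, Fintype.card_coe, hT]
  · rw [Nat.card_eq_fintype_card, Fintype.card_subtype_compl, Fintype.card_coe, hT]
    omega

theorem isSymbolChar_iff {χ : SignedPerm ι → K} {A B : Finset ℕ} :
    IsSymbolChar χ A B ↔ A.card = B.card ∧ rank A + rank B = Fintype.card ι ∧
      χ = symbolFun K ι A B := by
  classical
  constructor
  · rintro ⟨hc, S, φ, ψ, hφ, hψ, h⟩
    have h1 := hφ.rank_eq
    have h2 := hψ.rank_eq
    refine ⟨hc, ?_, ?_⟩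
    · rw [h1, h2, Fintype.card_subtype_compl]
      have := Fintype.card_subtype_le S
      convert Nat.add_sub_of_le this
    · ext x
      rw [h x]
      rw [← indFn_twoBlock_youngChar S (by rw [h1, Nat.card_eq_fintype_card]) (by rw [h2, Nat.card_eq_fintype_card]), indFn_twoBlock]
      rw [hφ.eq_youngChar, hψ.eq_youngChar]
  · rintro ⟨hc, hr, rfl⟩
    obtain ⟨S, h1, h2⟩ := exists_subset_card (ι := ι) hr
    refine ⟨hc, S, youngChar K _ A, youngChar K _ B, ?_, ?_, fun x => ?_⟩
    · exact isYoungChar_youngChar h1.symm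
    · exact isYoungChar_youngChar h2.symm
    · rw [← indFn_twoBlock_youngChar S h1 h2, indFn_twoBlock]

end SignedPerm

/-! ### Fourier analysis on the group of signs and classification of the characters of type `B` -/

section Four

variable {K : Type*} [Field K] [IsAlgClosed K] [CharZero K]
variable {ι : Type} [Fintype ι]

theorem signOut_mulSingle [DecidableEq ι] (S : ι → Prop) (i : ι) (u : ℤˣ) [Decidable (S i)] :
    signOut K S (Pi.mulSingle i u) = if S i then 1 else ((u : ℤ) : K) := by
  classical
  rw [signOut, Finset.prod_eq_single i]
  · by_cases h : S i <;> simp [h]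
  · intro j _ hj
    simp [hj]
  · simp

theorem exists_signOut_mul_eq_neg {S S' : ι → Prop} (h : S ≠ S') :
    ∃ t : ι → ℤˣ, signOut K S t * signOut K S' t = -1 := by
  classical
  obtain ⟨i, hi⟩ : ∃ i, ¬ (S i ↔ S' i) := by
    by_contra! h'
    exact h (funext fun i => propext (h' i))
  refine ⟨Pi.mulSingle i (-1), ?_⟩
  rw [signOut_mulSingle, signOut_mulSingle]
  by_cases h1 : S i <;> by_cases h2 : S' i <;> simp_all

open scoped Classical in
theorem sum_signOut_mul (S S' : ι → Prop) [Decidable (S = S')] :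
    ∑ s : ι → ℤˣ, signOut K S s * signOut K S' s =
      if S = S' then (Nat.card (ι → ℤˣ) : K) else 0 := by
  classical
  split_ifs with h
  · subst h
    simp only [signOut_mul_self, Finset.sum_const, Finset.card_univ, nsmul_eq_mul, mul_one,
      Nat.card_eq_fintype_card]
  · obtain ⟨t, ht⟩ := exists_signOut_mul_eq_neg (K := K) h
    have h1 : ∑ s : ι → ℤˣ, signOut K S s * signOut K S' s =
        ∑ s : ι → ℤˣ, -(signOut K S s * signOut K S' s) := by
      rw [← Equiv.sum_comp (Equiv.mulLeft t)]
      refine Finset.sum_congr rfl fun s _ => ?_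
      rw [Equiv.coe_mulLeft, signOut_mul, signOut_mul]
      linear_combination (signOut K S s * signOut K S' s) * ht
    rw [Finset.sum_neg_distrib] at h1
    exact self_eq_neg.1 h1

/-- The coefficient at the linear character `signOut K S` of the signs. -/
def four (S : ι → Prop) (f : SignedPerm ι → K) (σ : Equiv.Perm ι) : K :=
  open Classical in
  (Nat.card (ι → ℤˣ) : K)⁻¹ * ∑ s : ι → ℤˣ, f ⟨s, σ⟩ * signOut K S s

theorem card_signs_ne_zero : (Nat.card (ι → ℤˣ) : K) ≠ 0 := by
  exact_mod_cast (Nat.card_pos (α := ι → ℤˣ)).ne'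

theorem four_twoBlock (S S' : ι → Prop) (φ : Equiv.Perm {i // S' i} → K)
    (ψ : Equiv.Perm {i // ¬ S' i} → K) (σ : Equiv.Perm ι) [Decidable (S = S')] :
    four S (twoBlock S' φ ψ) σ = if S = S' then pairFun K S' φ ψ σ else 0 := by
  classical
  rw [four]
  simp only [twoBlock_eq]
  have : ∀ s : ι → ℤˣ, pairFun K S' φ ψ σ * signOut K S' s * signOut K S s =
      pairFun K S' φ ψ σ * (signOut K S s * signOut K S' s) := fun s => by ring
  simp only [this]
  rw [← Finset.mul_sum, sum_signOut_mul]
  split_ifs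
  · rw [mul_left_comm, inv_mul_cancel₀ card_signs_ne_zero, mul_one]
  · simp

theorem four_sum {γ : Type*} (t : Finset γ) (S : ι → Prop) (f : γ → SignedPerm ι → K)
    (σ : Equiv.Perm ι) : four S (fun x => ∑ i ∈ t, f i x) σ = ∑ i ∈ t, four S (f i) σ := by
  classical
  simp only [four, Finset.sum_mul, Finset.mul_sum]
  exact Finset.sum_comm

/-- The summands of `symbolFun` belong to different linear characters of the group of signs; the
Fourier coefficient at S isolates one of them. -/
theorem four_symbolFun (S : ι → Prop) {A B : Finset ℕ} (hA : Nat.card {i // S i} = rank A)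
    (hB : Nat.card {i // ¬ S i} = rank B) (σ : Equiv.Perm ι) :
    four S (symbolFun K ι A B) σ = pairFun K S (youngChar K _ A) (youngChar K _ B) σ := by
  classical
  have h1 : symbolFun K ι A B = fun x => ∑ S ∈ (Finset.univ : Finset (ι → Prop)),
    if Nat.card {i // S i} = rank A ∧ Nat.card {i // ¬ S i} = rank B then
      twoBlock S (youngChar K _ A) (youngChar K _ B) x else 0 := rfl
  rw [h1, four_sum, Finset.sum_eq_single S]
  · simp only [hA, hB, and_self, if_true]
    exact (four_twoBlock ..).trans (if_pos rfl)
  · intro S' _ hS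
    split_ifs
    · exact (four_twoBlock ..).trans (if_neg hS.symm)
    · simp [four]
  · simp

theorem four_symbolFun_ne {S : ι → Prop} {A B : Finset ℕ}
    (h : ¬ (Nat.card {i // S i} = rank A ∧ Nat.card {i // ¬ S i} = rank B)) (σ : Equiv.Perm ι) :
    four S (symbolFun K ι A B) σ = 0 := by
  classical
  have h1 : symbolFun K ι A B = fun x => ∑ S ∈ (Finset.univ : Finset (ι → Prop)),
    if Nat.card {i // S i} = rank A ∧ Nat.card {i // ¬ S i} = rank B then
      twoBlock S (youngChar K _ A) (youngChar K _ B) x else 0 := rfl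
  rw [h1, four_sum, Finset.sum_eq_zero]
  intro S' _
  split_ifs with h2
  · refine (four_twoBlock ..).trans (if_neg ?_)
    rintro rfl
    exact h h2
  · simp [four]

open scoped Classical in
/-- Fourier inversion. -/
theorem sum_four (f : SignedPerm ι → K) (σ : Equiv.Perm ι) :
    ∑ S : ι → Prop, four S f σ = f ⟨1, σ⟩ := by
  classical
  have key : ∀ s : ι → ℤˣ, ∑ S : ι → Prop, signOut K S s =
      if s = 1 then (Nat.card (ι → ℤˣ) : K) else 0 := by
    intro s
    split_ifs with h
    · subst h
      simp only [signOut_one, Finset.sum_const, Finset.card_univ, nsmul_eq_mul, mul_one]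
      rw [Nat.card_eq_fintype_card, Fintype.card_fun, Fintype.card_fun]
      simp
    · obtain ⟨i, hi⟩ : ∃ i, s i ≠ 1 := by
        by_contra! h'
        exact h (funext h')
      have hi' : s i = -1 := (Int.units_eq_one_or (s i)).resolve_left hi
      -- Changing the membership of a place i with s i = -1 reverses the sign of every term.
      let e : (ι → Prop) ≃ (ι → Prop) := Function.Involutive.toPerm
        (fun S j => if j = i then ¬ S j else S j) (by
          intro S
          ext j
          by_cases hj : j = i <;> simp [hj])
      have h1 : ∑ S : ι → Prop, signOut K S s = ∑ S : ι → Prop, -signOut K S s := by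
        rw [← Equiv.sum_comp e]
        refine Finset.sum_congr rfl fun S _ => ?_
        have h2 : ∀ S' : ι → Prop, signOut K S' s = (if S' i then 1 else -1) *
            (((∏ j ∈ Finset.univ.erase i, if S' j then 1 else s j : ℤˣ) : ℤ) : K) := by
          intro S'
          rw [signOut, ← Finset.mul_prod_erase _ _ (Finset.mem_univ i), hi']
          split_ifs <;> simp
        rw [h2, h2 S]
        have h3 : (∏ j ∈ Finset.univ.erase i, if e S j then 1 else s j : ℤˣ) =
            ∏ j ∈ Finset.univ.erase i, if S j then 1 else s j := by
          refine Finset.prod_congr rfl fun j hj => ?_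
          have : e S j ↔ S j := by
            simp [e, Function.Involutive.toPerm, Finset.ne_of_mem_erase hj]
          exact if_congr this rfl rfl
        have h4 : e S i ↔ ¬ S i := by
          simp [e, Function.Involutive.toPerm]
        rw [h3, if_congr h4 rfl rfl]
        split_ifs <;> simp
      rw [Finset.sum_neg_distrib] at h1
      exact self_eq_neg.1 h1
  simp only [four]
  rw [← Finset.mul_sum, Finset.sum_comm]
  simp only [← Finset.mul_sum, key, mul_ite, mul_zero]
  rw [Finset.sum_ite_eq' Finset.univ (1 : ι → ℤˣ), if_pos (Finset.mem_univ _), mul_left_comm,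
    inv_mul_cancel₀ card_signs_ne_zero, mul_one]

open scoped Classical in
/-- The signed permutations preserving `S`, as triples. -/
def stabEquiv (S : ι → Prop) :
    ((Equiv.Perm {i // S i} × Equiv.Perm {i // ¬ S i}) × (ι → ℤˣ)) ≃ stabSub S where
  toFun q := ⟨⟨q.2, q.1.1.subtypeCongr q.1.2⟩, subtypeCongr_preserves S q.1⟩
  invFun z := (stabHom S z, z.1.left)
  left_inv q := by
    refine Prod.ext (Prod.ext ?_ ?_) rfl
    · exact subtypePerm_subtypeCongr_left S q.1
    · exact subtypePerm_subtypeCongr_right S q.1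
  right_inv z := by
    refine Subtype.ext (SemidirectProduct.ext rfl ?_)
    ext i
    simp only
    by_cases h : S i
    · rw [Equiv.Perm.subtypeCongr.left_apply _ _ h]
      rfl
    · rw [Equiv.Perm.subtypeCongr.right_apply _ _ h]
      rfl

theorem signOut_inv_left {S : ι → Prop} (z : stabSub S) :
    signOut K S (z⁻¹).1.left = signOut K S z.1.left := by
  have h1 : signOutHom K S z⁻¹ * signOutHom K S z = 1 := by
    rw [← map_mul, inv_mul_cancel, map_one]
  have h2 : signOutHom K S z * signOutHom K S z = 1 := signOut_mul_self S _
  exact mul_right_cancel₀ (right_ne_zero_of_mul_eq_one h2) (h1.trans h2.symm)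

open scoped Classical in
/-- Frobenius reciprocity for the characters labelled by symbols. -/
theorem cinner_symbolFun (S : ι → Prop) {A B : Finset ℕ} (hA : Nat.card {i // S i} = rank A)
    (hB : Nat.card {i // ¬ S i} = rank B) {f : SignedPerm ι → K} (hf : IsClassFn f) :
    cinner f (symbolFun K ι A B) =
      cinner (fun p : Equiv.Perm {i // S i} × Equiv.Perm {i // ¬ S i} =>
        four S f (p.1.subtypeCongr p.2)) (fun p => youngChar K _ A p.1 * youngChar K _ B p.2) := by
  rw [← indFn_twoBlock_youngChar S hA hB, cinner_comm, cinner_indFn _ hf, cinner_comm, cinner_eq,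
    cinner_eq, Nat.card_congr (stabEquiv S).symm, Nat.card_prod,
    ← Equiv.sum_comp (stabEquiv S), Fintype.sum_prod_type]
  rw [Nat.cast_mul, mul_inv, mul_assoc, Finset.mul_sum]
  congr 1
  refine Finset.sum_congr rfl fun p _ => ?_
  rw [four, mul_assoc, Finset.sum_mul]
  congr 1
  refine Finset.sum_congr rfl fun s _ => ?_
  have h1 : twoBlock S (youngChar K _ A) (youngChar K _ B) ((stabEquiv S (p, s))⁻¹ : stabSub S) =
      youngChar K _ A p.1⁻¹ * youngChar K _ B p.2⁻¹ * signOut K S s := by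
    rw [twoBlock_eq, signOut_inv_left]
    congr 1
    rw [pairFun, dif_pos (show ∀ i, _ from ((stabEquiv S (p, s))⁻¹).2)]
    have h2 : stabHom S (stabEquiv S (p, s))⁻¹ = p⁻¹ := by
      rw [map_inv]
      congr 1
      exact congrArg Prod.fst ((stabEquiv S).symm_apply_apply (p, s))
    rw [← Prod.fst_inv, ← Prod.snd_inv, ← h2]
    rfl
  rw [h1]
  have h3 : ((stabEquiv S (p, s) : stabSub S) : SignedPerm ι) = ⟨s, p.1.subtypeCongr p.2⟩ := rfl
  rw [h3]
  simp only [Prod.fst_inv, Prod.snd_inv]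
  ring

theorem isClassFn_symbolFun {A B : Finset ℕ} (h : rank A + rank B = Fintype.card ι) :
    IsClassFn (symbolFun K ι A B) := by
  obtain ⟨S, hA, hB⟩ := exists_subset_card h
  rw [← indFn_twoBlock_youngChar S hA hB]
  exact isClassFn_indFn _

theorem isIrrChar_youngChar {κ : Type} [Finite κ] {A : Finset ℕ} (h : rank A = Nat.card κ) :
    IsIrrChar (youngChar K κ A) := by
  have := Fintype.ofFinite κ
  exact (isYoungChar_youngChar h).1

theorem isChar_symbolFun {A B : Finset ℕ} (h : rank A + rank B = Fintype.card ι) :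
    IsChar (symbolFun K ι A B) := by
  obtain ⟨S, hA, hB⟩ := exists_subset_card h
  rw [← indFn_twoBlock_youngChar S hA hB]
  exact IsChar.indFn (isIrrChar_twoBlock S (isIrrChar_youngChar hA.symm)
    (isIrrChar_youngChar hB.symm)).isChar

open scoped Classical in
theorem pairFun_subtypeCongr (S : ι → Prop) (φ : Equiv.Perm {i // S i} → K)
    (ψ : Equiv.Perm {i // ¬ S i} → K) (p : Equiv.Perm {i // S i} × Equiv.Perm {i // ¬ S i}) :
    pairFun K S φ ψ (p.1.subtypeCongr p.2) = φ p.1 * ψ p.2 := by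
  rw [pairFun, dif_pos (subtypeCongr_preserves S p), subtypePerm_subtypeCongr_left,
    subtypePerm_subtypeCongr_right]

/-- The Fourier coefficient of the first character at a set belonging to the second is a product of
two Young characters or zero, so everything reduces to orthonormality for symmetric groups. -/
theorem cinner_symbolFun_symbolFun {A B A' B' : Finset ℕ} (h : rank A + rank B = Fintype.card ι)
    (h' : rank A' + rank B' = Fintype.card ι) [Decidable (pt A = pt A' ∧ pt B = pt B')] :
    cinner (symbolFun K ι A B) (symbolFun K ι A' B') =
      if pt A = pt A' ∧ pt B = pt B' then 1 else 0 := by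
  classical
  obtain ⟨S, hA, hB⟩ := exists_subset_card h'
  rw [cinner_symbolFun S hA hB (isClassFn_symbolFun h)]
  by_cases hr : Nat.card {i // S i} = rank A ∧ Nat.card {i // ¬ S i} = rank B
  · simp only [four_symbolFun S hr.1 hr.2, pairFun_subtypeCongr]
    rw [cinner_prod, (isIrrChar_youngChar hr.1.symm).cinner_eq_ite (isIrrChar_youngChar hA.symm),
      (isIrrChar_youngChar hr.2.symm).cinner_eq_ite (isIrrChar_youngChar hB.symm)]
    have := Fintype.ofFinite {i // S i}
    have := Fintype.ofFinite {i // ¬ S i}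
    have e1 : youngChar K {i // S i} A = youngChar K _ A' ↔ pt A = pt A' :=
      ⟨fun h => (isYoungChar_youngChar (K := K) hr.1.symm).pt_eq
        (h ▸ isYoungChar_youngChar (K := K) hA.symm), fun h => youngChar_congr hr.1.symm h⟩
    have e2 : youngChar K {i // ¬ S i} B = youngChar K _ B' ↔ pt B = pt B' :=
      ⟨fun h => (isYoungChar_youngChar (K := K) hr.2.symm).pt_eq
        (h ▸ isYoungChar_youngChar (K := K) hB.symm), fun h => youngChar_congr hr.2.symm h⟩
    simp only [e1, e2]
    split_ifs <;> simp_all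
  · rw [if_neg]
    · simp only [four_symbolFun_ne hr]
      exact cinner_zero_left _
    · rintro ⟨h1, h2⟩
      exact hr ⟨hA.trans (rank_eq_of_pt_eq h1).symm, hB.trans (rank_eq_of_pt_eq h2).symm⟩

theorem isIrrChar_symbolFun {A B : Finset ℕ} (h : rank A + rank B = Fintype.card ι) :
    IsIrrChar (symbolFun K ι A B) := by
  classical
  exact (isChar_symbolFun h).isIrrChar
    ((cinner_symbolFun_symbolFun h h).trans (if_pos ⟨rfl, rfl⟩))

theorem symbolFun_eq_iff {A B A' B' : Finset ℕ} (h : rank A + rank B = Fintype.card ι)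
    (h' : rank A' + rank B' = Fintype.card ι) :
    symbolFun K ι A B = symbolFun K ι A' B' ↔ pt A = pt A' ∧ pt B = pt B' := by
  classical
  have h1 := (isIrrChar_symbolFun (K := K) h).cinner_eq_ite (isIrrChar_symbolFun h')
  rw [cinner_symbolFun_symbolFun h h'] at h1
  split_ifs at h1 <;> simp_all

/-- Every irreducible character of the group of signed permutations has a label. -/
theorem IsIrrChar.exists_symbolFun {X : SignedPerm ι → K} (hX : IsIrrChar X) :
    ∃ A B : Finset ℕ, A.card = B.card ∧ rank A + rank B = Fintype.card ι ∧
      X = symbolFun K ι A B := by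
  classical
  -- By Fourier inversion the coefficients at the identity permutation add up to the degree, which
  -- is not zero.
  obtain ⟨S, hS⟩ : ∃ S : ι → Prop, four S X 1 ≠ 0 := by
    by_contra! h
    apply hX.one_ne_zero
    have := sum_four X 1
    simp only [h, Finset.sum_const_zero] at this
    exact this.symm
  by_contra hcon
  let mixHom : Equiv.Perm {i // S i} × Equiv.Perm {i // ¬ S i} →* Equiv.Perm ι :=
    Equiv.Perm.subtypeCongrHom S
  -- The coefficient at S is a class function on the product of the two symmetric groups. If X had
  -- no label, it would be orthogonal to all products of irreducible characters and hence vanish.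
  have hcl : IsClassFn fun p : Equiv.Perm {i // S i} × Equiv.Perm {i // ¬ S i} =>
      four S X (p.1.subtypeCongr p.2) := by
    intro x y
    have e1 : ∀ p : Equiv.Perm {i // S i} × Equiv.Perm {i // ¬ S i},
      p.1.subtypeCongr p.2 = mixHom p := fun _ => rfl
    simp only [e1, map_mul, map_inv]
    simp only [four]
    congr 1
    have hy : ∀ i, S (mixHom y i) ↔ S i := subtypeCongr_preserves S y
    refine Fintype.sum_equiv (Equiv.arrowCongr (mixHom y)⁻¹ (Equiv.refl _)) _ _ fun s => ?_
    have e2 : Equiv.arrowCongr (mixHom y)⁻¹ (Equiv.refl ℤˣ) s = fun i => s (mixHom y i) := rfl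
    have hy' : ∀ i, S ((mixHom y)⁻¹ i) ↔ S i := fun i => by
      rw [← hy, show mixHom y ((mixHom y)⁻¹ i) = i from (mixHom y).apply_symm_apply i]
    have e3 := signOut_left_smul (K := K) S s hy'
    rw [inv_inv] at e3
    rw [e2, e3]
    congr 1
    rw [← hX.isClassFn.conj' _ ⟨1, mixHom y⟩]
    congr 1
    refine SemidirectProduct.ext ?_ ?_
    · ext i
      simp [SemidirectProduct.mul_left]
      rfl
    · simp [SemidirectProduct.mul_right, mul_assoc]
  refine hS ?_
  have h0 := hcl.eq_zero_of_prod fun φ ψ hφ hψ => ?_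
  · have := congrFun h0 1
    have e1 : ((1 : Equiv.Perm {i // S i} × Equiv.Perm {i // ¬ S i}).1.subtypeCongr
        (1 : Equiv.Perm {i // S i} × Equiv.Perm {i // ¬ S i}).2) = 1 := map_one mixHom
    rw [e1] at this
    exact this
  · obtain ⟨A, hA⟩ := hφ.exists_isYoungChar
    obtain ⟨B, hB⟩ := hψ.exists_isYoungChar
    -- The two rows of a symbol must have equally many entries, so both beta-sets are enlarged to a
    -- common size.
    have hA' := hA.resize (le_max_left A.card B.card)
    have hB' := hB.resize (le_max_right A.card B.card)
    have hA1 : Nat.card {i // S i} = rank (betaOf (max A.card B.card) (pt A)) := by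
      rw [hA'.rank_eq, Nat.card_eq_fintype_card]
    have hB1 : Nat.card {i // ¬ S i} = rank (betaOf (max A.card B.card) (pt B)) := by
      rw [hB'.rank_eq, Nat.card_eq_fintype_card]
    have hr : rank (betaOf (max A.card B.card) (pt A)) + rank (betaOf (max A.card B.card) (pt B))
        = Fintype.card ι := by
      rw [← hA1, ← hB1, Nat.card_eq_fintype_card, Nat.card_eq_fintype_card,
        Fintype.card_subtype_compl]
      exact Nat.add_sub_of_le (Fintype.card_subtype_le S)
    have h1 := cinner_symbolFun S hA1 hB1 hX.isClassFn
    rw [← hA'.eq_youngChar, ← hB'.eq_youngChar] at h1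
    rw [← h1]
    refine hX.cinner_of_ne (isIrrChar_symbolFun hr) fun h2 => hcon ⟨_, _, ?_, hr, h2⟩
    rw [card_betaOf _ (pt_antitone _), card_betaOf _ (pt_antitone _)]

end Four

/-! ### Exchange of the rows and the character given by the product of the signs -/

section Swap

variable {K : Type*} [Field K] [IsAlgClosed K] [CharZero K]
variable {ι : Type} [Fintype ι]

variable (K ι) in
/-- The product of the signs, with values in `K`. -/
def signProdHom : SignedPerm ι →* K :=
  ((Int.castRingHom K).toMonoidHom.comp (Units.coeHom ℤ)).comp (signProd ι)

theorem signProdHom_apply (x : SignedPerm ι) :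
    signProdHom K ι x = (((signProd ι x : ℤˣ) : ℤ) : K) := rfl

theorem signProdHom_eq_or (x : SignedPerm ι) :
    signProdHom K ι x = 1 ∨ signProdHom K ι x = -1 := by
  rw [signProdHom_apply]
  rcases Int.units_eq_one_or (signProd ι x) with h | h <;> simp [h]

theorem mem_evenSub_iff (x : SignedPerm ι) : x ∈ evenSub ι ↔ signProdHom K ι x = 1 := by
  rw [signProdHom_apply, evenSub, MonoidHom.mem_ker]
  rcases Int.units_eq_one_or (signProd ι x) with h | h
  · simp [h]
  · rw [h]
    refine iff_of_false (by decide) ?_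
    norm_num

theorem signProdHom_of_notMem {x : SignedPerm ι} (h : x ∉ evenSub ι) : signProdHom K ι x = -1 :=
  (signProdHom_eq_or x).resolve_left fun h' => h ((mem_evenSub_iff x).2 h')

theorem signOut_not_mul (S : ι → Prop) (x : SignedPerm ι) :
    signOut K (fun i => ¬ S i) x.left = signProdHom K ι x * signOut K S x.left := by
  classical
  have h1 : signOut K (fun i => ¬ S i) x.left * signOut K S x.left = signProdHom K ι x := by
    rw [signProdHom_apply, signOut, signOut, ← Int.cast_mul, ← Units.val_mul,
      ← Finset.prod_mul_distrib]
    congr 2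
    refine Finset.prod_congr rfl fun i _ => ?_
    by_cases h : S i <;> simp [h]
  rw [← h1, mul_assoc, signOut_mul_self, mul_one]

theorem pairFun_not (S : ι → Prop) {A B : Finset ℕ} (hA : Nat.card {i // S i} = rank A)
    (σ : Equiv.Perm ι) :
    pairFun K (fun i => ¬ S i) (youngChar K _ B) (youngChar K _ A) σ =
      pairFun K S (youngChar K _ A) (youngChar K _ B) σ := by
  classical
  rw [pairFun, pairFun]
  by_cases h : ∀ i, S (σ i) ↔ S i
  · rw [dif_pos h, dif_pos fun i => not_congr (h i), mul_comm,
      ← youngChar_permCongr hA.symm (Equiv.subtypeEquivRight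
        fun i => (not_not (a := S i)).symm)]
    rfl
  · rw [dif_neg h, dif_neg fun h' => h fun i => not_iff_not.1 (h' i)]

/-- Passing from S to its complement exchanges the two Young characters; the signs outside the
complement are the product of all signs times the signs outside S. -/
theorem symbolFun_swap (A B : Finset ℕ) (x : SignedPerm ι) :
    symbolFun K ι B A x = signProdHom K ι x * symbolFun K ι A B x := by
  classical
  rw [symbolFun, symbolFun, Finset.mul_sum]
  refine Fintype.sum_equiv (Function.Involutive.toPerm (fun (S : ι → Prop) i => ¬ S i)
    fun S => by ext i; simp) _ _ fun S => ?_
  change _ = signProdHom K ι x * (if Nat.card {i // ¬ S i} = rank A ∧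
    Nat.card {i // ¬ ¬ S i} = rank B then twoBlock (fun i => ¬ S i) (youngChar K _ A)
      (youngChar K _ B) x else 0)
  simp only [not_not]
  by_cases h : Nat.card {i // S i} = rank B ∧ Nat.card {i // ¬ S i} = rank A
  · rw [if_pos h, if_pos h.symm, twoBlock_eq, twoBlock_eq, pairFun_not S h.1, signOut_not_mul]
    rcases signProdHom_eq_or (K := K) x with h | h <;> rw [h] <;> ring
  · rw [if_neg h, if_neg fun h' => h h'.symm, mul_zero]

end Swap

/-! ### Restriction from W_{a+b} to W_a × W_b -/

section Block

variable {K : Type*} [Field K] [IsAlgClosed K] [CharZero K]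
variable {α β : Type} [Fintype α] [Fintype β]

/-- The linear characters of the signs of both blocks together are products, so Fourier coefficients
may be taken one block at a time. -/
theorem four_four_block (S₁ : α → Prop) (S₂ : β → Prop) (f : SignedPerm (α ⊕ β) → K)
    (σ : Equiv.Perm α) (τ : Equiv.Perm β) :
    four S₂ (fun y => four S₁ (fun x => f (blockHom α β (x, y))) σ) τ =
      four (Sum.elim S₁ S₂) f (Equiv.Perm.sumCongrHom α β (σ, τ)) := by
  classical
  have hs : ∀ (s : α → ℤˣ) (t : β → ℤˣ), signOut K (Sum.elim S₁ S₂) (Sum.elim s t) =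
      signOut K S₁ s * signOut K S₂ t := by
    intro s t
    rw [signOut, signOut, signOut, ← Int.cast_mul, ← Units.val_mul, Fintype.prod_sum_type]
    congr!
  have hsum : ∀ (inst : Fintype (α ⊕ β → ℤˣ)) (F : (α ⊕ β → ℤˣ) → K),
      ∑ s, F s = ∑ t : β → ℤˣ, ∑ s : α → ℤˣ, F (Sum.elim s t) := by
    intro inst F
    rw [← Equiv.sum_comp (Equiv.sumArrowEquivProdArrow α β ℤˣ).symm,
      Fintype.sum_prod_type_right]
    rfl
  rw [four, four, hsum, Nat.card_congr (Equiv.sumArrowEquivProdArrow α β ℤˣ),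
    Nat.card_prod, Nat.cast_mul, mul_inv, mul_comm (Nat.card (α → ℤˣ) : K)⁻¹, mul_assoc]
  congr 1
  rw [Finset.mul_sum]
  refine Finset.sum_congr rfl fun t _ => ?_
  rw [four, mul_assoc, Finset.sum_mul]
  congr 1
  refine Finset.sum_congr rfl fun s _ => ?_
  rw [hs, mul_assoc]
  rfl

theorem four_cinner {ι : Type} [Fintype ι] {G : Type} [Group G] [Finite G] (S : ι → Prop)
    (F : SignedPerm ι → G → K) (φ : G → K) (σ : Equiv.Perm ι) :
    four S (fun y => cinner (F y) φ) σ = cinner (fun g => four S (fun y => F y g) σ) φ := by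
  classical
  have : (fun g => four S (fun y => F y g) σ) = (Nat.card (ι → ℤˣ) : K)⁻¹ •
      ∑ s : ι → ℤˣ, signOut K S s • F ⟨s, σ⟩ := by
    ext g
    simp only [four, Pi.smul_apply, Finset.sum_apply, smul_eq_mul]
    congr 1
    exact Finset.sum_congr rfl fun s _ => mul_comm _ _
  rw [this, cinner_smul_left, cinner_sum_left, four]
  congr 1
  refine Finset.sum_congr rfl fun s _ => ?_
  rw [cinner_smul_left, mul_comm]

variable (K α β) in
/-- The multiplicity of `(A₁ / A₂) ⊠ (B₁ / B₂)` in the restriction of `(C₁ / C₂)`. -/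
def blockMult (A₁ A₂ B₁ B₂ C₁ C₂ : Finset ℕ) : K :=
  cinner (fun p => symbolFun K (α ⊕ β) C₁ C₂ (blockHom α β p))
    (fun p => symbolFun K α A₁ A₂ p.1 * symbolFun K β B₁ B₂ p.2)

variable {A₁ A₂ B₁ B₂ C₁ C₂ : Finset ℕ}

open scoped Classical in
theorem pairFun_sumElim (S₁ : α → Prop) (S₂ : β → Prop)
    (h1 : Nat.card {i // Sum.elim S₁ S₂ i} = rank C₁)
    (h2 : Nat.card {i // ¬ Sum.elim S₁ S₂ i} = rank C₂)
    (p : Equiv.Perm {i // S₁ i} × Equiv.Perm {i // ¬ S₁ i})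
    (q : Equiv.Perm {i // S₂ i} × Equiv.Perm {i // ¬ S₂ i}) :
    pairFun K (Sum.elim S₁ S₂) (youngChar K _ C₁) (youngChar K _ C₂)
      (Equiv.Perm.sumCongrHom α β (p.1.subtypeCongr p.2, q.1.subtypeCongr q.2)) =
    youngChar K ({i // S₁ i} ⊕ {i // S₂ i}) C₁ (Equiv.Perm.sumCongrHom _ _ (p.1, q.1)) *
    youngChar K ({i // ¬ S₁ i} ⊕ {i // ¬ S₂ i}) C₂ (Equiv.Perm.sumCongrHom _ _ (p.2, q.2)) := by
  have h : ∀ i, Sum.elim S₁ S₂ ((Equiv.Perm.sumCongrHom α β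
      (p.1.subtypeCongr p.2, q.1.subtypeCongr q.2)) i) ↔ Sum.elim S₁ S₂ i := by
    rintro (i | i)
    · exact subtypeCongr_preserves S₁ p i
    · exact subtypeCongr_preserves S₂ q i
  rw [pairFun, dif_pos h]
  let e₁ : {i // Sum.elim S₁ S₂ i} ≃ {i // S₁ i} ⊕ {i // S₂ i} := Equiv.subtypeSum
  let e₂ : {i // ¬ Sum.elim S₁ S₂ i} ≃ {i // ¬ S₁ i} ⊕ {i // ¬ S₂ i} := Equiv.subtypeSum
  rw [← youngChar_permCongr h1.symm e₁, ← youngChar_permCongr h2.symm e₂]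
  congr 2
  · ext1 x
    rcases x with ⟨i, hi⟩ | ⟨i, hi⟩
    · have : e₁ ⟨Sum.inl (p.1 ⟨i, hi⟩), (p.1 ⟨i, hi⟩).2⟩ = Sum.inl (p.1 ⟨i, hi⟩) := rfl
      refine Eq.trans ?_ this
      rw [Equiv.permCongr_apply]
      congr 1
      refine Subtype.ext ?_
      exact congrArg Sum.inl (Equiv.Perm.subtypeCongr.left_apply p.1 p.2 hi)
    · have : e₁ ⟨Sum.inr (q.1 ⟨i, hi⟩), (q.1 ⟨i, hi⟩).2⟩ = Sum.inr (q.1 ⟨i, hi⟩) := rfl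
      refine Eq.trans ?_ this
      rw [Equiv.permCongr_apply]
      congr 1
      refine Subtype.ext ?_
      exact congrArg Sum.inr (Equiv.Perm.subtypeCongr.left_apply q.1 q.2 hi)
  · ext1 x
    rcases x with ⟨i, hi⟩ | ⟨i, hi⟩
    · have : e₂ ⟨Sum.inl (p.2 ⟨i, hi⟩), (p.2 ⟨i, hi⟩).2⟩ = Sum.inl (p.2 ⟨i, hi⟩) := rfl
      refine Eq.trans ?_ this
      rw [Equiv.permCongr_apply]
      congr 1
      refine Subtype.ext ?_
      exact congrArg Sum.inl (Equiv.Perm.subtypeCongr.right_apply p.1 p.2 hi)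
    · have : e₂ ⟨Sum.inr (q.2 ⟨i, hi⟩), (q.2 ⟨i, hi⟩).2⟩ = Sum.inr (q.2 ⟨i, hi⟩) := rfl
      refine Eq.trans ?_ this
      rw [Equiv.permCongr_apply]
      congr 1
      refine Subtype.ext ?_
      exact congrArg Sum.inr (Equiv.Perm.subtypeCongr.right_apply q.1 q.2 hi)

-- Frobenius reciprocity is applied in each factor, after which the two Fourier coefficients merge
-- into one for the union of the two subsets.
open scoped Classical in
theorem blockMult_eq_four (S₁ : α → Prop) (S₂ : β → Prop)
    (hA1 : Nat.card {i // S₁ i} = rank A₁) (hA2 : Nat.card {i // ¬ S₁ i} = rank A₂)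
    (hB1 : Nat.card {i // S₂ i} = rank B₁) (hB2 : Nat.card {i // ¬ S₂ i} = rank B₂)
    (hC : rank C₁ + rank C₂ = Fintype.card (α ⊕ β)) :
    blockMult K α β A₁ A₂ B₁ B₂ C₁ C₂ =
      cinner (fun r : (Equiv.Perm {i // S₁ i} × Equiv.Perm {i // ¬ S₁ i}) ×
          (Equiv.Perm {i // S₂ i} × Equiv.Perm {i // ¬ S₂ i}) =>
        four (Sum.elim S₁ S₂) (symbolFun K (α ⊕ β) C₁ C₂) (Equiv.Perm.sumCongrHom α β
          (r.1.1.subtypeCongr r.1.2, r.2.1.subtypeCongr r.2.2)))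
      (fun r => (youngChar K _ A₁ r.1.1 * youngChar K _ A₂ r.1.2) *
        (youngChar K _ B₁ r.2.1 * youngChar K _ B₂ r.2.2)) := by
  have hcl : IsClassFn fun p => symbolFun K (α ⊕ β) C₁ C₂ (blockHom α β p) :=
    (isClassFn_symbolFun hC).comp (blockHom α β)
  rw [blockMult, cinner_prod_iterate, cinner_symbolFun S₂ hB1 hB2 (hcl.cinner_left _)]
  have h1 : ∀ y, cinner (fun x => symbolFun K (α ⊕ β) C₁ C₂ (blockHom α β (x, y)))
      (symbolFun K α A₁ A₂) = _ := fun y => cinner_symbolFun S₁ hA1 hA2 (hcl.left y)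
  simp only [h1, four_cinner, four_four_block]
  exact (cinner_prod_iterate (fun r : (Equiv.Perm {i // S₁ i} × Equiv.Perm {i // ¬ S₁ i}) ×
          (Equiv.Perm {i // S₂ i} × Equiv.Perm {i // ¬ S₂ i}) =>
        four (Sum.elim S₁ S₂) (symbolFun K (α ⊕ β) C₁ C₂) (Equiv.Perm.sumCongrHom α β
          (r.1.1.subtypeCongr r.1.2, r.2.1.subtypeCongr r.2.2)))
      (fun p => youngChar K _ A₁ p.1 * youngChar K _ A₂ p.2)
      (fun q => youngChar K _ B₁ q.1 * youngChar K _ B₂ q.2)).symm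

-- When the ranks fit, the Fourier coefficient is a product of two Young characters, one on the
-- union of the chosen sets and one on the union of their complements. Regrouping the four symmetric
-- groups by rows instead of by blocks separates the scalar product.
open scoped Classical in
theorem blockMult_eq_lr (S₁ : α → Prop) (S₂ : β → Prop)
    (hA1 : Nat.card {i // S₁ i} = rank A₁) (hA2 : Nat.card {i // ¬ S₁ i} = rank A₂)
    (hB1 : Nat.card {i // S₂ i} = rank B₁) (hB2 : Nat.card {i // ¬ S₂ i} = rank B₂)
    (hC1 : rank C₁ = rank A₁ + rank B₁) (hC2 : rank C₂ = rank A₂ + rank B₂)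
    (hC : rank C₁ + rank C₂ = Fintype.card (α ⊕ β)) :
    blockMult K α β A₁ A₂ B₁ B₂ C₁ C₂ =
      lr (youngChar K ({i // S₁ i} ⊕ {i // S₂ i}) C₁) (youngChar K _ A₁) (youngChar K _ B₁) *
      lr (youngChar K ({i // ¬ S₁ i} ⊕ {i // ¬ S₂ i}) C₂) (youngChar K _ A₂)
        (youngChar K _ B₂) := by
  have h1 : Nat.card {i // Sum.elim S₁ S₂ i} = rank C₁ := by
    rw [Nat.card_congr (Equiv.subtypeSum (p := Sum.elim S₁ S₂)), Nat.card_sum, hC1, ← hA1, ← hB1]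
    rfl
  have h2 : Nat.card {i // ¬ Sum.elim S₁ S₂ i} = rank C₂ := by
    rw [Nat.card_congr (Equiv.subtypeSum (p := fun i => ¬ Sum.elim S₁ S₂ i)), Nat.card_sum, hC2,
      ← hA2, ← hB2]
    rfl
  rw [blockMult_eq_four S₁ S₂ hA1 hA2 hB1 hB2 hC]
  simp only [four_symbolFun _ h1 h2, pairFun_sumElim S₁ S₂ h1 h2]
  rw [lr, lr, ← cinner_prod, ← cinner_comp_equiv (MulEquiv.prodProdProdComm
    (Equiv.Perm {i // S₁ i}) (Equiv.Perm {i // ¬ S₁ i})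
    (Equiv.Perm {i // S₂ i}) (Equiv.Perm {i // ¬ S₂ i}))]
  congr 1
  ext r
  exact mul_mul_mul_comm _ _ _ _

/-- The relevant Fourier coefficient of the big character vanishes unless the chosen subset has the
size prescribed by its first row. -/
theorem rank_eq_of_blockMult (hA : rank A₁ + rank A₂ = Fintype.card α)
    (hB : rank B₁ + rank B₂ = Fintype.card β) (hC : rank C₁ + rank C₂ = Fintype.card (α ⊕ β))
    (h : blockMult K α β A₁ A₂ B₁ B₂ C₁ C₂ ≠ 0) :
    rank C₁ = rank A₁ + rank B₁ ∧ rank C₂ = rank A₂ + rank B₂ := by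
  classical
  obtain ⟨S₁, hA1, hA2⟩ := exists_subset_card hA
  obtain ⟨S₂, hB1, hB2⟩ := exists_subset_card hB
  by_contra hne
  apply h
  rw [blockMult_eq_four S₁ S₂ hA1 hA2 hB1 hB2 hC]
  have : ¬ (Nat.card {i // Sum.elim S₁ S₂ i} = rank C₁ ∧
      Nat.card {i // ¬ Sum.elim S₁ S₂ i} = rank C₂) := by
    rintro ⟨h1, h2⟩
    apply hne
    rw [← h1, ← h2, ← hA1, ← hA2, ← hB1, ← hB2,
      Nat.card_congr (Equiv.subtypeSum (p := Sum.elim S₁ S₂)), Nat.card_sum,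
      Nat.card_congr (Equiv.subtypeSum (p := fun i => ¬ Sum.elim S₁ S₂ i)), Nat.card_sum]
    exact ⟨rfl, rfl⟩
  simp only [four_symbolFun_ne this]
  exact cinner_zero_left _

/-- Dominance. -/
theorem top_le_of_blockMult (hA : rank A₁ + rank A₂ = Fintype.card α)
    (hB : rank B₁ + rank B₂ = Fintype.card β) (hC : rank C₁ + rank C₂ = Fintype.card (α ⊕ β))
    (h : blockMult K α β A₁ A₂ B₁ B₂ C₁ C₂ ≠ 0) (k : ℕ) :
    top (pt C₁) k ≤ top (pt A₁ + pt B₁) k ∧ top (pt C₂) k ≤ top (pt A₂ + pt B₂) k := by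
  classical
  obtain ⟨S₁, hA1, hA2⟩ := exists_subset_card hA
  obtain ⟨S₂, hB1, hB2⟩ := exists_subset_card hB
  obtain ⟨h1, h2⟩ := rank_eq_of_blockMult hA hB hC h
  rw [blockMult_eq_lr S₁ S₂ hA1 hA2 hB1 hB2 h1 h2 hC] at h
  refine ⟨(isYoungChar_youngChar ?_).top_le_of_lr (isYoungChar_youngChar hA1.symm)
    (isYoungChar_youngChar hB1.symm) (left_ne_zero_of_mul h) k,
    (isYoungChar_youngChar ?_).top_le_of_lr (isYoungChar_youngChar hA2.symm)
    (isYoungChar_youngChar hB2.symm) (right_ne_zero_of_mul h) k⟩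
  · rw [Nat.card_sum, h1, hA1, hB1]
  · rw [Nat.card_sum, h2, hA2, hB2]

theorem blockMult_eq_one (hA : rank A₁ + rank A₂ = Fintype.card α)
    (hB : rank B₁ + rank B₂ = Fintype.card β) (h1 : rank C₁ = rank A₁ + rank B₁)
    (h2 : rank C₂ = rank A₂ + rank B₂) (hC1 : pt C₁ = pt A₁ + pt B₁)
    (hC2 : pt C₂ = pt A₂ + pt B₂) : blockMult K α β A₁ A₂ B₁ B₂ C₁ C₂ = 1 := by
  classical
  obtain ⟨S₁, hA1, hA2⟩ := exists_subset_card hA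
  obtain ⟨S₂, hB1, hB2⟩ := exists_subset_card hB
  have hC : rank C₁ + rank C₂ = Fintype.card (α ⊕ β) := by
    rw [Fintype.card_sum, ← hA, ← hB, h1, h2]
    omega
  rw [blockMult_eq_lr S₁ S₂ hA1 hA2 hB1 hB2 h1 h2 hC,
    (isYoungChar_youngChar (by rw [Nat.card_sum, h1, hA1, hB1])).lr_eq_one
      (isYoungChar_youngChar hA1.symm) (isYoungChar_youngChar hB1.symm) hC1,
    (isYoungChar_youngChar (by rw [Nat.card_sum, h2, hA2, hB2])).lr_eq_one
      (isYoungChar_youngChar hA2.symm) (isYoungChar_youngChar hB2.symm) hC2, one_mul]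

theorem signProdHom_blockHom (p : SignedPerm α × SignedPerm β) :
    signProdHom K (α ⊕ β) (blockHom α β p) = signProdHom K α p.1 * signProdHom K β p.2 := by
  simp only [signProdHom_apply, ← Int.cast_mul, ← Units.val_mul]
  congr 2
  exact Fintype.prod_sum_type _

end Block

/-! ### Clifford theory for a subgroup of index two -/

section SignKernel

variable {K : Type*} [Field K] [IsAlgClosed K] [CharZero K]
variable {G : Type} [Group G] [Finite G] {ε : G →* K} {N : Subgroup G}

theorem sum_sign_eq_zero [Fintype G] {t : G} (ht : ε t = -1) : ∑ x : G, ε x = 0 := by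
  have h : ∑ x : G, ε x = ∑ x : G, -ε x := by
    rw [← Equiv.sum_comp (Equiv.mulLeft t)]
    simp [ht]
  rw [Finset.sum_neg_distrib] at h
  exact self_eq_neg.1 h

theorem two_mul_card_ker (hε : ∀ x, ε x = 1 ∨ ε x = -1) (hN : ∀ x, x ∈ N ↔ ε x = 1) {t : G}
    (ht : t ∉ N) : 2 * (Nat.card N : K) = Nat.card G := by
  classical
  have := Fintype.ofFinite G
  have ht' : ε t = -1 := (hε t).resolve_left fun h => ht ((hN t).2 h)
  rw [card_subgroup_eq_sum (K := K) N, Finset.mul_sum]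
  have h1 : ∀ x : G, 2 * (if x ∈ N then (1 : K) else 0) = 1 + ε x := by
    intro x
    rcases hε x with h | h
    · rw [if_pos ((hN x).2 h), h]
      norm_num
    · rw [if_neg fun h' => ?_, h]
      · norm_num
      · rw [hN, h] at h'
        norm_num at h'
  rw [Finset.sum_congr rfl fun x _ => h1 x, Finset.sum_add_distrib, sum_sign_eq_zero ht']
  simp [Nat.card_eq_fintype_card]

/-- The scalar product on the kernel of a linear character of order two. -/
theorem cinner_ker (hε : ∀ x, ε x = 1 ∨ ε x = -1) (hN : ∀ x, x ∈ N ↔ ε x = 1) {t : G}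
    (ht : t ∉ N) (f g : G → K) :
    cinner (fun x : N => f x) (fun x : N => g x) =
      cinner f g + cinner f (fun x => ε x * g x) := by
  classical
  have := Fintype.ofFinite G
  have h0 : (Nat.card N : K) ≠ 0 := by exact_mod_cast (Nat.card_pos (α := N)).ne'
  rw [cinner_restrict, cinner_eq, cinner_eq, ← mul_add, ← Finset.sum_add_distrib,
    ← two_mul_card_ker hε hN ht, mul_inv, mul_comm (2 : K)⁻¹, mul_assoc]
  congr 1
  rw [Finset.mul_sum]
  refine Finset.sum_congr rfl fun x _ => ?_
  rcases hε x with h | h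
  · have h' : ε x⁻¹ = 1 := by rw [← hN, inv_mem_iff, hN, h]
    rw [if_pos ((hN x).2 h), h']
    ring
  · have h1 : x ∉ N := fun h' => by
      rw [hN, h] at h'
      norm_num at h'
    have h' : ε x⁻¹ = -1 := (hε x⁻¹).resolve_left fun h2 => h1 (inv_mem_iff.1 ((hN _).2 h2))
    rw [if_neg h1, h']
    ring

/-- The conjugate of a function on a normal subgroup. -/
def conjFn [N.Normal] (t : G) (X : N → K) : N → K := X ∘ MulAut.conjNormal t

theorem conjFn_apply [N.Normal] (t : G) (X : N → K) (x : N) (h : t * x * t⁻¹ ∈ N) :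
    conjFn t X x = X ⟨t * x * t⁻¹, h⟩ := rfl

theorem IsIrrChar.conjFn [N.Normal] {X : N → K} (hX : IsIrrChar X) (t : G) :
    IsIrrChar (conjFn t X) :=
  hX.comp_surjective (MulAut.conjNormal t).toMonoidHom (MulAut.conjNormal t).surjective

theorem conjFn_restrict [N.Normal] {f : G → K} (hf : IsClassFn f) (t : G) :
    conjFn t (fun x : N => f x) = fun x : N => f x := by
  ext x
  exact hf _ _

theorem cinner_conjFn [N.Normal] (t : G) (X Y : N → K) :
    cinner (conjFn t X) (conjFn t Y) = cinner X Y := cinner_comp_equiv _ _ _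

theorem conjFn_mul [N.Normal] (s t : G) (X : N → K) : conjFn s (conjFn t X) = conjFn (t * s) X := by
  ext x
  simp [conjFn]

theorem conjFn_of_mem [N.Normal] {X : N → K} (hX : IsClassFn X) {t : G} (ht : t ∈ N) :
    conjFn t X = X := by
  ext x
  exact hX x ⟨t, ht⟩

/-- Two elements outside a subgroup of index two differ by an element of it, and inner conjugation
fixes class functions. -/
theorem conjFn_eq_conjFn [N.Normal] (hε : ∀ x, ε x = 1 ∨ ε x = -1) (hN : ∀ x, x ∈ N ↔ ε x = 1)
    {X : N → K} (hX : IsClassFn X) {s t : G} (hs : s ∉ N) (ht : t ∉ N) :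
    conjFn s X = conjFn t X := by
  have h : s * t⁻¹ ∈ N := by
    rw [hN, map_mul]
    have h1 := (hε s).resolve_left fun h => hs ((hN s).2 h)
    have h2 := (hε t⁻¹).resolve_left fun h => ht (inv_mem_iff.1 ((hN t⁻¹).2 h))
    rw [h1, h2]
    norm_num
  calc conjFn s X = conjFn t (conjFn (s * t⁻¹) X) := by rw [conjFn_mul]; simp
    _ = conjFn t X := by rw [conjFn_of_mem hX h]

/-- Restriction of an induced character. -/
theorem indFn_ker_apply [N.Normal] (hε : ∀ x, ε x = 1 ∨ ε x = -1) (hN : ∀ x, x ∈ N ↔ ε x = 1)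
    {t : G} (ht : t ∉ N) {X : N → K} (hX : IsClassFn X) (x : N) :
    indFn X (x : G) = X x + conjFn t X x := by
  classical
  have := Fintype.ofFinite G
  have h0 : (Nat.card N : K) ≠ 0 := by exact_mod_cast (Nat.card_pos (α := N)).ne'
  have h1 : ∀ y : G, extZero X (y⁻¹ * x * y) =
      (if y ∈ N then 1 else 0) * X x + (1 - if y ∈ N then 1 else 0) * conjFn t X x := by
    intro y
    have hmem : y⁻¹ * x * y ∈ N := by
      simpa using Subgroup.Normal.conj_mem ‹N.Normal› x x.2 y⁻¹
    rw [extZero_of_mem _ hmem]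
    have h2 : X ⟨y⁻¹ * x * y, hmem⟩ = conjFn y⁻¹ X x := by
      rw [conjFn_apply y⁻¹ X x (by simpa using hmem)]
      simp
    rw [h2]
    split_ifs with hy
    · rw [conjFn_of_mem hX (inv_mem hy)]
      ring
    · rw [conjFn_eq_conjFn hε hN hX (fun h => hy (inv_mem_iff.1 h)) ht]
      ring
  rw [indFn, finsum_eq_sum_of_fintype]
  simp only [h1]
  rw [Finset.sum_add_distrib, ← Finset.sum_mul, ← Finset.sum_mul, Finset.sum_sub_distrib,
    ← card_subgroup_eq_sum]
  have h3 : ∑ _x : G, (1 : K) = 2 * Nat.card N := by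
    rw [two_mul_card_ker hε hN ht]
    simp [Nat.card_eq_fintype_card]
  rw [h3]
  field_simp
  ring

/-- By Parseval the norm is the sum of the squares of all multiplicities. -/
theorem IsChar.sq_le {f χ : G → K} (hf : IsChar f) (hχ : IsIrrChar χ) {m n : ℕ}
    (hm : cinner f χ = m) (hn : cinner f f = n) : m ^ 2 ≤ n := by
  obtain ⟨c, hc, -⟩ := hf.exists_mult
  rw [hf.1.parseval f, Finset.sum_congr rfl fun ψ hψ => by rw [hc ψ (mem_irrChars.1 hψ)]] at hn
  have h1 : ∑ ψ ∈ irrChars K G, c ψ * c ψ = n := by exact_mod_cast hn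
  have h2 : c χ = m := by
    have := hc χ hχ
    rw [hm] at this
    exact_mod_cast this.symm
  rw [← h1, ← h2, sq]
  exact Finset.single_le_sum (f := fun ψ => c ψ * c ψ) (fun _ _ => Nat.zero_le _)
    (mem_irrChars.2 hχ)

end SignKernel

/-! ### Labels of the irreducible characters of types `B` and `D` -/

section Labels

variable {K : Type*} [Field K] [IsAlgClosed K] [CharZero K]
variable {ι : Type} [Fintype ι]

instance : (evenSub ι).Normal := MonoidHom.normal_ker _

variable (ι) in
/-- `(A / B)` is a symbol of defect zero and rank `|ι|`. -/
def IsLabel (A B : Finset ℕ) : Prop := A.card = B.card ∧ rank A + rank B = Fintype.card ι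

variable {A B A' B' : Finset ℕ}

theorem IsLabel.swap (h : IsLabel ι A B) : IsLabel ι B A := ⟨h.1.symm, (add_comm _ _).trans h.2⟩

theorem IsLabel.of_pt_eq (h : IsLabel ι A B) (hc : A'.card = B'.card) (hA : pt A = pt A')
    (hB : pt B = pt B') : IsLabel ι A' B' :=
  ⟨hc, by rw [← rank_eq_of_pt_eq hA, ← rank_eq_of_pt_eq hB, h.2]⟩

theorem symbolFun_congr (h : IsLabel ι A B) (hA : pt A = pt A') (hB : pt B = pt B') :
    symbolFun K ι A B = symbolFun K ι A' B' :=
  (symbolFun_eq_iff h.2 (by rw [← rank_eq_of_pt_eq hA, ← rank_eq_of_pt_eq hB, h.2])).2 ⟨hA, hB⟩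

theorem hasLabel_iff {U : Subgroup (SignedPerm ι)} {X : U → K} :
    HasLabel U X A B ↔ IsIrrChar X ∧ IsLabel ι A B ∧
      cinner (fun x : U => symbolFun K ι A B x) X ≠ 0 := by
  classical
  have h0 : (Nat.card U : K)⁻¹ ≠ 0 := inv_ne_zero (by exact_mod_cast (Nat.card_pos (α := U)).ne')
  have h1 : ∀ f : SignedPerm ι → K, cinner (fun x : U => f x) X ≠ 0 ↔
      ∑ x : U, f x * X x⁻¹ ≠ 0 := by
    intro f
    rw [cinner_eq, mul_ne_zero_iff]
    refine (and_iff_right h0).trans ?_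
    congr!
  constructor
  · rintro ⟨hX, χ, hχ, h⟩
    obtain ⟨h2, h3, rfl⟩ := isSymbolChar_iff.1 hχ
    exact ⟨hX, ⟨h2, h3⟩, (h1 _).2 (by convert h)⟩
  · rintro ⟨hX, hl, h⟩
    refine ⟨hX, _, isSymbolChar_iff.2 ⟨hl.1, hl.2, rfl⟩, ?_⟩
    have := (h1 _).1 h
    convert this

theorem HasLabel.isLabel {U : Subgroup (SignedPerm ι)} {X : U → K} (h : HasLabel U X A B) :
    IsLabel ι A B := (hasLabel_iff.1 h).2.1

theorem HasLabel.of_pt_eq {U : Subgroup (SignedPerm ι)} {X : U → K} (h : HasLabel U X A B)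
    (hc : A'.card = B'.card) (hA : pt A = pt A') (hB : pt B = pt B') : HasLabel U X A' B' := by
  obtain ⟨h1, h2, h3⟩ := hasLabel_iff.1 h
  rw [symbolFun_congr h2 hA hB] at h3
  exact hasLabel_iff.2 ⟨h1, h2.of_pt_eq hc hA hB, h3⟩

/-! #### The whole group -/

theorem IsIrrChar.restrict_top {G : Type} [Group G] [Finite G] {f : G → K} (hf : IsIrrChar f) :
    IsIrrChar fun x : (⊤ : Subgroup G) => f x :=
  hf.comp_surjective (⊤ : Subgroup G).subtype fun x => ⟨⟨x, Subgroup.mem_top x⟩, rfl⟩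

theorem hasLabel_top_iff {X : (⊤ : Subgroup (SignedPerm ι)) → K} :
    HasLabel ⊤ X A B ↔ IsLabel ι A B ∧ X = fun x : (⊤ : Subgroup (SignedPerm ι)) => symbolFun K ι A B x := by
  rw [hasLabel_iff]
  constructor
  · rintro ⟨h1, h2, h3⟩
    exact ⟨h2, ((isIrrChar_symbolFun h2.2).restrict_top.eq_of_cinner_ne_zero h1 h3).symm⟩
  · rintro ⟨h1, rfl⟩
    have := (isIrrChar_symbolFun (K := K) h1.2).restrict_top
    exact ⟨this, h1, by rw [this.cinner_self]; exact one_ne_zero⟩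

theorem exists_hasLabel_top {X : (⊤ : Subgroup (SignedPerm ι)) → K} (hX : IsIrrChar X) :
    ∃ A B, HasLabel ⊤ X A B := by
  have h1 : IsIrrChar fun x : SignedPerm ι => X ⟨x, Subgroup.mem_top x⟩ :=
    hX.comp_surjective (Subgroup.topEquiv (G := SignedPerm ι)).symm.toMonoidHom
      (Subgroup.topEquiv (G := SignedPerm ι)).symm.surjective
  obtain ⟨A, B, h2, h3, h4⟩ := h1.exists_symbolFun
  exact ⟨A, B, hasLabel_top_iff.2 ⟨⟨h2, h3⟩, by rw [← h4]⟩⟩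

/-! #### The group of type `D` -/

theorem restrict_swap (A B : Finset ℕ) : (fun x : evenSub ι => symbolFun K ι B A x) =
    fun x : evenSub ι => symbolFun K ι A B x := by
  ext x
  rw [symbolFun_swap, (mem_evenSub_iff _).1 x.2, one_mul]

theorem HasLabel.swap {X : evenSub ι → K} (h : HasLabel (evenSub ι) X A B) :
    HasLabel (evenSub ι) X B A := by
  obtain ⟨h1, h2, h3⟩ := hasLabel_iff.1 h
  rw [restrict_swap B A] at h3
  exact hasLabel_iff.2 ⟨h1, h2.swap, h3⟩

/-- Restricting to index two adds the product with the sign twist, and the sign twist exchanges the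
rows. -/
theorem cinner_evenSub {t : SignedPerm ι} (ht : t ∉ evenSub ι) (h : IsLabel ι A B)
    (h' : IsLabel ι A' B') [Decidable (pt A = pt A' ∧ pt B = pt B')]
    [Decidable (pt A = pt B' ∧ pt B = pt A')] :
    cinner (fun x : evenSub ι => symbolFun K ι A B x) (fun x : evenSub ι => symbolFun K ι A' B' x) =
      (if pt A = pt A' ∧ pt B = pt B' then 1 else 0) +
        if pt A = pt B' ∧ pt B = pt A' then 1 else 0 := by
  rw [cinner_ker signProdHom_eq_or mem_evenSub_iff ht, cinner_symbolFun_symbolFun h.2 h'.2,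
    ← cinner_symbolFun_symbolFun h.2 h'.swap.2]
  simp only [← symbolFun_swap]

theorem cinner_evenSub_of_forall (ht : ∀ t, t ∈ evenSub ι) (f g : SignedPerm ι → K) :
    cinner (fun x : evenSub ι => f x) (fun x : evenSub ι => g x) = cinner f g := by
  have : evenSub ι = ⊤ := (Subgroup.eq_top_iff' _).2 ht
  rw [this]
  exact cinner_comp_equiv Subgroup.topEquiv f g

/-- Without an element having an odd number of signs, both orders of the rows label the same
character. The conclusion is purely combinatorial, so the auxiliary field `AlgebraicClosure ℚ`
serves to have characters at all. -/
theorem pt_eq_of_forall_mem_evenSub (ht : ∀ t, t ∈ evenSub ι) (h : IsLabel ι A B) :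
    pt A = pt B := by
  have h1 : symbolFun (AlgebraicClosure ℚ) ι A B = symbolFun (AlgebraicClosure ℚ) ι B A := by
    ext x
    rw [symbolFun_swap, (mem_evenSub_iff _).1 (ht x), one_mul]
  exact ((symbolFun_eq_iff h.2 h.swap.2).1 h1).1

/-- Two restrictions with a common constituent are not orthogonal, and the explicit scalar product
then forces the symbols to agree up to the order of the rows. -/
theorem HasLabel.unique {X : evenSub ι → K} (h : HasLabel (evenSub ι) X A B)
    (h' : HasLabel (evenSub ι) X A' B') :
    (pt A = pt A' ∧ pt B = pt B') ∨ (pt A = pt B' ∧ pt B = pt A') := by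
  classical
  obtain ⟨h1, h2, h3⟩ := hasLabel_iff.1 h
  obtain ⟨-, h2', h3'⟩ := hasLabel_iff.1 h'
  have h4 := ((isChar_symbolFun (K := K) h2.2).restrict (evenSub ι)).cinner_ne_zero
    ((isChar_symbolFun h2'.2).restrict (evenSub ι)) h1 h3 h3'
  by_contra! hcon
  apply h4
  by_cases ht : ∀ t, t ∈ evenSub ι
  · rw [cinner_evenSub_of_forall ht, cinner_symbolFun_symbolFun h2.2 h2'.2, if_neg]
    exact fun h5 => hcon.1 h5.1 h5.2
  · push Not at ht
    obtain ⟨t, ht⟩ := ht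
    rw [cinner_evenSub ht h2 h2', if_neg fun h5 => hcon.1 h5.1 h5.2,
      if_neg fun h5 => hcon.2 h5.1 h5.2, add_zero]

/-- The restriction has norm at most 2, so the square of the multiplicity is at most 2. -/
theorem HasLabel.cinner_eq_one {X : evenSub ι → K} (h : HasLabel (evenSub ι) X A B) :
    cinner (fun x : evenSub ι => symbolFun K ι A B x) X = 1 := by
  classical
  obtain ⟨h1, h2, h3⟩ := hasLabel_iff.1 h
  have hc := (isChar_symbolFun (K := K) h2.2).restrict (evenSub ι)
  obtain ⟨n, hn⟩ := hc.2 X h1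
  obtain ⟨N, hN⟩ := hc.exists_cinner hc
  have h4 : N ≤ 2 := by
    by_cases ht : ∀ t, t ∈ evenSub ι
    · rw [cinner_evenSub_of_forall ht, cinner_symbolFun_symbolFun h2.2 h2.2,
        if_pos ⟨rfl, rfl⟩] at hN
      have : N = 1 := by exact_mod_cast hN.symm
      omega
    · push Not at ht
      obtain ⟨t, ht⟩ := ht
      rw [cinner_evenSub ht h2 h2, if_pos ⟨rfl, rfl⟩] at hN
      split_ifs at hN
      · have : ((1 + 1 : ℕ) : K) = N := by rw [Nat.cast_add, Nat.cast_one]; exact hN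
        have : 1 + 1 = N := by exact_mod_cast this
        omega
      · have : 1 = N := by rw [add_zero] at hN; exact_mod_cast hN
        omega
  have h5 := (hc.sq_le h1 hn hN).trans h4
  have h6 : n = 1 := by
    have : n ≠ 0 := by
      rintro rfl
      exact h3 (by rw [hn, Nat.cast_zero])
    have : n < 2 := by
      by_contra! h7
      nlinarith
    omega
  rw [hn, h6, Nat.cast_one]

/-- A character without label would induce to a class function orthogonal to all irreducible
characters of the big group, yet the induced function does not vanish at 1. -/
theorem exists_hasLabel_evenSub {X : evenSub ι → K} (hX : IsIrrChar X) :
    ∃ A B, HasLabel (evenSub ι) X A B := by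
  classical
  by_contra! hcon
  have h0 : (Nat.card (evenSub ι) : K) ≠ 0 := by
    exact_mod_cast (Nat.card_pos (α := evenSub ι)).ne'
  have h1 : (indFn X : SignedPerm ι → K) = 0 := by
    refine (isClassFn_indFn X).eq_zero fun χ hχ => ?_
    rw [cinner_indFn X hχ.isClassFn]
    obtain ⟨A, B, h2, h3, rfl⟩ := hχ.exists_symbolFun
    by_contra h4
    refine hcon A B (hasLabel_iff.2 ⟨hX, ⟨h2, h3⟩, ?_⟩)
    rwa [cinner_comm]
  have h2 := congrFun h1 1
  rw [indFn, finsum_eq_sum_of_fintype] at h2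
  have h3 : ∀ y : SignedPerm ι, extZero X (y⁻¹ * 1 * y) = X 1 := fun y => by
    rw [mul_one, inv_mul_cancel]
    exact extZero_of_mem X (one_mem _)
  simp only [h3, Finset.sum_const, nsmul_eq_mul, Pi.zero_apply, mul_eq_zero, inv_eq_zero, h0,
    hX.one_ne_zero, Finset.card_univ, false_or, or_false, Nat.cast_eq_zero] at h2
  exact Fintype.card_ne_zero h2

theorem exists_hasLabel_of_isLabel (h : IsLabel ι A B) :
    ∃ X : evenSub ι → K, HasLabel (evenSub ι) X A B := by
  classical
  by_contra! hcon
  have hc := (isChar_symbolFun (K := K) h.2).restrict (evenSub ι)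
  have h1 := hc.1.eq_zero fun X hX => by
    by_contra h2
    exact hcon X (hasLabel_iff.2 ⟨hX, h, h2⟩)
  exact (isIrrChar_symbolFun (K := K) h.2).one_ne_zero (congrFun h1 1)

-- By Frobenius reciprocity the constituents are the symbols labelling X; these are the two orders
-- of the rows, which coincide in the degenerate case.
open scoped Classical in
theorem HasLabel.indFn_eq {X : evenSub ι → K} (h : HasLabel (evenSub ι) X A B) :
    (indFn X : SignedPerm ι → K) =
      symbolFun K ι A B + if pt A = pt B then 0 else symbolFun K ι B A := by
  have hl := h.isLabel
  have hg : IsClassFn (symbolFun K ι A B + if pt A = pt B then 0 else symbolFun K ι B A) := by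
    refine (isClassFn_symbolFun hl.2).add ?_
    split_ifs
    · exact fun _ _ => rfl
    · exact isClassFn_symbolFun hl.swap.2
  refine sub_eq_zero.1 (((isClassFn_indFn X).sub hg).eq_zero fun χ hχ => ?_)
  rw [cinner_sub_left, cinner_indFn X hχ.isClassFn, sub_eq_zero, cinner_add_left]
  obtain ⟨A', B', h2, h3, rfl⟩ := hχ.exists_symbolFun
  rw [cinner_symbolFun_symbolFun hl.2 h3]
  have h4 : cinner (if pt A = pt B then 0 else symbolFun K ι B A) (symbolFun K ι A' B') =
      if pt A = pt B then 0 else if pt B = pt A' ∧ pt A = pt B' then 1 else 0 := by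
    split_ifs with h5 h6
    · exact cinner_zero_left _
    · rw [cinner_symbolFun_symbolFun hl.swap.2 h3, if_pos h6]
    · rw [cinner_symbolFun_symbolFun hl.swap.2 h3, if_neg h6]
  rw [h4, cinner_comm]
  have hX := (hasLabel_iff.1 h).1
  by_cases hl' : HasLabel (evenSub ι) X A' B'
  · rw [hl'.cinner_eq_one]
    rcases h.unique hl' with ⟨h5, h6⟩ | ⟨h5, h6⟩
    · rw [if_pos ⟨h5, h6⟩]
      by_cases h7 : pt A = pt B
      · rw [if_pos h7, add_zero]
      · rw [if_neg h7, if_neg, add_zero]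
        rintro ⟨h8, h9⟩
        exact h7 (h5.trans h8.symm)
    · by_cases h7 : pt A = pt B
      · rw [if_pos h7, add_zero, if_pos ⟨h7.trans h6, h7.symm.trans h5⟩]
      · rw [if_neg h7, if_neg (show ¬ (pt A = pt A' ∧ pt B = pt B') from
          fun h8 => h7 (h8.1.trans h6.symm)), if_pos ⟨h6, h5⟩, zero_add]
  · have h5 : cinner (fun x : evenSub ι => symbolFun K ι A' B' x) X = 0 := by
      by_contra h6
      exact hl' (hasLabel_iff.2 ⟨hX, ⟨h2, h3⟩, h6⟩)
    rw [h5, if_neg]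
    · split_ifs with h6 h7
      · simp
      · exact absurd (h.swap.of_pt_eq h2 h7.1 h7.2) hl'
      · simp
    · rintro ⟨h6, h7⟩
      exact hl' (h.of_pt_eq h2 h6 h7)

/-- A character with non-degenerate label is a restriction. -/
theorem HasLabel.eq_restrict {X : evenSub ι → K} (h : HasLabel (evenSub ι) X A B)
    (hne : pt A ≠ pt B ∨ ∀ t, t ∈ evenSub ι) : X = fun x : evenSub ι => symbolFun K ι A B x := by
  classical
  obtain ⟨h1, h2, h3⟩ := hasLabel_iff.1 h
  have hc := (isChar_symbolFun (K := K) h2.2).restrict (evenSub ι)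
  refine ((hc.isIrrChar ?_).eq_of_cinner_ne_zero h1 h3).symm
  by_cases ht : ∀ t, t ∈ evenSub ι
  · rw [cinner_evenSub_of_forall ht, cinner_symbolFun_symbolFun h2.2 h2.2, if_pos ⟨rfl, rfl⟩]
  · have hne' := hne.resolve_right ht
    push Not at ht
    obtain ⟨t, ht⟩ := ht
    rw [cinner_evenSub ht h2 h2, if_pos ⟨rfl, rfl⟩, if_neg fun h5 => hne' h5.1, add_zero]

/-- A symbol with equal rows labels two conjugate characters. -/
theorem HasLabel.add_conjFn {X : evenSub ι → K} (h : HasLabel (evenSub ι) X A B)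
    (hd : pt A = pt B) {t : SignedPerm ι} (ht : t ∉ evenSub ι) :
    X + conjFn t X = fun x : evenSub ι => symbolFun K ι A B x := by
  ext x
  rw [Pi.add_apply, ← indFn_ker_apply signProdHom_eq_or mem_evenSub_iff ht
    (hasLabel_iff.1 h).1.isClassFn x, h.indFn_eq, if_pos hd, add_zero]

theorem HasLabel.conjFn {X : evenSub ι → K} (h : HasLabel (evenSub ι) X A B)
    (t : SignedPerm ι) : HasLabel (evenSub ι) (conjFn t X) A B := by
  obtain ⟨h1, h2, h3⟩ := hasLabel_iff.1 h
  refine hasLabel_iff.2 ⟨h1.conjFn t, h2, ?_⟩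
  rw [← conjFn_restrict (isClassFn_symbolFun h2.2) t, cinner_conjFn]
  exact h3

/-- Were the two conjugates equal, their sum would contain X twice, against the multiplicity 1 in
the restriction. -/
theorem HasLabel.conjFn_ne {X : evenSub ι → K} (h : HasLabel (evenSub ι) X A B)
    (hd : pt A = pt B) {t : SignedPerm ι} (ht : t ∉ evenSub ι) : SymbolInduction.conjFn t X ≠ X := by
  intro heq
  have h1 := h.cinner_eq_one
  rw [← h.add_conjFn hd ht, heq, cinner_add_left, (hasLabel_iff.1 h).1.cinner_self] at h1
  norm_num at h1

theorem HasLabel.eq_or_eq_conjFn {X Y : evenSub ι → K} (h : HasLabel (evenSub ι) X A B)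
    (hY : HasLabel (evenSub ι) Y A B) (hd : pt A = pt B) {t : SignedPerm ι} (ht : t ∉ evenSub ι) :
    Y = X ∨ Y = SymbolInduction.conjFn t X := by
  obtain ⟨h1, -, h3⟩ := hasLabel_iff.1 hY
  rw [← h.add_conjFn hd ht, cinner_add_left] at h3
  have hX := (hasLabel_iff.1 h).1
  by_contra! hcon
  rw [hX.cinner_of_ne h1 hcon.1.symm, (hX.conjFn t).cinner_of_ne h1 hcon.2.symm] at h3
  simp at h3

end Labels

/-! ### The b-function as a sum of minima -/

section MinSum

/-- The sum of the minima `min x y`, where `x` is in `M` and `y` is in `N`. -/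
def minSum (M N : Multiset ℕ) : ℤ :=
  (M.map fun x => (N.map fun y => ((min x y : ℕ) : ℤ)).sum).sum

theorem minSum_add_left (M M' N : Multiset ℕ) :
    minSum (M + M') N = minSum M N + minSum M' N := by
  simp [minSum]

theorem minSum_add_right (M N N' : Multiset ℕ) :
    minSum M (N + N') = minSum M N + minSum M N' := by
  simp [minSum, Multiset.sum_map_add]

theorem minSum_comm (M N : Multiset ℕ) : minSum M N = minSum N M := by
  rw [minSum, Multiset.sum_map_sum_map]
  simp only [minSum, min_comm]

/-- In a sorted list x_j is the minimum of its pairs with the l - 1 - j later entries. Counting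
ordered pairs gives twice the weighted sum plus the diagonal. The result no longer refers to the
sorting. -/
theorem two_mul_sum_list : ∀ {L : List ℕ}, L.Pairwise (· ≤ ·) →
    2 * ∑ j ∈ Finset.range L.length, ((L.length : ℤ) - 1 - j) * (L.getD j 0 : ℤ) =
      minSum L L - (L.sum : ℕ)
  | [], _ => by simp [minSum]
  | a :: L, h => by
    rw [List.pairwise_cons] at h
    have ih := two_mul_sum_list h.2
    have h1 : minSum (a :: L : List ℕ) (a :: L : List ℕ) = a + 2 * (L.length * a) + minSum L L := by
      have h2 : ((a :: L : List ℕ) : Multiset ℕ) = {a} + (L : Multiset ℕ) := by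
        simp
      have h3 : minSum {a} (L : Multiset ℕ) = L.length * a := by
        simp only [minSum, Multiset.map_singleton, Multiset.sum_singleton]
        rw [Multiset.map_congr rfl fun y hy => by
          rw [min_eq_left (h.1 y (Multiset.mem_coe.1 hy))]]
        simp
      have h4 : minSum {a} {a} = a := by simp [minSum]
      rw [h2, minSum_add_left, minSum_add_right, minSum_add_right, minSum_comm (L : Multiset ℕ) {a}, h3, h4]
      ring
    rw [h1, List.length_cons, Finset.sum_range_succ']
    simp only [List.getD_cons_succ, List.getD_cons_zero, Nat.cast_add, Nat.cast_one,
      Nat.cast_zero, List.sum_cons]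
    have h4 : ∀ j : ℕ, ((L.length : ℤ) + 1 - 1 - (j + 1)) = L.length - 1 - j := fun j => by ring
    simp only [h4]
    linarith

/-- The contribution of the minimal sequence to the `b`-function. -/
def baseSum (T : Series) (l : ℕ) : ℤ :=
  ∑ j ∈ Finset.range l, ((l : ℤ) - 1 - j) * baseEntry T j

/-- For rows of fixed sizes and partitions of fixed ranks only the sum of minima varies, so
comparing b-values becomes comparing these sums. -/
theorem two_mul_bSymbol (T : Series) (t : ℕ) (A B : Finset ℕ) {M : Multiset ℕ}
    (hM : (springerPair T t A B).1.val + (springerPair T t A B).2.val = M) :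
    2 * bSymbol T t A B = minSum M M - (M.sum : ℕ) - 2 * baseSum T (Multiset.card M) := by
  have h1 := two_mul_sum_list (L := M.sort) (Multiset.pairwise_sort M (· ≤ ·))
  rw [Multiset.sort_eq] at h1
  have h2 : (M.sort).sum = M.sum := by
    rw [← Multiset.sum_coe, Multiset.sort_eq]
  have h3 : (M.sort).length = Multiset.card M := Multiset.length_sort _
  rw [h2] at h1
  rw [← h1, bSymbol, hM, baseSum]
  simp only [h3, mul_sub, Finset.sum_sub_distrib]

end MinSum

/-! ### The b-function and the dominance order -/

section Rows

/-- The entries `p_k + 2 (s - 1 - k) + c` of a row, in decreasing order. -/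
def rowEntry (s c : ℕ) (p : ℕ → ℕ) (k : ℕ) : ℕ := p k + (2 * (s - 1 - k) + c)

/-- The multiset of the entries of a row. -/
def row (s c : ℕ) (p : ℕ → ℕ) : Multiset ℕ := (Finset.range s).val.map (rowEntry s c p)

/-- The beta-set is read from its largest entry: with i = s - 1 - k the number a_i + i + c becomes
p_k + 2i + c. -/
theorem spread_val (A : Finset ℕ) (c : ℕ) : (spread A c).val = row A.card c (pt A) := by
  rw [spread, Finset.image_val_of_injOn]
  · rw [← Finset.range_image_pred_top_sub A.card, Finset.image_val_of_injOn, Multiset.map_map, row]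
    · refine Multiset.map_congr rfl fun k hk => ?_
      have hk' : k < A.card := Finset.mem_range.1 hk
      simp only [Function.comp_apply]
      rw [entry_eq_pt (by omega), rowEntry, show A.card - 1 - (A.card - 1 - k) = k by omega]
      omega
    · intro i hi j hj h
      have h1 := Finset.mem_range.1 (Finset.mem_coe.1 hi)
      have h2 := Finset.mem_range.1 (Finset.mem_coe.1 hj)
      simp only at h
      omega
  · intro i hi j hj h
    have h1 := Finset.mem_range.1 (Finset.mem_coe.1 hi)
    have h2 := Finset.mem_range.1 (Finset.mem_coe.1 hj)
    simp only at h
    by_contra hne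
    rcases Nat.lt_or_gt_of_ne hne with h3 | h3
    · have := entry_lt_entry A h3 h2
      omega
    · have := entry_lt_entry A h3 h1
      omega

theorem row_map_add (s c d : ℕ) (p : ℕ → ℕ) : (row s c p).map (· + d) = row s (c + d) p := by
  rw [row, Multiset.map_map, row]
  refine Multiset.map_congr rfl fun k _ => ?_
  simp only [Function.comp_apply, rowEntry]
  omega

theorem zero_notMem_spread (A : Finset ℕ) {c : ℕ} (hc : 0 < c) : 0 ∉ spread A c := by
  simp only [spread, Finset.mem_image, not_exists]
  omega

theorem insert_zero_val (A : Finset ℕ) {c : ℕ} (hc : 0 < c) :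
    (insert 0 (spread A c)).val = {0} + row A.card c (pt A) := by
  rw [Finset.insert_val_of_notMem (zero_notMem_spread A hc), spread_val]
  rfl

theorem evenShift_val (k : ℕ) (X : Finset ℕ) :
    (evenShift k X).val = (Finset.range k).val.map (fun i => 2 * i) + X.val.map (· + 2 * k) := by
  have hd : Disjoint ((Finset.range k).image (fun i => 2 * i)) (X.image (fun x => x + 2 * k)) := by
    rw [Finset.disjoint_left]
    simp only [Finset.mem_image, Finset.mem_range]
    rintro _ ⟨i, hi, rfl⟩ ⟨x, -, hx⟩
    omega
  rw [evenShift, ← Finset.disjUnion_eq_union _ _ hd, Finset.disjUnion_val,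
    Finset.image_val_of_injOn, Finset.image_val_of_injOn]
  · exact fun x _ y _ h => by simpa using h
  · exact fun x _ y _ h => by simpa using h

theorem oddShift_val (k : ℕ) (X : Finset ℕ) :
    (oddShift k X).val = (Finset.range k).val.map (fun i => 2 * i + 1) + X.val.map (· + 2 * k) := by
  have hd : Disjoint ((Finset.range k).image (fun i => 2 * i + 1))
      (X.image (fun x => x + 2 * k)) := by
    rw [Finset.disjoint_left]
    simp only [Finset.mem_image, Finset.mem_range]
    rintro _ ⟨i, hi, rfl⟩ ⟨x, -, hx⟩
    omega
  rw [oddShift, ← Finset.disjUnion_eq_union _ _ hd, Finset.disjUnion_val,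
    Finset.image_val_of_injOn, Finset.image_val_of_injOn]
  · exact fun x _ y _ h => by simpa using h
  · exact fun x _ y _ h => by simpa using h

/-- Apart from a fixed part, the entries are those of two rows. -/
theorem exists_springerPair_val (T : Series) (t : ℕ) : ∃ (F : Multiset ℕ) (c d : ℕ),
    ∀ A B : Finset ℕ, (springerPair T t A B).1.val + (springerPair T t A B).2.val =
      F + (row A.card c (pt A) + row B.card d (pt B)) := by
  rcases T with _ | _ | _ | _
  · refine ⟨(Finset.range (2 * t)).val.map (fun i => 2 * i) + ({0} : Multiset ℕ).map
      (· + 2 * (2 * t)), 2 + 2 * (2 * t), 0, fun A B => ?_⟩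
    simp only [springerPair]
    rw [evenShift_val, insert_zero_val A two_pos, spread_val, Multiset.map_add, row_map_add]
    simp only [add_assoc]
  · refine ⟨(Finset.range (4 * t)).val.map (fun i => 2 * i) + ({0} : Multiset ℕ).map
      (· + 2 * (4 * t)), 2 + 2 * (4 * t), 1, fun A B => ?_⟩
    simp only [springerPair]
    rw [evenShift_val, insert_zero_val A two_pos, spread_val, Multiset.map_add, row_map_add]
    simp only [add_assoc]
  · refine ⟨{0} + (Finset.range (4 * t)).val.map (fun i => 2 * i + 1), 1 + 2 * (4 * t), 2,
      fun A B => ?_⟩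
    simp only [springerPair]
    rw [oddShift_val, insert_zero_val B two_pos, spread_val, row_map_add]
    rw [add_comm (row A.card _ _), add_add_add_comm]
  · rcases t with _ | t
    · refine ⟨0, 0, 0, fun A B => ?_⟩
      simp only [springerPair]
      rw [spread_val, spread_val, zero_add]
    · refine ⟨(Finset.range (4 * t + 3)).val.map (fun i => 2 * i) + ({0} : Multiset ℕ).map
        (· + 2 * (4 * t + 3)), 2 + 2 * (4 * t + 3), 0, fun A B => ?_⟩
      simp only [springerPair]
      rw [evenShift_val, insert_zero_val A two_pos, spread_val, Multiset.map_add, row_map_add]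
      simp only [add_assoc]

theorem minSum_row (s c d : ℕ) (p q : ℕ → ℕ) : minSum (row s c p) (row s d q) =
    ∑ k ∈ Finset.range s, ∑ j ∈ Finset.range s,
      ((min (rowEntry s c p k) (rowEntry s d q j) : ℕ) : ℤ) := by
  simp only [minSum, row, Multiset.map_map]
  rfl

theorem card_row (s c : ℕ) (p : ℕ → ℕ) : Multiset.card (row s c p) = s := by
  simp [row]

theorem sum_row (s c : ℕ) (p : ℕ → ℕ) :
    (row s c p).sum = top p s + ∑ k ∈ Finset.range s, (2 * (s - 1 - k) + c) := by
  rw [top, ← Finset.sum_add_distrib]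
  rfl

/-- `∑ min(x, y)` over the entries `x` of a row is a decreasing function in the dominance order. -/
theorem sum_min_le {s c : ℕ} {p p' : ℕ → ℕ} (hp : Antitone p)
    (htop : ∀ k, top p k ≤ top p' k) (hs : top p s = top p' s) (y : ℕ) :
    ∑ k ∈ Finset.range s, ((min (rowEntry s c p' k) y : ℕ) : ℤ) ≤
      ∑ k ∈ Finset.range s, ((min (rowEntry s c p k) y : ℕ) : ℤ) := by
  classical
  -- m is the first index whose entry for `p` is at most y. Before m the minimum for `p` is y, the
  -- largest possible value; from m on it is the entry itself, and there the tail sums of `p` and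
  -- `p'` are compared, dominance making the tail of `p'` smaller.
  have hex : ∃ m, s ≤ m ∨ rowEntry s c p m ≤ y := ⟨s, Or.inl le_rfl⟩
  obtain ⟨m, hm, hmin⟩ : ∃ m, (s ≤ m ∨ rowEntry s c p m ≤ y) ∧
      ∀ k < m, ¬ (s ≤ k ∨ rowEntry s c p k ≤ y) := ⟨Nat.find hex, Nat.find_spec hex,
    fun k hk => Nat.find_min hex hk⟩
  have hms : m ≤ s := by
    by_contra! h
    exact hmin s h (Or.inl le_rfl)
  have hge : ∀ k, m ≤ k → k < s → rowEntry s c p k ≤ y := by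
    intro k h1 h2
    have h3 := hm.resolve_left (by omega)
    have h4 := hp h1
    simp only [rowEntry] at h3 ⊢
    omega
  have hsplit : ∀ F : ℕ → ℤ, ∑ k ∈ Finset.range s, F k =
      ∑ k ∈ Finset.range m, F k + ∑ k ∈ Finset.Ico m s, F k := fun F =>
    (Finset.sum_range_add_sum_Ico F hms).symm
  have htm : (top p m : ℤ) ≤ top p' m := by exact_mod_cast htop m
  have e1 : ∀ r : ℕ → ℕ, (top r s : ℤ) = top r m + ∑ k ∈ Finset.Ico m s, (r k : ℤ) := by
    intro r
    simp only [top, Nat.cast_sum]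
    exact hsplit fun k => (r k : ℤ)
  have e2 := e1 p
  have e3 := e1 p'
  have hs' : (top p s : ℤ) = top p' s := by exact_mod_cast hs
  have hle : ∑ k ∈ Finset.Ico m s, (p' k : ℤ) ≤ ∑ k ∈ Finset.Ico m s, (p k : ℤ) := by linarith
  rw [hsplit, hsplit]
  refine add_le_add ?_ ?_
  · refine Finset.sum_le_sum fun k hk => ?_
    have := hmin k (Finset.mem_range.1 hk)
    push Not at this
    rw [min_eq_right this.2.le]
    exact_mod_cast min_le_right _ _
  · calc ∑ k ∈ Finset.Ico m s, ((min (rowEntry s c p' k) y : ℕ) : ℤ)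
        ≤ ∑ k ∈ Finset.Ico m s, ((p' k : ℤ) + ((2 * (s - 1 - k) + c : ℕ) : ℤ)) := by
          refine Finset.sum_le_sum fun k _ => ?_
          exact_mod_cast min_le_left (rowEntry s c p' k) y
      _ ≤ ∑ k ∈ Finset.Ico m s, ((p k : ℤ) + ((2 * (s - 1 - k) + c : ℕ) : ℤ)) := by
          rw [Finset.sum_add_distrib, Finset.sum_add_distrib]
          linarith
      _ = ∑ k ∈ Finset.Ico m s, ((min (rowEntry s c p k) y : ℕ) : ℤ) := by
          refine Finset.sum_congr rfl fun k hk => ?_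
          rw [Finset.mem_Ico] at hk
          rw [min_eq_left (hge k hk.1 hk.2)]
          rfl

theorem minSum_row_le {s c : ℕ} {p p' : ℕ → ℕ} (hp : Antitone p)
    (htop : ∀ k, top p k ≤ top p' k) (hs : top p s = top p' s) (N : Multiset ℕ) :
    minSum (row s c p') N ≤ minSum (row s c p) N := by
  rw [minSum_comm, minSum_comm _ N]
  refine Multiset.sum_map_le_sum_map _ _ fun y _ => ?_
  have := sum_min_le (c := c) hp htop hs y
  simp only [row, Multiset.map_map, Function.comp_def, min_comm y]
  exact this

/-- For a decreasing sequence the value at k is the minimum of exactly the 2k + 1 ordered pairs of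
indices with maximum k. -/
theorem sum_min_self : ∀ (s : ℕ) {g : ℕ → ℕ}, Antitone g →
    ∑ k ∈ Finset.range s, ∑ j ∈ Finset.range s, ((min (g k) (g j) : ℕ) : ℤ) =
      ∑ k ∈ Finset.range s, (2 * (k : ℤ) + 1) * g k
  | 0, _, _ => by simp
  | s + 1, g, hg => by
    have ih := sum_min_self s hg
    simp only [Finset.sum_range_succ, Finset.sum_add_distrib, ih]
    have h1 : ∀ k ∈ Finset.range s, ((min (g k) (g s) : ℕ) : ℤ) = g s := fun k hk => by
      rw [min_eq_right (hg (Finset.mem_range.1 hk).le)]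
    have h2 : ∀ k ∈ Finset.range s, ((min (g s) (g k) : ℕ) : ℤ) = g s := fun k hk => by
      rw [min_eq_left (hg (Finset.mem_range.1 hk).le)]
    rw [Finset.sum_congr rfl h1, Finset.sum_congr rfl h2]
    simp
    ring

theorem rowEntry_antitone {s c : ℕ} {p : ℕ → ℕ} (hp : Antitone p) : Antitone (rowEntry s c p) := by
  intro i j h
  have := hp h
  simp only [rowEntry]
  omega

/-- Abel summation. -/
theorem sum_mul_add_sum_top (s : ℕ) (p : ℕ → ℕ) :
    ∑ k ∈ Finset.range s, (k : ℤ) * p k + ∑ k ∈ Finset.range s, (top p (k + 1) : ℤ) =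
      s * top p s := by
  induction s with
  | zero => simp
  | succ s ih =>
    rw [Finset.sum_range_succ, Finset.sum_range_succ, top_succ]
    push_cast
    linarith

/-- Abel summation exhibits the partial sums of the partition with a negative coefficient; this
makes the dependence on the dominance order strict. -/
theorem minSum_row_self {s c : ℕ} {p : ℕ → ℕ} (hp : Antitone p) :
    minSum (row s c p) (row s c p) = 2 * (s * top p s - ∑ k ∈ Finset.range s, (top p (k + 1) : ℤ)) +
      top p s + ∑ k ∈ Finset.range s, (2 * (k : ℤ) + 1) * ((2 * (s - 1 - k) + c : ℕ) : ℤ) := by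
  rw [minSum_row, sum_min_self s (rowEntry_antitone hp)]
  have h1 : ∀ k ∈ Finset.range s, (2 * (k : ℤ) + 1) * (rowEntry s c p k : ℤ) =
      2 * ((k : ℤ) * p k) + p k + (2 * (k : ℤ) + 1) * ((2 * (s - 1 - k) + c : ℕ) : ℤ) := by
    intro k _
    rw [rowEntry, Nat.cast_add]
    ring
  rw [Finset.sum_congr rfl h1, Finset.sum_add_distrib, Finset.sum_add_distrib, ← Finset.mul_sum]
  have h2 := sum_mul_add_sum_top s p
  have h3 : (top p s : ℤ) = ∑ k ∈ Finset.range s, (p k : ℤ) := by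
    rw [top, Nat.cast_sum]
  rw [← h3]
  linarith

/-- The difference of both sides is twice the sum of the differences of partial sums. Equality
forces every partial sum to agree; the strictness of the b-function has its only source here. -/
theorem minSum_row_self_le {s c : ℕ} {p p' : ℕ → ℕ} (hp : Antitone p) (hp' : Antitone p')
    (htop : ∀ k, top p k ≤ top p' k) (hs : top p s = top p' s) :
    minSum (row s c p') (row s c p') ≤ minSum (row s c p) (row s c p) ∧
    (minSum (row s c p') (row s c p') = minSum (row s c p) (row s c p) →
      ∀ k ≤ s, top p k = top p' k) := by
  have h0 : ∀ k ∈ Finset.range s, (top p (k + 1) : ℤ) ≤ top p' (k + 1) :=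
    fun k _ => by exact_mod_cast htop (k + 1)
  have h1 := Finset.sum_le_sum h0
  rw [minSum_row_self hp, minSum_row_self hp', hs]
  refine ⟨by linarith, fun h k hk => ?_⟩
  rcases k with _ | k
  · simp [top]
  · have h2 := (Finset.sum_eq_sum_iff_of_le h0).1 (by linarith) k (Finset.mem_range.2 hk)
    exact_mod_cast h2

/-- The `b`-function is strictly decreasing in the dominance order. -/
theorem bSymbol_le (T : Series) (t : ℕ) {s : ℕ} {A B A' B' : Finset ℕ} (hA : A.card = s)
    (hB : B.card = s) (hA' : A'.card = s) (hB' : B'.card = s)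
    (h1 : ∀ k, top (pt A) k ≤ top (pt A') k) (h2 : ∀ k, top (pt B) k ≤ top (pt B') k)
    (hr1 : rank A = rank A') (hr2 : rank B = rank B') :
    bSymbol T t A' B' ≤ bSymbol T t A B ∧
      (bSymbol T t A' B' = bSymbol T t A B → A = A' ∧ B = B') := by
  obtain ⟨F, c, d, hF⟩ := exists_springerPair_val T t
  have e1 := two_mul_bSymbol T t A B (hF A B)
  have e2 := two_mul_bSymbol T t A' B' (hF A' B')
  have s1 : top (pt A) s = top (pt A') s := by
    rw [top_pt_of_le A hA.le, top_pt_of_le A' hA'.le, hr1]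
  have s2 : top (pt B) s = top (pt B') s := by
    rw [top_pt_of_le B hB.le, top_pt_of_le B' hB'.le, hr2]
  rw [hA, hB] at e1
  rw [hA', hB'] at e2
  simp only [Multiset.card_add, card_row, Multiset.sum_add, sum_row, s1, s2, minSum_add_left,
    minSum_add_right] at e1 e2
  have k1 := minSum_row_self_le (c := c) (pt_antitone A) (pt_antitone A') h1 s1
  have k2 := minSum_row_self_le (c := d) (pt_antitone B) (pt_antitone B') h2 s2
  have k3 := minSum_row_le (c := c) (pt_antitone A) h1 s1 F
  have k4 := minSum_row_le (c := d) (pt_antitone B) h2 s2 F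
  -- For the mixed term between the two rows one row is replaced at a time, with the other one
  -- fixed.
  have k5 := minSum_row_le (c := c) (pt_antitone A) h1 s1 (row s d (pt B))
  have k6 := minSum_row_le (c := d) (pt_antitone B) h2 s2 (row s c (pt A'))
  have c1 := minSum_comm F (row s c (pt A))
  have c2 := minSum_comm F (row s c (pt A'))
  have c3 := minSum_comm F (row s d (pt B))
  have c4 := minSum_comm F (row s d (pt B'))
  have c5 := minSum_comm (row s d (pt B)) (row s c (pt A))
  have c6 := minSum_comm (row s d (pt B')) (row s c (pt A'))
  rw [minSum_comm (row s d (pt B')) (row s c _), minSum_comm (row s d (pt B)) (row s c _)] at k6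
  refine ⟨by linarith [k1.1, k2.1], fun h => ?_⟩
  have t1 := k1.2 (by linarith [k1.1, k2.1])
  have t2 := k2.2 (by linarith [k1.1, k2.1])
  have key : ∀ C C' : Finset ℕ, C.card = s → C'.card = s → (∀ k ≤ s, top (pt C) k = top (pt C') k) →
      C = C' := by
    intro C C' hC hC' h
    refine eq_of_pt_eq (hC.trans hC'.symm) (eq_of_top_eq fun k => ?_)
    rcases le_total k s with hk | hk
    · exact h k hk
    · have h3 := h s le_rfl
      rw [top_pt_of_le C hC.le, top_pt_of_le C' hC'.le] at h3
      rw [top_pt_of_le C (hC.le.trans hk), top_pt_of_le C' (hC'.le.trans hk), h3]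
  exact ⟨key A A' hA hA' t1, key B B' hB hB' t2⟩

/-! #### Type `D` with `d = 0` -/

theorem springerPair_D_val (A B : Finset ℕ) :
    (springerPair .D 0 A B).1.val + (springerPair .D 0 A B).2.val =
      row A.card 0 (pt A) + row B.card 0 (pt B) := by
  simp only [springerPair]
  rw [spread_val, spread_val]

/-- For d = 0 both rows are spread with the same offset, so only their union enters. -/
theorem bSymbol_D_swap (A B : Finset ℕ) : bSymbol .D 0 A B = bSymbol .D 0 B A := by
  have e1 := two_mul_bSymbol .D 0 A B (springerPair_D_val A B)
  have e2 := two_mul_bSymbol .D 0 B A (springerPair_D_val B A)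
  rw [add_comm (row B.card _ _)] at e2
  linarith

/-- The minimal sequence begins with 0, 0 and continues with a copy of itself raised by 2. This
matches the effect of a shift on the entries of a symbol. -/
theorem baseSum_D_add_two (l : ℕ) : baseSum .D (l + 2) = baseSum .D l + l * ((l : ℤ) - 1) := by
  rw [baseSum, Finset.sum_range_succ', Finset.sum_range_succ']
  have h1 : ∀ j : ℕ, (((l + 2 : ℕ) : ℤ) - 1 - ((j + 1 + 1 : ℕ) : ℤ)) *
      (baseEntry .D (j + 1 + 1) : ℤ) = ((l : ℤ) - 1 - j) * baseEntry .D j +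
        2 * ((l : ℤ) - 1 - j) := by
    intro j
    have : baseEntry .D (j + 1 + 1) = baseEntry .D j + 2 := by
      simp only [baseEntry]
      omega
    rw [this]
    push_cast
    ring
  have h2 : ∀ l : ℕ, ∑ j ∈ Finset.range l, 2 * ((l : ℤ) - 1 - j) = l * ((l : ℤ) - 1) := by
    intro l
    rw [← Finset.mul_sum, Finset.sum_sub_distrib, mul_sub, ← Nat.cast_sum]
    have := Finset.sum_range_id_mul_two l
    have h3 : ((∑ i ∈ Finset.range l, i : ℕ) : ℤ) * 2 = l * (l - 1) := by
      rcases l with _ | l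
      · simp
      · rw [Nat.add_sub_cancel] at this
        have := congrArg (fun n : ℕ => (n : ℤ)) this
        push_cast at this ⊢
        linarith
    simp only [Finset.sum_const, Finset.card_range, nsmul_eq_mul]
    linarith
  simp only [h1, Finset.sum_add_distrib, h2]
  simp [baseEntry, baseSum]

/-- A further part equal to zero contributes the entry 0 and raises every other entry by 2. -/
theorem row_succ {s : ℕ} {p : ℕ → ℕ} (hp : p s = 0) : row (s + 1) 0 p = (row s 2 p) + {0} := by
  rw [row, Finset.range_val, Multiset.range_succ, Multiset.map_cons, row, Finset.range_val,
    ← Multiset.singleton_add, add_comm]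
  congr 1
  · refine Multiset.map_congr rfl fun k hk => ?_
    have := Multiset.mem_range.1 hk
    simp only [rowEntry]
    omega
  · simp [rowEntry, hp]

theorem minSum_zero_right (M : Multiset ℕ) : minSum M {0} = 0 := by
  simp [minSum]

theorem minSum_row_two (s : ℕ) (p q : ℕ → ℕ) :
    minSum (row s 2 p) (row s 2 q) = minSum (row s 0 p) (row s 0 q) + 2 * s * s := by
  rw [minSum_row, minSum_row]
  have h1 : ∀ k j, ((min (rowEntry s 2 p k) (rowEntry s 2 q j) : ℕ) : ℤ) =
      ((min (rowEntry s 0 p k) (rowEntry s 0 q j) : ℕ) : ℤ) + 2 := by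
    intro k j
    simp only [rowEntry]
    omega
  simp only [h1, Finset.sum_add_distrib, Finset.sum_const, Finset.card_range, nsmul_eq_mul]
  ring

/-- Shift invariance of the `b`-function. -/
theorem bSymbol_D_succ {s : ℕ} {A B A' B' : Finset ℕ} (hA : A.card = s) (hB : B.card = s)
    (hA' : A'.card = s + 1) (hB' : B'.card = s + 1) (h1 : pt A = pt A') (h2 : pt B = pt B') :
    bSymbol .D 0 A' B' = bSymbol .D 0 A B := by
  have e1 := two_mul_bSymbol .D 0 A B (springerPair_D_val A B)
  have e2 := two_mul_bSymbol .D 0 A' B' (springerPair_D_val A' B')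
  have e3 : pt A s = 0 := pt_of_le hA.le
  have e4 : pt B s = 0 := pt_of_le hB.le
  rw [hA, hB] at e1
  rw [hA', hB', ← h1, ← h2, row_succ e3, row_succ e4] at e2
  simp only [minSum_add_left, minSum_add_right, minSum_zero_right, minSum_comm {0},
    minSum_row_two, Multiset.card_add, card_row, Multiset.card_singleton, Multiset.sum_add,
    sum_row, Multiset.sum_singleton, Finset.sum_add_distrib, Finset.sum_const, Finset.card_range,
    smul_eq_mul] at e1 e2
  rw [show s + 1 + (s + 1) = s + s + 2 by ring, baseSum_D_add_two] at e2
  push_cast at e1 e2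
  linarith

/-- Two symbols with the same partitions are both enlarged to the sum of their sizes. Proving that a
character is minimal needs this, since its label is only determined up to shift. -/
theorem bSymbol_D_congr {A B A' B' : Finset ℕ} (hA : A.card = B.card) (hA' : A'.card = B'.card)
    (h1 : pt A = pt A') (h2 : pt B = pt B') : bSymbol .D 0 A B = bSymbol .D 0 A' B' := by
  have key : ∀ (n : ℕ) {A B : Finset ℕ}, A.card = B.card →
      bSymbol .D 0 (betaOf (A.card + n) (pt A)) (betaOf (A.card + n) (pt B)) =
        bSymbol .D 0 A B := by
    intro n A B h
    have hc : ∀ (C : Finset ℕ) m, (betaOf m (pt C)).card = m := fun C m =>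
      card_betaOf m (pt_antitone C)
    have hp : ∀ (C : Finset ℕ) m, C.card ≤ m → pt (betaOf m (pt C)) = pt C := fun C m hm =>
      pt_betaOf (pt_antitone C) fun i hi => pt_of_le (hm.trans hi)
    induction n with
    | zero =>
      congr 1
      · exact eq_of_pt_eq (hc A _) (hp A _ le_rfl)
      · exact eq_of_pt_eq ((hc B _).trans h) (hp B _ h.ge)
    | succ n ih =>
      rw [← ih]
      refine bSymbol_D_succ (hc A _) (hc B _) (hc A _) (hc B _) ?_ ?_
      · rw [hp A _ (by omega), hp A _ (by omega)]
      · rw [hp B _ (by omega), hp B _ (by omega)]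
  rw [← key A'.card hA, ← key A.card hA', h1, h2, add_comm]

/-- A symbol with equal rows has larger `b`-value than a non-degenerate one with the same sum of
rows. -/
theorem bSymbol_D_lt {s : ℕ} {L L₁ L₂ : Finset ℕ} (hL : L.card = s) (h1 : L₁.card = s)
    (h2 : L₂.card = s) (hsum : pt L₁ + pt L₂ = pt L + pt L) (hne : pt L₁ ≠ pt L₂) :
    bSymbol .D 0 L₁ L₂ < bSymbol .D 0 L L := by
  have e1 := two_mul_bSymbol .D 0 L L (springerPair_D_val L L)
  have e2 := two_mul_bSymbol .D 0 L₁ L₂ (springerPair_D_val L₁ L₂)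
  rw [hL] at e1
  rw [h1, h2] at e2
  have htop : top (pt L₁) s + top (pt L₂) s = top (pt L) s + top (pt L) s := by
    rw [← top_add, ← top_add, hsum]
  have hk : ∀ k, pt L₁ k + pt L₂ k = pt L k + pt L k := fun k => congrFun hsum k
  have hsum' : ((top (pt L₁) s : ℤ) + top (pt L₂) s) = top (pt L) s + top (pt L) s := by
    exact_mod_cast htop
  simp only [minSum_add_left, minSum_add_right, Multiset.card_add, card_row, Multiset.sum_add,
    sum_row] at e1 e2
  rw [minSum_comm (row s 0 (pt L₂)) (row s 0 (pt L₁))] at e2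
  -- Concavity of min: the entries of `L` are the averages of those of `L₁` and `L₂`.
  have m1 : minSum (row s 0 (pt L₁)) (row s 0 (pt L₁)) + minSum (row s 0 (pt L₂)) (row s 0 (pt L₂))
      ≤ 2 * minSum (row s 0 (pt L)) (row s 0 (pt L)) := by
    simp only [minSum_row, Finset.mul_sum, ← Finset.sum_add_distrib]
    refine Finset.sum_le_sum fun k _ => Finset.sum_le_sum fun j _ => ?_
    have := hk k
    have := hk j
    simp only [rowEntry]
    omega
  -- The mixed sum is first symmetrised, after which concavity applies to each pair of indices. A
  -- diagonal pair at which `L₁` and `L₂` differ gives the strict inequality.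
  have m2 : 2 * minSum (row s 0 (pt L₁)) (row s 0 (pt L₂))
      < 2 * minSum (row s 0 (pt L)) (row s 0 (pt L)) := by
    have hsw : minSum (row s 0 (pt L₁)) (row s 0 (pt L₂)) = ∑ k ∈ Finset.range s,
        ∑ j ∈ Finset.range s,
        ((min (rowEntry s 0 (pt L₁) j) (rowEntry s 0 (pt L₂) k) : ℕ) : ℤ) := by
      rw [minSum_row, Finset.sum_comm]
    rw [two_mul]
    nth_rewrite 2 [hsw]
    simp only [minSum_row, Finset.mul_sum, ← Finset.sum_add_distrib]
    have hle : ∀ k j, ((min (rowEntry s 0 (pt L₁) k) (rowEntry s 0 (pt L₂) j) : ℕ) : ℤ) +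
        ((min (rowEntry s 0 (pt L₁) j) (rowEntry s 0 (pt L₂) k) : ℕ) : ℤ) ≤
        2 * ((min (rowEntry s 0 (pt L) k) (rowEntry s 0 (pt L) j) : ℕ) : ℤ) := by
      intro k j
      have := hk k
      have := hk j
      simp only [rowEntry]
      omega
    obtain ⟨k, hk1⟩ : ∃ k, pt L₁ k ≠ pt L₂ k := Function.ne_iff.1 hne
    have hks : k < s := by
      by_contra! hks
      exact hk1 ((pt_of_le (h1.le.trans hks)).trans (pt_of_le (h2.le.trans hks)).symm)
    refine Finset.sum_lt_sum (fun k _ => Finset.sum_le_sum fun j _ => hle k j)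
      ⟨k, Finset.mem_range.2 hks, Finset.sum_lt_sum (fun j _ => hle k j)
        ⟨k, Finset.mem_range.2 hks, ?_⟩⟩
    have := hk k
    simp only [rowEntry]
    omega
  push_cast at e1 e2
  linarith

end Rows

/-! ### Frobenius reciprocity for cosets -/

section Mult

variable {K : Type*} [Field K] [IsAlgClosed K] [CharZero K]
variable {Γ : Type} [Group Γ] [Fintype Γ]

/-- Frobenius reciprocity for twisted induction. -/
theorem mult_eq (bar : K ≃+* K) (hbar : ∀ (ω : K) (k : ℕ), 0 < k → ω ^ k = 1 → bar ω = ω⁻¹)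
    {W H : Subgroup Γ} {f v : Γ} (hH : H ≤ W) (hv : v * f⁻¹ ∈ W)
    (hf : ∀ w ∈ W, f * w * f⁻¹ ∈ W) (E' : adjoin H v → K) {X' : adjoin W f → K}
    (hX : IsIrrChar X') [DecidablePred fun z => z * v⁻¹ ∈ H] :
    mult bar W H f v E' X' = (Nat.card H : K)⁻¹ *
      ∑ z : Γ, (if z * v⁻¹ ∈ H then extZero E' z else 0) * extZero X' z⁻¹ := by
  classical
  have h0 : (Nat.card W : K) ≠ 0 := by exact_mod_cast (Nat.card_pos (α := W)).ne'
  have hWle : W ≤ adjoin W f := le_sup_left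
  have hfmem : f ∈ adjoin W f := (le_sup_right : Subgroup.zpowers f ≤ _)
    (Subgroup.mem_zpowers f)
  have hmem : ∀ z, z * v⁻¹ ∈ H → z * f⁻¹ ∈ W := fun z hz => by
    have := mul_mem (hH hz) hv
    simpa [mul_assoc] using this
  -- For fixed y the substitution z = y⁻¹ x f y turns the inner sum into one independent of y: the
  -- character of W⟨f⟩ is constant on conjugacy classes, and z in H v already forces x into W.
  -- Summing over y then cancels the order of W.
  have key : ∀ y ∈ W, ∑ x : Γ, (if x ∈ W then
      (if y ∈ W ∧ y⁻¹ * (x * f) * y * v⁻¹ ∈ H then extZero E' (y⁻¹ * (x * f) * y) else 0) *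
        bar (extZero X' (x * f)) else 0) =
      ∑ z : Γ, (if z * v⁻¹ ∈ H then extZero E' z else 0) * extZero X' z⁻¹ := by
    intro y hy
    refine Fintype.sum_equiv ((Equiv.mulRight f).trans ((Equiv.mulLeft y⁻¹).trans
      (Equiv.mulRight y))) _ _ fun x => ?_
    have e1 : ((Equiv.mulRight f).trans ((Equiv.mulLeft y⁻¹).trans (Equiv.mulRight y))) x =
      y⁻¹ * (x * f) * y := rfl
    rw [e1]
    by_cases hz : y⁻¹ * (x * f) * y * v⁻¹ ∈ H
    · have hx : x ∈ W := by
        have h1 := hmem _ hz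
        have h2 : x = y * (y⁻¹ * (x * f) * y * f⁻¹) * (f * y⁻¹ * f⁻¹) := by group
        rw [h2]
        exact mul_mem (mul_mem hy h1) (hf _ (inv_mem hy))
      have hxf : x * f ∈ adjoin W f := mul_mem (hWle hx) hfmem
      rw [if_pos hx, if_pos ⟨hy, hz⟩, if_pos hz]
      congr 1
      rw [extZero_of_mem _ hxf, hX.bar_apply bar hbar]
      have hi : (y⁻¹ * (x * f) * y)⁻¹ ∈ adjoin W f :=
        inv_mem (mul_mem (mul_mem (inv_mem (hWle hy)) hxf) (hWle hy))
      rw [extZero_of_mem _ hi, ← hX.isClassFn.conj' _ ⟨y, hWle hy⟩]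
      congr 1
      refine Subtype.ext ?_
      simp [mul_assoc]
    · rw [if_neg hz, zero_mul]
      split_ifs with h1 h2
      · exact absurd h2.2 hz
      · rw [zero_mul]
      · rfl
  have hm : mult bar W H f v E' X' = (Nat.card W : K)⁻¹ * ∑ x : Γ, if x ∈ W then
      (Nat.card H : K)⁻¹ * (∑ y : Γ, if y ∈ W ∧ y⁻¹ * (x * f) * y * v⁻¹ ∈ H then
        extZero E' (y⁻¹ * (x * f) * y) else 0) * bar (extZero X' (x * f)) else 0 := by
    rw [mult, cosetInner]
    unfold cosetInd
    congr!
  rw [hm]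
  have h1 : ∀ x : Γ, (if x ∈ W then (Nat.card H : K)⁻¹ * (∑ y : Γ, if y ∈ W ∧
      y⁻¹ * (x * f) * y * v⁻¹ ∈ H then extZero E' (y⁻¹ * (x * f) * y) else 0) *
      bar (extZero X' (x * f)) else 0) = ∑ y : Γ, (Nat.card H : K)⁻¹ * (if x ∈ W then
      (if y ∈ W ∧ y⁻¹ * (x * f) * y * v⁻¹ ∈ H then extZero E' (y⁻¹ * (x * f) * y) else 0) *
        bar (extZero X' (x * f)) else 0) := by
    intro x
    split_ifs
    · rw [mul_assoc, Finset.sum_mul, Finset.mul_sum]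
    · simp
  simp only [h1]
  rw [Finset.sum_comm]
  simp only [← Finset.mul_sum]
  have h2 : ∀ y : Γ, ∑ x : Γ, (if x ∈ W then
      (if y ∈ W ∧ y⁻¹ * (x * f) * y * v⁻¹ ∈ H then extZero E' (y⁻¹ * (x * f) * y) else 0) *
        bar (extZero X' (x * f)) else 0) =
      (if y ∈ W then 1 else 0) *
        ∑ z : Γ, (if z * v⁻¹ ∈ H then extZero E' z else 0) * extZero X' z⁻¹ := by
    intro y
    by_cases hy : y ∈ W
    · rw [if_pos hy, one_mul, key y hy]
    · rw [if_neg hy, zero_mul]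
      refine Finset.sum_eq_zero fun x _ => ?_
      rw [if_neg (fun h : y ∈ W ∧ _ => hy h.1), zero_mul, ite_self]
  simp only [h2]
  rw [← Finset.sum_mul, ← card_subgroup_eq_sum, mul_left_comm,
    inv_mul_cancel_left₀ h0]

theorem extZero_adjoin_of_mem {S : Subgroup Γ} {f : Γ} {χ : S → K} {χ' : adjoin S f → K}
    (h : IsExtension S f χ χ') {x : Γ} (hx : x ∈ S) : extZero χ' x = χ ⟨x, hx⟩ := by
  rw [extZero_of_mem χ' ((le_sup_left : S ≤ adjoin S f) hx)]
  exact h.2 ⟨x, hx⟩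

theorem adjoin_one (S : Subgroup Γ) : adjoin S 1 = S := by
  rw [adjoin, Subgroup.zpowers_one_eq_bot, sup_bot_eq]

theorem exists_extension_one {S : Subgroup Γ} {χ : S → K} (h : IsIrrChar χ) :
    ∃ χ' : adjoin S 1 → K, IsExtension S 1 χ χ' := by
  refine ⟨χ ∘ Subgroup.inclusion (adjoin_one S).le, h.comp_surjective _ fun x => ?_, fun x => rfl⟩
  exact ⟨⟨x, (adjoin_one S).ge x.2⟩, rfl⟩

end Mult

/-! ### Partial sums over a group as scalar products with class functions -/

section Represents

variable {K : Type*} [Field K] [IsAlgClosed K] [CharZero K]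
variable {G H : Type} [Group G] [Fintype G] [Group H] [Fintype H]

/-- The functional `g ↦ c⁻¹ ∑ a(x) g(x⁻¹)` on class functions is the scalar product with `u`. -/
def Represents (c : K) (a u : G → K) : Prop :=
  ∀ g : G → K, IsClassFn g → c⁻¹ * ∑ x, a x * g x⁻¹ = cinner u g

theorem represents_indFn {S : Subgroup G} (φ : S → K) :
    Represents (Nat.card S : K) (extZero φ) (indFn φ) := by
  classical
  intro g hg
  rw [cinner_indFn φ hg, cinner_eq]
  congr 1
  exact (sum_subgroup_eq φ fun x => g x⁻¹).symm

/-- 1 - ε is twice the indicator function of the coset, and the factor 2 is the index. -/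
theorem represents_coset {ε : G →* K} {N : Subgroup G} (hε : ∀ x, ε x = 1 ∨ ε x = -1)
    (hN : ∀ x, x ∈ N ↔ ε x = 1) {t : G} (ht : t ∉ N) (Φ : G → K)
    [DecidablePred fun x => x ∈ N] :
    Represents (Nat.card N : K) (fun x => if x ∈ N then 0 else Φ x)
      (Φ - fun x => ε x * Φ x) := by
  intro g hg
  rw [cinner_eq, ← two_mul_card_ker hε hN ht, mul_inv, mul_comm (2 : K)⁻¹, mul_assoc]
  congr 1
  rw [Finset.mul_sum]
  refine Finset.sum_congr rfl fun x _ => ?_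
  rcases hε x with h | h
  · simp [(hN x).2 h, h]
  · have h1 : x ∉ N := fun h' => by
      rw [hN, h] at h'
      norm_num at h'
    simp only [h1, if_false, Pi.sub_apply, h]
    ring

/-- The functional on the product is evaluated one variable at a time; a class function on the
product stays one when a variable is fixed or integrated out. -/
theorem Represents.prod {c d : K} {a u : G → K} {b w : H → K} (h : Represents c a u)
    (h' : Represents d b w) : ∀ F : G × H → K, IsClassFn F →
      (c * d)⁻¹ * ∑ p : G × H, (a p.1 * b p.2) * F p⁻¹ =
        cinner (fun p : G × H => u p.1 * w p.2) F := by
  intro F hF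
  rw [cinner_comm, cinner_prod_iterate, cinner_comm, ← h' _ (hF.cinner_left u),
    Fintype.sum_prod_type_right, mul_inv, mul_comm c⁻¹, mul_assoc]
  congr 1
  rw [Finset.mul_sum]
  refine Finset.sum_congr rfl fun y _ => ?_
  rw [cinner_comm, ← h _ (hF.left y⁻¹), Finset.mul_sum, Finset.mul_sum, Finset.mul_sum]
  refine Finset.sum_congr rfl fun x _ => ?_
  rw [Prod.inv_mk]
  ring

end Represents

/-! ### Block diagonal elements and sign changes -/

section Block

variable {K : Type*} [Field K] [IsAlgClosed K] [CharZero K]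
variable {α β : Type} [Fintype α] [Fintype β]

theorem blockHom_injective : Function.Injective (blockHom α β) := by
  intro p q h
  have h1 : Sum.elim p.1.left p.2.left = Sum.elim q.1.left q.2.left :=
    congrArg SemidirectProduct.left h
  have h2 : Equiv.sumCongr p.1.right p.2.right = Equiv.sumCongr q.1.right q.2.right :=
    congrArg SemidirectProduct.right h
  have h3 : (p.1.right, p.2.right) = (q.1.right, q.2.right) :=
    Equiv.Perm.sumCongrHom_injective h2
  refine Prod.ext (SemidirectProduct.ext ?_ ?_) (SemidirectProduct.ext ?_ ?_)
  · exact funext fun i => congrFun h1 (Sum.inl i)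
  · exact congrArg Prod.fst h3
  · exact funext fun i => congrFun h1 (Sum.inr i)
  · exact congrArg Prod.snd h3

theorem blockHom_mem_blockSub {U : Subgroup (SignedPerm α)} {V : Subgroup (SignedPerm β)}
    {p : SignedPerm α × SignedPerm β} : blockHom α β p ∈ blockSub U V ↔ p.1 ∈ U ∧ p.2 ∈ V := by
  rw [blockSub, Subgroup.mem_map_iff_mem blockHom_injective, Subgroup.mem_prod]

theorem blockSub_le_range (U : Subgroup (SignedPerm α)) (V : Subgroup (SignedPerm β)) :
    blockSub U V ≤ (blockHom α β).range := Subgroup.map_le_range _ _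

theorem card_blockSub (U : Subgroup (SignedPerm α)) (V : Subgroup (SignedPerm β)) :
    Nat.card (blockSub U V) = Nat.card U * Nat.card V := by
  rw [← Nat.card_prod, blockSub, ← Nat.card_congr (Subgroup.prodEquiv U V).toEquiv]
  exact (Nat.card_congr ((U.prod V).equivMapOfInjective _ blockHom_injective).toEquiv).symm

/-- The multiplicity as a sum over block diagonal elements. -/
theorem mult_eq_block (bar : K ≃+* K)
    (hbar : ∀ (ω : K) (k : ℕ), 0 < k → ω ^ k = 1 → bar ω = ω⁻¹)
    {W H : Subgroup (SignedPerm (α ⊕ β))} {f v : SignedPerm (α ⊕ β)} (hH : H ≤ W)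
    (hv : v * f⁻¹ ∈ W) (hf : ∀ w ∈ W, f * w * f⁻¹ ∈ W) (hHr : H ≤ (blockHom α β).range)
    (hvr : v ∈ (blockHom α β).range) (E' : adjoin H v → K) {X' : adjoin W f → K}
    (hX : IsIrrChar X') [DecidablePred fun z => z * v⁻¹ ∈ H] :
    mult bar W H f v E' X' = (Nat.card H : K)⁻¹ * ∑ p : SignedPerm α × SignedPerm β,
      (if blockHom α β p * v⁻¹ ∈ H then extZero E' (blockHom α β p) else 0) *
        extZero X' (blockHom α β p⁻¹) := by
  classical
  rw [mult_eq bar hbar hH hv hf E' hX]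
  congr 1
  symm
  refine Finset.sum_of_injOn (blockHom α β) blockHom_injective.injOn (fun _ _ => Finset.mem_univ _)
    (fun z _ hz => ?_) (fun p _ => by rw [map_inv])
  rw [if_neg, zero_mul]
  intro h
  obtain ⟨p, hp⟩ : z ∈ (blockHom α β).range := by
    have := mul_mem (hHr h) hvr
    simpa using this
  exact hz ⟨p, Finset.mem_coe.2 (Finset.mem_univ _), hp⟩

theorem signFlip_left {ι : Type} (i j : ι) [Decidable (j = i)] :
    (signFlip i).left j = if j = i then -1 else 1 := by
  by_cases h : j = i
  · subst h
    simp [signFlip]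
  · simp [signFlip, h]

theorem signFlip_notMem_evenSub {ι : Type} [Fintype ι] (i : ι) : signFlip i ∉ evenSub ι := by
  classical
  intro h
  have h1 : signProd ι (signFlip i) = 1 := h
  have h2 : signProd ι (signFlip i) = -1 := by
    change ∏ j, (signFlip i).left j = -1
    simp only [signFlip_left]
    rw [Finset.prod_ite_eq' Finset.univ i, if_pos (Finset.mem_univ i)]
  rw [h2] at h1
  exact absurd h1 (by decide)

theorem blockHom_signFlip_inl (i : α) :
    blockHom α β (signFlip i, 1) = signFlip (Sum.inl i) := by
  classical
  refine SemidirectProduct.ext ?_ ?_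
  · ext1 j
    rcases j with j | j
    · change (signFlip i).left j = _
      simp [signFlip_left]
    · change 1 = _
      simp [signFlip_left]
  · ext j
    rcases j with j | j <;> rfl

theorem blockHom_signFlip_inr (i : β) :
    blockHom α β (1, signFlip i) = signFlip (Sum.inr i) := by
  classical
  refine SemidirectProduct.ext ?_ ?_
  · ext1 j
    rcases j with j | j
    · change 1 = _
      simp [signFlip_left]
    · change (signFlip i).left j = _
      simp [signFlip_left]
  · ext j
    rcases j with j | j <;> rfl

theorem blockHom_mem_evenSub {p : SignedPerm α × SignedPerm β} :
    blockHom α β p ∈ evenSub (α ⊕ β) ↔ (p.1 ∈ evenSub α ↔ p.2 ∈ evenSub β) := by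
  -- The parity of the number of signs is read off from a character; the field is auxiliary.
  have h := signProdHom_blockHom (K := AlgebraicClosure ℚ) p
  have e1 := mem_evenSub_iff (K := AlgebraicClosure ℚ) p.1
  have e2 := mem_evenSub_iff (K := AlgebraicClosure ℚ) p.2
  rw [mem_evenSub_iff (K := AlgebraicClosure ℚ), h, e1, e2]
  rcases signProdHom_eq_or (K := AlgebraicClosure ℚ) p.1 with h1 | h1 <;>
    rcases signProdHom_eq_or (K := AlgebraicClosure ℚ) p.2 with h2 | h2 <;>
    rw [h1, h2] <;> norm_num

end Block

/-! ### Comparison of constituents with the ⊙-symbol -/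

section Dominance

variable {K : Type*} [Field K] [IsAlgClosed K] [CharZero K]
variable {α β : Type} [Fintype α] [Fintype β]
variable {A₁ A₂ B₁ B₂ C₁ C₂ : Finset ℕ}

/-- The beta-set with `s` elements giving the same partition as `A`. -/
def resize (s : ℕ) (A : Finset ℕ) : Finset ℕ := betaOf s (pt A)

theorem card_resize (s : ℕ) (A : Finset ℕ) : (resize s A).card = s := card_betaOf s (pt_antitone A)

theorem pt_resize {s : ℕ} {A : Finset ℕ} (h : A.card ≤ s) : pt (resize s A) = pt A :=
  pt_betaOf (pt_antitone A) fun _ hi => pt_of_le (h.trans hi)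

theorem isLabel_odot (hA : IsLabel α A₁ A₂) (hB : IsLabel β B₁ B₂) (hAB : A₁.card = B₁.card) :
    IsLabel (α ⊕ β) (odot A₁ B₁) (odot A₂ B₂) := by
  have h2 : A₂.card = B₂.card := by rw [← hA.1, hAB, hB.1]
  refine ⟨by rw [card_odot hAB, card_odot h2, hA.1], ?_⟩
  rw [rank_odot hAB, rank_odot h2, Fintype.card_sum, ← hA.2, ← hB.2]
  omega

theorem blockMult_odot (hA : IsLabel α A₁ A₂) (hB : IsLabel β B₁ B₂) (hAB : A₁.card = B₁.card) :
    blockMult K α β A₁ A₂ B₁ B₂ (odot A₁ B₁) (odot A₂ B₂) = 1 := by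
  have h2 : A₂.card = B₂.card := by rw [← hA.1, hAB, hB.1]
  exact blockMult_eq_one hA.2 hB.2 (rank_odot hAB) (rank_odot h2) (pt_odot hAB) (pt_odot h2)

/-- A constituent of the induced character has larger `b`-value than the symbol `(A₁ ⊙ B₁ /
A₂ ⊙ B₂)`. -/
theorem blockMult_dom (T : Series) (t : ℕ) (hA : IsLabel α A₁ A₂) (hB : IsLabel β B₁ B₂)
    (hAB : A₁.card = B₁.card) (hC : IsLabel (α ⊕ β) C₁ C₂) {s : ℕ} (hs : A₁.card ≤ s)
    (hs' : C₁.card ≤ s) (h : blockMult K α β A₁ A₂ B₁ B₂ C₁ C₂ ≠ 0) :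
    bSymbol T t (resize s (odot A₁ B₁)) (resize s (odot A₂ B₂)) ≤
        bSymbol T t (resize s C₁) (resize s C₂) ∧
      (bSymbol T t (resize s (odot A₁ B₁)) (resize s (odot A₂ B₂)) =
        bSymbol T t (resize s C₁) (resize s C₂) →
          pt C₁ = pt (odot A₁ B₁) ∧ pt C₂ = pt (odot A₂ B₂)) := by
  have h2 : A₂.card = B₂.card := by rw [← hA.1, hAB, hB.1]
  have e1 : pt (resize s (odot A₁ B₁)) = pt (odot A₁ B₁) :=
    pt_resize (by rw [card_odot hAB]; exact hs)
  have e2 : pt (resize s (odot A₂ B₂)) = pt (odot A₂ B₂) :=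
    pt_resize (by rw [card_odot h2, ← hA.1]; exact hs)
  have e3 : pt (resize s C₁) = pt C₁ := pt_resize hs'
  have e4 : pt (resize s C₂) = pt C₂ := pt_resize (hC.1 ▸ hs')
  obtain ⟨r1, r2⟩ := rank_eq_of_blockMult hA.2 hB.2 hC.2 h
  have hd := top_le_of_blockMult hA.2 hB.2 hC.2 h
  obtain ⟨k1, k2⟩ := bSymbol_le T t (card_resize s C₁) (card_resize s C₂)
    (card_resize s (odot A₁ B₁)) (card_resize s (odot A₂ B₂))
    (fun k => by rw [e1, e3, pt_odot hAB]; exact (hd k).1)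
    (fun k => by rw [e2, e4, pt_odot h2]; exact (hd k).2)
    (by rw [rank_eq_of_pt_eq e1, rank_eq_of_pt_eq e3, rank_odot hAB, r1])
    (by rw [rank_eq_of_pt_eq e2, rank_eq_of_pt_eq e4, rank_odot h2, r2])
  refine ⟨k1, fun h => ?_⟩
  obtain ⟨k3, k4⟩ := k2 h
  exact ⟨by rw [← e1, ← e3, k3], by rw [← e2, ← e4, k4]⟩

/-- By shift invariance the enlargement to a common size may be dropped here. -/
theorem blockMult_dom_D (hA : IsLabel α A₁ A₂) (hB : IsLabel β B₁ B₂)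
    (hAB : A₁.card = B₁.card) (hC : IsLabel (α ⊕ β) C₁ C₂)
    (h : blockMult K α β A₁ A₂ B₁ B₂ C₁ C₂ ≠ 0) :
    bSymbol .D 0 (odot A₁ B₁) (odot A₂ B₂) ≤ bSymbol .D 0 C₁ C₂ ∧
      (bSymbol .D 0 (odot A₁ B₁) (odot A₂ B₂) = bSymbol .D 0 C₁ C₂ →
          pt C₁ = pt (odot A₁ B₁) ∧ pt C₂ = pt (odot A₂ B₂)) := by
  have h2 : A₂.card = B₂.card := by rw [← hA.1, hAB, hB.1]
  have key : ∀ {s : ℕ} {D₁ D₂ : Finset ℕ}, D₁.card = D₂.card → D₁.card ≤ s →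
      bSymbol .D 0 (resize s D₁) (resize s D₂) = bSymbol .D 0 D₁ D₂ := fun hc hs =>
    bSymbol_D_congr (by rw [card_resize, card_resize]) hc (pt_resize hs) (pt_resize (hc ▸ hs))
  have h1 := blockMult_dom .D 0 hA hB hAB hC (le_max_left A₁.card C₁.card)
    (le_max_right A₁.card C₁.card) h
  rwa [key (by rw [card_odot hAB, card_odot h2, hA.1])
    (by rw [card_odot hAB]; exact le_max_left _ _), key hC.1 (le_max_right _ _)] at h1

theorem odot_left_cancel (hA : A₁.card = A₂.card) (hAB : A₁.card = B₁.card)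
    (h : pt (odot A₁ B₁) = pt (odot A₂ B₁)) : A₁ = A₂ := by
  rw [pt_odot hAB, pt_odot (hA ▸ hAB)] at h
  exact eq_of_pt_eq hA (add_right_cancel h)

theorem odot_right_cancel (hB : B₁.card = B₂.card) (hAB : A₁.card = B₁.card)
    (h : pt (odot A₁ B₁) = pt (odot A₁ B₂)) : B₁ = B₂ := by
  rw [pt_odot hAB, pt_odot (hAB.trans hB)] at h
  exact eq_of_pt_eq hB (add_left_cancel h)

end Dominance

/-! ### Minimal characters for a given linear combination of multiplicities -/

section Minimal

variable {K : Type*} [Field K] [IsAlgClosed K] [CharZero K]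
variable {ι : Type} [Fintype ι]

/-- `X` has minimal `b`-value among the irreducible characters with property `P` for which `m` does
not vanish. -/
structure MinFor (T : Series) (t : ℕ) {U : Subgroup (SignedPerm ι)} (P : (U → K) → Prop)
    (m : (U → K) → K) (X : U → K) : Prop where
  irr : IsIrrChar X
  stable : P X
  occurs : m X ≠ 0
  minimal : ∀ Y : U → K, IsIrrChar Y → P Y → m Y ≠ 0 → ∀ C₁ C₂ D₁ D₂, HasLabel U X C₁ C₂ →
    HasLabel U Y D₁ D₂ → bSymbol T t C₁ C₂ ≤ bSymbol T t D₁ D₂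

variable {α β : Type} [Fintype α] [Fintype β] {A₁ A₂ B₁ B₂ : Finset ℕ}

/-- Minimality refers to all labels of both characters, hence may be used at labels with a common
number of entries. For types `B` and `C` this replaces shift invariance of the b-function. -/
theorem MinFor.le_resize {T : Series} {t : ℕ} {U : Subgroup (SignedPerm ι)} {P : (U → K) → Prop}
    {m : (U → K) → K} {X Y : U → K} (h : MinFor T t P m X) {C₁ C₂ D₁ D₂ : Finset ℕ}
    (hX : HasLabel U X C₁ C₂) (hY : HasLabel U Y D₁ D₂) (hP : P Y) (hm : m Y ≠ 0) {s : ℕ}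
    (hs : C₁.card ≤ s) (hs' : D₁.card ≤ s) :
    bSymbol T t (resize s C₁) (resize s C₂) ≤ bSymbol T t (resize s D₁) (resize s D₂) := by
  have hc : ∀ C D, (resize s C).card = (resize s D).card := fun C D => by
    rw [card_resize, card_resize]
  exact h.minimal Y (hasLabel_iff.1 hY).1 hP hm _ _ _ _
    (hX.of_pt_eq (hc _ _) (pt_resize hs).symm (pt_resize (hX.isLabel.1 ▸ hs)).symm)
    (hY.of_pt_eq (hc _ _) (pt_resize hs').symm (pt_resize (hY.isLabel.1 ▸ hs')).symm)

theorem exists_hasLabel_top_of_isLabel {C₁ C₂ : Finset ℕ} (h : IsLabel ι C₁ C₂) :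
    ∃ X : (⊤ : Subgroup (SignedPerm ι)) → K, HasLabel ⊤ X C₁ C₂ :=
  ⟨_, hasLabel_top_iff.2 ⟨h, rfl⟩⟩

theorem HasLabel.pt_eq_top {X : (⊤ : Subgroup (SignedPerm ι)) → K} {C₁ C₂ D₁ D₂ : Finset ℕ}
    (hC : HasLabel ⊤ X C₁ C₂) (hD : HasLabel ⊤ X D₁ D₂) : pt C₁ = pt D₁ ∧ pt C₂ = pt D₂ := by
  obtain ⟨h1, h2⟩ := hasLabel_top_iff.1 hC
  obtain ⟨h3, h4⟩ := hasLabel_top_iff.1 hD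
  refine (symbolFun_eq_iff (K := K) h1.2 h3.2).1 (funext fun x => ?_)
  exact congrFun (h2.symm.trans h4) ⟨x, Subgroup.mem_top x⟩

/-- Minimal characters of the group of type `B`. -/
theorem MinFor.top {T : Series} {t : ℕ} (hA : IsLabel α A₁ A₂) (hB : IsLabel β B₁ B₂)
    (hAB : A₁.card = B₁.card) {c₀ c₁ : K} (h0 : c₀ ≠ 0) (h1 : c₁ ≠ 0 → A₁ ≠ A₂)
    {m : ((⊤ : Subgroup (SignedPerm (α ⊕ β))) → K) → K}
    (hm : ∀ X C₁ C₂, HasLabel ⊤ X C₁ C₂ → m X = c₀ * blockMult K α β A₁ A₂ B₁ B₂ C₁ C₂ +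
      c₁ * blockMult K α β A₂ A₁ B₁ B₂ C₁ C₂) {X : (⊤ : Subgroup (SignedPerm (α ⊕ β))) → K}
    (hX : MinFor T t (fun _ => True) m X) :
    (HasLabel ⊤ X (odot A₁ B₁) (odot A₂ B₂) ∧ m X = c₀) ∨
      (c₁ ≠ 0 ∧ HasLabel ⊤ X (odot A₂ B₁) (odot A₁ B₂) ∧ m X = c₁) := by
  have hAB' : A₂.card = B₁.card := hA.1 ▸ hAB
  have hAB2 : A₂.card = B₂.card := hAB'.trans hB.1
  have hAB3 : A₁.card = B₂.card := hAB.trans hB.1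
  have hL := isLabel_odot hA hB hAB
  have hL' := isLabel_odot hA.swap hB hAB'
  obtain ⟨C₁, C₂, hC⟩ := exists_hasLabel_top hX.irr
  set s := max A₁.card C₁.card with hs
  have s1 : A₁.card ≤ s := le_max_left _ _
  have s1' : A₂.card ≤ s := hA.1 ▸ s1
  have s2 : C₁.card ≤ s := le_max_right _ _
  have s3 : (odot A₁ B₁).card ≤ s := by rwa [card_odot hAB]
  have s3' : (odot A₂ B₁).card ≤ s := by rwa [card_odot hAB']
  obtain ⟨Y, hY⟩ := exists_hasLabel_top_of_isLabel (K := K) hL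
  obtain ⟨Y', hY'⟩ := exists_hasLabel_top_of_isLabel (K := K) hL'
  -- values at the two symbols
  have v1 : (c₁ ≠ 0 → bSymbol T t (resize s (odot A₁ B₁)) (resize s (odot A₂ B₂)) ≤
      bSymbol T t (resize s (odot A₂ B₁)) (resize s (odot A₁ B₂))) →
      ∀ Y, HasLabel ⊤ Y (odot A₁ B₁) (odot A₂ B₂) → m Y = c₀ := by
    intro hle Y hY
    rw [hm Y _ _ hY, blockMult_odot hA hB hAB, mul_one]
    by_cases hc : c₁ = 0
    · rw [hc, zero_mul, add_zero]
    -- The constituents of the second term have b at least that of Λ', with equality only at Λ'.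
    -- Since b(Λ) ≤ b(Λ'), a non-zero value would give Λ = Λ' and hence A₁ = A₂.
    · have : blockMult K α β A₂ A₁ B₁ B₂ (odot A₁ B₁) (odot A₂ B₂) = 0 := by
        by_contra hne
        have h2 := blockMult_dom T t hA.swap hB hAB' hL s1' s3 hne
        exact h1 hc (odot_left_cancel hA.1 hAB (h2.2 (le_antisymm h2.1 (hle hc))).1)
      rw [this, mul_zero, add_zero]
  have v2 : c₁ ≠ 0 → bSymbol T t (resize s (odot A₂ B₁)) (resize s (odot A₁ B₂)) ≤
      bSymbol T t (resize s (odot A₁ B₁)) (resize s (odot A₂ B₂)) →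
      ∀ Y, HasLabel ⊤ Y (odot A₂ B₁) (odot A₁ B₂) → m Y = c₁ := by
    intro hc hle Y hY
    rw [hm Y _ _ hY, blockMult_odot hA.swap hB hAB', mul_one]
    have : blockMult K α β A₁ A₂ B₁ B₂ (odot A₂ B₁) (odot A₁ B₂) = 0 := by
      by_contra hne
      have h2 := blockMult_dom T t hA hB hAB hL' s1 s3' hne
      exact h1 hc (odot_left_cancel hA.1.symm hAB' (h2.2 (le_antisymm h2.1 hle)).1).symm
    rw [this, mul_zero, zero_add]
  have hmX := hX.occurs
  rw [hm X _ _ hC] at hmX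
  -- One of the two terms is non-zero at the label of X, so its b-value is bounded below by that of
  -- the corresponding symbol.
  have hdom : (bSymbol T t (resize s (odot A₁ B₁)) (resize s (odot A₂ B₂)) ≤
        bSymbol T t (resize s C₁) (resize s C₂) ∧
      (bSymbol T t (resize s (odot A₁ B₁)) (resize s (odot A₂ B₂)) =
        bSymbol T t (resize s C₁) (resize s C₂) → HasLabel ⊤ X (odot A₁ B₁) (odot A₂ B₂))) ∨
      (c₁ ≠ 0 ∧ bSymbol T t (resize s (odot A₂ B₁)) (resize s (odot A₁ B₂)) ≤
        bSymbol T t (resize s C₁) (resize s C₂) ∧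
      (bSymbol T t (resize s (odot A₂ B₁)) (resize s (odot A₁ B₂)) =
        bSymbol T t (resize s C₁) (resize s C₂) → HasLabel ⊤ X (odot A₂ B₁) (odot A₁ B₂))) := by
    by_cases h2 : blockMult K α β A₁ A₂ B₁ B₂ C₁ C₂ = 0
    · rw [h2, mul_zero, zero_add] at hmX
      have h3 := blockMult_dom T t hA.swap hB hAB' hC.isLabel s1' s2 (right_ne_zero_of_mul hmX)
      exact Or.inr ⟨left_ne_zero_of_mul hmX, h3.1,
        fun h => hC.of_pt_eq hL'.1 (h3.2 h).1 (h3.2 h).2⟩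
    · have h3 := blockMult_dom T t hA hB hAB hC.isLabel s1 s2 h2
      exact Or.inl ⟨h3.1, fun h => hC.of_pt_eq hL.1 (h3.2 h).1 (h3.2 h).2⟩
  -- Either Λ' does not count or b(Λ) ≤ b(Λ'): then Λ itself occurs and bounds b(X) from above.
  -- Otherwise Λ' takes this role. If the values are equal, both symbols are possible.
  by_cases hcase : c₁ ≠ 0 → bSymbol T t (resize s (odot A₁ B₁)) (resize s (odot A₂ B₂)) ≤
      bSymbol T t (resize s (odot A₂ B₁)) (resize s (odot A₁ B₂))
  · have hle := hX.le_resize hC hY trivial (by rw [v1 hcase Y hY]; exact h0) s2 s3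
    rcases hdom with ⟨h2, h3⟩ | ⟨hc, h2, h3⟩
    · have h4 := h3 (le_antisymm h2 hle)
      exact Or.inl ⟨h4, v1 hcase X h4⟩
    · have h5 := hcase hc
      have h4 := h3 (le_antisymm h2 (hle.trans h5))
      exact Or.inr ⟨hc, h4, v2 hc (h2.trans hle) X h4⟩
  · push Not at hcase
    obtain ⟨hc, hlt⟩ := hcase
    have hle := hX.le_resize hC hY' trivial (by rw [v2 hc hlt.le Y' hY']; exact hc) s2 s3'
    rcases hdom with ⟨h2, h3⟩ | ⟨-, h2, h3⟩
    · omega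
    · have h4 := h3 (le_antisymm h2 hle)
      exact Or.inr ⟨hc, h4, v2 hc hlt.le X h4⟩

/-! #### Type `D` -/

variable (K α β) in
/-- A linear combination of the multiplicities of the four twists of a character. -/
def twistSum (A₁ A₂ B₁ B₂ : Finset ℕ) (c₀₀ c₁₀ c₀₁ c₁₁ : K) (C₁ C₂ : Finset ℕ) : K :=
  c₀₀ * blockMult K α β A₁ A₂ B₁ B₂ C₁ C₂ + c₁₀ * blockMult K α β A₂ A₁ B₁ B₂ C₁ C₂ +
    c₀₁ * blockMult K α β A₁ A₂ B₂ B₁ C₁ C₂ + c₁₁ * blockMult K α β A₂ A₁ B₂ B₁ C₁ C₂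

/-- Replacing (A₁/A₂) by (A₂/A₁) permutes the coefficients and exchanges Λ with Λ', so statements on
Λ' follow from those on Λ. -/
theorem twistSum_swap_left (c₀₀ c₁₀ c₀₁ c₁₁ : K) (C₁ C₂ : Finset ℕ) :
    twistSum K α β A₂ A₁ B₁ B₂ c₁₀ c₀₀ c₁₁ c₀₁ C₁ C₂ =
      twistSum K α β A₁ A₂ B₁ B₂ c₀₀ c₁₀ c₀₁ c₁₁ C₁ C₂ := by
  rw [twistSum, twistSum]
  ring

variable {c₀₀ c₁₀ c₀₁ c₁₁ : K}

/-- The value of the linear combination at `(A₁ ⊙ B₁ / A₂ ⊙ B₂)`. -/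
theorem twistSum_odot (hA : IsLabel α A₁ A₂) (hB : IsLabel β B₁ B₂) (hAB : A₁.card = B₁.card)
    (h1 : c₁₀ ≠ 0 ∨ c₀₁ ≠ 0 → bSymbol .D 0 (odot A₁ B₁) (odot A₂ B₂) ≤
      bSymbol .D 0 (odot A₂ B₁) (odot A₁ B₂))
    (h2 : c₁₀ ≠ 0 → A₁ ≠ A₂) (h3 : c₀₁ ≠ 0 → B₁ ≠ B₂) [Decidable (odot A₁ B₁ = odot A₂ B₂)] :
    twistSum K α β A₁ A₂ B₁ B₂ c₀₀ c₁₀ c₀₁ c₁₁ (odot A₁ B₁) (odot A₂ B₂) =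
      c₀₀ + if odot A₁ B₁ = odot A₂ B₂ then c₁₁ else 0 := by
  have hAB' : A₂.card = B₁.card := hA.1 ▸ hAB
  have hAB2 : A₂.card = B₂.card := hAB'.trans hB.1
  have hAB3 : A₁.card = B₂.card := hAB.trans hB.1
  have hL := isLabel_odot hA hB hAB
  -- This twist belongs to Λ'. At Λ it could be non-zero only for equal b-values, and then the
  -- symbols would coincide and A would be degenerate.
  have e1 : c₁₀ * blockMult K α β A₂ A₁ B₁ B₂ (odot A₁ B₁) (odot A₂ B₂) = 0 := by
    by_contra hne
    have hc := left_ne_zero_of_mul hne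
    have h4 := blockMult_dom_D hA.swap hB hAB' hL (right_ne_zero_of_mul hne)
    exact h2 hc (odot_left_cancel hA.1 hAB (h4.2 (le_antisymm h4.1 (h1 (Or.inl hc)))).1)
  have e2 : c₀₁ * blockMult K α β A₁ A₂ B₂ B₁ (odot A₁ B₁) (odot A₂ B₂) = 0 := by
    by_contra hne
    have hc := left_ne_zero_of_mul hne
    have h4 := blockMult_dom_D hA hB.swap hAB3 hL (right_ne_zero_of_mul hne)
    rw [bSymbol_D_swap (odot A₁ B₂)] at h4
    exact h3 hc (odot_right_cancel hB.1 hAB (h4.2 (le_antisymm h4.1 (h1 (Or.inr hc)))).1)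
  -- Exchanging the rows of both A and B exchanges the rows of Λ. The two orders have the same
  -- b-value, so this twist vanishes at Λ unless its rows are equal.
  have e3 : blockMult K α β A₂ A₁ B₂ B₁ (odot A₁ B₁) (odot A₂ B₂) =
      if odot A₁ B₁ = odot A₂ B₂ then 1 else 0 := by
    split_ifs with h
    · have := blockMult_odot (K := K) hA.swap hB.swap hAB2
      rwa [h, ← h, h] at this ⊢
    · by_contra hne
      have h4 := blockMult_dom_D hA.swap hB.swap hAB2 hL hne
      rw [bSymbol_D_swap (odot A₂ B₂)] at h4
      exact h (eq_of_pt_eq hL.1 (h4.2 rfl).1)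
  rw [twistSum, blockMult_odot hA hB hAB, e1, e2, e3]
  split_ifs <;> ring

/-- Characters occurring with non-zero multiplicity. -/
theorem twistSum_dom (hA : IsLabel α A₁ A₂) (hB : IsLabel β B₁ B₂) (hAB : A₁.card = B₁.card)
    {X : evenSub (α ⊕ β) → K} {C₁ C₂ : Finset ℕ} (hC : HasLabel (evenSub (α ⊕ β)) X C₁ C₂)
    (h : twistSum K α β A₁ A₂ B₁ B₂ c₀₀ c₁₀ c₀₁ c₁₁ C₁ C₂ ≠ 0) :
    (bSymbol .D 0 (odot A₁ B₁) (odot A₂ B₂) ≤ bSymbol .D 0 C₁ C₂ ∧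
      (bSymbol .D 0 (odot A₁ B₁) (odot A₂ B₂) = bSymbol .D 0 C₁ C₂ →
        HasLabel (evenSub (α ⊕ β)) X (odot A₁ B₁) (odot A₂ B₂))) ∨
    ((c₁₀ ≠ 0 ∨ c₀₁ ≠ 0) ∧ bSymbol .D 0 (odot A₂ B₁) (odot A₁ B₂) ≤ bSymbol .D 0 C₁ C₂ ∧
      (bSymbol .D 0 (odot A₂ B₁) (odot A₁ B₂) = bSymbol .D 0 C₁ C₂ →
        HasLabel (evenSub (α ⊕ β)) X (odot A₂ B₁) (odot A₁ B₂))) := by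
  have hAB' : A₂.card = B₁.card := hA.1 ▸ hAB
  have hAB2 : A₂.card = B₂.card := hAB'.trans hB.1
  have hAB3 : A₁.card = B₂.card := hAB.trans hB.1
  have hL := isLabel_odot hA hB hAB
  have hL' := isLabel_odot hA.swap hB hAB'
  by_cases h1 : blockMult K α β A₁ A₂ B₁ B₂ C₁ C₂ = 0
  swap
  · have h5 := blockMult_dom_D hA hB hAB hC.isLabel h1
    exact Or.inl ⟨h5.1, fun h => hC.of_pt_eq hL.1 (h5.2 h).1 (h5.2 h).2⟩
  by_cases h2 : blockMult K α β A₂ A₁ B₂ B₁ C₁ C₂ = 0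
  swap
  · have h5 := blockMult_dom_D hA.swap hB.swap hAB2 hC.isLabel h2
    rw [bSymbol_D_swap (odot A₂ B₂)] at h5
    exact Or.inl ⟨h5.1, fun h => (hC.of_pt_eq hL.1.symm (h5.2 h).1 (h5.2 h).2).swap⟩
  rw [twistSum, h1, h2, mul_zero, mul_zero, zero_add, add_zero] at h
  by_cases h3 : c₁₀ * blockMult K α β A₂ A₁ B₁ B₂ C₁ C₂ = 0
  · rw [h3, zero_add] at h
    have h5 := blockMult_dom_D hA hB.swap hAB3 hC.isLabel (right_ne_zero_of_mul h)
    rw [bSymbol_D_swap (odot A₁ B₂)] at h5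
    exact Or.inr ⟨Or.inr (left_ne_zero_of_mul h), h5.1,
      fun h => (hC.of_pt_eq hL'.1.symm (h5.2 h).1 (h5.2 h).2).swap⟩
  · have h5 := blockMult_dom_D hA.swap hB hAB' hC.isLabel (right_ne_zero_of_mul h3)
    exact Or.inr ⟨Or.inl (left_ne_zero_of_mul h3), h5.1,
      fun h => hC.of_pt_eq hL'.1 (h5.2 h).1 (h5.2 h).2⟩

variable {P : (evenSub (α ⊕ β) → K) → Prop} {m : (evenSub (α ⊕ β) → K) → K}
  {X : evenSub (α ⊕ β) → K}

/-- Minimal characters of the group of type `D`, where both factors are non-degenerate. -/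
theorem MinFor.even_of_ne (hA : IsLabel α A₁ A₂) (hB : IsLabel β B₁ B₂) (hAB : A₁.card = B₁.card)
    (hA' : A₁ ≠ A₂) (hB' : B₁ ≠ B₂) {c c' : K} (h0 : c ≠ 0)
    (hm : ∀ X C₁ C₂, HasLabel (evenSub (α ⊕ β)) X C₁ C₂ →
      (pt C₁ ≠ pt C₂ → m X = twistSum K α β A₁ A₂ B₁ B₂ c c' c' c C₁ C₂) ∧
      (pt C₁ = pt C₂ → 2 * m X = twistSum K α β A₁ A₂ B₁ B₂ c c' c' c C₁ C₂))
    (hX : MinFor .D 0 (fun _ => True) m X) :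
    (HasLabel (evenSub (α ⊕ β)) X (odot A₁ B₁) (odot A₂ B₂) ∧ m X = c) ∨
      (c' ≠ 0 ∧ HasLabel (evenSub (α ⊕ β)) X (odot A₂ B₁) (odot A₁ B₂) ∧ m X = c') := by
  classical
  have hAB' : A₂.card = B₁.card := hA.1 ▸ hAB
  have hL := isLabel_odot hA hB hAB
  have hL' := isLabel_odot hA.swap hB hAB'
  obtain ⟨C₁, C₂, hC⟩ := exists_hasLabel_evenSub hX.irr
  obtain ⟨Y, hY⟩ := exists_hasLabel_of_isLabel (K := K) hL
  obtain ⟨Y', hY'⟩ := exists_hasLabel_of_isLabel (K := K) hL'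
  have v1 : (c' ≠ 0 → bSymbol .D 0 (odot A₁ B₁) (odot A₂ B₂) ≤
      bSymbol .D 0 (odot A₂ B₁) (odot A₁ B₂)) →
      ∀ Y, HasLabel (evenSub (α ⊕ β)) Y (odot A₁ B₁) (odot A₂ B₂) → m Y = c := by
    intro hle Y hY
    have h1 := twistSum_odot (K := K) hA hB hAB (c₀₀ := c) (c₁₀ := c') (c₀₁ := c') (c₁₁ := c)
      (fun h => hle (h.elim id id)) (fun _ => hA') (fun _ => hB')
    by_cases hd : odot A₁ B₁ = odot A₂ B₂
    -- For a degenerate symbol two twists contribute `c` each, and the sum is shared equally by the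
    -- two characters with this label.
    · have h2 := (hm Y _ _ hY).2 (congrArg pt hd)
      rw [h1, if_pos hd, ← two_mul] at h2
      exact mul_left_cancel₀ two_ne_zero h2
    · rw [(hm Y _ _ hY).1 fun h => hd (eq_of_pt_eq hL.1 h), h1, if_neg hd, add_zero]
  have v2 : c' ≠ 0 → bSymbol .D 0 (odot A₂ B₁) (odot A₁ B₂) ≤
      bSymbol .D 0 (odot A₁ B₁) (odot A₂ B₂) →
      ∀ Y, HasLabel (evenSub (α ⊕ β)) Y (odot A₂ B₁) (odot A₁ B₂) → m Y = c' := by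
    intro hc hle Y hY
    have h1 := twistSum_odot (K := K) hA.swap hB hAB' (c₀₀ := c') (c₁₀ := c) (c₀₁ := c)
      (c₁₁ := c') (fun _ => hle) (fun _ => hA'.symm) (fun _ => hB')
    rw [twistSum_swap_left] at h1
    by_cases hd : odot A₂ B₁ = odot A₁ B₂
    · have h2 := (hm Y _ _ hY).2 (congrArg pt hd)
      rw [h1, if_pos hd, ← two_mul] at h2
      exact mul_left_cancel₀ two_ne_zero h2
    · rw [(hm Y _ _ hY).1 fun h => hd (eq_of_pt_eq hL'.1 h), h1, if_neg hd, add_zero]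
  have hmX : twistSum K α β A₁ A₂ B₁ B₂ c c' c' c C₁ C₂ ≠ 0 := by
    by_cases hd : pt C₁ = pt C₂
    · rw [← (hm X _ _ hC).2 hd]
      exact mul_ne_zero two_ne_zero hX.occurs
    · rw [← (hm X _ _ hC).1 hd]
      exact hX.occurs
  have hdom := twistSum_dom hA hB hAB hC hmX
  have hmin := fun Y hm' D₁ D₂ hY => hX.minimal Y (hasLabel_iff.1 hY).1 trivial hm' C₁ C₂ D₁ D₂ hC hY
  by_cases hcase : c' ≠ 0 → bSymbol .D 0 (odot A₁ B₁) (odot A₂ B₂) ≤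
      bSymbol .D 0 (odot A₂ B₁) (odot A₁ B₂)
  · have hle := hmin Y (by rw [v1 hcase Y hY]; exact h0) _ _ hY
    rcases hdom with ⟨h2, h3⟩ | ⟨hc, h2, h3⟩
    · have h4 := h3 (le_antisymm h2 hle)
      exact Or.inl ⟨h4, v1 hcase X h4⟩
    · have hc' : c' ≠ 0 := hc.elim id id
      have h5 := hcase hc'
      have h4 := h3 (le_antisymm h2 (hle.trans h5))
      exact Or.inr ⟨hc', h4, v2 hc' (h2.trans hle) X h4⟩
  · push Not at hcase
    obtain ⟨hc, hlt⟩ := hcase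
    have hle := hmin Y' (by rw [v2 hc hlt.le Y' hY']; exact hc) _ _ hY'
    rcases hdom with ⟨h2, h3⟩ | ⟨-, h2, h3⟩
    · omega
    · have h4 := h3 (le_antisymm h2 hle)
      exact Or.inr ⟨hc, h4, v2 hc hlt.le X h4⟩

/-- If one of the two characters with a degenerate label is minimal, so is the other. -/
theorem MinFor.even_of_hasLabel {F : Finset ℕ → Finset ℕ → K}
    (hm : ∀ X C₁ C₂, HasLabel (evenSub (α ⊕ β)) X C₁ C₂ → pt C₁ = pt C₂ → 2 * m X = F C₁ C₂)
    (hX : MinFor .D 0 (fun _ => True) m X) {C : Finset ℕ}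
    (hC : HasLabel (evenSub (α ⊕ β)) X C C) {Y : evenSub (α ⊕ β) → K}
    (hY : HasLabel (evenSub (α ⊕ β)) Y C C) : MinFor .D 0 (fun _ => True) m Y := by
  refine ⟨(hasLabel_iff.1 hY).1, trivial, ?_, fun Z hZ _ hmZ C₁ C₂ D₁ D₂ h1 h2 => ?_⟩
  · intro h0
    have h1 := hm Y _ _ hY rfl
    rw [h0, mul_zero, ← hm X _ _ hC rfl] at h1
    exact hX.occurs ((mul_eq_zero.1 h1.symm).resolve_left two_ne_zero)
  · refine hX.minimal Z hZ trivial hmZ C₁ C₂ D₁ D₂ ?_ h2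
    rcases hY.unique h1 with ⟨h3, h4⟩ | ⟨h3, h4⟩
    · exact hC.of_pt_eq h1.isLabel.1 h3 h4
    · exact hC.of_pt_eq h1.isLabel.1 h4 h3

section OneDegenerate

variable (hA : IsLabel α A₁ A₂) (hB : IsLabel β B₁ B₂) (hAB : A₁.card = B₁.card)
  (hd : A₁ = A₂ ∨ B₁ = B₂) (h10 : c₁₀ ≠ 0 → A₁ ≠ A₂) (h01 : c₀₁ ≠ 0 → B₁ ≠ B₂)
  (hnat : ∀ X, IsIrrChar X → ∃ n : ℕ, m X = n)
  (hm : ∀ X C₁ C₂, HasLabel (evenSub (α ⊕ β)) X C₁ C₂ →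
    (pt C₁ ≠ pt C₂ ∨ ∀ t, t ∈ evenSub (α ⊕ β)) →
      m X = twistSum K α β A₁ A₂ B₁ B₂ 1 c₁₀ c₀₁ 0 C₁ C₂)
  (hm' : ∀ X C₁ C₂, HasLabel (evenSub (α ⊕ β)) X C₁ C₂ → pt C₁ = pt C₂ →
    ∀ t, t ∉ evenSub (α ⊕ β) →
      m X + m (conjFn t X) = twistSum K α β A₁ A₂ B₁ B₂ 1 c₁₀ c₀₁ 0 C₁ C₂)

include hA hB hAB hd h10 h01

/-- A degenerate factor is unaffected by exchanging its rows, so Λ' is Λ up to the order of the rows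
and there is one candidate only. -/
theorem odot_swap_of_degenerate : (odot A₂ B₁ = odot A₁ B₁ ∧ odot A₁ B₂ = odot A₂ B₂) ∨
    (odot A₂ B₁ = odot A₂ B₂ ∧ odot A₁ B₂ = odot A₁ B₁) := by
  rcases hd with rfl | rfl
  · exact Or.inl ⟨rfl, rfl⟩
  · exact Or.inr ⟨rfl, rfl⟩

theorem twistSum_odot_of_degenerate :
    twistSum K α β A₁ A₂ B₁ B₂ 1 c₁₀ c₀₁ 0 (odot A₁ B₁) (odot A₂ B₂) = 1 := by
  classical
  rw [twistSum_odot hA hB hAB (fun _ => ?_) h10 h01]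
  · split_ifs <;> simp
  · rcases odot_swap_of_degenerate hA hB hAB hd h10 h01 with ⟨h1, h2⟩ | ⟨h1, h2⟩
    · rw [h1, h2]
    · rw [h1, h2, bSymbol_D_swap]

include hnat hm hm'

/-- For a degenerate label only the sum over the two conjugate characters is known. The
multiplicities being natural numbers, a non-zero one makes this sum non-zero. -/
theorem dom_of_degenerate {C₁ C₂ : Finset ℕ} (hC : HasLabel (evenSub (α ⊕ β)) X C₁ C₂)
    (h : m X ≠ 0) : bSymbol .D 0 (odot A₁ B₁) (odot A₂ B₂) ≤ bSymbol .D 0 C₁ C₂ ∧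
      (bSymbol .D 0 (odot A₁ B₁) (odot A₂ B₂) = bSymbol .D 0 C₁ C₂ →
        HasLabel (evenSub (α ⊕ β)) X (odot A₁ B₁) (odot A₂ B₂)) := by
  have hmX : twistSum K α β A₁ A₂ B₁ B₂ 1 c₁₀ c₀₁ 0 C₁ C₂ ≠ 0 := by
    by_cases hcd : pt C₁ ≠ pt C₂ ∨ ∀ t, t ∈ evenSub (α ⊕ β)
    · rwa [← hm X _ _ hC hcd]
    · push Not at hcd
      obtain ⟨hcd, t, ht⟩ := hcd
      rw [← hm' X _ _ hC hcd t ht]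
      obtain ⟨n, hn⟩ := hnat X (hasLabel_iff.1 hC).1
      obtain ⟨n', hn'⟩ := hnat _ ((hasLabel_iff.1 hC).1.conjFn t)
      rw [hn] at h
      rw [hn, hn', ← Nat.cast_add]
      have : n ≠ 0 := by exact_mod_cast h
      exact_mod_cast (by omega : n + n' ≠ 0)
  rcases twistSum_dom hA hB hAB hC hmX with h1 | ⟨-, h1, h2⟩
  · exact h1
  · rcases odot_swap_of_degenerate hA hB hAB hd h10 h01 with ⟨h3, h4⟩ | ⟨h3, h4⟩
    · rw [h3, h4] at h1 h2
      exact ⟨h1, h2⟩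
    · rw [h3, h4, bSymbol_D_swap] at h1 h2
      exact ⟨h1, fun h => (h2 h).swap⟩

theorem exists_occurs_of_degenerate :
    ∃ X, HasLabel (evenSub (α ⊕ β)) X (odot A₁ B₁) (odot A₂ B₂) ∧ m X ≠ 0 := by
  obtain ⟨Y, hY⟩ := exists_hasLabel_of_isLabel (K := K) (isLabel_odot hA hB hAB)
  have h1 := twistSum_odot_of_degenerate (K := K) hA hB hAB hd h10 h01
  by_cases hcd : pt (odot A₁ B₁) ≠ pt (odot A₂ B₂) ∨ ∀ t, t ∈ evenSub (α ⊕ β)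
  · refine ⟨Y, hY, ?_⟩
    rw [hm Y _ _ hY hcd, h1]
    exact one_ne_zero
  · push Not at hcd
    obtain ⟨hcd, t, ht⟩ := hcd
    have h2 := hm' Y _ _ hY hcd t ht
    rw [h1] at h2
    by_cases h3 : m Y = 0
    · refine ⟨_, hY.conjFn t, ?_⟩
      rw [h3, zero_add] at h2
      rw [h2]
      exact one_ne_zero
    · exact ⟨Y, hY, h3⟩

/-- Minimal characters of the group of type `D`, where one factor is degenerate. -/
theorem MinFor.even_of_degenerate (hX : MinFor .D 0 (fun _ => True) m X) :
    HasLabel (evenSub (α ⊕ β)) X (odot A₁ B₁) (odot A₂ B₂) ∧ m X = 1 := by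
  obtain ⟨C₁, C₂, hC⟩ := exists_hasLabel_evenSub hX.irr
  obtain ⟨Y, hY, hmY⟩ := exists_occurs_of_degenerate hA hB hAB hd h10 h01 hnat hm hm'
  have h1 := dom_of_degenerate hA hB hAB hd h10 h01 hnat hm hm' hC hX.occurs
  have h2 := hX.minimal Y (hasLabel_iff.1 hY).1 trivial hmY _ _ _ _ hC hY
  have h3 := h1.2 (le_antisymm h1.1 h2)
  refine ⟨h3, ?_⟩
  have h4 := twistSum_odot_of_degenerate (K := K) hA hB hAB hd h10 h01
  by_cases hcd : pt (odot A₁ B₁) ≠ pt (odot A₂ B₂) ∨ ∀ t, t ∈ evenSub (α ⊕ β)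
  · rw [hm X _ _ h3 hcd, h4]
  · push Not at hcd
    obtain ⟨hcd, t, ht⟩ := hcd
    have h5 := hm' X _ _ h3 hcd t ht
    obtain ⟨n, hn⟩ := hnat X hX.irr
    obtain ⟨n', hn'⟩ := hnat _ (hX.irr.conjFn t)
    have h6 := hX.occurs
    rw [hn] at h6
    rw [h4, hn, hn', ← Nat.cast_add] at h5
    have h7 : n ≠ 0 := by exact_mod_cast h6
    have h8 : n + n' = 1 := by exact_mod_cast h5
    rw [hn, show n = 1 by omega, Nat.cast_one]

/-- Exactly one of the characters with a degenerate label is minimal. -/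
theorem existsUnique_minFor_of_degenerate {C : Finset ℕ} (h1 : odot A₁ B₁ = C)
    (h2 : odot A₂ B₂ = C) :
    ∃! X, HasLabel (evenSub (α ⊕ β)) X C C ∧ MinFor .D 0 (fun _ => True) m X := by
  obtain ⟨X, hX, hmX⟩ := exists_occurs_of_degenerate hA hB hAB hd h10 h01 hnat hm hm'
  have hX' : HasLabel (evenSub (α ⊕ β)) X C C := by rwa [h1, h2] at hX
  refine ⟨X, ⟨hX', (hasLabel_iff.1 hX).1, trivial, hmX, fun Y hY _ hmY C₁ C₂ D₁ D₂ hC hD => ?_⟩,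
    fun Y ⟨hY, hYm⟩ => ?_⟩
  · have h3 := (dom_of_degenerate hA hB hAB hd h10 h01 hnat hm hm' hD hmY).1
    have h4 : bSymbol .D 0 C₁ C₂ = bSymbol .D 0 C C := by
      rcases hC.unique hX' with ⟨h5, h6⟩ | ⟨h5, h6⟩ <;>
        exact bSymbol_D_congr hC.isLabel.1 rfl h5 h6
    rw [h1, h2] at h3
    rw [h4]
    exact h3
  -- Without an odd element, which happens in rank zero, the label determines the character.
  · by_cases ht : ∀ t, t ∈ evenSub (α ⊕ β)
    · rw [hY.eq_restrict (Or.inr ht), hX'.eq_restrict (Or.inr ht)]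
    · push Not at ht
      obtain ⟨t, ht⟩ := ht
      -- If both conjugate characters occurred, their multiplicities would be positive natural
      -- numbers with sum 1.
      refine (hX'.eq_or_eq_conjFn hY rfl ht).resolve_right fun hcon => ?_
      have h5 := hm' X _ _ hX' rfl t ht
      have h6 := twistSum_odot_of_degenerate (K := K) hA hB hAB hd h10 h01
      rw [h1, h2] at h6
      rw [h6, ← hcon] at h5
      obtain ⟨n, hn⟩ := hnat X (hasLabel_iff.1 hX).1
      obtain ⟨n', hn'⟩ := hnat Y hYm.irr
      have h7 := hYm.occurs
      rw [hn] at hmX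
      rw [hn'] at h7
      rw [hn, hn', ← Nat.cast_add] at h5
      have h8 : n ≠ 0 := by exact_mod_cast hmX
      have h9 : n' ≠ 0 := by exact_mod_cast h7
      have h10 : n + n' = 1 := by exact_mod_cast h5
      omega

end OneDegenerate

end Minimal

/-! ### Minimal stable characters for non-trivial F -/

section Stable

variable {K : Type*} [Field K] [IsAlgClosed K] [CharZero K]
variable {α β : Type} [Fintype α] [Fintype β] {A₁ A₂ B₁ B₂ : Finset ℕ} {c₀₀ c₁₀ c₀₁ c₁₁ : K}
variable {P : (evenSub (α ⊕ β) → K) → Prop} {m : (evenSub (α ⊕ β) → K) → K}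
  {X : evenSub (α ⊕ β) → K}

/-- Since `m` is only controlled up to sign, cancellation has to be excluded by strictness of the
b-function instead of positivity. The first symbol is assumed to have the smaller b-value; the
opposite case follows by exchanging A₁ and A₂. -/
theorem MinFor.stable_of_le (hA : IsLabel α A₁ A₂) (hB : IsLabel β B₁ B₂)
    (hAB : A₁.card = B₁.card) (hA' : A₁ ≠ A₂) (hB' : B₁ ≠ B₂)
    (h00 : c₀₀ = 1 ∨ c₀₀ = -1) (h10 : c₁₀ = 1 ∨ c₁₀ = -1)
    (hne : odot A₁ B₁ ≠ odot A₂ B₂ ∨ odot A₂ B₁ ≠ odot A₁ B₂)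
    (hP : ∀ X C₁ C₂, HasLabel (evenSub (α ⊕ β)) X C₁ C₂ → (P X ↔ pt C₁ ≠ pt C₂))
    (hm : ∀ X C₁ C₂, HasLabel (evenSub (α ⊕ β)) X C₁ C₂ → pt C₁ ≠ pt C₂ →
      m X = twistSum K α β A₁ A₂ B₁ B₂ c₀₀ c₁₀ c₀₁ c₁₁ C₁ C₂ ∨
      m X = -twistSum K α β A₁ A₂ B₁ B₂ c₀₀ c₁₀ c₀₁ c₁₁ C₁ C₂)
    (hle : bSymbol .D 0 (odot A₁ B₁) (odot A₂ B₂) ≤ bSymbol .D 0 (odot A₂ B₁) (odot A₁ B₂))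
    (hX : MinFor .D 0 P m X) :
    (HasLabel (evenSub (α ⊕ β)) X (odot A₁ B₁) (odot A₂ B₂) ∨
      HasLabel (evenSub (α ⊕ β)) X (odot A₂ B₁) (odot A₁ B₂)) ∧ (m X = 1 ∨ m X = -1) := by
  classical
  have hAB' : A₂.card = B₁.card := hA.1 ▸ hAB
  have hAB2 : A₂.card = B₂.card := hAB'.trans hB.1
  have hAB3 : A₁.card = B₂.card := hAB.trans hB.1
  have hL := isLabel_odot hA hB hAB
  have hL' := isLabel_odot hA.swap hB hAB'
  -- If Λ had equal rows, Λ' would be non-degenerate by `hne`. Both have the same sum of rows, so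
  -- b(Λ') < b(Λ), contradicting `hle`.
  have hnd : odot A₁ B₁ ≠ odot A₂ B₂ := by
    intro h
    refine absurd hle (not_le.2 ?_)
    have h1 := hne.resolve_left fun h' => h' h
    conv_rhs => rw [← h]
    refine bSymbol_D_lt (s := A₁.card) (by rw [card_odot hAB])
      (by rw [card_odot hAB', hA.1]) (by rw [card_odot hAB3]) ?_ fun h' => h1 (eq_of_pt_eq hL'.1 h')
    conv_rhs => enter [2]; rw [h]
    rw [pt_odot hAB, pt_odot hAB', pt_odot hAB2, pt_odot hAB3]
    abel
  have hndp : pt (odot A₁ B₁) ≠ pt (odot A₂ B₂) := fun h => hnd (eq_of_pt_eq hL.1 h)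
  obtain ⟨Y, hY⟩ := exists_hasLabel_of_isLabel (K := K) hL
  have v1 : ∀ Y, HasLabel (evenSub (α ⊕ β)) Y (odot A₁ B₁) (odot A₂ B₂) → m Y = 1 ∨ m Y = -1 := by
    intro Y hY
    have h1 := hm Y _ _ hY hndp
    rw [twistSum_odot hA hB hAB (fun _ => hle) (fun _ => hA') (fun _ => hB'), if_neg hnd,
      add_zero] at h1
    rcases h00 with h2 | h2 <;> rw [h2] at h1
    · exact h1
    · rw [neg_neg] at h1
      exact h1.symm
  have v2 : bSymbol .D 0 (odot A₂ B₁) (odot A₁ B₂) ≤ bSymbol .D 0 (odot A₁ B₁) (odot A₂ B₂) →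
      HasLabel (evenSub (α ⊕ β)) X (odot A₂ B₁) (odot A₁ B₂) → m X = 1 ∨ m X = -1 := by
    intro hle' hX'
    have hnd' := (hP X _ _ hX').1 hX.stable
    have h1 := hm X _ _ hX' hnd'
    rw [← twistSum_swap_left, twistSum_odot hA.swap hB hAB' (fun _ => hle') (fun _ => hA'.symm)
      (fun _ => hB'), if_neg (fun h => hnd' (congrArg pt h)), add_zero] at h1
    rcases h10 with h2 | h2 <;> rw [h2] at h1
    · exact h1
    · rw [neg_neg] at h1
      exact h1.symm
  have hmY : m Y ≠ 0 := by
    rcases v1 Y hY with h | h <;> rw [h] <;> norm_num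
  obtain ⟨C₁, C₂, hC⟩ := exists_hasLabel_evenSub hX.irr
  have h1 := hX.minimal Y (hasLabel_iff.1 hY).1 ((hP Y _ _ hY).2 hndp) hmY _ _ _ _ hC hY
  have hmX : twistSum K α β A₁ A₂ B₁ B₂ c₀₀ c₁₀ c₀₁ c₁₁ C₁ C₂ ≠ 0 := by
    intro h
    have h2 := hm X _ _ hC ((hP X _ _ hC).1 hX.stable)
    rw [h, neg_zero, or_self] at h2
    exact hX.occurs h2
  rcases twistSum_dom hA hB hAB hC hmX with ⟨h2, h3⟩ | ⟨-, h2, h3⟩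
  · have h4 := h3 (le_antisymm h2 h1)
    exact ⟨Or.inl h4, v1 X h4⟩
  · have h4 := h3 (le_antisymm h2 (h1.trans hle))
    exact ⟨Or.inr h4, v2 (h2.trans h1) h4⟩

/-- Minimal characters in the non-split case, where both factors are non-degenerate. -/
theorem MinFor.stable_of_ne (hA : IsLabel α A₁ A₂) (hB : IsLabel β B₁ B₂)
    (hAB : A₁.card = B₁.card) (hA' : A₁ ≠ A₂) (hB' : B₁ ≠ B₂)
    (h00 : c₀₀ = 1 ∨ c₀₀ = -1) (h10 : c₁₀ = 1 ∨ c₁₀ = -1)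
    (hne : odot A₁ B₁ ≠ odot A₂ B₂ ∨ odot A₂ B₁ ≠ odot A₁ B₂)
    (hP : ∀ X C₁ C₂, HasLabel (evenSub (α ⊕ β)) X C₁ C₂ → (P X ↔ pt C₁ ≠ pt C₂))
    (hm : ∀ X C₁ C₂, HasLabel (evenSub (α ⊕ β)) X C₁ C₂ → pt C₁ ≠ pt C₂ →
      m X = twistSum K α β A₁ A₂ B₁ B₂ c₀₀ c₁₀ c₀₁ c₁₁ C₁ C₂ ∨
      m X = -twistSum K α β A₁ A₂ B₁ B₂ c₀₀ c₁₀ c₀₁ c₁₁ C₁ C₂)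
    (hX : MinFor .D 0 P m X) :
    (HasLabel (evenSub (α ⊕ β)) X (odot A₁ B₁) (odot A₂ B₂) ∨
      HasLabel (evenSub (α ⊕ β)) X (odot A₂ B₁) (odot A₁ B₂)) ∧ (m X = 1 ∨ m X = -1) := by
  rcases le_total (bSymbol .D 0 (odot A₁ B₁) (odot A₂ B₂))
    (bSymbol .D 0 (odot A₂ B₁) (odot A₁ B₂)) with hle | hle
  · exact hX.stable_of_le hA hB hAB hA' hB' h00 h10 hne hP hm hle
  · simp only [← twistSum_swap_left c₀₀ c₁₀ c₀₁ c₁₁] at hm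
    have h := hX.stable_of_le hA.swap hB (hA.1 ▸ hAB) hA'.symm hB' h10 h00 hne.symm hP hm hle
    exact ⟨h.1.symm, h.2⟩

/-- Minimal characters in the non-split case, where one of the factors is degenerate. -/
theorem MinFor.stable_of_degenerate (hA : IsLabel α A₁ A₂) (hB : IsLabel β B₁ B₂)
    (hAB : A₁.card = B₁.card) (hd : A₁ = A₂ ∨ B₁ = B₂) (h10 : c₁₀ ≠ 0 → A₁ ≠ A₂)
    (h01 : c₀₁ ≠ 0 → B₁ ≠ B₂)
    (hne : odot A₁ B₁ ≠ odot A₂ B₂ ∨ odot A₂ B₁ ≠ odot A₁ B₂)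
    (hP : ∀ X C₁ C₂, HasLabel (evenSub (α ⊕ β)) X C₁ C₂ → (P X ↔ pt C₁ ≠ pt C₂))
    (hm : ∀ X C₁ C₂, HasLabel (evenSub (α ⊕ β)) X C₁ C₂ → pt C₁ ≠ pt C₂ →
      m X = twistSum K α β A₁ A₂ B₁ B₂ 1 c₁₀ c₀₁ 0 C₁ C₂ ∨
      m X = -twistSum K α β A₁ A₂ B₁ B₂ 1 c₁₀ c₀₁ 0 C₁ C₂)
    (hX : MinFor .D 0 P m X) :
    (HasLabel (evenSub (α ⊕ β)) X (odot A₁ B₁) (odot A₂ B₂) ∨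
      HasLabel (evenSub (α ⊕ β)) X (odot A₂ B₁) (odot A₁ B₂)) ∧ (m X = 1 ∨ m X = -1) := by
  have hL := isLabel_odot hA hB hAB
  have hsw := odot_swap_of_degenerate (K := K) hA hB hAB hd h10 h01
  have hndp : pt (odot A₁ B₁) ≠ pt (odot A₂ B₂) := by
    intro h
    have h1 := eq_of_pt_eq hL.1 h
    rcases hsw with ⟨h2, h3⟩ | ⟨h2, h3⟩ <;> rw [h2, h3, h1] at hne <;> simp at hne
  have h1 := twistSum_odot_of_degenerate (K := K) hA hB hAB hd h10 h01
  have v1 : ∀ Y, HasLabel (evenSub (α ⊕ β)) Y (odot A₁ B₁) (odot A₂ B₂) →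
      m Y = 1 ∨ m Y = -1 := fun Y hY => h1 ▸ hm Y _ _ hY hndp
  obtain ⟨Y, hY⟩ := exists_hasLabel_of_isLabel (K := K) hL
  have hmY : m Y ≠ 0 := by
    rcases v1 Y hY with h | h <;> rw [h] <;> norm_num
  obtain ⟨C₁, C₂, hC⟩ := exists_hasLabel_evenSub hX.irr
  have h2 := hX.minimal Y (hasLabel_iff.1 hY).1 ((hP Y _ _ hY).2 hndp) hmY _ _ _ _ hC hY
  have hmX : twistSum K α β A₁ A₂ B₁ B₂ 1 c₁₀ c₀₁ 0 C₁ C₂ ≠ 0 := by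
    intro h
    have h3 := hm X _ _ hC ((hP X _ _ hC).1 hX.stable)
    rw [h, neg_zero, or_self] at h3
    exact hX.occurs h3
  have h4 : HasLabel (evenSub (α ⊕ β)) X (odot A₁ B₁) (odot A₂ B₂) := by
    rcases twistSum_dom hA hB hAB hC hmX with ⟨h3, h4⟩ | ⟨-, h3, h4⟩
    · exact h4 (le_antisymm h3 h2)
    · rcases hsw with ⟨h5, h6⟩ | ⟨h5, h6⟩ <;> rw [h5, h6] at h3 h4
      · exact h4 (le_antisymm h3 h2)
      · rw [bSymbol_D_swap] at h3 h4
        exact (h4 (le_antisymm h3 h2)).swap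
  exact ⟨Or.inl h4, v1 X h4⟩

end Stable

/-! ### The remaining functionals and the passage to `twistSum` -/

section Represents

variable {K : Type*} [Field K] [IsAlgClosed K] [CharZero K]
variable {G H : Type} [Group G] [Fintype G] [Group H] [Fintype H]

theorem represents_self (Φ : G → K) : Represents (Nat.card G : K) Φ Φ := by
  intro g _
  rw [cinner_eq]

theorem represents_ker {ε : G →* K} {N : Subgroup G} (hε : ∀ x, ε x = 1 ∨ ε x = -1)
    (hN : ∀ x, x ∈ N ↔ ε x = 1) {t : G} (ht : t ∉ N) (Φ : G → K)
    [DecidablePred fun x => x ∈ N] :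
    Represents (Nat.card N : K) (fun x => if x ∈ N then Φ x else 0)
      (Φ + fun x => ε x * Φ x) := by
  intro g hg
  rw [cinner_eq, ← two_mul_card_ker hε hN ht, mul_inv, mul_comm (2 : K)⁻¹, mul_assoc]
  congr 1
  rw [Finset.mul_sum]
  refine Finset.sum_congr rfl fun x _ => ?_
  rcases hε x with h | h
  · simp only [(hN x).2 h, if_true, Pi.add_apply, h]
    ring
  · have h1 : x ∉ N := fun h' => by
      rw [hN, h] at h'
      norm_num at h'
    simp [h1, h]

end Represents

section BlockSum

variable {K : Type*} [Field K] [IsAlgClosed K] [CharZero K]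
variable {α β : Type} [Fintype α] [Fintype β]

/-- The pairing of a function on block diagonal elements with a function on the whole group. -/
def blockSum (c : K) (Ψ : SignedPerm α × SignedPerm β → K) (F : SignedPerm (α ⊕ β) → K) : K :=
  c⁻¹ * ∑ p, Ψ p * F (blockHom α β p⁻¹)

theorem blockSum_add {c : K} {Ψ : SignedPerm α × SignedPerm β → K}
    (F F' : SignedPerm (α ⊕ β) → K) :
    blockSum c Ψ (F + F') = blockSum c Ψ F + blockSum c Ψ F' := by
  simp only [blockSum, Pi.add_apply, mul_add, Finset.sum_add_distrib]

theorem blockSum_congr {c : K} {Ψ : SignedPerm α × SignedPerm β → K}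
    {F F' : SignedPerm (α ⊕ β) → K}
    (h : ∀ p, Ψ p ≠ 0 → F (blockHom α β p⁻¹) = F' (blockHom α β p⁻¹)) :
    blockSum c Ψ F = blockSum c Ψ F' := by
  rw [blockSum, blockSum]
  congr 1
  refine Finset.sum_congr rfl fun p _ => ?_
  by_cases h0 : Ψ p = 0
  · rw [h0, zero_mul, zero_mul]
  · rw [h p h0]

theorem Represents.blockSum_eq {c : K} {Ψ U : SignedPerm α × SignedPerm β → K}
    (h : Represents c Ψ U) {F : SignedPerm (α ⊕ β) → K} (hF : IsClassFn F) :
    blockSum c Ψ F = cinner U (fun p => F (blockHom α β p)) :=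
  h _ (hF.comp (blockHom α β))

theorem blockSum_conj {c : K} {Ψ : SignedPerm α × SignedPerm β → K}
    (q : SignedPerm α × SignedPerm β) (hΨ : ∀ p, Ψ (q⁻¹ * p * q) = Ψ p)
    (F : SignedPerm (α ⊕ β) → K) :
    blockSum c Ψ (fun x => F (blockHom α β q * x * (blockHom α β q)⁻¹)) = blockSum c Ψ F := by
  rw [blockSum, blockSum]
  congr 1
  refine Fintype.sum_equiv ((Equiv.mulLeft q).trans (Equiv.mulRight q⁻¹)) _ _ fun p => ?_
  have e1 : ((Equiv.mulLeft q).trans (Equiv.mulRight q⁻¹)) p = q * p * q⁻¹ := rfl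
  rw [e1, ← hΨ (q * p * q⁻¹)]
  congr 2
  · group
  · simp only [map_mul, map_inv, mul_inv_rev, inv_inv, mul_assoc]

/-- The factors `σ` and `τ` record the freedom in choosing extensions; only the values of `F` at
inverses of points in the support of `Ψ` matter. -/
theorem mult_eq_blockSum (bar : K ≃+* K)
    (hbar : ∀ (ω : K) (k : ℕ), 0 < k → ω ^ k = 1 → bar ω = ω⁻¹)
    {W H : Subgroup (SignedPerm (α ⊕ β))} {f v : SignedPerm (α ⊕ β)} (hH : H ≤ W)
    (hv : v * f⁻¹ ∈ W) (hf : ∀ w ∈ W, f * w * f⁻¹ ∈ W) (hHr : H ≤ (blockHom α β).range)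
    (hvr : v ∈ (blockHom α β).range) {E' : adjoin H v → K} {X' : adjoin W f → K}
    (hX : IsIrrChar X') {σ τ c : K} (hc : (Nat.card H : K) = c)
    {Ψ : SignedPerm α × SignedPerm β → K} {F : SignedPerm (α ⊕ β) → K}
    (hΨ : ∀ p, blockHom α β p * v⁻¹ ∈ H → extZero E' (blockHom α β p) = σ * Ψ p)
    (hΨ0 : ∀ p, blockHom α β p * v⁻¹ ∉ H → Ψ p = 0)
    (hF : ∀ p, Ψ p ≠ 0 → extZero X' (blockHom α β p⁻¹) = τ * F (blockHom α β p⁻¹)) :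
    mult bar W H f v E' X' = σ * τ * blockSum c Ψ F := by
  classical
  rw [mult_eq_block bar hbar hH hv hf hHr hvr E' hX, blockSum, hc, mul_left_comm (σ * τ)]
  congr 1
  rw [Finset.mul_sum]
  refine Finset.sum_congr rfl fun p _ => ?_
  by_cases h : blockHom α β p * v⁻¹ ∈ H
  · rw [if_pos h, hΨ p h]
    by_cases h0 : Ψ p = 0
    · rw [h0, mul_zero, zero_mul, zero_mul, mul_zero]
    · rw [hF p h0]
      ring
  · rw [if_neg h, hΨ0 p h, zero_mul, zero_mul, mul_zero]

theorem extZero_of_isExtension_one {Γ : Type} [Group Γ] [Fintype Γ] {S : Subgroup Γ} {χ : S → K}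
    {χ' : adjoin S 1 → K} (h : IsExtension S 1 χ χ') : extZero χ' = extZero χ := by
  ext x
  by_cases hx : x ∈ S
  · rw [extZero_adjoin_of_mem h hx, extZero_of_mem χ hx]
  · rw [extZero_of_notMem χ hx, extZero_of_notMem]
    rwa [adjoin_one]

section Twist

variable {A₁ A₂ B₁ B₂ C₁ C₂ : Finset ℕ}

/-- Multiplying out gives the four twists with coefficients 1, x, y, xy. -/
theorem cinner_twist (x y : K) :
    cinner (fun p : SignedPerm α × SignedPerm β =>
        (symbolFun K α A₁ A₂ + x • symbolFun K α A₂ A₁) p.1 *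
          (symbolFun K β B₁ B₂ + y • symbolFun K β B₂ B₁) p.2)
      (fun p => symbolFun K (α ⊕ β) C₁ C₂ (blockHom α β p)) =
      twistSum K α β A₁ A₂ B₁ B₂ 1 x y (x * y) C₁ C₂ := by
  have h : (fun p : SignedPerm α × SignedPerm β =>
      (symbolFun K α A₁ A₂ + x • symbolFun K α A₂ A₁) p.1 *
        (symbolFun K β B₁ B₂ + y • symbolFun K β B₂ B₁) p.2) =
      (fun p => symbolFun K α A₁ A₂ p.1 * symbolFun K β B₁ B₂ p.2) +
      x • (fun p => symbolFun K α A₂ A₁ p.1 * symbolFun K β B₁ B₂ p.2) +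
      y • (fun p => symbolFun K α A₁ A₂ p.1 * symbolFun K β B₂ B₁ p.2) +
      (x * y) • (fun p => symbolFun K α A₂ A₁ p.1 * symbolFun K β B₂ B₁ p.2) := by
    ext p
    simp only [Pi.add_apply, Pi.smul_apply, smul_eq_mul]
    ring
  rw [h, cinner_comm]
  simp only [cinner_add_right, cinner_smul_right]
  rw [twistSum, blockMult, blockMult, blockMult, blockMult, one_mul]

/-- Summing over W_a' pairs with the character induced to W_a, which consists of both orders of the
rows, or of one character in the degenerate case. -/
theorem HasLabel.represents [Decidable (A₁ = A₂)] {φ : evenSub α → K}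
    (h : HasLabel (evenSub α) φ A₁ A₂) :
    Represents (Nat.card (evenSub α) : K) (extZero φ)
      (symbolFun K α A₁ A₂ + (if A₁ = A₂ then (0 : K) else 1) • symbolFun K α A₂ A₁) := by
  classical
  have h1 := represents_indFn φ
  rw [h.indFn_eq] at h1
  by_cases hd : A₁ = A₂
  · rw [if_pos (congrArg pt hd)] at h1
    rwa [if_pos hd, zero_smul]
  · rw [if_neg fun h' => hd (eq_of_pt_eq h.isLabel.1 h')] at h1
    rwa [if_neg hd, one_smul]

/-- Outside W_a' the two orders of the rows differ by the sign -1, so their difference lives on the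
coset and is twice the given character there. -/
theorem represents_notMem_evenSub {t : SignedPerm α} (ht : t ∉ evenSub α) (A₁ A₂ : Finset ℕ)
    [DecidablePred fun x => x ∈ evenSub α] :
    Represents (Nat.card (evenSub α) : K) (fun x => if x ∈ evenSub α then 0 else symbolFun K α A₁ A₂ x)
      (symbolFun K α A₁ A₂ + (-1 : K) • symbolFun K α A₂ A₁) := by
  have h := represents_coset (ε := signProdHom K α) signProdHom_eq_or mem_evenSub_iff ht
    (symbolFun K α A₁ A₂)
  convert h using 1
  ext x
  rw [Pi.add_apply, Pi.smul_apply, Pi.sub_apply, symbolFun_swap A₁ A₂, smul_eq_mul]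
  ring

theorem represents_symbolFun (A₁ A₂ : Finset ℕ) :
    Represents (Nat.card (SignedPerm α) : K) (symbolFun K α A₁ A₂)
      (symbolFun K α A₁ A₂ + (0 : K) • symbolFun K α A₂ A₁) := by
  rw [zero_smul, add_zero]
  exact represents_self _

theorem Represents.blockSum_twist {c d x y : K} {a : SignedPerm α → K} {b : SignedPerm β → K}
    (h : Represents c a (symbolFun K α A₁ A₂ + x • symbolFun K α A₂ A₁))
    (h' : Represents d b (symbolFun K β B₁ B₂ + y • symbolFun K β B₂ B₁))
    (hC : IsLabel (α ⊕ β) C₁ C₂) :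
    blockSum (c * d) (fun p => a p.1 * b p.2) (symbolFun K (α ⊕ β) C₁ C₂) =
      twistSum K α β A₁ A₂ B₁ B₂ 1 x y (x * y) C₁ C₂ := by
  rw [← cinner_twist]
  exact Represents.blockSum_eq (h.prod h') (isClassFn_symbolFun hC.2)

variable {c : K} {Ψ : SignedPerm α × SignedPerm β → K}
  (hΨ : ∀ p, blockHom α β p ∉ evenSub (α ⊕ β) → Ψ p = 0)
  {X : evenSub (α ⊕ β) → K} (hX : HasLabel (evenSub (α ⊕ β)) X C₁ C₂)

include hΨ hX

theorem blockSum_extZero (hne : pt C₁ ≠ pt C₂ ∨ ∀ t, t ∈ evenSub (α ⊕ β)) :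
    blockSum c Ψ (extZero X) = blockSum c Ψ (symbolFun K (α ⊕ β) C₁ C₂) := by
  refine blockSum_congr fun p hp => ?_
  have hp' : blockHom α β p⁻¹ ∈ evenSub (α ⊕ β) := by
    rw [map_inv, inv_mem_iff]
    by_contra h
    exact hp (hΨ p h)
  rw [extZero_of_mem X hp', hX.eq_restrict hne]

/-- The two characters with a degenerate label add up to the restriction from type `B`, whose
pairing is known. -/
theorem blockSum_extZero_add (hd : pt C₁ = pt C₂) {t : SignedPerm (α ⊕ β)}
    (ht : t ∉ evenSub (α ⊕ β)) :
    blockSum c Ψ (extZero X) + blockSum c Ψ (extZero (conjFn t X)) =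
      blockSum c Ψ (symbolFun K (α ⊕ β) C₁ C₂) := by
  rw [← blockSum_add]
  refine blockSum_congr fun p hp => ?_
  have hp' : blockHom α β p⁻¹ ∈ evenSub (α ⊕ β) := by
    rw [map_inv, inv_mem_iff]
    by_contra h
    exact hp (hΨ p h)
  rw [Pi.add_apply, extZero_of_mem X hp', extZero_of_mem (conjFn t X) hp']
  exact congrFun (hX.add_conjFn hd ht) ⟨_, hp'⟩

/-- Conjugation by the odd block diagonal element `q` exchanges the two characters with the given
label and leaves `Ψ` unchanged, so both have the same multiplicity. -/
theorem two_mul_blockSum_extZero (hd : pt C₁ = pt C₂) {q : SignedPerm α × SignedPerm β}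
    (hq : blockHom α β q ∉ evenSub (α ⊕ β)) (hc : ∀ p, Ψ (q⁻¹ * p * q) = Ψ p) :
    2 * blockSum c Ψ (extZero X) = blockSum c Ψ (symbolFun K (α ⊕ β) C₁ C₂) := by
  rw [← blockSum_extZero_add hΨ hX hd hq, two_mul]
  congr 1
  rw [← blockSum_conj q hc (extZero X)]
  congr 1
  ext x
  by_cases hx : x ∈ evenSub (α ⊕ β)
  · have hx' := (inferInstance : (evenSub (α ⊕ β)).Normal).conj_mem x hx (blockHom α β q)
    rw [extZero_of_mem X hx', extZero_of_mem _ hx, conjFn_apply _ _ _ hx']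
  · rw [extZero_of_notMem _ hx, extZero_of_notMem]
    intro h
    have := (inferInstance : (evenSub (α ⊕ β)).Normal).conj_mem _ h (blockHom α β q)⁻¹
    refine hx ?_
    simpa [mul_assoc] using this

end Twist

end BlockSum

/-! ### The groups H⟨v⟩ -/

section Adjoin

variable {α β : Type} [Fintype α] [Fintype β]

theorem mul_inv_mem_evenSub {ι : Type} [Fintype ι] {x t : SignedPerm ι} (hx : x ∉ evenSub ι)
    (ht : t ∉ evenSub ι) : x * t⁻¹ ∈ evenSub ι := by
  change ¬ signProd ι x = 1 at hx
  change ¬ signProd ι t = 1 at ht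
  change signProd ι (x * t⁻¹) = 1
  rw [map_mul, map_inv, (Int.units_eq_one_or _).resolve_left hx,
    (Int.units_eq_one_or _).resolve_left ht]
  rfl

theorem mul_inv_mem_evenSub_iff {ι : Type} [Fintype ι] {x t : SignedPerm ι} (ht : t ∉ evenSub ι) :
    x * t⁻¹ ∈ evenSub ι ↔ x ∉ evenSub ι := by
  refine ⟨fun h hx => ht ?_, fun h => mul_inv_mem_evenSub h ht⟩
  rwa [Subgroup.mul_mem_cancel_left _ hx, inv_mem_iff] at h

theorem blockHom_mul_inv (p q : SignedPerm α × SignedPerm β) :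
    blockHom α β p * (blockHom α β q)⁻¹ = blockHom α β (p * q⁻¹) := by
  rw [map_mul, map_inv]

/-- `R` consists of the product subgroup and its coset containing `q`, so the product subgroup and
`q` generate it. -/
theorem adjoin_eq_map {R : Subgroup (SignedPerm α × SignedPerm β)}
    {U : Subgroup (SignedPerm α)} {V : Subgroup (SignedPerm β)} {q : SignedPerm α × SignedPerm β}
    (hUV : U.prod V ≤ R) (hq : q ∈ R) (hR : ∀ p ∈ R, p ∈ U.prod V ∨ p * q⁻¹ ∈ U.prod V) :
    adjoin (blockSub U V) (blockHom α β q) = R.map (blockHom α β) := by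
  refine le_antisymm (sup_le (Subgroup.map_mono hUV) ?_) ?_
  · rw [Subgroup.zpowers_le]
    exact ⟨q, hq, rfl⟩
  · rintro _ ⟨p, hp, rfl⟩
    rcases hR p hp with h | h
    · exact (le_sup_left : blockSub U V ≤ _) ⟨p, h, rfl⟩
    · have h1 : blockHom α β p = blockHom α β (p * q⁻¹) * blockHom α β q := by
        rw [← map_mul, inv_mul_cancel_right]
      rw [h1]
      exact mul_mem ((le_sup_left : blockSub U V ≤ _) ⟨_, h, rfl⟩)
        ((le_sup_right : Subgroup.zpowers (blockHom α β q) ≤ _) (Subgroup.mem_zpowers _))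

theorem adjoin_left (V : Subgroup (SignedPerm β)) {t : SignedPerm α} (ht : t ∉ evenSub α) :
    adjoin (blockSub (evenSub α) V) (blockHom α β (t, 1)) = blockSub ⊤ V := by
  refine adjoin_eq_map (R := Subgroup.prod ⊤ V) (Subgroup.prod_mono le_top le_rfl)
    ⟨trivial, one_mem _⟩ fun p hp => ?_
  by_cases h : p.1 ∈ evenSub α
  · exact Or.inl ⟨h, hp.2⟩
  · exact Or.inr ⟨mul_inv_mem_evenSub h ht, by simpa using hp.2⟩

theorem adjoin_right (U : Subgroup (SignedPerm α)) {t : SignedPerm β} (ht : t ∉ evenSub β) :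
    adjoin (blockSub U (evenSub β)) (blockHom α β (1, t)) = blockSub U ⊤ := by
  refine adjoin_eq_map (R := Subgroup.prod U ⊤) (Subgroup.prod_mono le_rfl le_top)
    ⟨one_mem _, trivial⟩ fun p hp => ?_
  by_cases h : p.2 ∈ evenSub β
  · exact Or.inl ⟨hp.1, h⟩
  · exact Or.inr ⟨by simpa using hp.1, mul_inv_mem_evenSub h ht⟩

theorem adjoin_both {t : SignedPerm α} {s : SignedPerm β} (ht : t ∉ evenSub α)
    (hs : s ∉ evenSub β) :
    adjoin (blockSub (evenSub α) (evenSub β)) (blockHom α β (t, s)) =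
      ((evenSub (α ⊕ β)).comap (blockHom α β)).map (blockHom α β) := by
  refine adjoin_eq_map (fun p hp => ?_) ?_ fun p hp => ?_
  · exact blockHom_mem_evenSub.2 ⟨fun _ => hp.2, fun _ => hp.1⟩
  · exact blockHom_mem_evenSub.2 ⟨fun h => absurd h ht, fun h => absurd h hs⟩
  · have h1 := blockHom_mem_evenSub.1 (Subgroup.mem_comap.1 hp)
    by_cases h : p.1 ∈ evenSub α
    · exact Or.inl ⟨h, h1.1 h⟩
    · exact Or.inr ⟨mul_inv_mem_evenSub h ht, mul_inv_mem_evenSub (fun h' => h (h1.2 h')) hs⟩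

end Adjoin

/-! ### Extensions of box products to H⟨v⟩ -/

section Extensions

variable {K : Type*} [Field K] [IsAlgClosed K] [CharZero K]
variable {α β : Type} [Fintype α] [Fintype β] {A₁ A₂ B₁ B₂ : Finset ℕ}

/-- Pulling back a function on a group of block diagonal elements. -/
def blockPull {G : Type} [Group G] {S : Subgroup (SignedPerm (α ⊕ β))}
    (θ : G →* SignedPerm (α ⊕ β)) (hθ : θ.range = S) : G →* S :=
  θ.codRestrict S fun x => hθ ▸ ⟨x, rfl⟩

theorem isIrrChar_blockPull {G : Type} [Group G] {S : Subgroup (SignedPerm (α ⊕ β))}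
    (θ : G →* SignedPerm (α ⊕ β)) (hθ : θ.range = S) {E : S → K} (hE : IsIrrChar E) :
    IsIrrChar fun x : G => E (blockPull θ hθ x) := by
  refine hE.comp_surjective (blockPull θ hθ) ?_
  rintro ⟨y, hy⟩
  obtain ⟨x, rfl⟩ : y ∈ θ.range := hθ ▸ hy
  exact ⟨x, rfl⟩

theorem extZero_blockPull {G : Type} [Group G] {S : Subgroup (SignedPerm (α ⊕ β))}
    (θ : G →* SignedPerm (α ⊕ β)) (hθ : θ.range = S) (E : S → K) (x : G) :
    extZero E (θ x) = E (blockPull θ hθ x) :=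
  extZero_of_mem E (hθ ▸ ⟨x, rfl⟩)

theorem isIrrChar_symbolFun_of_isLabel {ι : Type} [Fintype ι] {A B : Finset ℕ}
    (h : IsLabel ι A B) : IsIrrChar (symbolFun K ι A B) := isIrrChar_symbolFun h.2

/-- Extensions in the first factor. -/
theorem extension_left (V : Subgroup (SignedPerm β)) {t : SignedPerm α} (ht : t ∉ evenSub α)
    (hA : IsLabel α A₁ A₂) {ψ : V → K} (hψ : IsIrrChar ψ)
    {E' : adjoin (blockSub (evenSub α) V) (blockHom α β (t, 1)) → K} (hE : IsIrrChar E')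
    (h : ∀ x ∈ evenSub α, ∀ y : V,
      extZero E' (blockHom α β (x, y)) = symbolFun K α A₁ A₂ x * ψ y) :
    (∀ x (y : V), extZero E' (blockHom α β (x, y)) = symbolFun K α A₁ A₂ x * ψ y) ∨
      (∀ x (y : V), extZero E' (blockHom α β (x, y)) = symbolFun K α A₂ A₁ x * ψ y) := by
  have hθ : ((blockHom α β).comp ((MonoidHom.id (SignedPerm α)).prodMap V.subtype)).range =
      adjoin (blockSub (evenSub α) V) (blockHom α β (t, 1)) := by
    rw [adjoin_left V ht]
    ext z
    constructor
    · rintro ⟨p, rfl⟩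
      exact ⟨(p.1, p.2), ⟨trivial, p.2.2⟩, rfl⟩
    · rintro ⟨p, hp, rfl⟩
      exact ⟨(p.1, ⟨p.2, hp.2⟩), rfl⟩
  have h1 := isIrrChar_blockPull _ hθ hE
  have h2 := h1.eq_or_eq_hom_mul ((isIrrChar_symbolFun_of_isLabel hA).prod hψ)
    ((signProdHom K α).comp (MonoidHom.fst _ V)) (fun p => signProdHom_eq_or p.1) (fun p hp => by
      rw [← extZero_blockPull _ hθ E']
      exact h p.1 ((mem_evenSub_iff (K := K) p.1).2 hp) p.2)
  rcases h2 with h2 | h2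
  · refine Or.inl fun x y => ?_
    have h3 := congrFun h2 (x, y)
    rwa [← extZero_blockPull _ hθ E'] at h3
  · refine Or.inr fun x y => ?_
    have h3 := congrFun h2 (x, y)
    rw [← extZero_blockPull _ hθ E'] at h3
    rw [symbolFun_swap A₁ A₂, mul_assoc]
    exact h3

/-- Extensions in the second factor. -/
theorem extension_right (U : Subgroup (SignedPerm α)) {t : SignedPerm β} (ht : t ∉ evenSub β)
    (hB : IsLabel β B₁ B₂) {φ : U → K} (hφ : IsIrrChar φ)
    {E' : adjoin (blockSub U (evenSub β)) (blockHom α β (1, t)) → K} (hE : IsIrrChar E')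
    (h : ∀ x : U, ∀ y ∈ evenSub β,
      extZero E' (blockHom α β (x, y)) = φ x * symbolFun K β B₁ B₂ y) :
    (∀ (x : U) y, extZero E' (blockHom α β (x, y)) = φ x * symbolFun K β B₁ B₂ y) ∨
      (∀ (x : U) y, extZero E' (blockHom α β (x, y)) = φ x * symbolFun K β B₂ B₁ y) := by
  have hθ : ((blockHom α β).comp (U.subtype.prodMap (MonoidHom.id (SignedPerm β)))).range =
      adjoin (blockSub U (evenSub β)) (blockHom α β (1, t)) := by
    rw [adjoin_right U ht]
    ext z
    constructor
    · rintro ⟨p, rfl⟩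
      exact ⟨(p.1, p.2), ⟨p.1.2, trivial⟩, rfl⟩
    · rintro ⟨p, hp, rfl⟩
      exact ⟨(⟨p.1, hp.1⟩, p.2), rfl⟩
  have h1 := isIrrChar_blockPull _ hθ hE
  have h2 := h1.eq_or_eq_hom_mul (hφ.prod (isIrrChar_symbolFun_of_isLabel hB))
    ((signProdHom K β).comp (MonoidHom.snd U _)) (fun p => signProdHom_eq_or p.2) (fun p hp => by
      rw [← extZero_blockPull _ hθ E']
      exact h p.1 p.2 ((mem_evenSub_iff (K := K) p.2).2 hp))
  rcases h2 with h2 | h2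
  · refine Or.inl fun x y => ?_
    have h3 := congrFun h2 (x, y)
    rwa [← extZero_blockPull _ hθ E'] at h3
  · refine Or.inr fun x y => ?_
    have h3 := congrFun h2 (x, y)
    rw [← extZero_blockPull _ hθ E'] at h3
    rw [symbolFun_swap B₁ B₂, mul_left_comm]
    exact h3

/-- Extensions in both factors. -/
theorem extension_both {t : SignedPerm α} {s : SignedPerm β} (ht : t ∉ evenSub α)
    (hs : s ∉ evenSub β) (hA : IsLabel α A₁ A₂) (hB : IsLabel β B₁ B₂) (hA' : A₁ ≠ A₂)
    {E' : adjoin (blockSub (evenSub α) (evenSub β)) (blockHom α β (t, s)) → K} (hE : IsIrrChar E')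
    (h : ∀ x ∈ evenSub α, ∀ y ∈ evenSub β,
      extZero E' (blockHom α β (x, y)) = symbolFun K α A₁ A₂ x * symbolFun K β B₁ B₂ y) :
    (∀ x y, (x ∈ evenSub α ↔ y ∈ evenSub β) →
        extZero E' (blockHom α β (x, y)) = symbolFun K α A₁ A₂ x * symbolFun K β B₁ B₂ y) ∨
      (∀ x y, (x ∈ evenSub α ↔ y ∈ evenSub β) →
        extZero E' (blockHom α β (x, y)) = symbolFun K α A₂ A₁ x * symbolFun K β B₁ B₂ y) := by
  classical
  set N := (evenSub (α ⊕ β)).comap (blockHom α β) with hN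
  have hθ : ((blockHom α β).comp N.subtype).range =
      adjoin (blockSub (evenSub α) (evenSub β)) (blockHom α β (t, s)) := by
    rw [adjoin_both ht hs, MonoidHom.range_comp, Subgroup.range_subtype]
  have h1 := isIrrChar_blockPull _ hθ hE
  have hΦ := (isIrrChar_symbolFun_of_isLabel (K := K) hA).prod
    (isIrrChar_symbolFun_of_isLabel (K := K) hB)
  -- By the index-two formula the norm is 1 plus the product with the character having both pairs of
  -- rows exchanged; the latter vanishes because A is non-degenerate.
  have hirr : IsIrrChar fun p : N => symbolFun K α A₁ A₂ p.1.1 * symbolFun K β B₁ B₂ p.1.2 := by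
    refine IsChar.isIrrChar (hΦ.isChar.restrict N) ?_
    have h2 := cinner_ker (ε := (signProdHom K (α ⊕ β)).comp (blockHom α β)) (N := N) (t := (t, 1))
      (fun p => signProdHom_eq_or _) (fun p => by
        rw [hN, Subgroup.mem_comap, mem_evenSub_iff (K := K)]; rfl)
      (by
        rw [hN, Subgroup.mem_comap, blockHom_mem_evenSub]
        exact fun h => ht (h.2 (one_mem _)))
      (fun p : SignedPerm α × SignedPerm β => symbolFun K α A₁ A₂ p.1 * symbolFun K β B₁ B₂ p.2)
      (fun p => symbolFun K α A₁ A₂ p.1 * symbolFun K β B₁ B₂ p.2)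
    rw [h2, hΦ.cinner_self]
    have h3 : (fun p : SignedPerm α × SignedPerm β =>
        ((signProdHom K (α ⊕ β)).comp (blockHom α β)) p *
          (symbolFun K α A₁ A₂ p.1 * symbolFun K β B₁ B₂ p.2)) =
        fun p => symbolFun K α A₂ A₁ p.1 * symbolFun K β B₂ B₁ p.2 := by
      ext p
      rw [MonoidHom.comp_apply, signProdHom_blockHom, symbolFun_swap A₁ A₂, symbolFun_swap B₁ B₂]
      ring
    rw [h3, cinner_prod, (isIrrChar_symbolFun_of_isLabel hA).cinner_of_ne
      (isIrrChar_symbolFun_of_isLabel hA.swap), zero_mul, add_zero]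
    intro h4
    exact hA' (eq_of_pt_eq hA.1 ((symbolFun_eq_iff hA.2 hA.swap.2).1 h4).1)
  -- On N the signs of the two components agree, so the product of the signs of the first component
  -- has kernel W_a' × W_b' in N. Twisting by it exchanges the rows of A.
  have h2 := h1.eq_or_eq_hom_mul hirr
    (((signProdHom K α).comp (MonoidHom.fst _ _)).comp N.subtype) (fun p => signProdHom_eq_or p.1.1)
    (fun p hp => by
      rw [← extZero_blockPull _ hθ E']
      have hp1 := (mem_evenSub_iff (K := K) p.1.1).2 hp
      exact h p.1.1 hp1 p.1.2 ((blockHom_mem_evenSub.1 p.2).1 hp1))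
  rcases h2 with h2 | h2
  · refine Or.inl fun x y hxy => ?_
    have h3 := congrFun h2 ⟨(x, y), blockHom_mem_evenSub.2 hxy⟩
    rwa [← extZero_blockPull _ hθ E'] at h3
  · refine Or.inr fun x y hxy => ?_
    have h3 := congrFun h2 ⟨(x, y), blockHom_mem_evenSub.2 hxy⟩
    rw [← extZero_blockPull _ hθ E'] at h3
    rw [symbolFun_swap A₁ A₂, mul_assoc]
    exact h3

end Extensions

/-! ### From d-minimality to `MinFor` -/

section Minimal

variable {K : Type*} [Field K] [IsAlgClosed K] [CharZero K] {a b : ℕ} {D : Datum a b}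
  {bar : K ≃+* K} {E : D.H → K} {m : (D.W → K) → K}

/-- Different extensions change the multiplicity at most by a sign, so occurrence is the
non-vanishing of the single function `m`. Existence of extensions is needed only to pass from `m`
back to occurrence. -/
theorem isDMinimal_iff (hE : ∃ E' : adjoin D.H D.v → K, IsExtension D.H D.v E E')
    (hW : ∀ X : D.W → K, IsIrrChar X → IsStable D.W D.f X → ∃ X', IsExtension D.W D.f X X')
    {P : (D.W → K) → Prop} (hP : ∀ X : D.W → K, IsIrrChar X → (IsStable D.W D.f X ↔ P X))
    (hm : ∀ X : D.W → K, IsIrrChar X → P X → ∀ E' X', IsExtension D.H D.v E E' → IsExtension D.W D.f X X' →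
      mult bar D.W D.H D.f D.v E' X' = m X ∨ mult bar D.W D.H D.f D.v E' X' = -m X)
    (X : D.W → K) : D.IsDMinimal bar E X ↔ MinFor D.T D.t P m X := by
  have hocc : ∀ Y, IsIrrChar Y → P Y → (D.Occurs bar E Y ↔ m Y ≠ 0) := by
    intro Y hY hPY
    constructor
    · rintro ⟨E', Y', h1, h2, h3⟩ h0
      rcases hm Y hY hPY E' Y' h1 h2 with h | h <;> rw [h, h0] at h3 <;> simp at h3
    · intro h0
      obtain ⟨E', hE'⟩ := hE
      obtain ⟨Y', hY'⟩ := hW Y hY ((hP Y hY).2 hPY)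
      refine ⟨E', Y', hE', hY', ?_⟩
      rcases hm Y hY hPY E' Y' hE' hY' with h | h <;> rw [h]
      · exact h0
      · exact neg_ne_zero.2 h0
  constructor
  · rintro ⟨h1, h2, h3, h4⟩
    refine ⟨h1, (hP X h1).1 h2, (hocc X h1 ((hP X h1).1 h2)).1 h3,
      fun Y hY hPY hmY C₁ C₂ D₁ D₂ hC hD => ?_⟩
    exact h4 Y hY ((hP Y hY).2 hPY) ((hocc Y hY hPY).2 hmY) _ _ ⟨_, _, hC, rfl⟩ ⟨_, _, hD, rfl⟩
  · rintro ⟨h1, h2, h3, h4⟩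
    refine ⟨h1, (hP X h1).2 h2, (hocc X h1 h2).2 h3, ?_⟩
    rintro Y hY hYs hYo _ _ ⟨C₁, C₂, hC, rfl⟩ ⟨D₁, D₂, hD, rfl⟩
    have hPY := (hP Y hY).1 hYs
    exact h4 Y hY hPY ((hocc Y hY hPY).1 hYo) _ _ _ _ hC hD

theorem isStable_one {Γ : Type} [Group Γ] (W : Subgroup Γ) (X : W → K) : IsStable W 1 X :=
  fun x h => by
    congr 1
    exact Subtype.ext (by simp)

end Minimal

/-! ### Twisted induction to types `B` and `D` -/

variable {K : Type*} [Field K] [IsAlgClosed K] [CharZero K] {bar : K ≃+* K}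
  {a b : ℕ} {A₁ A₂ B₁ B₂ : Finset ℕ} {T : Series} {t : ℕ}
  {H : Subgroup (SignedPerm (Fin a ⊕ Fin b))} {f v : SignedPerm (Fin a ⊕ Fin b)}
  {E : H → K} {c x y : K} {Ψ : SignedPerm (Fin a) × SignedPerm (Fin b) → K}

/-- On the coset of block diagonal elements in `H v`, the function `E'` is `σ` times `Ψ`. -/
def AgreesUpTo (H : Subgroup (SignedPerm (Fin a ⊕ Fin b))) (v : SignedPerm (Fin a ⊕ Fin b)) (σ : K)
    (Ψ : SignedPerm (Fin a) × SignedPerm (Fin b) → K) (E' : adjoin H v → K) : Prop :=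
  ∀ p, blockHom _ _ p * v⁻¹ ∈ H → extZero E' (blockHom _ _ p) = σ * Ψ p

/-- The multiplicity for trivial `F`. -/
theorem mult_one_eq (hbar : ∀ (ω : K) (k : ℕ), 0 < k → ω ^ k = 1 → bar ω = ω⁻¹)
    {W : Subgroup (SignedPerm (Fin a ⊕ Fin b))} (hH : H ≤ W) (hv : v ∈ W)
    (hHr : H ≤ (blockHom (Fin a) (Fin b)).range) (hvr : v ∈ (blockHom (Fin a) (Fin b)).range)
    (hc : (Nat.card H : K) = c) (hΨ0 : ∀ p, blockHom _ _ p * v⁻¹ ∉ H → Ψ p = 0)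
    {E' : adjoin H v → K} {σ : K} (hE' : AgreesUpTo H v σ Ψ E') {X : W → K}
    {X' : adjoin W 1 → K} (hX : IsExtension W 1 X X') :
    mult bar W H 1 v E' X' = σ * blockSum c Ψ (extZero X) := by
  rw [mult_eq_blockSum (τ := 1) bar hbar hH (by simpa using hv) (by simp) hHr hvr hX.1 hc hE' hΨ0
    (F := extZero X) (fun p _ => by rw [one_mul, extZero_of_isExtension_one hX]), mul_one]

theorem extZero_eq_of_hasLabel_top {ι : Type} [Fintype ι] {C₁ C₂ : Finset ℕ}
    {X : (⊤ : Subgroup (SignedPerm ι)) → K} (h : HasLabel ⊤ X C₁ C₂) :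
    extZero X = symbolFun K ι C₁ C₂ := by
  ext x
  rw [extZero_of_mem X (Subgroup.mem_top x), (hasLabel_top_iff.1 h).2]

/-- Twisted induction to a group of type `B`. -/
theorem exists_mult_top (hbar : ∀ (ω : K) (k : ℕ), 0 < k → ω ^ k = 1 → bar ω = ω⁻¹)
    (hHr : H ≤ (blockHom (Fin a) (Fin b)).range) (hvr : v ∈ (blockHom (Fin a) (Fin b)).range)
    (hA : IsLabel (Fin a) A₁ A₂) (hB : IsLabel (Fin b) B₁ B₂) (hAB : A₁.card = B₁.card)
    (hc : (Nat.card H : K) = c) (hx : x ≠ 0 → A₁ ≠ A₂)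
    (hΨ0 : ∀ p, blockHom _ _ p * v⁻¹ ∉ H → Ψ p = 0)
    (hE : ∀ E' : adjoin H v → K, IsExtension H v E E' →
      ∃ σ : K, (σ = 1 ∨ σ = -1) ∧ AgreesUpTo H v σ Ψ E')
    (hsum : ∀ C₁ C₂, IsLabel (Fin a ⊕ Fin b) C₁ C₂ → blockSum c Ψ (symbolFun K _ C₁ C₂) =
      twistSum K (Fin a) (Fin b) A₁ A₂ B₁ B₂ 1 x 0 (x * 0) C₁ C₂)
    {X : (⊤ : Subgroup (SignedPerm (Fin a ⊕ Fin b))) → K}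
    (hX : (⟨T, t, ⊤, H, 1, v⟩ : Datum a b).IsDMinimal bar E X) :
    ∃ μ : K, ((HasLabel ⊤ X (odot A₁ B₁) (odot A₂ B₂) ∧ μ = 1) ∨
        (x ≠ 0 ∧ HasLabel ⊤ X (odot A₂ B₁) (odot A₁ B₂) ∧ μ = x)) ∧
      ∀ (E' : adjoin H v → K) (X' : adjoin (⊤ : Subgroup (SignedPerm (Fin a ⊕ Fin b))) 1 → K) (σ : K),
        IsExtension ⊤ 1 X X' → AgreesUpTo H v σ Ψ E' → mult bar ⊤ H 1 v E' X' = σ * μ := by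
  have key : ∀ (E' : adjoin H v → K) (X : (⊤ : Subgroup (SignedPerm (Fin a ⊕ Fin b))) → K)
      (X' : adjoin (⊤ : Subgroup (SignedPerm (Fin a ⊕ Fin b))) 1 → K) (σ : K),
      IsExtension ⊤ 1 X X' → AgreesUpTo H v σ Ψ E' →
        mult bar ⊤ H 1 v E' X' = σ * blockSum c Ψ (extZero X) := fun E' X X' σ h1 h2 =>
    mult_one_eq hbar le_top (Subgroup.mem_top v) hHr hvr hc hΨ0 h2 h1
  obtain ⟨E₀, X₀, hE₀, -, -⟩ := hX.occurs
  have h1 := (isDMinimal_iff (D := ⟨T, t, ⊤, H, 1, v⟩) (bar := bar) (E := E)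
    (m := fun X => blockSum c Ψ (extZero X)) (P := fun _ => True) ⟨E₀, hE₀⟩
    (fun X hX _ => exists_extension_one hX) (fun X _ => ⟨fun _ => trivial, fun _ => isStable_one _ X⟩)
    (fun X _ _ E' X' h h' => by
      obtain ⟨σ, hσ, h2⟩ := hE E' h
      rw [show mult bar _ _ _ _ E' X' = _ from key E' X X' σ h' h2]
      rcases hσ with rfl | rfl <;> simp) X).1 hX
  refine ⟨_, ?_, fun E' X' σ h h' => key E' X X' σ h h'⟩
  have h2 := MinFor.top (m := fun X => blockSum c Ψ (extZero X)) hA hB hAB one_ne_zero hx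
    (fun X C₁ C₂ hC => by
      rw [extZero_eq_of_hasLabel_top hC, hsum _ _ hC.isLabel, twistSum]
      ring) h1
  exact h2

theorem blockSum_support {W : Subgroup (SignedPerm (Fin a ⊕ Fin b))} (hH : H ≤ W) (hv : v ∈ W)
    (hΨ0 : ∀ p, blockHom (Fin a) (Fin b) p * v⁻¹ ∉ H → Ψ p = 0) :
    ∀ p, blockHom (Fin a) (Fin b) p ∉ W → Ψ p = 0 := fun p hp => hΨ0 p fun h => hp <| by
  have := mul_mem (hH h) hv
  rwa [inv_mul_cancel_right] at this

/-- Twisted induction to a group of type `D` with trivial `F`, for non-degenerate factors. -/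
theorem exists_mult_even (hbar : ∀ (ω : K) (k : ℕ), 0 < k → ω ^ k = 1 → bar ω = ω⁻¹)
    (hHW : H ≤ evenSub (Fin a ⊕ Fin b)) (hvW : v ∈ evenSub (Fin a ⊕ Fin b))
    (hHr : H ≤ (blockHom (Fin a) (Fin b)).range) (hvr : v ∈ (blockHom (Fin a) (Fin b)).range)
    (hA : IsLabel (Fin a) A₁ A₂) (hB : IsLabel (Fin b) B₁ B₂) (hAB : A₁.card = B₁.card)
    (hA' : A₁ ≠ A₂) (hB' : B₁ ≠ B₂) (hc : (Nat.card H : K) = c)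
    (hΨ0 : ∀ p, blockHom _ _ p * v⁻¹ ∉ H → Ψ p = 0)
    (hE : ∀ E' : adjoin H v → K, IsExtension H v E E' →
      ∃ σ : K, (σ = 1 ∨ σ = -1) ∧ AgreesUpTo H v σ Ψ E')
    (hsum : ∀ C₁ C₂, IsLabel (Fin a ⊕ Fin b) C₁ C₂ → blockSum c Ψ (symbolFun K _ C₁ C₂) =
      twistSum K (Fin a) (Fin b) A₁ A₂ B₁ B₂ 1 x x 1 C₁ C₂)
    {q : SignedPerm (Fin a) × SignedPerm (Fin b)} (hq : blockHom _ _ q ∉ evenSub (Fin a ⊕ Fin b))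
    (hΨq : ∀ p, Ψ (q⁻¹ * p * q) = Ψ p) :
    (∀ X : evenSub (Fin a ⊕ Fin b) → K,
      (⟨.D, 0, evenSub _, H, 1, v⟩ : Datum a b).IsDMinimal bar E X →
      ∃ μ : K, ((HasLabel (evenSub _) X (odot A₁ B₁) (odot A₂ B₂) ∧ μ = 1) ∨
        (x ≠ 0 ∧ HasLabel (evenSub _) X (odot A₂ B₁) (odot A₁ B₂) ∧ μ = x)) ∧
      ∀ (E' : adjoin H v → K) (X' : adjoin (evenSub (Fin a ⊕ Fin b)) 1 → K) (σ : K),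
        IsExtension (evenSub _) 1 X X' → AgreesUpTo H v σ Ψ E' →
          mult bar (evenSub _) H 1 v E' X' = σ * μ) ∧
    (⟨.D, 0, evenSub _, H, 1, v⟩ : Datum a b).DegenerateClause bar E A₁ A₂ B₁ B₂ := by
  have hΨe := blockSum_support hHW hvW hΨ0
  have key : ∀ (E' : adjoin H v → K) (X : evenSub (Fin a ⊕ Fin b) → K)
      (X' : adjoin (evenSub (Fin a ⊕ Fin b)) 1 → K) (σ : K),
      IsExtension (evenSub _) 1 X X' → AgreesUpTo H v σ Ψ E' →
        mult bar (evenSub _) H 1 v E' X' = σ * blockSum c Ψ (extZero X) := fun E' X X' σ h1 h2 =>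
    mult_one_eq hbar hHW hvW hHr hvr hc hΨ0 h2 h1
  have hm : ∀ X C₁ C₂, HasLabel (evenSub (Fin a ⊕ Fin b)) X C₁ C₂ →
      (pt C₁ ≠ pt C₂ → blockSum c Ψ (extZero X) =
        twistSum K (Fin a) (Fin b) A₁ A₂ B₁ B₂ 1 x x 1 C₁ C₂) ∧
      (pt C₁ = pt C₂ → 2 * blockSum c Ψ (extZero X) =
        twistSum K (Fin a) (Fin b) A₁ A₂ B₁ B₂ 1 x x 1 C₁ C₂) := by
    intro X C₁ C₂ hC
    refine ⟨fun h => ?_, fun h => ?_⟩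
    · rw [blockSum_extZero hΨe hC (Or.inl h), hsum _ _ hC.isLabel]
    · rw [two_mul_blockSum_extZero hΨe hC h hq hΨq, hsum _ _ hC.isLabel]
  have hiff : ∀ X, (∃ E' : adjoin H v → K, IsExtension H v E E') →
      ((⟨.D, 0, evenSub _, H, 1, v⟩ : Datum a b).IsDMinimal bar E X ↔
        MinFor .D 0 (fun _ => True) (fun X => blockSum c Ψ (extZero X)) X) := fun X hE₀ =>
    isDMinimal_iff (D := ⟨.D, 0, evenSub _, H, 1, v⟩) (bar := bar) (E := E)
      (m := fun X => blockSum c Ψ (extZero X)) (P := fun _ => True) hE₀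
      (fun X hX _ => exists_extension_one hX)
      (fun X _ => ⟨fun _ => trivial, fun _ => isStable_one _ X⟩)
      (fun X _ _ E' X' h h' => by
        obtain ⟨σ, hσ, h2⟩ := hE E' h
        rw [show mult bar _ _ _ _ E' X' = _ from key E' X X' σ h' h2]
        rcases hσ with rfl | rfl <;> simp) X
  refine ⟨fun X hX => ?_, fun C _ => ⟨fun h => absurd h (not_or.2 ⟨hA', hB'⟩), ?_⟩⟩
  · obtain ⟨E₀, X₀, hE₀, -, -⟩ := id hX.occurs
    have h1 := (hiff X ⟨E₀, hE₀⟩).1 hX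
    exact ⟨_, h1.even_of_ne hA hB hAB hA' hB' one_ne_zero hm, fun E' X' σ h h' => key E' X X' σ h h'⟩
  · rintro - ⟨X, hXC, hX⟩ Y hY
    obtain ⟨E₀, X₀, hE₀, -, -⟩ := id hX.occurs
    have h1 := (hiff X ⟨E₀, hE₀⟩).1 hX
    exact (hiff Y ⟨E₀, hE₀⟩).2 (h1.even_of_hasLabel (fun X C₁ C₂ hC => (hm X C₁ C₂ hC).2) hXC hY)

theorem adjoin_evenSub {ι : Type} [Fintype ι] {f : SignedPerm ι} (hf : f ∉ evenSub ι) :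
    adjoin (evenSub ι) f = ⊤ := by
  refine (Subgroup.eq_top_iff' _).2 fun x => ?_
  by_cases hx : x ∈ evenSub ι
  · exact (le_sup_left : evenSub ι ≤ _) hx
  · have h1 := mul_mem ((le_sup_left : evenSub ι ≤ adjoin (evenSub ι) f) (mul_inv_mem_evenSub hx hf))
      ((le_sup_right : Subgroup.zpowers f ≤ adjoin (evenSub ι) f) (Subgroup.mem_zpowers f))
    rwa [inv_mul_cancel_right] at h1

/-- A degenerate label belongs to two characters interchanged by `f`; a non-degenerate one belongs
to a restriction of a class function of the big group. -/
theorem isStable_evenSub_iff {ι : Type} [Fintype ι] {f : SignedPerm ι} (hf : f ∉ evenSub ι)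
    {X : evenSub ι → K} {C₁ C₂ : Finset ℕ} (hX : HasLabel (evenSub ι) X C₁ C₂) :
    IsStable (evenSub ι) f X ↔ pt C₁ ≠ pt C₂ := by
  constructor
  · intro h hd
    refine hX.conjFn_ne hd hf (funext fun z => ?_)
    exact h z ((inferInstance : (evenSub ι).Normal).conj_mem _ z.2 f)
  · intro h z hz
    rw [hX.eq_restrict (Or.inl h)]
    exact isClassFn_symbolFun hX.isLabel.2 _ _

theorem exists_extension_evenSub {ι : Type} [Fintype ι] {f : SignedPerm ι} (hf : f ∉ evenSub ι)
    {X : evenSub ι → K} {C₁ C₂ : Finset ℕ} (hX : HasLabel (evenSub ι) X C₁ C₂)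
    (hne : pt C₁ ≠ pt C₂) : ∃ X', IsExtension (evenSub ι) f X X' := by
  refine ⟨fun z => symbolFun K ι C₁ C₂ z, ?_, fun z => ?_⟩
  · refine (isIrrChar_symbolFun_of_isLabel hX.isLabel).comp_surjective
      (adjoin (evenSub ι) f).subtype fun z => ⟨⟨z, ?_⟩, rfl⟩
    rw [adjoin_evenSub hf]
    trivial
  · rw [hX.eq_restrict (Or.inl hne)]

/-- An extension of an invariant character of the group of type `D` to the group of type `B`. -/
theorem extension_evenSub {ι : Type} [Fintype ι] {f : SignedPerm ι} (hf : f ∉ evenSub ι)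
    {X : evenSub ι → K} {C₁ C₂ : Finset ℕ} (hX : HasLabel (evenSub ι) X C₁ C₂)
    (hne : pt C₁ ≠ pt C₂) {X' : adjoin (evenSub ι) f → K} (h : IsExtension (evenSub ι) f X X') :
    ∃ τ : K, (τ = 1 ∨ τ = -1) ∧ ∀ z, z ∉ evenSub ι → extZero X' z = τ * symbolFun K ι C₁ C₂ z := by
  have htop : ∀ z, z ∈ adjoin (evenSub ι) f := fun z => by
    rw [adjoin_evenSub hf]
    trivial
  have h1 : IsIrrChar fun z : SignedPerm ι => X' ⟨z, htop z⟩ :=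
    h.1.comp_surjective ((MonoidHom.id _).codRestrict (adjoin (evenSub ι) f) htop)
      fun z => ⟨z, rfl⟩
  have h2 := h1.eq_or_eq_hom_mul (isIrrChar_symbolFun_of_isLabel hX.isLabel) (signProdHom K ι)
    signProdHom_eq_or fun z hz => by
      have hz' := (mem_evenSub_iff (K := K) z).2 hz
      have h3 := h.2 ⟨z, hz'⟩
      rw [hX.eq_restrict (Or.inl hne)] at h3
      exact h3
  rcases h2 with h2 | h2
  · refine ⟨1, Or.inl rfl, fun z _ => ?_⟩
    rw [extZero_of_mem X' (htop z), one_mul]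
    exact congrFun h2 z
  · refine ⟨-1, Or.inr rfl, fun z hz => ?_⟩
    rw [extZero_of_mem X' (htop z)]
    exact (congrFun h2 z).trans (by rw [signProdHom_of_notMem hz])

/-- Twisted induction to a group of type `D` with non-trivial `F`. -/
theorem mult_stable (hbar : ∀ (ω : K) (k : ℕ), 0 < k → ω ^ k = 1 → bar ω = ω⁻¹)
    (hHW : H ≤ evenSub (Fin a ⊕ Fin b)) (hf : f ∉ evenSub (Fin a ⊕ Fin b))
    (hv : v ∉ evenSub (Fin a ⊕ Fin b))
    (hHr : H ≤ (blockHom (Fin a) (Fin b)).range) (hvr : v ∈ (blockHom (Fin a) (Fin b)).range)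
    (hA : IsLabel (Fin a) A₁ A₂) (hB : IsLabel (Fin b) B₁ B₂) (hAB : A₁.card = B₁.card)
    (hxy : (A₁ ≠ A₂ ∧ B₁ ≠ B₂ ∧ (x = 1 ∨ x = -1)) ∨
      ((A₁ = A₂ ∨ B₁ = B₂) ∧ x * y = 0 ∧ (x ≠ 0 → A₁ ≠ A₂) ∧ (y ≠ 0 → B₁ ≠ B₂)))
    (hne : odot A₁ B₁ ≠ odot A₂ B₂ ∨ odot A₂ B₁ ≠ odot A₁ B₂)
    (hc : (Nat.card H : K) = c)
    (hΨ0 : ∀ p, blockHom _ _ p * v⁻¹ ∉ H → Ψ p = 0)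
    (hE : ∀ E' : adjoin H v → K, IsExtension H v E E' →
      ∃ σ : K, (σ = 1 ∨ σ = -1) ∧ AgreesUpTo H v σ Ψ E')
    (hsum : ∀ C₁ C₂, IsLabel (Fin a ⊕ Fin b) C₁ C₂ → blockSum c Ψ (symbolFun K _ C₁ C₂) =
      twistSum K (Fin a) (Fin b) A₁ A₂ B₁ B₂ 1 x y (x * y) C₁ C₂)
    {X : evenSub (Fin a ⊕ Fin b) → K}
    (hX : (⟨.D, 0, evenSub _, H, f, v⟩ : Datum a b).IsDMinimal bar E X) :
    (HasLabel (evenSub _) X (odot A₁ B₁) (odot A₂ B₂) ∨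
      HasLabel (evenSub _) X (odot A₂ B₁) (odot A₁ B₂)) ∧
    (⟨.D, 0, evenSub _, H, f, v⟩ : Datum a b).MultMem bar E X (fun _ => True) {1, -1} := by
  classical
  -- The coset H v consists of odd elements only, which is where extensions to W⟨f⟩ are determined
  -- up to a common sign.
  have hΨe : ∀ p, Ψ p ≠ 0 → blockHom (Fin a) (Fin b) p⁻¹ ∉ evenSub (Fin a ⊕ Fin b) := by
    intro p hp hp'
    refine hp (hΨ0 p fun h => hv ?_)
    rw [map_inv, inv_mem_iff] at hp'
    have h1 := hHW h
    rwa [Subgroup.mul_mem_cancel_left _ hp', inv_mem_iff] at h1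
  have key : ∀ (X : evenSub (Fin a ⊕ Fin b) → K) (C₁ C₂ : Finset ℕ), HasLabel (evenSub _) X C₁ C₂ →
      pt C₁ ≠ pt C₂ → ∀ (E' : adjoin H v → K) (X' : adjoin (evenSub (Fin a ⊕ Fin b)) f → K),
      IsExtension H v E E' → IsExtension (evenSub _) f X X' →
        mult bar (evenSub _) H f v E' X' =
          twistSum K (Fin a) (Fin b) A₁ A₂ B₁ B₂ 1 x y (x * y) C₁ C₂ ∨
        mult bar (evenSub _) H f v E' X' =
          -twistSum K (Fin a) (Fin b) A₁ A₂ B₁ B₂ 1 x y (x * y) C₁ C₂ := by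
    intro X C₁ C₂ hC hd E' X' h h'
    obtain ⟨σ, hσ, h1⟩ := hE E' h
    obtain ⟨τ, hτ, h2⟩ := extension_evenSub hf hC hd h'
    rw [mult_eq_blockSum bar hbar hHW (mul_inv_mem_evenSub hv hf)
      (fun w hw => (inferInstance : (evenSub (Fin a ⊕ Fin b)).Normal).conj_mem w hw f) hHr hvr h'.1
      hc h1 hΨ0 fun p hp => h2 _ (hΨe p hp), hsum _ _ hC.isLabel]
    rcases hσ with rfl | rfl <;> rcases hτ with rfl | rfl <;> simp
  obtain ⟨E₀, X₀, hE₀, -, -⟩ := id hX.occurs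
  -- No extension is preferred, so one is chosen for every character having one. The value 0
  -- elsewhere plays no role, as stable characters extend.
  set m : (evenSub (Fin a ⊕ Fin b) → K) → K := fun X =>
    if h : ∃ X', IsExtension (evenSub _) f X X' then
      mult bar (evenSub _) H f v E₀ (Classical.choose h) else 0 with hm
  have hm' : ∀ X C₁ C₂, HasLabel (evenSub (Fin a ⊕ Fin b)) X C₁ C₂ → pt C₁ ≠ pt C₂ →
      m X = twistSum K (Fin a) (Fin b) A₁ A₂ B₁ B₂ 1 x y (x * y) C₁ C₂ ∨
      m X = -twistSum K (Fin a) (Fin b) A₁ A₂ B₁ B₂ 1 x y (x * y) C₁ C₂ := by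
    intro X C₁ C₂ hC hd
    have h1 := exists_extension_evenSub hf hC hd
    simp only [hm, dif_pos h1]
    exact key X C₁ C₂ hC hd E₀ _ hE₀ (Classical.choose_spec h1)
  have hmm : ∀ X, IsIrrChar X → IsStable (evenSub _) f X → ∀ (E' : adjoin H v → K)
      (X' : adjoin (evenSub (Fin a ⊕ Fin b)) f → K),
      IsExtension H v E E' → IsExtension (evenSub _) f X X' →
      mult bar (evenSub _) H f v E' X' = m X ∨ mult bar (evenSub _) H f v E' X' = -m X := by
    intro X hX hs E' X' h h'
    obtain ⟨C₁, C₂, hC⟩ := exists_hasLabel_evenSub hX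
    have hd := (isStable_evenSub_iff hf hC).1 hs
    rcases key X C₁ C₂ hC hd E' X' h h' with h1 | h1 <;> rcases hm' X C₁ C₂ hC hd with h2 | h2 <;>
      rw [h1, h2] <;> simp
  have h1 := (isDMinimal_iff (D := ⟨.D, 0, evenSub _, H, f, v⟩) (bar := bar) (E := E)
    (m := m) (P := IsStable (evenSub _) f) ⟨E₀, hE₀⟩
    (fun X hX hs => by
      obtain ⟨C₁, C₂, hC⟩ := exists_hasLabel_evenSub hX
      exact exists_extension_evenSub hf hC ((isStable_evenSub_iff hf hC).1 hs))
    (fun X _ => Iff.rfl) hmm X).1 hX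
  have h2 : (HasLabel (evenSub _) X (odot A₁ B₁) (odot A₂ B₂) ∨
      HasLabel (evenSub _) X (odot A₂ B₁) (odot A₁ B₂)) ∧ (m X = 1 ∨ m X = -1) := by
    rcases hxy with ⟨hA', hB', hx⟩ | ⟨hd, h0, hx, hy⟩
    · exact h1.stable_of_ne hA hB hAB hA' hB' (Or.inl rfl) hx hne
        (fun X C₁ C₂ hC => isStable_evenSub_iff hf hC) hm'
    · rw [h0] at hm'
      exact h1.stable_of_degenerate hA hB hAB hd hx hy hne
        (fun X C₁ C₂ hC => isStable_evenSub_iff hf hC) hm'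
  refine ⟨h2.1, fun E' X' h h' _ => ?_⟩
  have h3 := hmm X hX.irr hX.stable E' X' h h'
  change mult bar (evenSub _) H f v E' X' = 1 ∨ mult bar (evenSub _) H f v E' X' = -1
  rcases h3 with h3 | h3 <;> rcases h2.2 with h4 | h4 <;> rw [h3, h4] <;> simp

/-! ### Box products -/

section Box

variable {K : Type*} [Field K] [IsAlgClosed K] [CharZero K]
variable {α β : Type} [Fintype α] [Fintype β] {A₁ A₂ B₁ B₂ : Finset ℕ}
variable {U : Subgroup (SignedPerm α)} {V : Subgroup (SignedPerm β)} {E : blockSub U V → K}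
  {φ : U → K} {ψ : V → K}

theorem box_apply
    (hE : ∀ (x : U) (y : V), E ⟨blockHom α β (x, y), ⟨(x, y), ⟨x.2, y.2⟩, rfl⟩⟩ = φ x * ψ y)
    {p : SignedPerm α × SignedPerm β} (hp : blockHom α β p ∈ blockSub U V) :
    E ⟨blockHom α β p, hp⟩ = extZero φ p.1 * extZero ψ p.2 := by
  obtain ⟨h1, h2⟩ := blockHom_mem_blockSub.1 hp
  rw [extZero_of_mem φ h1, extZero_of_mem ψ h2]
  exact hE ⟨_, h1⟩ ⟨_, h2⟩

theorem box_extZero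
    (hE : ∀ (x : U) (y : V), E ⟨blockHom α β (x, y), ⟨(x, y), ⟨x.2, y.2⟩, rfl⟩⟩ = φ x * ψ y)
    {v : SignedPerm (α ⊕ β)} {E' : adjoin (blockSub U V) v → K}
    (h : IsExtension (blockSub U V) v E E') {p : SignedPerm α × SignedPerm β}
    (hp : blockHom α β p ∈ blockSub U V) :
    extZero E' (blockHom α β p) = extZero φ p.1 * extZero ψ p.2 := by
  rw [extZero_adjoin_of_mem h hp, box_apply hE]

theorem box_eq_zero {p : SignedPerm α × SignedPerm β}
    (hp : blockHom α β p * (1 : SignedPerm (α ⊕ β))⁻¹ ∉ blockSub U V) :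
    extZero φ p.1 * extZero ψ p.2 = 0 := by
  rw [inv_one, mul_one, blockHom_mem_blockSub, not_and_or] at hp
  rcases hp with h | h
  · rw [extZero_of_notMem φ h, zero_mul]
  · rw [extZero_of_notMem ψ h, mul_zero]

theorem card_blockSub_cast (U : Subgroup (SignedPerm α)) (V : Subgroup (SignedPerm β)) :
    (Nat.card (blockSub U V) : K) = Nat.card U * Nat.card V := by
  rw [card_blockSub, Nat.cast_mul]

theorem IsBoxRestriction.extZero_eq {S : Subgroup (SignedPerm (α ⊕ β))} {E' : S → K}
    (h : IsBoxRestriction S E' A₁ A₂ B₁ B₂) {p : SignedPerm α × SignedPerm β}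
    (hp : blockHom α β p ∈ S) :
    extZero E' (blockHom α β p) = symbolFun K α A₁ A₂ p.1 * symbolFun K β B₁ B₂ p.2 := by
  obtain ⟨χ, ω, hχ, hω, h1⟩ := h
  obtain ⟨-, -, rfl⟩ := isSymbolChar_iff.1 hχ
  obtain ⟨-, -, rfl⟩ := isSymbolChar_iff.1 hω
  rw [extZero_of_mem E' hp]
  exact h1 p.1 p.2 hp

theorem symbolFun_swap_of_notMem {x : SignedPerm α} (hx : x ∉ evenSub α) (A₁ A₂ : Finset ℕ) :
    symbolFun K α A₂ A₁ x = -symbolFun K α A₁ A₂ x := by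
  rw [symbolFun_swap A₁ A₂, signProdHom_of_notMem hx, neg_one_mul]

/-- An odd element moves every character with degenerate label. Evaluating invariance at the
elements (x, 1) and dividing by the non-zero degree of ψ reduces it to invariance of φ. -/
theorem ne_of_isStable_left {E : blockSub (evenSub α) V → K} {φ : evenSub α → K}
    (hφ : HasLabel (evenSub α) φ A₁ A₂) (hψ : IsIrrChar ψ)
    (hE : ∀ (x : evenSub α) (y : V),
      E ⟨blockHom α β (x, y), ⟨(x, y), ⟨x.2, y.2⟩, rfl⟩⟩ = φ x * ψ y)
    {q : SignedPerm α × SignedPerm β} (hq : q.1 ∉ evenSub α)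
    (h : IsStable (blockSub (evenSub α) V) (blockHom α β q) E) : A₁ ≠ A₂ := by
  intro hd
  refine hφ.conjFn_ne (congrArg pt hd) hq (funext fun x => ?_)
  have hx' := (inferInstance : (evenSub α).Normal).conj_mem x x.2 q.1
  have e : blockHom α β q * blockHom α β (x, 1) * (blockHom α β q)⁻¹ =
      blockHom α β (q.1 * x * q.1⁻¹, 1) := by
    rw [← map_inv, ← map_mul, ← map_mul]
    congr 1
    exact Prod.ext rfl (by simp)
  have hm : blockHom α β (q.1 * x * q.1⁻¹, 1) ∈ blockSub (evenSub α) V :=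
    blockHom_mem_blockSub.2 ⟨hx', one_mem _⟩
  have h1 := h ⟨blockHom α β (x, 1), blockHom_mem_blockSub.2 ⟨x.2, one_mem _⟩⟩ (by
    rw [e]
    exact hm)
  rw [box_apply hE] at h1
  simp only [e] at h1
  rw [box_apply hE] at h1
  rw [extZero_of_mem φ hx', extZero_of_mem φ x.2, extZero_of_mem ψ (one_mem V)] at h1
  exact mul_right_cancel₀ hψ.one_ne_zero h1

theorem ne_of_isStable_right {E : blockSub U (evenSub β) → K} {ψ : evenSub β → K}
    (hφ : IsIrrChar φ) (hψ : HasLabel (evenSub β) ψ B₁ B₂)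
    (hE : ∀ (x : U) (y : evenSub β),
      E ⟨blockHom α β (x, y), ⟨(x, y), ⟨x.2, y.2⟩, rfl⟩⟩ = φ x * ψ y)
    {q : SignedPerm α × SignedPerm β} (hq : q.2 ∉ evenSub β)
    (h : IsStable (blockSub U (evenSub β)) (blockHom α β q) E) : B₁ ≠ B₂ := by
  intro hd
  refine hψ.conjFn_ne (congrArg pt hd) hq (funext fun y => ?_)
  have hy' := (inferInstance : (evenSub β).Normal).conj_mem y y.2 q.2
  have e : blockHom α β q * blockHom α β (1, y) * (blockHom α β q)⁻¹ =
      blockHom α β (1, q.2 * y * q.2⁻¹) := by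
    rw [← map_inv, ← map_mul, ← map_mul]
    congr 1
    exact Prod.ext (by simp) rfl
  have hm : blockHom α β (1, q.2 * y * q.2⁻¹) ∈ blockSub U (evenSub β) :=
    blockHom_mem_blockSub.2 ⟨one_mem _, hy'⟩
  have h1 := h ⟨blockHom α β (1, y), blockHom_mem_blockSub.2 ⟨one_mem _, y.2⟩⟩ (by
    rw [e]
    exact hm)
  rw [box_apply hE] at h1
  simp only [e] at h1
  rw [box_apply hE] at h1
  rw [extZero_of_mem ψ hy', extZero_of_mem ψ y.2, extZero_of_mem φ (one_mem U)] at h1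
  exact mul_left_cancel₀ hφ.one_ne_zero h1

theorem HasLabel.extZero_eq {X : evenSub α → K} (h : HasLabel (evenSub α) X A₁ A₂)
    (hne : A₁ ≠ A₂) {x : SignedPerm α} (hx : x ∈ evenSub α) :
    extZero X x = symbolFun K α A₁ A₂ x := by
  rw [extZero_of_mem X hx, h.eq_restrict (Or.inl fun h' => hne (eq_of_pt_eq h.isLabel.1 h'))]

/-- A non-degenerate character is a restriction, hence invariant under all signed permutations. This
supplies the invariance of `Ψ` under an odd element. -/
theorem HasLabel.extZero_conj {X : evenSub α → K} (h : HasLabel (evenSub α) X A₁ A₂)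
    (hne : A₁ ≠ A₂) (t x : SignedPerm α) : extZero X (t⁻¹ * x * t) = extZero X x := by
  have hmem : t⁻¹ * x * t ∈ evenSub α ↔ x ∈ evenSub α := by
    have := (inferInstance : (evenSub α).Normal).mem_comm_iff (a := t⁻¹ * x) (b := t)
    rwa [mul_inv_cancel_left] at this
  by_cases hx : x ∈ evenSub α
  · rw [h.extZero_eq hne hx, h.extZero_eq hne (hmem.2 hx),
      (isClassFn_symbolFun h.isLabel.2).conj']
  · rw [extZero_of_notMem X hx, extZero_of_notMem X (fun h' => hx (hmem.1 h'))]

end Box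

/-! ### Type `B` and type `C` -/

section Cases

variable {K : Type*} [Field K] [IsAlgClosed K] [CharZero K] {bar : K ≃+* K}
  {a b : ℕ} {A₁ A₂ B₁ B₂ : Finset ℕ}
  (hbar : ∀ (ω : K) (k : ℕ), 0 < k → ω ^ k = 1 → bar ω = ω⁻¹) (hAB : A₁.card = B₁.card)

theorem agrees_of_box {U : Subgroup (SignedPerm (Fin a))} {V : Subgroup (SignedPerm (Fin b))}
    {E : blockSub U V → K} {φ : U → K} {ψ : V → K}
    (hE : ∀ (x : U) (y : V), E ⟨blockHom _ _ (x, y), ⟨(x, y), ⟨x.2, y.2⟩, rfl⟩⟩ = φ x * ψ y)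
    {E' : adjoin (blockSub U V) 1 → K} (h : IsExtension (blockSub U V) 1 E E') :
    AgreesUpTo (blockSub U V) 1 1 (fun p => extZero φ p.1 * extZero ψ p.2) E' := by
  intro p hp
  rw [inv_one, mul_one] at hp
  rw [one_mul, box_extZero hE h hp]

theorem represents_top {α : Type} [Fintype α] {φ : (⊤ : Subgroup (SignedPerm α)) → K}
    (h : HasLabel ⊤ φ A₁ A₂) :
    Represents (Nat.card (⊤ : Subgroup (SignedPerm α)) : K) (extZero φ)
      (symbolFun K α A₁ A₂ + (0 : K) • symbolFun K α A₂ A₁) := by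
  rw [extZero_eq_of_hasLabel_top h, Subgroup.card_top]
  exact represents_symbolFun _ _

include hbar hAB

/-- Both factors are full groups, so x = y = 0 and only the untwisted term is present; hence the
symbol Λ is forced for every parameter of the b-function. -/
theorem typeB_case (T : Series) (t : ℕ) {E : blockSub (⊤ : Subgroup (SignedPerm (Fin a)))
      (⊤ : Subgroup (SignedPerm (Fin b))) → K} (hE : HasBoxLabel ⊤ ⊤ E A₁ A₂ B₁ B₂)
    {X : (⊤ : Subgroup (SignedPerm (Fin a ⊕ Fin b))) → K}
    (hX : (Datum.split a b T t).IsDMinimal bar E X) :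
    HasLabel ⊤ X (odot A₁ B₁) (odot A₂ B₂) ∧
      (Datum.split a b T t).MultMem bar E X (fun _ => True) {1} := by
  obtain ⟨φ, ψ, hφ, hψ, hE⟩ := hE
  obtain ⟨μ, h1, h2⟩ := exists_mult_top (x := 0) hbar (blockSub_le_range _ _) (one_mem _)
    hφ.isLabel hψ.isLabel hAB (card_blockSub_cast _ _) (fun h => absurd rfl h)
    (fun p hp => box_eq_zero hp) (fun E' h => ⟨1, Or.inl rfl, agrees_of_box hE h⟩)
    (fun C₁ C₂ hC => (represents_top hφ).blockSum_twist (represents_top hψ) hC) hX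
  rcases h1 with ⟨h3, rfl⟩ | ⟨h3, -⟩
  · refine ⟨h3, fun E' X' h h' _ => ?_⟩
    exact (h2 E' X' 1 h' (agrees_of_box hE h)).trans (one_mul _)
  · exact absurd rfl h3

/-- Here y = 0, and x is 0 or 1 according to whether A is degenerate. -/
theorem typeC_case {E : blockSub (evenSub (Fin a)) (⊤ : Subgroup (SignedPerm (Fin b))) → K}
    (hE : HasBoxLabel (evenSub _) ⊤ E A₁ A₂ B₁ B₂)
    {X : (⊤ : Subgroup (SignedPerm (Fin a ⊕ Fin b))) → K}
    (hX : (Datum.typeC a b 1).IsDMinimal bar E X) :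
    (A₁ ≠ A₂ → HasLabel ⊤ X (odot A₁ B₁) (odot A₂ B₂) ∨
      HasLabel ⊤ X (odot A₂ B₁) (odot A₁ B₂)) ∧
    (A₁ = A₂ → HasLabel ⊤ X (odot A₁ B₁) (odot A₂ B₂)) ∧
    (Datum.typeC a b 1).MultMem bar E X (fun _ => True) {1} := by
  classical
  obtain ⟨φ, ψ, hφ, hψ, hE⟩ := hE
  obtain ⟨μ, h1, h2⟩ := exists_mult_top (x := if A₁ = A₂ then 0 else 1) hbar
    (blockSub_le_range _ _) (one_mem _) hφ.isLabel hψ.isLabel hAB (card_blockSub_cast _ _)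
    (fun h hd => h (if_pos hd))
    (fun p hp => box_eq_zero hp) (fun E' h => ⟨1, Or.inl rfl, agrees_of_box hE h⟩)
    (fun C₁ C₂ hC => hφ.represents.blockSum_twist (represents_top hψ) hC) hX
  have hmult : μ = 1 → (Datum.typeC a b 1).MultMem bar E X (fun _ => True) {1} := by
    rintro rfl E' X' h h' -
    exact (h2 E' X' 1 h' (agrees_of_box hE h)).trans (one_mul _)
  rcases h1 with ⟨h3, h4⟩ | ⟨hx, h3, h4⟩
  · exact ⟨fun _ => Or.inl h3, fun _ => h3, hmult h4⟩
  · have hd : A₁ ≠ A₂ := fun hd => hx (if_pos hd)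
    rw [if_neg hd] at h4
    exact ⟨fun _ => Or.inr h3, fun h => absurd h hd, hmult h4⟩

/-- Invariance of E makes A non-degenerate, and the coset gives x = -1, y = 0. The value -1 at Λ' is
compensated when the extension has the rows of A exchanged. For ordinary induction, E' is the
irreducible character of W_a × W_b with one of the two orders of the rows of A, so only one symbol
remains. -/
theorem typeC_twisted_case {t : SignedPerm (Fin a)} (ht : t ∉ evenSub (Fin a))
    {E : blockSub (evenSub (Fin a)) (⊤ : Subgroup (SignedPerm (Fin b))) → K}
    (hE : HasBoxLabel (evenSub _) ⊤ E A₁ A₂ B₁ B₂)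
    (hst : IsStable (blockSub (evenSub (Fin a)) ⊤) (blockHom _ _ (t, 1)) E) :
    (∀ X, (Datum.typeC a b (blockHom _ _ (t, 1))).IsDMinimal bar E X →
      (HasLabel ⊤ X (odot A₁ B₁) (odot A₂ B₂) ∨ HasLabel ⊤ X (odot A₂ B₁) (odot A₁ B₂)) ∧
      (Datum.typeC a b (blockHom _ _ (t, 1))).MultMem bar E X (fun _ => True) {1, -1} ∧
      (HasLabel ⊤ X (odot A₁ B₁) (odot A₂ B₂) →
        (Datum.typeC a b (blockHom _ _ (t, 1))).MultMem bar E X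
          (fun E' => IsBoxRestriction _ E' A₁ A₂ B₁ B₂) {1}) ∧
      (HasLabel ⊤ X (odot A₂ B₁) (odot A₁ B₂) →
        (Datum.typeC a b (blockHom _ _ (t, 1))).MultMem bar E X
          (fun E' => IsBoxRestriction _ E' A₂ A₁ B₁ B₂) {1})) ∧
    (∀ E', IsExtension _ (blockHom _ _ (t, 1)) E E' →
      ∀ X, (Datum.typeC a b (blockHom _ _ (t, 1))).ordinary.IsDMinimal bar E' X →
      (HasLabel ⊤ X (odot A₁ B₁) (odot A₂ B₂) ∨ HasLabel ⊤ X (odot A₂ B₁) (odot A₁ B₂)) ∧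
      (Datum.typeC a b (blockHom _ _ (t, 1))).ordinary.MultMem bar E' X (fun _ => True) {1}) := by
  classical
  obtain ⟨φ, ψ, hφ, hψ, hE⟩ := hE
  have hA' := ne_of_isStable_left hφ (hasLabel_iff.1 hψ).1 hE (q := (t, 1)) ht hst
  have hψ' : ∀ y (h : y ∈ (⊤ : Subgroup (SignedPerm (Fin b)))), ψ ⟨y, h⟩ = symbolFun K _ B₁ B₂ y :=
    fun y h => congrFun (hasLabel_top_iff.1 hψ).2 ⟨y, h⟩
  have hform : ∀ E', IsExtension _ (blockHom _ _ (t, 1)) E E' →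
      (∀ p, extZero E' (blockHom _ _ p) = symbolFun K _ A₁ A₂ p.1 * symbolFun K _ B₁ B₂ p.2) ∨
      (∀ p, extZero E' (blockHom _ _ p) = symbolFun K _ A₂ A₁ p.1 * symbolFun K _ B₁ B₂ p.2) := by
    intro E' h
    rcases extension_left ⊤ ht hφ.isLabel (hasLabel_iff.1 hψ).1 h.1 (fun x hx y => by
      rw [box_extZero hE h (blockHom_mem_blockSub.2 ⟨hx, y.2⟩), hφ.extZero_eq hA' hx,
        extZero_of_mem ψ y.2]) with h1 | h1
    · exact Or.inl fun p => (h1 p.1 ⟨p.2, Subgroup.mem_top p.2⟩).trans (by rw [hψ'])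
    · exact Or.inr fun p => (h1 p.1 ⟨p.2, Subgroup.mem_top p.2⟩).trans (by rw [hψ'])
  refine ⟨fun X hX => ?_, fun E' hE' X hX => ?_⟩
  · set Ψ : SignedPerm (Fin a) × SignedPerm (Fin b) → K := fun p =>
      (if p.1 ∈ evenSub (Fin a) then 0 else symbolFun K _ A₁ A₂ p.1) * symbolFun K _ B₁ B₂ p.2
      with hΨ
    have hmem : ∀ p : SignedPerm (Fin a) × SignedPerm (Fin b),
        blockHom _ _ p * (blockHom _ _ (t, 1))⁻¹ ∈
          blockSub (evenSub (Fin a)) (⊤ : Subgroup (SignedPerm (Fin b))) ↔ p.1 ∉ evenSub _ := by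
      intro p
      rw [blockHom_mul_inv, blockHom_mem_blockSub]
      exact (and_iff_left trivial).trans (mul_inv_mem_evenSub_iff ht)
    -- Only values outside W_a' enter, where exchanging the rows of A amounts to σ = -1.
    have hag1 : ∀ E' : adjoin (blockSub (evenSub (Fin a)) ⊤) (blockHom _ _ (t, 1)) → K,
        (∀ p, p.1 ∉ evenSub _ → extZero E' (blockHom _ _ p) =
          symbolFun K _ A₁ A₂ p.1 * symbolFun K _ B₁ B₂ p.2) → AgreesUpTo _ _ 1 Ψ E' := by
      intro E' h p hp
      rw [h p ((hmem p).1 hp), one_mul]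
      simp only [hΨ, if_neg ((hmem p).1 hp)]
    have hag2 : ∀ E' : adjoin (blockSub (evenSub (Fin a)) ⊤) (blockHom _ _ (t, 1)) → K,
        (∀ p, p.1 ∉ evenSub _ → extZero E' (blockHom _ _ p) =
          symbolFun K _ A₂ A₁ p.1 * symbolFun K _ B₁ B₂ p.2) → AgreesUpTo _ _ (-1) Ψ E' := by
      intro E' h p hp
      rw [h p ((hmem p).1 hp), symbolFun_swap_of_notMem ((hmem p).1 hp)]
      simp only [hΨ, if_neg ((hmem p).1 hp)]
      ring
    have hag : ∀ E', IsExtension _ (blockHom _ _ (t, 1)) E E' →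
        ∃ σ : K, (σ = 1 ∨ σ = -1) ∧ AgreesUpTo _ _ σ Ψ E' := by
      intro E' h
      rcases hform E' h with h1 | h1
      · exact ⟨1, Or.inl rfl, hag1 E' fun p _ => h1 p⟩
      · exact ⟨-1, Or.inr rfl, hag2 E' fun p _ => h1 p⟩
    have hbox : ∀ p : SignedPerm (Fin a) × SignedPerm (Fin b), blockHom _ _ p ∈
        adjoin (blockSub (evenSub (Fin a)) ⊤) (blockHom _ _ (t, 1)) := by
      intro p
      rw [adjoin_left ⊤ ht]
      exact blockHom_mem_blockSub.2 ⟨trivial, trivial⟩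
    obtain ⟨μ, h1, h2⟩ := exists_mult_top (x := -1) (Ψ := Ψ) hbar
      (blockSub_le_range _ _) ⟨_, rfl⟩ hφ.isLabel hψ.isLabel hAB (card_blockSub_cast _ _)
      (fun _ => hA')
      (fun p hp => by
        rw [hmem, not_not] at hp
        simp only [hΨ, if_pos hp, zero_mul]) hag
      (fun C₁ C₂ hC => (represents_notMem_evenSub ht A₁ A₂).blockSum_twist
        (by rw [Subgroup.card_top]; exact represents_symbolFun B₁ B₂) hC) hX
    have hAB' : A₂.card = B₁.card := hφ.isLabel.1 ▸ hAB
    have hμ : μ = 1 ∨ μ = -1 := h1.imp (fun h => h.2) fun h => h.2.2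
    refine ⟨h1.imp (fun h => h.1) fun h => h.2.1, fun E' X' h h' _ => ?_, fun hL E' X' h h' hbx => ?_,
      fun hL E' X' h h' hbx => ?_⟩
    · obtain ⟨σ, hσ, h3⟩ := hag E' h
      rw [h2 E' X' σ h' h3]
      rcases hσ with rfl | rfl <;> rcases hμ with rfl | rfl <;> simp
    · rw [h2 E' X' 1 h' (hag1 E' fun p _ => hbx.extZero_eq (hbox p)), one_mul]
      rcases h1 with h3 | ⟨-, h3, -⟩
      · exact h3.2
      · exact absurd (odot_left_cancel hφ.isLabel.1 hAB (hL.pt_eq_top h3).1) hA'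
    · rw [h2 E' X' (-1) h' (hag2 E' fun p _ => hbx.extZero_eq (hbox p))]
      rcases h1 with ⟨h3, -⟩ | ⟨-, -, rfl⟩
      · exact absurd (odot_left_cancel hφ.isLabel.1 hAB (h3.pt_eq_top hL).1) hA'
      · simp
  · have htop : adjoin (blockSub (evenSub (Fin a)) ⊤) (blockHom _ _ (t, 1)) =
        blockSub ⊤ (⊤ : Subgroup (SignedPerm (Fin b))) := adjoin_left ⊤ ht
    have hc : (Nat.card (adjoin (blockSub (evenSub (Fin a)) (⊤ : Subgroup (SignedPerm (Fin b))))
        (blockHom _ _ (t, 1))) : K) = Nat.card (SignedPerm (Fin a)) * Nat.card (SignedPerm (Fin b)) := by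
      rw [htop, card_blockSub_cast, Subgroup.card_top, Subgroup.card_top]
    have hr : adjoin (blockSub (evenSub (Fin a)) ⊤) (blockHom _ _ (t, 1)) ≤
        (blockHom (Fin a) (Fin b)).range := by
      rw [htop]
      exact blockSub_le_range _ _
    have hmem : ∀ p, blockHom (Fin a) (Fin b) p * 1⁻¹ ∈
        adjoin (blockSub (evenSub (Fin a)) ⊤) (blockHom _ _ (t, 1)) := by
      intro p
      rw [htop, inv_one, mul_one]
      exact blockHom_mem_blockSub.2 ⟨trivial, trivial⟩
    have main : ∀ {A₁ A₂ : Finset ℕ}, IsLabel (Fin a) A₁ A₂ → A₁.card = B₁.card →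
        (∀ p, extZero E' (blockHom _ _ p) = symbolFun K _ A₁ A₂ p.1 * symbolFun K _ B₁ B₂ p.2) →
        HasLabel ⊤ X (odot A₁ B₁) (odot A₂ B₂) ∧
        (Datum.typeC a b (blockHom _ _ (t, 1))).ordinary.MultMem bar E' X (fun _ => True) {1} := by
      intro A₁ A₂ hA hAB h
      have hag : ∀ E'', IsExtension _ 1 E' E'' → AgreesUpTo _ 1 1
          (fun p => symbolFun K _ A₁ A₂ p.1 * symbolFun K _ B₁ B₂ p.2) E'' := by
        intro E'' h' p _
        rw [extZero_of_isExtension_one h', h, one_mul]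
      obtain ⟨μ, h1, h2⟩ := exists_mult_top (x := 0) hbar hr (one_mem _) hA hψ.isLabel hAB hc
        (fun h => absurd rfl h) (fun p hp => absurd (hmem p) hp)
        (fun E'' h' => ⟨1, Or.inl rfl, hag E'' h'⟩)
        (fun C₁ C₂ hC => (represents_symbolFun A₁ A₂).blockSum_twist (represents_symbolFun B₁ B₂) hC)
        hX
      rcases h1 with ⟨h3, rfl⟩ | ⟨h3, -⟩
      · exact ⟨h3, fun E'' X' h h' _ => (h2 E'' X' 1 h' (hag E'' h)).trans (one_mul _)⟩
      · exact absurd rfl h3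
    rcases hform E' hE' with h | h
    · obtain ⟨h1, h2⟩ := main hφ.isLabel hAB h
      exact ⟨Or.inl h1, h2⟩
    · obtain ⟨h1, h2⟩ := main hφ.isLabel.swap (hφ.isLabel.1 ▸ hAB) h
      exact ⟨Or.inr h1, h2⟩

end Cases

/-! ### Integrality of the untwisted multiplicities -/

section Natural

variable {K : Type*} [Field K] [IsAlgClosed K] [CharZero K]
variable {α β : Type} [Fintype α] [Fintype β]

/-- It is a scalar product of characters of W_a' × W_b'. Positivity is what separates the two
characters with a degenerate label when one factor is degenerate. -/
theorem exists_blockSum_eq_natCast {φ : evenSub α → K} {ψ : evenSub β → K}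
    {X : evenSub (α ⊕ β) → K} (hφ : IsIrrChar φ) (hψ : IsIrrChar ψ) (hX : IsIrrChar X) :
    ∃ n : ℕ, blockSum (Nat.card (evenSub α) * Nat.card (evenSub β) : K)
      (fun p => extZero φ p.1 * extZero ψ p.2) (extZero X) = n := by
  classical
  set R := (evenSub α).prod (evenSub β) with hR
  have hmem : ∀ p : R, blockHom α β p ∈ evenSub (α ⊕ β) := fun p =>
    blockHom_mem_evenSub.2 ⟨fun _ => p.2.2, fun _ => p.2.1⟩
  set f : R → K := fun p => φ ⟨p.1.1, p.2.1⟩ * ψ ⟨p.1.2, p.2.2⟩ with hf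
  have h1 : IsIrrChar f := (hφ.prod hψ).comp_surjective
    (Subgroup.prodEquiv (evenSub α) (evenSub β)).toMonoidHom (MulEquiv.surjective _)
  have h2 := hX.isChar.comp (((blockHom α β).comp R.subtype).codRestrict _ hmem)
  obtain ⟨n, hn⟩ := h1.isChar.exists_cinner h2
  refine ⟨n, ?_⟩
  rw [← hn, cinner_eq, blockSum]
  have hc : (Nat.card R : K) = Nat.card (evenSub α) * Nat.card (evenSub β) := by
    rw [hR, Nat.card_congr (Subgroup.prodEquiv (evenSub α) (evenSub β)).toEquiv, Nat.card_prod,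
      Nat.cast_mul]
  rw [hc]
  congr 1
  have h3 := sum_subgroup_eq f fun p => extZero X (blockHom α β p⁻¹)
  have h4 : ∀ p, extZero f p = extZero φ p.1 * extZero ψ p.2 := by
    intro p
    by_cases hp : p ∈ R
    · rw [extZero_of_mem f hp, extZero_of_mem φ hp.1, extZero_of_mem ψ hp.2]
    · rw [extZero_of_notMem f hp]
      rw [hR, Subgroup.mem_prod, not_and_or] at hp
      rcases hp with h | h
      · rw [extZero_of_notMem φ h, zero_mul]
      · rw [extZero_of_notMem ψ h, mul_zero]
  simp only [h4] at h3
  rw [← h3]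
  refine Finset.sum_congr rfl fun p _ => ?_
  congr 1
  exact extZero_of_mem X (hmem p⁻¹)

end Natural

/-! ### Type `D` with trivial F_w and type `D` with non-trivial F -/

section Cases

variable {K : Type*} [Field K] [IsAlgClosed K] [CharZero K] {bar : K ≃+* K}
  {a b : ℕ} {A₁ A₂ B₁ B₂ : Finset ℕ}
  (hbar : ∀ (ω : K) (k : ℕ), 0 < k → ω ^ k = 1 → bar ω = ω⁻¹) (hAB : A₁.card = B₁.card)

theorem blockSub_even_le : blockSub (evenSub (Fin a)) (evenSub (Fin b)) ≤
    evenSub (Fin a ⊕ Fin b) := by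
  rintro _ ⟨p, hp, rfl⟩
  exact blockHom_mem_evenSub.2 ⟨fun _ => hp.2, fun _ => hp.1⟩

theorem blockHom_notMem_evenSub {t : SignedPerm (Fin a)} (ht : t ∉ evenSub (Fin a)) :
    blockHom (Fin a) (Fin b) (t, 1) ∉ evenSub (Fin a ⊕ Fin b) := fun h =>
  ht ((blockHom_mem_evenSub.1 h).2 (one_mem _))

theorem blockHom_notMem_evenSub' {t : SignedPerm (Fin b)} (ht : t ∉ evenSub (Fin b)) :
    blockHom (Fin a) (Fin b) (1, t) ∉ evenSub (Fin a ⊕ Fin b) := fun h =>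
  ht ((blockHom_mem_evenSub.1 h).1 (one_mem _))

include hbar hAB

/-- With a degenerate factor one of x, y is 0, so the coefficient xy of the double twist vanishes
and the multiplicities at a degenerate Λ add up to 1, not 2. -/
theorem typeD_case_of_degenerate {E : blockSub (evenSub (Fin a)) (evenSub (Fin b)) → K}
    (hE : HasBoxLabel (evenSub _) (evenSub _) E A₁ A₂ B₁ B₂) (hd : A₁ = A₂ ∨ B₁ = B₂) :
    (∀ X, (Datum.typeD a b 1 1).IsDMinimal bar E X →
      HasLabel (evenSub _) X (odot A₁ B₁) (odot A₂ B₂) ∧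
      (Datum.typeD a b 1 1).MultMem bar E X (fun _ => True) {1}) ∧
    (Datum.typeD a b 1 1).DegenerateClause bar E A₁ A₂ B₁ B₂ := by
  classical
  obtain ⟨φ, ψ, hφ, hψ, hE⟩ := hE
  set c : K := Nat.card (evenSub (Fin a)) * Nat.card (evenSub (Fin b)) with hc
  set Ψ : SignedPerm (Fin a) × SignedPerm (Fin b) → K := fun p => extZero φ p.1 * extZero ψ p.2
    with hΨ
  set x : K := if A₁ = A₂ then 0 else 1 with hx
  set y : K := if B₁ = B₂ then 0 else 1 with hy
  have hA := hφ.isLabel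
  have hB := hψ.isLabel
  have hxy : x * y = 0 := by
    rcases hd with h | h
    · rw [hx, if_pos h, zero_mul]
    · rw [hy, if_pos h, mul_zero]
  have hx' : x ≠ 0 → A₁ ≠ A₂ := fun h h' => h (if_pos h')
  have hy' : y ≠ 0 → B₁ ≠ B₂ := fun h h' => h (if_pos h')
  have hΨ0 : ∀ p, blockHom (Fin a) (Fin b) p * 1⁻¹ ∉ blockSub (evenSub _) (evenSub _) → Ψ p = 0 :=
    fun p hp => box_eq_zero hp
  have hΨe := blockSum_support blockSub_even_le (one_mem _) hΨ0
  have hsum : ∀ C₁ C₂, IsLabel (Fin a ⊕ Fin b) C₁ C₂ → blockSum c Ψ (symbolFun K _ C₁ C₂) =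
      twistSum K (Fin a) (Fin b) A₁ A₂ B₁ B₂ 1 x y 0 C₁ C₂ := fun C₁ C₂ hC => by
    rw [← hxy]
    exact hφ.represents.blockSum_twist hψ.represents hC
  have key : ∀ E' X X', IsExtension _ 1 E E' → IsExtension (evenSub (Fin a ⊕ Fin b)) 1 X X' →
      mult bar (evenSub _) (blockSub (evenSub (Fin a)) (evenSub (Fin b))) 1 1 E' X' =
        blockSum c Ψ (extZero X) := fun E' X X' h h' =>
    (mult_one_eq hbar blockSub_even_le (one_mem _) (blockSub_le_range _ _) (one_mem _)
      (card_blockSub_cast _ _) hΨ0 (agrees_of_box hE h) h').trans (one_mul _)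
  set m : (evenSub (Fin a ⊕ Fin b) → K) → K := fun X => blockSum c Ψ (extZero X) with hm
  have hnat : ∀ X, IsIrrChar X → ∃ n : ℕ, m X = n := fun X hX =>
    exists_blockSum_eq_natCast (hasLabel_iff.1 hφ).1 (hasLabel_iff.1 hψ).1 hX
  have hm1 : ∀ X C₁ C₂, HasLabel (evenSub (Fin a ⊕ Fin b)) X C₁ C₂ →
      (pt C₁ ≠ pt C₂ ∨ ∀ t, t ∈ evenSub (Fin a ⊕ Fin b)) →
      m X = twistSum K (Fin a) (Fin b) A₁ A₂ B₁ B₂ 1 x y 0 C₁ C₂ := fun X C₁ C₂ hC h =>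
    (blockSum_extZero hΨe hC h).trans (hsum _ _ hC.isLabel)
  have hm2 : ∀ X C₁ C₂, HasLabel (evenSub (Fin a ⊕ Fin b)) X C₁ C₂ → pt C₁ = pt C₂ →
      ∀ t, t ∉ evenSub (Fin a ⊕ Fin b) → m X + m (conjFn t X) =
        twistSum K (Fin a) (Fin b) A₁ A₂ B₁ B₂ 1 x y 0 C₁ C₂ := fun X C₁ C₂ hC h t ht =>
    (blockSum_extZero_add hΨe hC h ht).trans (hsum _ _ hC.isLabel)
  -- The clause on degenerate labels asserts existence of a minimal character, so it must be known
  -- that E has an extension.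
  have hEirr : IsIrrChar E := by
    set e := (Subgroup.equivMapOfInjective ((evenSub (Fin a)).prod (evenSub (Fin b))) _
      blockHom_injective) with he
    have h1 := ((hasLabel_iff.1 hφ).1.prod (hasLabel_iff.1 hψ).1).comp_surjective
      (e.symm.trans (Subgroup.prodEquiv _ _)).toMonoidHom (MulEquiv.surjective _)
    refine (congrArg IsIrrChar (funext fun z => ?_)).mpr h1
    obtain ⟨w, rfl⟩ := e.surjective z
    have h2 : e.symm (e w) = w := e.symm_apply_apply w
    refine (hE ⟨w.1.1, w.2.1⟩ ⟨w.1.2, w.2.2⟩).trans ?_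
    change _ = φ (Subgroup.prodEquiv _ _ (e.symm (e w))).1 *
      ψ (Subgroup.prodEquiv _ _ (e.symm (e w))).2
    rw [h2]
    rfl
  have hiff : ∀ X, (Datum.typeD a b 1 1).IsDMinimal bar E X ↔ MinFor .D 0 (fun _ => True) m X :=
    fun X => isDMinimal_iff (D := Datum.typeD a b 1 1) (bar := bar) (E := E) (m := m)
      (P := fun _ => True) (exists_extension_one hEirr)
      (fun X hX _ => exists_extension_one hX)
      (fun X _ => ⟨fun _ => trivial, fun _ => isStable_one _ X⟩)
      (fun X _ _ E' X' h h' => Or.inl (key E' X X' h h')) X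
  refine ⟨fun X hX => ?_, fun C hC => ⟨fun _ => ?_, fun h => absurd hd (not_or.2 h)⟩⟩
  · obtain ⟨h1, h2⟩ := ((hiff X).1 hX).even_of_degenerate hA hB hAB hd hx' hy' hnat hm1 hm2
    exact ⟨h1, fun E' X' h h' _ => (key E' X X' h h').trans h2⟩
  -- If Y is given as Λ', it is also Λ, since the two agree up to the order of the equal rows.
  · have h1 : odot A₁ B₁ = C ∧ odot A₂ B₂ = C := by
      rcases hC with h | h
      · exact h
      · rcases odot_swap_of_degenerate (K := K) hA hB hAB hd hx' hy' with ⟨h1, h2⟩ | ⟨h1, h2⟩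
        · exact ⟨h1 ▸ h.1, h2 ▸ h.2⟩
        · exact ⟨h2 ▸ h.2, h1 ▸ h.1⟩
    simp only [hiff]
    exact existsUnique_minFor_of_degenerate hA hB hAB hd hx' hy' hnat hm1 hm2 h1.1 h1.2

theorem typeD_case {E : blockSub (evenSub (Fin a)) (evenSub (Fin b)) → K}
    (hE : HasBoxLabel (evenSub _) (evenSub _) E A₁ A₂ B₁ B₂) :
    (∀ X, (Datum.typeD a b 1 1).IsDMinimal bar E X →
      ((A₁ ≠ A₂ ∨ B₁ ≠ B₂) → HasLabel (evenSub _) X (odot A₁ B₁) (odot A₂ B₂) ∨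
        HasLabel (evenSub _) X (odot A₂ B₁) (odot A₁ B₂)) ∧
      ((A₁ = A₂ ∧ B₁ = B₂) → HasLabel (evenSub _) X (odot A₁ B₁) (odot A₂ B₂)) ∧
      (Datum.typeD a b 1 1).MultMem bar E X (fun _ => True) {1}) ∧
    (Datum.typeD a b 1 1).DegenerateClause bar E A₁ A₂ B₁ B₂ := by
  classical
  by_cases hd : A₁ = A₂ ∨ B₁ = B₂
  · obtain ⟨h1, h2⟩ := typeD_case_of_degenerate hbar hAB hE hd
    exact ⟨fun X hX => ⟨fun _ => Or.inl (h1 X hX).1, fun _ => (h1 X hX).1, (h1 X hX).2⟩, h2⟩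
  · rw [not_or] at hd
    obtain ⟨φ, ψ, hφ, hψ, hE⟩ := hE
    -- A non-degenerate label of the first factor requires an odd element there.
    obtain ⟨t, ht⟩ : ∃ t, t ∉ evenSub (Fin a) := by
      by_contra! h
      exact hd.1 (eq_of_pt_eq hφ.isLabel.1 (pt_eq_of_forall_mem_evenSub h hφ.isLabel))
    obtain ⟨h1, h2⟩ := exists_mult_even (x := 1) (q := (t, 1)) hbar blockSub_even_le (one_mem _)
      (blockSub_le_range _ _) (one_mem _) hφ.isLabel hψ.isLabel hAB hd.1 hd.2
      (card_blockSub_cast _ _) (fun p hp => box_eq_zero hp)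
      (fun E' h => ⟨1, Or.inl rfl, agrees_of_box hE h⟩)
      (fun C₁ C₂ hC => by
        have h := hφ.represents.blockSum_twist hψ.represents hC
        rwa [if_neg hd.1, if_neg hd.2, mul_one] at h)
      (blockHom_notMem_evenSub ht)
      (fun p => congrArg₂ (· * ·) (hφ.extZero_conj hd.1 t p.1) (hψ.extZero_conj hd.2 1 p.2))
    refine ⟨fun X hX => ?_, h2⟩
    obtain ⟨μ, h3, h4⟩ := h1 X hX
    have hμ : μ = 1 := h3.elim (fun h => h.2) fun h => h.2.2
    refine ⟨fun _ => h3.imp (fun h => h.1) fun h => h.2.1, fun h => absurd h.1 hd.1,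
      fun E' X' h h' _ => ?_⟩
    exact (h4 E' X' 1 h' (agrees_of_box hE h)).trans ((one_mul _).trans hμ)

/-- Non-trivial `F`, where `F_w` acts on the first factor. -/
theorem typeD_left_case {f : SignedPerm (Fin a ⊕ Fin b)} (hf : f ∉ evenSub (Fin a ⊕ Fin b))
    {t : SignedPerm (Fin a)} (ht : t ∉ evenSub (Fin a))
    {E : blockSub (evenSub (Fin a)) (evenSub (Fin b)) → K}
    (hE : HasBoxLabel (evenSub _) (evenSub _) E A₁ A₂ B₁ B₂)
    (hst : IsStable (blockSub (evenSub (Fin a)) (evenSub (Fin b))) (blockHom _ _ (t, 1)) E)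
    (hne : odot A₁ B₁ ≠ odot A₂ B₂ ∨ odot A₂ B₁ ≠ odot A₁ B₂) {X : evenSub (Fin a ⊕ Fin b) → K}
    (hX : (Datum.typeD a b f (blockHom _ _ (t, 1))).IsDMinimal bar E X) :
    (HasLabel (evenSub _) X (odot A₁ B₁) (odot A₂ B₂) ∨
      HasLabel (evenSub _) X (odot A₂ B₁) (odot A₁ B₂)) ∧
    (Datum.typeD a b f (blockHom _ _ (t, 1))).MultMem bar E X (fun _ => True) {1, -1} := by
  classical
  obtain ⟨φ, ψ, hφ, hψ, hE⟩ := hE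
  have hA' := ne_of_isStable_left hφ (hasLabel_iff.1 hψ).1 hE (q := (t, 1)) ht hst
  set Ψ : SignedPerm (Fin a) × SignedPerm (Fin b) → K := fun p =>
    (if p.1 ∈ evenSub (Fin a) then 0 else symbolFun K _ A₁ A₂ p.1) * extZero ψ p.2 with hΨ
  have hmem : ∀ p : SignedPerm (Fin a) × SignedPerm (Fin b),
      blockHom _ _ p * (blockHom _ _ (t, 1))⁻¹ ∈ blockSub (evenSub (Fin a)) (evenSub (Fin b)) ↔
        p.1 ∉ evenSub _ ∧ p.2 ∈ evenSub _ := by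
    intro p
    rw [blockHom_mul_inv, blockHom_mem_blockSub]
    exact and_congr (mul_inv_mem_evenSub_iff ht) (by simp)
  -- The first factor ranges over the odd coset, the second over W_b', whence y depends on whether B
  -- is degenerate.
  refine mult_stable (x := -1) (y := if B₁ = B₂ then 0 else 1) (Ψ := Ψ) hbar blockSub_even_le hf
    (blockHom_notMem_evenSub ht) (blockSub_le_range _ _) ⟨_, rfl⟩ hφ.isLabel hψ.isLabel hAB ?_ hne
    (card_blockSub_cast _ _) (fun p hp => ?_) (fun E' h => ?_)
    (fun C₁ C₂ hC => (represents_notMem_evenSub ht A₁ A₂).blockSum_twist hψ.represents hC) hX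
  · by_cases hB' : B₁ = B₂
    · refine Or.inr ⟨Or.inr hB', by rw [if_pos hB', mul_zero], fun _ => hA', fun h => ?_⟩
      exact absurd (if_pos hB') h
    · exact Or.inl ⟨hA', hB', Or.inr rfl⟩
  · rw [hmem, not_and_or, not_not] at hp
    rcases hp with h | h
    · simp only [hΨ, if_pos h, zero_mul]
    · simp only [hΨ, extZero_of_notMem ψ h, mul_zero]
  · rcases extension_left _ ht hφ.isLabel (hasLabel_iff.1 hψ).1 h.1 (fun x hx y => by
      rw [box_extZero hE h (blockHom_mem_blockSub.2 ⟨hx, y.2⟩), hφ.extZero_eq hA' hx,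
        extZero_of_mem ψ y.2]) with h1 | h1
    · refine ⟨1, Or.inl rfl, fun p hp => ?_⟩
      obtain ⟨h2, h3⟩ := (hmem p).1 hp
      simp only [hΨ, if_neg h2, extZero_of_mem ψ h3, one_mul]
      exact h1 p.1 ⟨p.2, h3⟩
    · refine ⟨-1, Or.inr rfl, fun p hp => ?_⟩
      obtain ⟨h2, h3⟩ := (hmem p).1 hp
      have h4 := h1 p.1 ⟨p.2, h3⟩
      rw [symbolFun_swap_of_notMem h2] at h4
      simp only [hΨ, if_neg h2, extZero_of_mem ψ h3]
      rw [h4]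
      ring

/-- Non-trivial `F`, where `F_w` acts on the second factor. -/
theorem typeD_right_case {f : SignedPerm (Fin a ⊕ Fin b)} (hf : f ∉ evenSub (Fin a ⊕ Fin b))
    {t : SignedPerm (Fin b)} (ht : t ∉ evenSub (Fin b))
    {E : blockSub (evenSub (Fin a)) (evenSub (Fin b)) → K}
    (hE : HasBoxLabel (evenSub _) (evenSub _) E A₁ A₂ B₁ B₂)
    (hst : IsStable (blockSub (evenSub (Fin a)) (evenSub (Fin b))) (blockHom _ _ (1, t)) E)
    (hne : odot A₁ B₁ ≠ odot A₂ B₂ ∨ odot A₂ B₁ ≠ odot A₁ B₂) {X : evenSub (Fin a ⊕ Fin b) → K}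
    (hX : (Datum.typeD a b f (blockHom _ _ (1, t))).IsDMinimal bar E X) :
    (HasLabel (evenSub _) X (odot A₁ B₁) (odot A₂ B₂) ∨
      HasLabel (evenSub _) X (odot A₂ B₁) (odot A₁ B₂)) ∧
    (Datum.typeD a b f (blockHom _ _ (1, t))).MultMem bar E X (fun _ => True) {1, -1} := by
  classical
  obtain ⟨φ, ψ, hφ, hψ, hE⟩ := hE
  have hB' := ne_of_isStable_right (hasLabel_iff.1 hφ).1 hψ hE (q := (1, t)) ht hst
  set Ψ : SignedPerm (Fin a) × SignedPerm (Fin b) → K := fun p =>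
    extZero φ p.1 * (if p.2 ∈ evenSub (Fin b) then 0 else symbolFun K _ B₁ B₂ p.2) with hΨ
  have hmem : ∀ p : SignedPerm (Fin a) × SignedPerm (Fin b),
      blockHom _ _ p * (blockHom _ _ (1, t))⁻¹ ∈ blockSub (evenSub (Fin a)) (evenSub (Fin b)) ↔
        p.1 ∈ evenSub _ ∧ p.2 ∉ evenSub _ := by
    intro p
    rw [blockHom_mul_inv, blockHom_mem_blockSub]
    exact and_congr (by simp) (mul_inv_mem_evenSub_iff ht)
  refine mult_stable (x := if A₁ = A₂ then 0 else 1) (y := -1) (Ψ := Ψ) hbar blockSub_even_le hf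
    (blockHom_notMem_evenSub' ht) (blockSub_le_range _ _) ⟨_, rfl⟩ hφ.isLabel hψ.isLabel hAB ?_ hne
    (card_blockSub_cast _ _) (fun p hp => ?_) (fun E' h => ?_)
    (fun C₁ C₂ hC => hφ.represents.blockSum_twist (represents_notMem_evenSub ht B₁ B₂) hC) hX
  · by_cases hA' : A₁ = A₂
    · refine Or.inr ⟨Or.inl hA', by rw [if_pos hA', zero_mul], fun h => ?_, fun _ => hB'⟩
      exact absurd (if_pos hA') h
    · exact Or.inl ⟨hA', hB', Or.inl (if_neg hA')⟩
  · rw [hmem, not_and_or, not_not] at hp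
    rcases hp with h | h
    · simp only [hΨ, extZero_of_notMem φ h, zero_mul]
    · simp only [hΨ, if_pos h, mul_zero]
  · rcases extension_right _ ht hψ.isLabel (hasLabel_iff.1 hφ).1 h.1 (fun x y hy => by
      rw [box_extZero hE h (blockHom_mem_blockSub.2 ⟨x.2, hy⟩), hψ.extZero_eq hB' hy,
        extZero_of_mem φ x.2]) with h1 | h1
    · refine ⟨1, Or.inl rfl, fun p hp => ?_⟩
      obtain ⟨h2, h3⟩ := (hmem p).1 hp
      simp only [hΨ, if_neg h3, extZero_of_mem φ h2, one_mul]
      exact h1 ⟨p.1, h2⟩ p.2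
    · refine ⟨-1, Or.inr rfl, fun p hp => ?_⟩
      obtain ⟨h2, h3⟩ := (hmem p).1 hp
      have h4 := h1 ⟨p.1, h2⟩ p.2
      rw [symbolFun_swap_of_notMem h3] at h4
      simp only [hΨ, if_neg h3, extZero_of_mem φ h2]
      rw [h4]
      ring

end Cases

/-! ### Type `D` with F_w = γ_a × γ_b -/

variable {K : Type*} [Field K] [IsAlgClosed K] [CharZero K] {bar : K ≃+* K}
  {a b : ℕ} {A₁ A₂ B₁ B₂ : Finset ℕ}

/-- Exchanging A₁ and A₂ exchanges Λ and Λ', and the clause treats them alike. -/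
theorem Datum.DegenerateClause.swap {D : Datum a b} {E : D.H → K}
    (h : D.DegenerateClause bar E A₂ A₁ B₁ B₂) : D.DegenerateClause bar E A₁ A₂ B₁ B₂ :=
  fun C hC => ⟨fun hd => (h C hC.symm).1 (hd.imp_left Eq.symm),
    fun hd => (h C hC.symm).2 ⟨hd.1.symm, hd.2⟩⟩

theorem symbolFun_conj {ι : Type} [Fintype ι] (h : IsLabel ι A₁ A₂) (t x : SignedPerm ι) :
    symbolFun K ι A₁ A₂ (t⁻¹ * x * t) = symbolFun K ι A₁ A₂ x :=
  (isClassFn_symbolFun h.2).conj' _ _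

theorem conj_mem_evenSub_iff {ι : Type} [Fintype ι] (t x : SignedPerm ι) :
    t⁻¹ * x * t ∈ evenSub ι ↔ x ∈ evenSub ι := by
  have := (inferInstance : (evenSub ι).Normal).mem_comm_iff (a := t⁻¹ * x) (b := t)
  rwa [mul_inv_cancel_left] at this

/-- The pairing with the restriction of an irreducible character to the elements with an even
number of signs. -/
theorem blockSum_even {α β : Type} [Fintype α] [Fintype β] {t : SignedPerm α} (ht : t ∉ evenSub α)
    (A₁ A₂ B₁ B₂ : Finset ℕ) {C₁ C₂ : Finset ℕ} (hC : IsLabel (α ⊕ β) C₁ C₂)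
    [DecidablePred fun p : SignedPerm α × SignedPerm β =>
      p ∈ (evenSub (α ⊕ β)).comap (blockHom α β)] :
    blockSum (Nat.card ((evenSub (α ⊕ β)).comap (blockHom α β)) : K)
      (fun p => if p ∈ (evenSub (α ⊕ β)).comap (blockHom α β) then
        symbolFun K α A₁ A₂ p.1 * symbolFun K β B₁ B₂ p.2 else 0) (symbolFun K (α ⊕ β) C₁ C₂) =
      twistSum K α β A₁ A₂ B₁ B₂ 1 0 0 1 C₁ C₂ := by
  have h := represents_ker (ε := (signProdHom K (α ⊕ β)).comp (blockHom α β))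
    (N := (evenSub (α ⊕ β)).comap (blockHom α β)) (t := (t, 1))
    (fun p => signProdHom_eq_or _) (fun p => by
      rw [Subgroup.mem_comap, mem_evenSub_iff (K := K)]; rfl)
    (by
      rw [Subgroup.mem_comap, blockHom_mem_evenSub]
      exact fun h => ht (h.2 (one_mem _)))
    (fun p : SignedPerm α × SignedPerm β => symbolFun K α A₁ A₂ p.1 * symbolFun K β B₁ B₂ p.2)
  have h3 : (fun p : SignedPerm α × SignedPerm β =>
      ((signProdHom K (α ⊕ β)).comp (blockHom α β)) p *
        (symbolFun K α A₁ A₂ p.1 * symbolFun K β B₁ B₂ p.2)) =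
      fun p => symbolFun K α A₂ A₁ p.1 * symbolFun K β B₂ B₁ p.2 := by
    ext p
    rw [MonoidHom.comp_apply, signProdHom_blockHom, symbolFun_swap A₁ A₂, symbolFun_swap B₁ B₂]
    ring
  rw [h.blockSum_eq (isClassFn_symbolFun hC.2), h3, cinner_add_left, cinner_comm,
    cinner_comm (fun p : SignedPerm α × SignedPerm β => symbolFun K α A₂ A₁ p.1 *
      symbolFun K β B₂ B₁ p.2), twistSum, blockMult, blockMult, blockMult,
    blockMult]
  ring

variable (hbar : ∀ (ω : K) (k : ℕ), 0 < k → ω ^ k = 1 → bar ω = ω⁻¹) (hAB : A₁.card = B₁.card)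

include hbar hAB

/-- Invariance of E makes both factors non-degenerate, since `t` and `s` are both odd. An extension
of E is, on H⟨v⟩, a box product with one of the two orders of the rows of A. -/
theorem typeD_twisted_case {t : SignedPerm (Fin a)} (ht : t ∉ evenSub (Fin a))
    {s : SignedPerm (Fin b)} (hs : s ∉ evenSub (Fin b))
    {E : blockSub (evenSub (Fin a)) (evenSub (Fin b)) → K}
    (hE : HasBoxLabel (evenSub _) (evenSub _) E A₁ A₂ B₁ B₂)
    (hst : IsStable (blockSub (evenSub (Fin a)) (evenSub (Fin b))) (blockHom _ _ (t, s)) E) :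
    (∀ X, (Datum.typeD a b 1 (blockHom _ _ (t, s))).IsDMinimal bar E X →
      (HasLabel (evenSub _) X (odot A₁ B₁) (odot A₂ B₂) ∨
        HasLabel (evenSub _) X (odot A₂ B₁) (odot A₁ B₂)) ∧
      (Datum.typeD a b 1 (blockHom _ _ (t, s))).MultMem bar E X (fun _ => True) {1, -1} ∧
      (HasLabel (evenSub _) X (odot A₁ B₁) (odot A₂ B₂) →
        (Datum.typeD a b 1 (blockHom _ _ (t, s))).MultMem bar E X
          (fun E' => IsBoxRestriction _ E' A₁ A₂ B₁ B₂) {1}) ∧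
      (HasLabel (evenSub _) X (odot A₂ B₁) (odot A₁ B₂) →
        (Datum.typeD a b 1 (blockHom _ _ (t, s))).MultMem bar E X
          (fun E' => IsBoxRestriction _ E' A₂ A₁ B₁ B₂) {1})) ∧
    (Datum.typeD a b 1 (blockHom _ _ (t, s))).DegenerateClause bar E A₁ A₂ B₁ B₂ ∧
    (∀ E', IsExtension _ (blockHom _ _ (t, s)) E E' →
      (∀ X, (Datum.typeD a b 1 (blockHom _ _ (t, s))).ordinary.IsDMinimal bar E' X →
        (HasLabel (evenSub _) X (odot A₁ B₁) (odot A₂ B₂) ∨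
          HasLabel (evenSub _) X (odot A₂ B₁) (odot A₁ B₂)) ∧
        (Datum.typeD a b 1 (blockHom _ _ (t, s))).ordinary.MultMem bar E' X (fun _ => True) {1}) ∧
      (Datum.typeD a b 1 (blockHom _ _ (t, s))).ordinary.DegenerateClause bar E' A₁ A₂ B₁ B₂) := by
  classical
  obtain ⟨φ, ψ, hφ, hψ, hE⟩ := hE
  have hA := hφ.isLabel
  have hB := hψ.isLabel
  have hA' := ne_of_isStable_left hφ (hasLabel_iff.1 hψ).1 hE (q := (t, s)) ht hst
  have hB' := ne_of_isStable_right (hasLabel_iff.1 hφ).1 hψ hE (q := (t, s)) hs hst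
  have hts : blockHom (Fin a) (Fin b) (t, s) ∈ evenSub (Fin a ⊕ Fin b) :=
    blockHom_mem_evenSub.2 ⟨fun h => absurd h ht, fun h => absurd h hs⟩
  have hform : ∀ E', IsExtension _ (blockHom _ _ (t, s)) E E' →
      (∀ x y, (x ∈ evenSub (Fin a) ↔ y ∈ evenSub (Fin b)) →
        extZero E' (blockHom _ _ (x, y)) = symbolFun K _ A₁ A₂ x * symbolFun K _ B₁ B₂ y) ∨
      (∀ x y, (x ∈ evenSub (Fin a) ↔ y ∈ evenSub (Fin b)) →
        extZero E' (blockHom _ _ (x, y)) = symbolFun K _ A₂ A₁ x * symbolFun K _ B₁ B₂ y) :=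
    fun E' h => extension_both ht hs hA hB hA' h.1 fun x hx y hy => by
      rw [box_extZero hE h (blockHom_mem_blockSub.2 ⟨hx, hy⟩), hφ.extZero_eq hA' hx,
        hψ.extZero_eq hB' hy]
  have hadj := adjoin_both ht hs
  have hmemS : ∀ p : SignedPerm (Fin a) × SignedPerm (Fin b), blockHom _ _ p ∈
      adjoin (blockSub (evenSub (Fin a)) (evenSub (Fin b))) (blockHom _ _ (t, s)) ↔
        (p.1 ∈ evenSub (Fin a) ↔ p.2 ∈ evenSub (Fin b)) := by
    intro p
    rw [hadj, Subgroup.mem_map_iff_mem blockHom_injective, Subgroup.mem_comap,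
      blockHom_mem_evenSub]
  set Ψ : SignedPerm (Fin a) × SignedPerm (Fin b) → K := fun p =>
    (if p.1 ∈ evenSub (Fin a) then 0 else symbolFun K _ A₁ A₂ p.1) *
      (if p.2 ∈ evenSub (Fin b) then 0 else symbolFun K _ B₁ B₂ p.2) with hΨ
  have hmem : ∀ p : SignedPerm (Fin a) × SignedPerm (Fin b),
      blockHom _ _ p * (blockHom _ _ (t, s))⁻¹ ∈ blockSub (evenSub (Fin a)) (evenSub (Fin b)) ↔
        p.1 ∉ evenSub _ ∧ p.2 ∉ evenSub _ := by
    intro p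
    rw [blockHom_mul_inv, blockHom_mem_blockSub]
    exact and_congr (mul_inv_mem_evenSub_iff ht) (mul_inv_mem_evenSub_iff hs)
  have hag1 : ∀ E' : adjoin (blockSub (evenSub (Fin a)) (evenSub (Fin b))) (blockHom _ _ (t, s)) → K,
      (∀ x y, (x ∈ evenSub (Fin a) ↔ y ∈ evenSub (Fin b)) → extZero E' (blockHom _ _ (x, y)) =
        symbolFun K _ A₁ A₂ x * symbolFun K _ B₁ B₂ y) → AgreesUpTo _ _ 1 Ψ E' := by
    intro E' h p hp
    obtain ⟨h1, h2⟩ := (hmem p).1 hp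
    simp only [hΨ, if_neg h1, if_neg h2, one_mul]
    exact h p.1 p.2 ⟨fun h => absurd h h1, fun h => absurd h h2⟩
  have hag2 : ∀ E' : adjoin (blockSub (evenSub (Fin a)) (evenSub (Fin b))) (blockHom _ _ (t, s)) → K,
      (∀ x y, (x ∈ evenSub (Fin a) ↔ y ∈ evenSub (Fin b)) → extZero E' (blockHom _ _ (x, y)) =
        symbolFun K _ A₂ A₁ x * symbolFun K _ B₁ B₂ y) → AgreesUpTo _ _ (-1) Ψ E' := by
    intro E' h p hp
    obtain ⟨h1, h2⟩ := (hmem p).1 hp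
    have h3 := h p.1 p.2 ⟨fun h => absurd h h1, fun h => absurd h h2⟩
    rw [symbolFun_swap_of_notMem h1] at h3
    simp only [hΨ, if_neg h1, if_neg h2]
    rw [h3]
    ring
  have hag : ∀ E', IsExtension _ (blockHom _ _ (t, s)) E E' →
      ∃ σ : K, (σ = 1 ∨ σ = -1) ∧ AgreesUpTo _ _ σ Ψ E' := by
    intro E' h
    rcases hform E' h with h1 | h1
    · exact ⟨1, Or.inl rfl, hag1 E' h1⟩
    · exact ⟨-1, Or.inr rfl, hag2 E' h1⟩
  -- Both factors range over their odd cosets, so x = y = -1 and the double twist has coefficient 1.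
  obtain ⟨h1, hdeg⟩ := exists_mult_even (x := -1) (Ψ := Ψ) (q := (t, 1)) hbar blockSub_even_le hts
    (blockSub_le_range _ _) ⟨_, rfl⟩ hA hB hAB hA' hB' (card_blockSub_cast _ _)
    (fun p hp => by
      rw [hmem, not_and_or, not_not, not_not] at hp
      rcases hp with h | h
      · simp only [hΨ, if_pos h, zero_mul]
      · simp only [hΨ, if_pos h, mul_zero]) hag
    (fun C₁ C₂ hC => by
      have h := (represents_notMem_evenSub (K := K) ht A₁ A₂).blockSum_twist
        (represents_notMem_evenSub hs B₁ B₂) hC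
      rwa [neg_mul_neg, one_mul] at h)
    (blockHom_notMem_evenSub ht)
    (fun p => by
      simp only [hΨ, Prod.fst_mul, Prod.snd_mul, Prod.fst_inv, Prod.snd_inv, conj_mem_evenSub_iff,
        symbolFun_conj hA, symbolFun_conj hB])
  have hAB' : A₂.card = B₁.card := hA.1 ▸ hAB
  -- Up to the order of the rows, Λ = Λ' would make A or B degenerate, so the two values of the
  -- multiplicity cannot compete.
  have hdisj : ∀ X, HasLabel (evenSub (Fin a ⊕ Fin b)) (X : _ → K) (odot A₁ B₁) (odot A₂ B₂) →
      HasLabel (evenSub _) X (odot A₂ B₁) (odot A₁ B₂) → False := by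
    intro X h2 h3
    rcases h2.unique h3 with ⟨h4, -⟩ | ⟨h4, -⟩
    · exact hA' (odot_left_cancel hA.1 hAB h4)
    · exact hB' (odot_right_cancel hB.1 hAB h4)
  refine ⟨fun X hX => ?_, hdeg, fun E' hE' => ?_⟩
  · obtain ⟨μ, h2, h3⟩ := h1 X hX
    have hμ : μ = 1 ∨ μ = -1 := h2.imp (fun h => h.2) fun h => h.2.2
    refine ⟨h2.imp (fun h => h.1) fun h => h.2.1, fun E' X' h h' _ => ?_, fun hL E' X' h h' hbx => ?_,
      fun hL E' X' h h' hbx => ?_⟩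
    · obtain ⟨σ, hσ, h4⟩ := hag E' h
      rw [h3 E' X' σ h' h4]
      rcases hσ with rfl | rfl <;> rcases hμ with rfl | rfl <;> simp
    · rw [h3 E' X' 1 h' (hag1 E' fun x y hxy => hbx.extZero_eq ((hmemS (x, y)).2 hxy)), one_mul]
      rcases h2 with h4 | ⟨-, h4, -⟩
      · exact h4.2
      · exact (hdisj X hL h4).elim
    · rw [h3 E' X' (-1) h' (hag2 E' fun x y hxy => hbx.extZero_eq ((hmemS (x, y)).2 hxy))]
      rcases h2 with ⟨h4, -⟩ | ⟨-, -, rfl⟩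
      · exact (hdisj X h4 hL).elim
      · simp
  · set N := (evenSub (Fin a ⊕ Fin b)).comap (blockHom (Fin a) (Fin b)) with hN
    have hc : (Nat.card (adjoin (blockSub (evenSub (Fin a)) (evenSub (Fin b)))
        (blockHom _ _ (t, s))) : K) = Nat.card N := by
      rw [hadj, ← Nat.card_congr (N.equivMapOfInjective _ blockHom_injective).toEquiv]
    have hr : adjoin (blockSub (evenSub (Fin a)) (evenSub (Fin b))) (blockHom _ _ (t, s)) ≤
        (blockHom (Fin a) (Fin b)).range := by
      rw [hadj]
      exact Subgroup.map_le_range _ _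
    have hle : adjoin (blockSub (evenSub (Fin a)) (evenSub (Fin b))) (blockHom _ _ (t, s)) ≤
        evenSub (Fin a ⊕ Fin b) := by
      rw [hadj]
      exact Subgroup.map_comap_le _ _
    have main : ∀ {A₁ A₂ : Finset ℕ}, IsLabel (Fin a) A₁ A₂ → A₁.card = B₁.card → A₁ ≠ A₂ →
        (∀ x y, (x ∈ evenSub (Fin a) ↔ y ∈ evenSub (Fin b)) → extZero E' (blockHom _ _ (x, y)) =
          symbolFun K _ A₁ A₂ x * symbolFun K _ B₁ B₂ y) →
        (∀ X, (Datum.typeD a b 1 (blockHom _ _ (t, s))).ordinary.IsDMinimal bar E' X →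
          HasLabel (evenSub _) X (odot A₁ B₁) (odot A₂ B₂) ∧
          (Datum.typeD a b 1 (blockHom _ _ (t, s))).ordinary.MultMem bar E' X
            (fun _ => True) {1}) ∧
        (Datum.typeD a b 1 (blockHom _ _ (t, s))).ordinary.DegenerateClause bar E' A₁ A₂ B₁ B₂ := by
      intro A₁ A₂ hA hAB hA' h
      have hag : ∀ E'', IsExtension _ 1 E' E'' → AgreesUpTo _ 1 1
          (fun p => if p ∈ N then symbolFun K _ A₁ A₂ p.1 * symbolFun K _ B₁ B₂ p.2 else 0) E'' := by
        intro E'' h' p hp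
        rw [inv_one, mul_one, hmemS] at hp
        rw [extZero_of_isExtension_one h', one_mul]
        exact (h p.1 p.2 hp).trans (if_pos (c := p ∈ N) (blockHom_mem_evenSub.2 hp)).symm
      -- H⟨v⟩ has index two in W_a × W_b. Inducing up gives the box product and its twist by the
      -- product of all signs, i.e. the coefficients 1, 0, 0, 1; so Λ' does not arise.
      obtain ⟨h1, h2⟩ := exists_mult_even (x := 0) (q := (t, 1)) hbar hle (one_mem _) hr (one_mem _)
        hA hB hAB hA' hB' hc
        (fun p hp => if_neg fun h' => hp (by
          rw [inv_one, mul_one, hmemS]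
          exact blockHom_mem_evenSub.1 h'))
        (fun E'' h' => ⟨1, Or.inl rfl, hag E'' h'⟩)
        (fun C₁ C₂ hC => blockSum_even ht A₁ A₂ B₁ B₂ hC)
        (blockHom_notMem_evenSub ht)
        (fun p => by
          simp only [hN, Subgroup.mem_comap, map_mul, map_inv, conj_mem_evenSub_iff, Prod.fst_mul,
            Prod.snd_mul, Prod.fst_inv, Prod.snd_inv, symbolFun_conj hA, symbolFun_conj hB])
      refine ⟨fun X hX => ?_, h2⟩
      obtain ⟨μ, h3, h4⟩ := h1 X hX
      rcases h3 with ⟨h3, rfl⟩ | ⟨h3, -⟩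
      · exact ⟨h3, fun E'' X' h h' _ => (h4 E'' X' 1 h' (hag E'' h)).trans (one_mul _)⟩
      · exact absurd rfl h3
    rcases hform E' hE' with h | h
    · obtain ⟨h1, h2⟩ := main hA hAB hA' h
      exact ⟨fun X hX => ⟨Or.inl (h1 X hX).1, (h1 X hX).2⟩, h2⟩
    · obtain ⟨h1, h2⟩ := main hA.swap hAB' hA'.symm h
      exact ⟨fun X hX => ⟨Or.inr (h1 X hX).1, (h1 X hX).2⟩, h2.swap⟩

end SymbolInduction

end

/-! ### Assembly of the cases -/

theorem mainTheorem5 {K : Type*} [Field K] [IsAlgClosed K] [CharZero K]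
    (bar : K ≃+* K) (hbar : ∀ (ω : K) (k : ℕ), 0 < k → ω ^ k = 1 → bar ω = ω⁻¹)
    (a b : ℕ) (A₁ A₂ B₁ B₂ : Finset ℕ)
    (hA : A₁.card = A₂.card) (hB : B₁.card = B₂.card) (hAB : A₁.card = B₁.card) :
    -- (a) `t ≠ 0` or type `B`
    (∀ (T : Series) (t : ℕ), (t ≠ 0 ∨ T = Series.B) →
      ∀ E : (Datum.split a b T t).H → K, HasBoxLabel ⊤ ⊤ E A₁ A₂ B₁ B₂ →
      ∀ X : (Datum.split a b T t).W → K, (Datum.split a b T t).IsDMinimal bar E X →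
        HasLabel ⊤ X (odot A₁ B₁) (odot A₂ B₂) ∧
        (Datum.split a b T t).MultMem bar E X (fun _ => True) {1}) ∧
    -- (b) type `C`, `t = 0`, `F_w` trivial
    (∀ E : (Datum.typeC a b 1).H → K, HasBoxLabel (evenSub _) ⊤ E A₁ A₂ B₁ B₂ →
      ∀ X : (Datum.typeC a b 1).W → K, (Datum.typeC a b 1).IsDMinimal bar E X →
        (A₁ ≠ A₂ → HasLabel ⊤ X (odot A₁ B₁) (odot A₂ B₂) ∨
          HasLabel ⊤ X (odot A₂ B₁) (odot A₁ B₂)) ∧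
        (A₁ = A₂ → HasLabel ⊤ X (odot A₁ B₁) (odot A₂ B₂)) ∧
        (Datum.typeC a b 1).MultMem bar E X (fun _ => True) {1}) ∧
    -- (b) type `C`, `t = 0`, `F_w = γ_a × id` is conjugation by `v`
    (∀ (i : Fin a) (v : SignedPerm (Fin a ⊕ Fin b)), 2 ≤ a → v = signFlip (Sum.inl i) →
      ∀ E : (Datum.typeC a b v).H → K, HasBoxLabel (evenSub _) ⊤ E A₁ A₂ B₁ B₂ →
      IsStable (Datum.typeC a b v).H v E →
        (∀ X : (Datum.typeC a b v).W → K, (Datum.typeC a b v).IsDMinimal bar E X →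
          (HasLabel ⊤ X (odot A₁ B₁) (odot A₂ B₂) ∨
            HasLabel ⊤ X (odot A₂ B₁) (odot A₁ B₂)) ∧
          (Datum.typeC a b v).MultMem bar E X (fun _ => True) {1, -1} ∧
          (HasLabel ⊤ X (odot A₁ B₁) (odot A₂ B₂) → (Datum.typeC a b v).MultMem bar E X
            (fun E' => IsBoxRestriction _ E' A₁ A₂ B₁ B₂) {1}) ∧
          (HasLabel ⊤ X (odot A₂ B₁) (odot A₁ B₂) → (Datum.typeC a b v).MultMem bar E X
            (fun E' => IsBoxRestriction _ E' A₂ A₁ B₁ B₂) {1})) ∧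
        -- the same for the ordinary induction of an extension of `E`
        (∀ E' : adjoin (Datum.typeC a b v).H v → K, IsExtension _ v E E' →
          ∀ X : (Datum.typeC a b v).W → K,
          (Datum.typeC a b v).ordinary.IsDMinimal bar E' X →
            (HasLabel ⊤ X (odot A₁ B₁) (odot A₂ B₂) ∨
              HasLabel ⊤ X (odot A₂ B₁) (odot A₁ B₂)) ∧
            (Datum.typeC a b v).ordinary.MultMem bar E' X (fun _ => True) {1})) ∧
    -- (c) type `D`, `t = 0`, `F` and `F_w` trivial
    (∀ E : (Datum.typeD a b 1 1).H → K,
      HasBoxLabel (evenSub _) (evenSub _) E A₁ A₂ B₁ B₂ →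
        (∀ X : (Datum.typeD a b 1 1).W → K, (Datum.typeD a b 1 1).IsDMinimal bar E X →
          ((A₁ ≠ A₂ ∨ B₁ ≠ B₂) → HasLabel (evenSub _) X (odot A₁ B₁) (odot A₂ B₂) ∨
            HasLabel (evenSub _) X (odot A₂ B₁) (odot A₁ B₂)) ∧
          ((A₁ = A₂ ∧ B₁ = B₂) → HasLabel (evenSub _) X (odot A₁ B₁) (odot A₂ B₂)) ∧
          (Datum.typeD a b 1 1).MultMem bar E X (fun _ => True) {1}) ∧
        (Datum.typeD a b 1 1).DegenerateClause bar E A₁ A₂ B₁ B₂) ∧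
    -- (c) type `D`, `t = 0`, `F` trivial, `F_w = γ_a × γ_b` is conjugation by `v`
    (∀ (i : Fin a) (j : Fin b) (v : SignedPerm (Fin a ⊕ Fin b)), 2 ≤ a → 2 ≤ b →
      v = signFlip (Sum.inr j) * signFlip (Sum.inl i) →
      ∀ E : (Datum.typeD a b 1 v).H → K,
      HasBoxLabel (evenSub _) (evenSub _) E A₁ A₂ B₁ B₂ →
      IsStable (Datum.typeD a b 1 v).H v E →
        (∀ X : (Datum.typeD a b 1 v).W → K, (Datum.typeD a b 1 v).IsDMinimal bar E X →
          (HasLabel (evenSub _) X (odot A₁ B₁) (odot A₂ B₂) ∨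
            HasLabel (evenSub _) X (odot A₂ B₁) (odot A₁ B₂)) ∧
          (Datum.typeD a b 1 v).MultMem bar E X (fun _ => True) {1, -1} ∧
          (HasLabel (evenSub _) X (odot A₁ B₁) (odot A₂ B₂) →
            (Datum.typeD a b 1 v).MultMem bar E X
              (fun E' => IsBoxRestriction _ E' A₁ A₂ B₁ B₂) {1}) ∧
          (HasLabel (evenSub _) X (odot A₂ B₁) (odot A₁ B₂) →
            (Datum.typeD a b 1 v).MultMem bar E X
              (fun E' => IsBoxRestriction _ E' A₂ A₁ B₁ B₂) {1})) ∧
        (Datum.typeD a b 1 v).DegenerateClause bar E A₁ A₂ B₁ B₂ ∧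
        -- the same for the ordinary induction of an extension of `E`
        (∀ E' : adjoin (Datum.typeD a b 1 v).H v → K, IsExtension _ v E E' →
          (∀ X : (Datum.typeD a b 1 v).W → K,
            (Datum.typeD a b 1 v).ordinary.IsDMinimal bar E' X →
              (HasLabel (evenSub _) X (odot A₁ B₁) (odot A₂ B₂) ∨
                HasLabel (evenSub _) X (odot A₂ B₁) (odot A₁ B₂)) ∧
              (Datum.typeD a b 1 v).ordinary.MultMem bar E' X (fun _ => True) {1}) ∧
          (Datum.typeD a b 1 v).ordinary.DegenerateClause bar E' A₁ A₂ B₁ B₂)) ∧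
    -- (d) type `D`, `t = 0`, `F = γ_n` is conjugation by `f`, a sign change in any coordinate,
    -- and `F_w = γ_a × id` or `id × γ_b` is conjugation by `v`
    (∀ (k : Fin a ⊕ Fin b) (f v : SignedPerm (Fin a ⊕ Fin b)), f = signFlip k →
      ((2 ≤ a ∧ ∃ i : Fin a, v = signFlip (Sum.inl i)) ∨
        (2 ≤ b ∧ ∃ j : Fin b, v = signFlip (Sum.inr j))) →
      ∀ E : (Datum.typeD a b f v).H → K,
      HasBoxLabel (evenSub _) (evenSub _) E A₁ A₂ B₁ B₂ →
      IsStable (Datum.typeD a b f v).H v E →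
      (odot A₁ B₁ ≠ odot A₂ B₂ ∨ odot A₂ B₁ ≠ odot A₁ B₂) →
        ∀ X : (Datum.typeD a b f v).W → K, (Datum.typeD a b f v).IsDMinimal bar E X →
          (HasLabel (evenSub _) X (odot A₁ B₁) (odot A₂ B₂) ∨
            HasLabel (evenSub _) X (odot A₂ B₁) (odot A₁ B₂)) ∧
          (Datum.typeD a b f v).MultMem bar E X (fun _ => True) {1, -1}) := by
  refine ⟨fun T t _ E hE X hX => typeB_case hbar hAB T t hE hX,
    fun E hE X hX => typeC_case hbar hAB hE hX, ?_, fun E hE => typeD_case hbar hAB hE, ?_, ?_⟩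
  · intro i v _ hv E hE hst
    rw [← blockHom_signFlip_inl] at hv
    subst hv
    exact typeC_twisted_case hbar hAB (signFlip_notMem_evenSub i) hE hst
  · intro i j v _ _ hv E hE hst
    -- The product of the two sign changes is the block diagonal element with one sign change in
    -- each block.
    rw [← blockHom_signFlip_inl, ← blockHom_signFlip_inr, ← map_mul, Prod.mk_mul_mk, one_mul,
      mul_one] at hv
    subst hv
    exact typeD_twisted_case hbar hAB (signFlip_notMem_evenSub i) (signFlip_notMem_evenSub j) hE hst
  · intro k f v hf hv E hE hst hne X hX
    subst hf
    rcases hv with ⟨_, i, hv⟩ | ⟨_, j, hv⟩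
    · rw [← blockHom_signFlip_inl] at hv
      subst hv
      exact typeD_left_case hbar hAB (signFlip_notMem_evenSub k) (signFlip_notMem_evenSub i) hE hst
        hne hX
    · rw [← blockHom_signFlip_inr] at hv
      subst hv
      exact typeD_right_case hbar hAB (signFlip_notMem_evenSub k) (signFlip_notMem_evenSub j) hE hst
        hne hX
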